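/- A ribbon graph is a finite set of discs (vertices) joined by finitely many, possibly twisted, rectangles (edges), each rectangle meeting the discs in exactly one pair of opposite sides; no disc is isolated. The two other sides of a rectangle are its strands. The faces are the closed curves forming the boundary of the union of the discs and rectangles; gluing a disc along each face gives a closed surface, and $\chi=V-E+F$. Let the edges be coloured timelike or spacelike such that the *CDT conditions* hold: every vertex is incident to exactly three edge ends, one timelike and two spacelike; every face contains exactly two timelike strands or none (so timelike edges are counted with multiplicity). A *strip* is a maximal set of faces connected through timelike edges. Its *boundaries* are the closed cycles of its spacelike strands, consecutive strands being joined at vertices inside the strip (a spacelike edge occurring twice in a strip gives two distinct strands). A *singular strip* is a single face without timelike edges, a *regular strip* is a strip with two boundaries, a *Möbius strip* is a non-singular strip with one boundary. Each cycle of spacelike edges is a *slice*, along which boundaries of strips are glued; a boundary that is glued to itself (the only one running along its slice) forms a *crosscap*. The graph is a *linear sequence* $(a,n,b)$ with $a,b\in\{\text{singular strip},\text{Möbius strip},\text{crosscap}\}$ and $n\ge 0$ ($n\ge1$ if $a=b=$ crosscap) if it consists of an end $a$, followed by $n$ regular strips, followed by an end $b$, each glued to the next along a slice; it is a *periodic sequence*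 of $n\ge1$ strips if it consists of $n$ cyclically ordered regular strips, each glued to the next and the last to the first. It is *orientable* if its faces can be oriented so that the two directions along every edge are opposite. **Theorem.** (A) For every ribbon graph satisfying the CDT conditions, $\chi=F_s$, where $F_s$ is the number of faces without timelike edges. If moreover the graph is connected, then: 1. $\chi\in\{0,1,2\}$, and the graph is a linear or a periodic sequence of strips. 2. If it is orientable, then either $\chi=2$, the surface is homeomorphic to the sphere and the graph is a linear sequence (singular, $n$, singular) with some $n\ge1$; or $\chi=0$, the surface is homeomorphic to the torus and the graph is a periodic sequence of regular strips. 3. If it is not orientable, then either $\chi=1$ and the surface is homeomorphic to the projective plane, or $\chi=0$ and the surface is homeomorphic to the Klein bottle. 4. The surface is homeomorphic to: the sphere, if the graph is a linear sequence (singular, $n$, singular); the torus, if it is periodic and orientable; the projective plane, if it is (singular, $n$, Möbius) or (singular, $n$, crosscap); the Klein bottle, if it is (Möbius, $n$, Möbius), (Möbius, $n$, crosscap), (crosscap, $n$, crosscap), or periodic and not orientable. (B) All these gluings exist, as connected ribbon graphs satisfying the CDT conditions with the stated surface: - sphere: (singular, $n$, singular) for every $n\ge1$; - torus: periodic with $n$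 strips and orientable, for every $n\ge1$; - projective plane: (singular, $n$, Möbius) for every $n\ge0$, and (singular, $n$, crosscap) for every $n\ge1$; - Klein bottle: (Möbius, $n$, Möbius) and (Möbius, $n$, crosscap) for every $n\ge0$; (crosscap, $n$, crosscap) and periodic with $n$ strips and not orientable, for every $n\ge1$. -/

import Mathlib

universe u

/-! ### Ribbon graphs -/

/-- A ribbon graph (of discs joined by rectangles, possibly twisted), without isolated discs, described
by the set `C` of its corners: every rectangle meets the discs in two opposite sides, and the corners
are the ends of these sides, four for each rectangle.  Two corners are joined
* by a strand (a side of a rectangle that does not lie on a disc),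
* by an arc (a piece of the circumference of a disc between two consecutive rectangle ends),
* by a crossing (the side of a rectangle that lies on a disc). -/
structure RibbonGraph (C : Type u) where
  strand : C → C
  arc : C → C
  cross : C → C
  strand_strand : ∀ c, strand (strand c) = c
  arc_arc : ∀ c, arc (arc c) = c
  cross_cross : ∀ c, cross (cross c) = c
  strand_ne : ∀ c, strand c ≠ c
  arc_ne : ∀ c, arc c ≠ c
  cross_ne : ∀ c, cross c ≠ c
  strand_cross : ∀ c, strand (cross c) = cross (strand c)
  strand_cross_ne : ∀ c, strand (cross c) ≠ c

namespace RibbonGraph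

variable {C : Type u} (G : RibbonGraph C)

/-- Discs: corners up to arcs and crossings. -/
def Vertex : Type u := Quot (fun c d : C => d = G.arc c ∨ d = G.cross c)

/-- Rectangles: corners up to strands and crossings. -/
def Edge : Type u := Quot (fun c d : C => d = G.strand c ∨ d = G.cross c)

/-- Faces (boundary curves of the union of discs and rectangles): corners up to strands and arcs. -/
def Face : Type u := Quot (fun c d : C => d = G.strand c ∨ d = G.arc c)

/-- Ends of rectangles on discs. -/
def HalfEdge : Type u := Quot (fun c d : C => d = G.cross c)

/-- Strands, i.e. the appearances of edges in faces. -/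
def Strand : Type u := Quot (fun c d : C => d = G.strand c)

/-- Connected components. -/
def Component : Type u := Quot (fun c d : C => d = G.strand c ∨ d = G.arc c ∨ d = G.cross c)

def vertex (c : C) : G.Vertex := Quot.mk _ c
def edge (c : C) : G.Edge := Quot.mk _ c
def face (c : C) : G.Face := Quot.mk _ c
def halfEdgeAt (c : C) : G.HalfEdge := Quot.mk _ c
def strandAt (c : C) : G.Strand := Quot.mk _ c

/-- The (nonempty) ribbon graph is connected. -/
def Connected : Prop := Nonempty C ∧ Subsingleton G.Component

/-- The Euler characteristic `V - E + F`. -/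
noncomputable def eulerChar : ℤ :=
  (Nat.card G.Vertex : ℤ) - Nat.card G.Edge + Nat.card G.Face

/-- Orientability: the faces can be oriented so that any two faces have opposite directions along
every common edge.  A direction of travel along each face amounts to saying at which corners one
leaves along the strand (`true`) and at which corners one arrives along the strand (`false`); these
alternate along the face.  The two strands of an edge are traversed in opposite directions exactly
when the values also differ across crossings. -/
def Orientable : Prop :=
  ∃ σ : C → Bool, ∀ c, σ (G.strand c) ≠ σ c ∧ σ (G.arc c) ≠ σ c ∧ σ (G.cross c) ≠ σ c

/-! ### The surface of a ribbon graph -/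

/-- The three involutions, numbered by what they change: the vertex, the edge, the face. -/
def move : Fin 3 → C → C := ![G.strand, G.arc, G.cross]

/-- The gluing that produces the surface: every corner `c` carries a triangle, whose vertices `0, 1, 2`
stand for (the centres of) the vertex, the edge and the face at `c`; the triangles of `c` and of
`G.move i c` are glued along their sides opposite to the vertex `i`. -/
def surfaceRel : (Σ _ : C, stdSimplex ℝ (Fin 3)) → (Σ _ : C, stdSimplex ℝ (Fin 3)) → Prop :=
  fun p q => ∃ i : Fin 3, (p.2 : Fin 3 → ℝ) i = 0 ∧ q = ⟨G.move i p.1, p.2⟩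

/-- The closed surface obtained from the ribbon graph by filling every face with a disc, as the
topological space glued from the triangles of the barycentric subdivision. -/
def Surface : Type u := Quot G.surfaceRel

instance : TopologicalSpace G.Surface := inferInstanceAs (TopologicalSpace (Quot G.surfaceRel))

end RibbonGraph

/-! ### Spacelike and timelike edges, the CDT conditions -/

/-- A ribbon graph whose edges are partitioned into timelike and spacelike (non-timelike) edges. -/
structure ColoredRibbonGraph (C : Type u) extends RibbonGraph C where
  timelike : C → Prop
  timelike_strand : ∀ c, timelike (strand c) ↔ timelike c
  timelike_cross : ∀ c, timelike (cross c) ↔ timelike c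

namespace ColoredRibbonGraph

variable {C : Type u} (G : ColoredRibbonGraph C)

/-- The number of timelike edges of a face, counted with multiplicity. -/
noncomputable def numTimelike (f : G.Face) : ℕ :=
  Set.ncard {s : G.Strand | ∃ c, G.strandAt c = s ∧ G.face c = f ∧ G.timelike c}

/-- The CDT conditions: at every vertex there are exactly one timelike and two spacelike edge ends,
and every face has two timelike edges or none. -/
structure IsCDT : Prop where
  vertex_timelike : ∀ v : G.Vertex,
    Set.ncard {h : G.HalfEdge | ∃ c, G.halfEdgeAt c = h ∧ G.vertex c = v ∧ G.timelike c} = 1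
  vertex_spacelike : ∀ v : G.Vertex,
    Set.ncard {h : G.HalfEdge | ∃ c, G.halfEdgeAt c = h ∧ G.vertex c = v ∧ ¬ G.timelike c} = 2
  face_timelike : ∀ f : G.Face, G.numTimelike f = 2 ∨ G.numTimelike f = 0

/-- The number of faces without timelike edges. -/
noncomputable def numSingularFaces : ℕ :=
  Nat.card {f : G.Face // ∀ c, G.face c = f → ¬ G.timelike c}

/-! ### Strips and their boundaries -/

/-- Strips: faces up to being connected through timelike edges. -/
def Strip : Type u :=
  Quot (fun c d : C => d = G.strand c ∨ d = G.arc c ∨ (G.timelike c ∧ d = G.cross c))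

/-- Boundaries of strips: spacelike strands up to being connected, inside one strip, through vertices.
The spacelike strands on the two sides of a timelike edge end are connected through this end. -/
def Boundary : Type u :=
  Quot (fun c d : C =>
    (¬ G.timelike c ∧ d = G.strand c) ∨ d = G.arc c ∨ (G.timelike c ∧ d = G.cross c))

/-- Slices: the connected components (cycles) of the graph formed by all vertices and the spacelike
edges.  Boundaries of strips are glued to each other, or to themselves, along slices. -/
def Slice : Type u :=
  Quot (fun c d : C => (¬ G.timelike c ∧ d = G.strand c) ∨ d = G.arc c ∨ d = G.cross c)

def strip (c : C) : G.Strip := Quot.mk _ c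
def boundary (c : C) : G.Boundary := Quot.mk _ c
def slice (c : C) : G.Slice := Quot.mk _ c

/-- The strip that a boundary belongs to. -/
def stripOf : G.Boundary → G.Strip :=
  Quot.map id (by
    rintro c d (⟨_, h⟩ | h | h)
    · exact Or.inl h
    · exact Or.inr (Or.inl h)
    · exact Or.inr (Or.inr h))

/-- The slice that a boundary runs along. -/
def sliceOf : G.Boundary → G.Slice :=
  Quot.map id (by
    rintro c d (h | h | ⟨_, h⟩)
    · exact Or.inl h
    · exact Or.inr (Or.inl h)
    · exact Or.inr (Or.inr h))

/-- The number of boundaries of a strip. -/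
noncomputable def numBoundaries (s : G.Strip) : ℕ := Set.ncard {β : G.Boundary | G.stripOf β = s}

/-- A regular strip has two boundaries. -/
def IsRegularStrip (s : G.Strip) : Prop := G.numBoundaries s = 2

/-- A singular strip consists of a single face, which has no timelike edges. -/
def IsSingularStrip (s : G.Strip) : Prop :=
  ∃ f : G.Face, (∀ c, G.strip c = s ↔ G.face c = f) ∧ G.numTimelike f = 0

/-- A Möbius strip is a non-singular strip with one boundary. -/
def IsMobiusStrip (s : G.Strip) : Prop := ¬ G.IsSingularStrip s ∧ G.numBoundaries s = 1

/-! ### Sequences of strips -/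

/-- The possible ends of a finite sequence of strips. In a crosscap, a boundary is glued to itself. -/
inductive Cap
  | singular
  | mobius
  | crosscap

/-- The graph is a finite sequence of strips: a cap of kind `a`, then `n` regular strips, then a cap of
kind `b`, each glued to the next.  There are `n + 1` slices, numbered in order; the boundaries that
run along slice `i` are exactly `L i` and `R i`, and the `i`-th regular strip is the one with
boundaries `R i` and `L (i + 1)`.  The two sides of a slice coincide exactly at a crosscap.  Two
crosscaps need at least one regular strip between them. -/
def IsLinear (a b : Cap) (n : ℕ) : Prop :=
  (a = Cap.crosscap → b = Cap.crosscap → 1 ≤ n) ∧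
  ∃ L R : Fin (n + 1) → G.Boundary,
    Function.Bijective (fun i => G.sliceOf (L i)) ∧
    (∀ i β, G.sliceOf β = G.sliceOf (L i) ↔ β = L i ∨ β = R i) ∧
    (∀ i, L i = R i ↔ (i = 0 ∧ a = Cap.crosscap) ∨ (i = Fin.last n ∧ b = Cap.crosscap)) ∧
    (∀ i : Fin n, R i.castSucc ≠ L i.succ ∧ G.stripOf (R i.castSucc) = G.stripOf (L i.succ) ∧
      G.IsRegularStrip (G.stripOf (R i.castSucc))) ∧
    (a = Cap.singular → G.IsSingularStrip (G.stripOf (L 0))) ∧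
    (a = Cap.mobius → G.IsMobiusStrip (G.stripOf (L 0))) ∧
    (b = Cap.singular → G.IsSingularStrip (G.stripOf (R (Fin.last n)))) ∧
    (b = Cap.mobius → G.IsMobiusStrip (G.stripOf (R (Fin.last n))))

/-- The graph is a periodic sequence of `n ≥ 1` regular strips, each glued to the next and the last one
to the first.  The slices are numbered cyclically; the two boundaries that run along slice `i` are
`L i` and `R i`, and the `i`-th strip is the one with boundaries `R i` and `L (i + 1)`. -/
def IsPeriodic (n : ℕ) : Prop :=
  1 ≤ n ∧ ∃ L R : ZMod n → G.Boundary,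
    Function.Bijective (fun i => G.sliceOf (L i)) ∧
    (∀ i β, G.sliceOf β = G.sliceOf (L i) ↔ β = L i ∨ β = R i) ∧
    (∀ i, L i ≠ R i) ∧
    (∀ i, R i ≠ L (i + 1) ∧ G.stripOf (R i) = G.stripOf (L (i + 1)) ∧
      G.IsRegularStrip (G.stripOf (R i)))

/-- The gluing pattern `P` is realized by a finite connected ribbon graph that satisfies the CDT
conditions and whose surface is homeomorphic to `X`. -/
def Realizes (P : ∀ {C : Type}, ColoredRibbonGraph C → Prop) (X : Type) [TopologicalSpace X] : Prop :=
  ∃ (C : Type) (_ : Finite C) (G : ColoredRibbonGraph C),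
    G.IsCDT ∧ G.Connected ∧ P G ∧ Nonempty (G.Surface ≃ₜ X)

end ColoredRibbonGraph

/-! ### The four model surfaces -/

namespace ModelSurface

abbrev Sphere : Type := Metric.sphere (0 : EuclideanSpace ℝ (Fin 3)) 1

abbrev Torus : Type := Circle × Circle

/-- The sphere with antipodal points identified. -/
def ProjectivePlane : Type := Quot (fun x y : Sphere => y = -x)

instance : TopologicalSpace ProjectivePlane :=
  inferInstanceAs (TopologicalSpace (Quot (fun x y : Sphere => y = -x)))

/-- The generating identifications of the square: `(t, 0)` with `(t, 1)`, `(0, t)` with `(1, 1 - t)`. -/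
def kleinRel (p q : unitInterval × unitInterval) : Prop :=
  (p.2 = 0 ∧ q.2 = 1 ∧ p.1 = q.1) ∨ (p.1 = 0 ∧ q.1 = 1 ∧ q.2 = unitInterval.symm p.2)

def KleinBottle : Type := Quot kleinRel

instance : TopologicalSpace KleinBottle := inferInstanceAs (TopologicalSpace (Quot kleinRel))

end ModelSurface

/-! Euler characteristic. A disc carries two timelike and four spacelike corners, a rectangle
carries four corners, and a face with timelike strands has exactly four timelike corners. Counting
corners in these ways gives 4E = 6V and 2V = 4(F - F_s), hence V - E + F = F_s
(`IsCDT.eulerChar_eq`). A connected closed surface has χ ≤ 2, so only 0, 1, 2 remain.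

Sequences of strips. The boundaries of strips carry two involutions: `acrossSlice` passes to the
other side of a slice, `acrossStrip` to the other side of a strip. The first is well defined because
the six corners of a disc form a hexagon. The second is well defined because a face with timelike
strands has exactly two of them: the pieces of faces between timelike strands pair off the timelike
corners (`partner`), and this pairing commutes with running along strands (`strand_partner`). The
boundaries of a strip, or along a slice, form an orbit of one of these involutions, so there are at
most two. In a connected graph the two involutions together act transitively, and a finite
transitive system of two involutions is a path or a cycle (`exists_isPath_or_isLoop`). An end of a
path is a fixed point of `acrossSlice` (crosscap) or of `acrossStrip` (singular or Möbius strip).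

Orientability. A crosscap or a Möbius strip is a symmetry (`cross` or `strand`) that maps a cycle of
two alternating involutions to itself. Such a symmetry acts as a rotation, which preserves the signs
of an orientation, or as a reflection, which agrees somewhere with one of the two involutions. Both
are impossible if the graph is orientable (`quot_ne_of_alternating`), so then all ends are singular.

Surfaces. The closed surfaces with χ ≥ 0 are classified for triangulations with three colours of
vertices (`Gem`); barycentric subdivisions of ribbon graphs are of this kind. Two triangles that
share a side but lie at different vertices opposite to it can be cancelled. This keeps the
homeomorphism type (`Dipole.nonempty_homeomorph`), χ, connectedness and orientability. After all
cancellations there is one vertex of each colour, so 2χ = 6 - #triangles, and χ ≥ 0 leaves 2, 4 or 6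
triangles (`exists_crystallization`). Around one vertex these form a polygon, and the third colour
is a matching of its triangles, which is forced up to rotation by χ and orientability
(`classification_crystal`). The model surfaces are recognised through explicit triangulations: the
octahedron, half of it, and the square. All homeomorphisms come from comparing quotients of compact
spaces inside one Hausdorff space (`nonempty_homeomorph_quot`).

Existence. In the explicit examples (`SlicePattern`) every strip with timelike edges is a single
face that meets one timelike edge twice. Only the caps and the number of slices have to be computed;
the structure theorem then yields the whole sequence (`isLinear_of_hasCap`,
`isPeriodic_of_not_hasCap`). -/

/-! ### Quotients of compact spaces -/

section Quotients

open Topology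

/-- Two relations on compact spaces have homeomorphic quotients if they correspond to each other
under continuous maps with the same range to a Hausdorff space whose fibres lie in the classes. -/
theorem quot_map_of_range_eq {X X' Y : Type*} [TopologicalSpace X] [TopologicalSpace X']
    [TopologicalSpace Y] [CompactSpace X] [T2Space Y]
    {r : X → X → Prop} {r' : X' → X' → Prop} {f : X → Y} {f' : X' → Y}
    (hf : Continuous f) (hf' : Continuous f') (hsub : ∀ p', ∃ p, f p = f' p')
    (hk : ∀ p q, f p = f q → Quot.mk r p = Quot.mk r q)
    (hr' : ∀ p' q', r' p' q' → ∃ p q, f p = f' p' ∧ f q = f' q' ∧ Quot.mk r p = Quot.mk r q) :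
    ∃ g : Quot r' → Quot r, Continuous g ∧
      ∀ p p', f p = f' p' → g (Quot.mk r' p') = Quot.mk r p := by
  -- A continuous map from a compact to a Hausdorff space is closed. Hence `X → Set.range f` is a
  -- quotient map, and `Quot.mk r` descends to the range because the fibres of `f` lie in classes.
  have hq : IsQuotientMap (Set.rangeFactorization f) := by
    have hc : Continuous (Set.rangeFactorization f) := hf.subtype_mk _
    exact hc.isClosedMap.isQuotientMap hc Set.rangeFactorization_surjective
  let F : C(X, Set.range f) := ⟨Set.rangeFactorization f, hq.continuous⟩
  have hF : IsQuotientMap F := hq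
  let m : C(X, Quot r) := ⟨Quot.mk r, continuous_quot_mk⟩
  have hm : Function.FactorsThrough m F := by
    intro p q h
    exact hk p q (congrArg Subtype.val h)
  let l : C(Set.range f, Quot r) := hF.lift m hm
  have hl : ∀ p, l (F p) = Quot.mk r p := fun p => by
    have := hF.lift_comp m hm
    exact congrArg (fun k : C(X, Quot r) => k p) this
  let f2 : X' → Set.range f := fun p' => ⟨f' p', hsub p'⟩
  have hf2 : Continuous f2 := hf'.subtype_mk _
  have hval : ∀ p p', f p = f' p' → l (f2 p') = Quot.mk r p := by
    intro p p' h
    rw [← hl p]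
    exact congrArg l (Subtype.ext h.symm)
  refine ⟨Quot.lift (fun p' => l (f2 p')) ?_, ?_, hval⟩
  · intro p' q' h
    obtain ⟨p, q, hp, hq, hpq⟩ := hr' p' q' h
    show l (f2 p') = l (f2 q')
    rw [hval p p' hp, hval q q' hq, hpq]
  · exact continuous_quot_lift _ (l.continuous.comp hf2)

/-- No inverse has to be written down: it suffices that both layouts in `Y` have the same range,
that their fibres lie in the classes, and that each generating identification on one side holds on
the other side. -/
theorem nonempty_homeomorph_quot {X X' Y : Type*} [TopologicalSpace X] [TopologicalSpace X']
    [TopologicalSpace Y] [CompactSpace X] [CompactSpace X'] [T2Space Y]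
    {r : X → X → Prop} {r' : X' → X' → Prop} {f : X → Y} {f' : X' → Y}
    (hf : Continuous f) (hf' : Continuous f')
    (hsub : ∀ p', ∃ p, f p = f' p') (hsub' : ∀ p, ∃ p', f' p' = f p)
    (hk : ∀ p q, f p = f q → Quot.mk r p = Quot.mk r q)
    (hk' : ∀ p q, f' p = f' q → Quot.mk r' p = Quot.mk r' q)
    (hr' : ∀ p' q', r' p' q' → ∃ p q, f p = f' p' ∧ f q = f' q' ∧ Quot.mk r p = Quot.mk r q)
    (hr : ∀ p q, r p q → ∃ p' q', f' p' = f p ∧ f' q' = f q ∧ Quot.mk r' p' = Quot.mk r' q') :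
    Nonempty (Quot r ≃ₜ Quot r') := by
  obtain ⟨g, hg, hgv⟩ := quot_map_of_range_eq hf hf' hsub hk hr'
  obtain ⟨g', hg', hgv'⟩ := quot_map_of_range_eq hf' hf hsub' hk' hr
  refine ⟨⟨⟨g', g, ?_, ?_⟩, hg', hg⟩⟩
  · rintro ⟨p⟩
    obtain ⟨p', hp'⟩ := hsub' p
    show g (g' (Quot.mk r p)) = Quot.mk r p
    rw [hgv' p' p hp', hgv p p' hp'.symm]
  · rintro ⟨p'⟩
    obtain ⟨p, hp⟩ := hsub p'
    show g' (g (Quot.mk r' p')) = Quot.mk r' p'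
    rw [hgv p p' hp, hgv' p' p hp.symm]

end Quotients

/-! ### Pairs of involutions -/

section Dihedral

variable {C : Type u}

/-- A reflection in a dihedral group inverts the rotations. -/
theorem involution_conj_zpow (α β : Equiv.Perm C) (hα : α * α = 1) (hβ : β * β = 1) (m : ℤ) :
    α * (α * β) ^ m = (α * β) ^ (-m) * α := by
  have hα' : α⁻¹ = α := inv_eq_of_mul_eq_one_left hα
  have hβ' : β⁻¹ = β := inv_eq_of_mul_eq_one_left hβ
  have h : SemiconjBy α (α * β) (α * β)⁻¹ := by
    show α * (α * β) = (α * β)⁻¹ * α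
    rw [mul_inv_rev, hα', hβ', mul_assoc β α α, hα, mul_one, ← mul_assoc, hα, one_mul]
  have := h.zpow_right m
  rw [inv_zpow', SemiconjBy] at this
  exact this

/-- A symmetry of a system of alternating cycles that never agrees with an edge is not a reflection. -/
theorem ne_reflection (α β θ : Equiv.Perm C) (hα : α * α = 1) (hβ : β * β = 1)
    (hθα : Commute θ α) (hθβ : Commute θ β) (h1 : ∀ c, θ c ≠ α c) (h2 : ∀ c, θ c ≠ β c)
    (m : ℤ) (c : C) : θ c ≠ (α * (α * β) ^ m) c := by
  have hc : Commute θ (α * β) := hθα.mul_right hθβ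
  intro h
  -- A reflection with even exponent is conjugate by a rotation to `α`, one with odd exponent to
  -- `β`. As `θ` commutes with rotations, the coincidence moves to a point where `θ` agrees with `α`
  -- or `β`.
  obtain ⟨q, rfl | rfl⟩ := Int.even_or_odd' m
  · apply h1 (((α * β) ^ q) c)
    have e : α * (α * β) ^ (2 * q) = (α * β) ^ (-q) * α * (α * β) ^ q := by
      rw [← involution_conj_zpow α β hα hβ, mul_assoc, ← zpow_add, two_mul]
    rw [e] at h
    have h' := congrArg ((α * β) ^ q) h
    rw [← Equiv.Perm.mul_apply, ← Equiv.Perm.mul_apply, ← (hc.zpow_right q).eq, mul_assoc,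
      ← mul_assoc, ← zpow_add, add_neg_cancel, zpow_zero, one_mul] at h'
    exact h'
  · apply h2 (((α * β) ^ q) c)
    have e : α * (α * β) ^ (2 * q + 1) = (α * β) ^ (-q) * β * (α * β) ^ q := by
      have : (2 * q + 1) = q + 1 + q := by ring
      rw [this, zpow_add, zpow_add, ← mul_assoc, ← mul_assoc, involution_conj_zpow α β hα hβ,
        zpow_one, mul_assoc _ α (α * β), ← mul_assoc α α β, hα, one_mul]
    rw [e] at h
    have h' := congrArg ((α * β) ^ q) h
    rw [← Equiv.Perm.mul_apply, ← Equiv.Perm.mul_apply, ← (hc.zpow_right q).eq, mul_assoc,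
      ← mul_assoc, ← zpow_add, add_neg_cancel, zpow_zero, one_mul] at h'
    exact h'

/-- The images of `c` under rotations and reflections are already closed under both involutions. -/
theorem dihedral_orbit (α β : Equiv.Perm C) (hα : α * α = 1) (hβ : β * β = 1) {c d : C}
    (h : Quot.mk (fun c d => d = α c ∨ d = β c) c = Quot.mk _ d) :
    ∃ m : ℤ, d = ((α * β) ^ m) c ∨ d = (α * (α * β) ^ m) c := by
  have hαα : ∀ x, α (α x) = x := fun x => by rw [← Equiv.Perm.mul_apply, hα]; rfl
  have hββ : ∀ x, β (β x) = x := fun x => by rw [← Equiv.Perm.mul_apply, hβ]; rfl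
  have key : ∀ x y, (y = α x ∨ y = β x) →
      (∃ m : ℤ, x = ((α * β) ^ m) c ∨ x = (α * (α * β) ^ m) c) →
      ∃ m : ℤ, y = ((α * β) ^ m) c ∨ y = (α * (α * β) ^ m) c := by
    rintro x y (rfl | rfl) ⟨m, rfl | rfl⟩
    · exact ⟨m, Or.inr rfl⟩
    · exact ⟨m, Or.inl (by simp [hαα])⟩
    · refine ⟨m + 1, Or.inr ?_⟩
      rw [add_comm, zpow_add, zpow_one]
      simp [hαα]
    · refine ⟨m - 1, Or.inl ?_⟩
      have : (α * β) ^ m = (α * β) * (α * β) ^ (m - 1) := by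
        rw [← zpow_one_add]; congr 1; ring
      rw [this]
      simp [hαα, hββ]
  rw [Quot.eq] at h
  have inv : ∀ x y, Relation.EqvGen (fun c d => d = α c ∨ d = β c) x y →
      ((∃ m : ℤ, x = ((α * β) ^ m) c ∨ x = (α * (α * β) ^ m) c) ↔
      ∃ m : ℤ, y = ((α * β) ^ m) c ∨ y = (α * (α * β) ^ m) c) := by
    intro x y hxy
    induction hxy with
    | rel x y h =>
      refine ⟨key x y h, key y x ?_⟩
      rcases h with rfl | rfl
      · exact Or.inl (hαα x).symm
      · exact Or.inr (hββ x).symm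
    | refl x => exact Iff.rfl
    | symm x y _ ih => exact ih.symm
    | trans x y z _ _ ih1 ih2 => exact ih1.trans ih2
  exact (inv c d h).1 ⟨0, Or.inl rfl⟩

end Dihedral

/-! ### Triangulated surfaces with coloured vertices -/

/-- A closed surface glued from triangles whose vertices are numbered `0, 1, 2`: the triangles of `c`
and of `mv i c` share their sides opposite to the vertex `i`. -/
structure Gem (C : Type u) where
  mv : Fin 3 → C → C
  mv_mv : ∀ i c, mv i (mv i c) = c
  mv_ne : ∀ i c, mv i c ≠ c

namespace Gem

abbrev Tri : Type := stdSimplex ℝ (Fin 3)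

variable {C : Type u} (G : Gem C)

def rel : (Σ _ : C, Tri) → (Σ _ : C, Tri) → Prop :=
  fun p q => ∃ i : Fin 3, (p.2 : Fin 3 → ℝ) i = 0 ∧ q = ⟨G.mv i p.1, p.2⟩

def Surface : Type u := Quot G.rel

instance : TopologicalSpace G.Surface := inferInstanceAs (TopologicalSpace (Quot G.rel))

/-- The vertices numbered `i`. -/
def Comp (i : Fin 3) : Type u := Quot (fun c d : C => ∃ a, a ≠ i ∧ d = G.mv a c)

def comp (i : Fin 3) (c : C) : G.Comp i := Quot.mk _ c

theorem comp_mv {i a : Fin 3} (h : a ≠ i) (c : C) : G.comp i (G.mv a c) = G.comp i c :=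
  (Quot.sound ⟨a, h, rfl⟩ : G.comp i c = G.comp i (G.mv a c)).symm

def Total : Type u := Quot (fun c d : C => ∃ a, d = G.mv a c)

def total (c : C) : G.Total := Quot.mk _ c

theorem total_mv (a : Fin 3) (c : C) : G.total (G.mv a c) = G.total c :=
  (Quot.sound ⟨a, rfl⟩ : G.total c = G.total (G.mv a c)).symm

def Connected : Prop := Nonempty C ∧ Subsingleton G.Total

def Orientable : Prop := ∃ σ : C → Bool, ∀ i c, σ (G.mv i c) ≠ σ c

/-- Twice the Euler characteristic. -/
noncomputable def chi2 : ℤ := 2 * ∑ i, (Nat.card (G.Comp i) : ℤ) - Nat.card C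

def perm (i : Fin 3) : Equiv.Perm C := ⟨G.mv i, G.mv i, G.mv_mv i, G.mv_mv i⟩

theorem perm_mul_self (i : Fin 3) : G.perm i * G.perm i = 1 := by
  ext c; exact G.mv_mv i c

theorem mv_inj (i : Fin 3) {c d : C} (h : G.mv i c = G.mv i d) : c = d := (G.perm i).injective h

theorem mv_eq_comm (i : Fin 3) {c d : C} : G.mv i c = d ↔ c = G.mv i d :=
  ⟨fun h => by rw [← h, G.mv_mv], fun h => by rw [h, G.mv_mv]⟩

/-- The triangles around a vertex numbered `0`, in order. -/
theorem exists_cycle [Finite C] (d : C) : ∃ (n : ℕ) (u : ℕ → C), Odd n ∧ u 0 = d ∧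
    (∀ l, u (l + 1) = if Even l then G.mv 2 (u l) else G.mv 1 (u l)) ∧ u (n + 1) = d ∧
    Set.InjOn u (Set.Iic n) ∧ ∀ c, G.comp 0 c = G.comp 0 d → ∃ l ≤ n, u l = c := by
  classical
  set α := G.perm 1
  set β := G.perm 2
  set π := α * β with hπ
  have hα := G.perm_mul_self 1
  have hβ := G.perm_mul_self 2
  have hper : d ∈ Function.periodicPts π :=
    Function.Injective.mem_periodicPts π.injective d
  set N := Function.minimalPeriod π d with hN
  have hN0 : 0 < N := Function.minimalPeriod_pos_of_mem_periodicPts hper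
  let u : ℕ → C := fun l => if Even l then (π ^ (l / 2)) d else β ((π ^ (l / 2)) d)
  have hue : ∀ l, u (2 * l) = (π ^ l) d := fun l => by simp [u]
  have huo : ∀ l, u (2 * l + 1) = β ((π ^ l) d) := fun l => by
    have : ¬ Even (2 * l + 1) := by simp
    simp only [u, this, if_false]
    congr 3; omega
  have hper' : (π ^ N) d = d := by
    rw [← Equiv.Perm.iterate_eq_pow]; exact Function.iterate_minimalPeriod
  have hinj : ∀ a b, a < N → b < N → (π ^ a) d = (π ^ b) d → a = b := by
    intro a b ha hb h
    rw [← Equiv.Perm.iterate_eq_pow, ← Equiv.Perm.iterate_eq_pow] at h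
    exact Function.iterate_injOn_Iio_minimalPeriod ha hb h
  -- If an even position coincided with an odd one, the identity would act at `d` as a reflection.
  -- `ne_reflection` with `θ = 1` excludes this, since the moves have no fixed points.
  have hne : ∀ a b : ℕ, (π ^ a) d ≠ β ((π ^ b) d) := by
    intro a b h
    have h' : (1 : Equiv.Perm C) d = (α * (α * β) ^ ((a : ℤ) + b + 1)) d := by
      have e : α * (α * β) ^ ((a : ℤ) + b + 1) = (α * β) ^ (-(a : ℤ)) * β * (α * β) ^ (b : ℤ) := by
        have : (a : ℤ) + b + 1 = a + 1 + b := by ring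
        rw [this, zpow_add, zpow_add, ← mul_assoc, ← mul_assoc, involution_conj_zpow α β hα hβ,
          zpow_one, mul_assoc _ α (α * β), ← mul_assoc α α β, hα, one_mul]
      rw [e]
      have h2 := congrArg ((π ^ (-(a : ℤ)))) h
      rw [← Equiv.Perm.mul_apply, ← zpow_natCast, ← zpow_add, neg_add_cancel] at h2
      rw [zpow_natCast]
      exact h2
    exact ne_reflection α β 1 hα hβ (Commute.one_left _) (Commute.one_left _)
      (fun c => (G.mv_ne 1 c).symm) (fun c => (G.mv_ne 2 c).symm) _ d h'
  have hstep : ∀ l, u (l + 1) = if Even l then G.mv 2 (u l) else G.mv 1 (u l) := by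
    intro l
    obtain ⟨k, rfl | rfl⟩ := Nat.even_or_odd' l
    · rw [huo, hue]; simp; rfl
    · have : ¬ Even (2 * k + 1) := by simp
      rw [if_neg this, huo, show 2 * k + 1 + 1 = 2 * (k + 1) by ring, hue, pow_succ']
      rfl
  refine ⟨2 * N - 1, u, ⟨N - 1, by omega⟩, ?_, hstep, ?_, ?_, ?_⟩
  · simpa using hue 0
  · rw [show 2 * N - 1 + 1 = 2 * N by omega, hue, hper']
  · intro a ha b hb h
    simp only [Set.mem_Iic] at ha hb
    obtain ⟨k, rfl | rfl⟩ := Nat.even_or_odd' a <;> obtain ⟨l, rfl | rfl⟩ := Nat.even_or_odd' b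
    · rw [hue, hue] at h
      rw [hinj k l (by omega) (by omega) h]
    · rw [hue, huo] at h
      exact absurd h (hne _ _)
    · rw [hue, huo] at h
      exact absurd h.symm (hne _ _)
    · rw [huo, huo] at h
      rw [hinj k l (by omega) (by omega) (β.injective h)]
  · have hlast : ∀ l, ∃ l' ≤ 2 * N - 1, u l' = u l := by
      intro l
      obtain ⟨k, rfl | rfl⟩ := Nat.even_or_odd' l
      · refine ⟨2 * (k % N), by have := Nat.mod_lt k hN0; omega, ?_⟩
        rw [hue, hue, ← Equiv.Perm.iterate_eq_pow, ← Equiv.Perm.iterate_eq_pow]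
        exact Function.iterate_mod_minimalPeriod_eq
      · refine ⟨2 * (k % N) + 1, by have := Nat.mod_lt k hN0; omega, ?_⟩
        rw [huo, huo, ← Equiv.Perm.iterate_eq_pow, ← Equiv.Perm.iterate_eq_pow]
        congr 1
        exact Function.iterate_mod_minimalPeriod_eq
    have hper2 : ∀ l, u (l + 2 * N) = u l := by
      intro l
      obtain ⟨k, rfl | rfl⟩ := Nat.even_or_odd' l
      · rw [show 2 * k + 2 * N = 2 * (k + N) by ring, hue, hue, pow_add, Equiv.Perm.mul_apply, hper']
      · rw [show 2 * k + 1 + 2 * N = 2 * (k + N) + 1 by ring, huo, huo, pow_add,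
          Equiv.Perm.mul_apply, hper']
    have key : ∀ x y, (∃ a, a ≠ (0 : Fin 3) ∧ y = G.mv a x) → (∃ l, u l = x) → ∃ l, u l = y := by
      rintro x y ⟨a, ha, rfl⟩ ⟨l, rfl⟩
      -- One step backwards is taken `2 * N - 1` steps forwards, so that indices stay natural.
      have hprev : ∀ l, (if Even l then G.mv 1 (u l) else G.mv 2 (u l)) = u (l + 2 * N - 1) := by
        intro l
        have h1 := hstep (l + 2 * N - 1)
        have hpar : Even (l + 2 * N - 1) ↔ ¬ Even l := by
          rw [show l + 2 * N - 1 = l + (2 * (N - 1) + 1) by omega]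
          simp [Nat.even_add, parity_simps]
        rw [show l + 2 * N - 1 + 1 = l + 2 * N by omega, hper2] at h1
        by_cases hl : Even l
        · simp only [hpar, hl, not_true, if_false] at h1
          simp only [hl, if_true]; rw [h1, G.mv_mv]
        · simp only [hpar, hl, not_false_iff, if_true] at h1
          simp only [hl, if_false]; rw [h1, G.mv_mv]
      have hs := hstep l
      have hp := hprev l
      by_cases hl : Even l
      · simp only [hl, if_true] at hs hp
        fin_cases a
        · exact absurd rfl ha
        · exact ⟨_, hp.symm⟩
        · exact ⟨_, hs⟩
      · simp only [hl, if_false] at hs hp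
        fin_cases a
        · exact absurd rfl ha
        · exact ⟨_, hs⟩
        · exact ⟨_, hp.symm⟩
    intro c hc
    have inv : ∀ x y, Relation.EqvGen (fun c d => ∃ a, a ≠ (0 : Fin 3) ∧ d = G.mv a c) x y →
        ((∃ l, u l = x) ↔ ∃ l, u l = y) := by
      intro x y hxy
      induction hxy with
      | rel x y h =>
        refine ⟨key x y h, key y x ?_⟩
        obtain ⟨a, ha, rfl⟩ := h
        exact ⟨a, ha, (G.mv_mv a x).symm⟩
      | refl x => exact Iff.rfl
      | symm x y _ ih => exact ih.symm
      | trans x y z _ _ ih1 ih2 => exact ih1.trans ih2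
    obtain ⟨l, hl⟩ := (inv c d (Quot.eq.1 hc)).2 ⟨0, by simpa using hue 0⟩
    obtain ⟨l', hl', h'⟩ := hlast l
    exact ⟨l', hl', h'.trans hl⟩

end Gem

namespace Gem

/-! ### Maps of the triangle -/

namespace Tri

theorem sum_eq (t : Tri) : t.1 0 + t.1 1 + t.1 2 = 1 := by
  have := t.2.2
  rwa [Fin.sum_univ_three] at this

theorem nonneg (t : Tri) (i : Fin 3) : 0 ≤ t.1 i := t.2.1 i

theorem ext_of {s t : Tri} (h0 : s.1 0 = t.1 0) (h2 : s.1 2 = t.1 2) : s = t := by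
  have hs := sum_eq s
  have ht := sum_eq t
  apply Subtype.ext
  funext i
  fin_cases i
  · exact h0
  · show s.1 1 = t.1 1; linarith
  · exact h2

def mk (a b c : ℝ) (ha : 0 ≤ a) (hb : 0 ≤ b) (hc : 0 ≤ c) (h : a + b + c = 1) : Tri :=
  ⟨![a, b, c], by
    refine ⟨fun i => ?_, ?_⟩
    · fin_cases i <;> assumption
    · rw [Fin.sum_univ_three]; exact h⟩

@[simp] theorem mk_zero (a b c : ℝ) (ha hb hc h) : (mk a b c ha hb hc h).1 0 = a := rfl
@[simp] theorem mk_one (a b c : ℝ) (ha hb hc h) : (mk a b c ha hb hc h).1 1 = b := rfl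
@[simp] theorem mk_two (a b c : ℝ) (ha hb hc h) : (mk a b c ha hb hc h).1 2 = c := rfl

theorem continuous_mk {X : Type*} [TopologicalSpace X] {a b c : X → ℝ} (ha : ∀ x, 0 ≤ a x)
    (hb : ∀ x, 0 ≤ b x) (hc : ∀ x, 0 ≤ c x) (h : ∀ x, a x + b x + c x = 1)
    (ca : Continuous a) (cb : Continuous b) (cc : Continuous c) :
    Continuous (fun x => mk (a x) (b x) (c x) (ha x) (hb x) (hc x) (h x)) := by
  refine Continuous.subtype_mk (continuous_pi fun i => ?_) _
  fin_cases i
  · exact ca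
  · exact cb
  · exact cc

theorem continuous_coord (i : Fin 3) : Continuous (fun t : Tri => t.1 i) :=
  (continuous_apply i).comp continuous_subtype_val

/-- The coordinate along the base in the direction of travel through the `l`-th triangle of a fan. -/
noncomputable def along (l : ℕ) (t : Tri) : ℝ := if Odd l then t.1 2 else t.1 1

theorem along_nonneg (l : ℕ) (t : Tri) : 0 ≤ along l t := by
  unfold along; split_ifs <;> exact nonneg t _

theorem along_le (l : ℕ) (t : Tri) : along l t ≤ t.1 1 + t.1 2 := by
  have h1 := nonneg t 1
  have h2 := nonneg t 2
  unfold along; split_ifs <;> linarith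

theorem along_succ (l : ℕ) (t : Tri) : along (l + 1) t = t.1 1 + t.1 2 - along l t := by
  unfold along
  by_cases h : Odd l
  · have : ¬ Odd (l + 1) := by simpa [parity_simps] using h
    simp [h, this]
  · have : Odd (l + 1) := by simpa [parity_simps] using h
    simp [h, this]

/-- Each line parallel to the base is cut into `n` equal parts, and the `l`-th triangle occupies the
`l`-th part. Neighbouring triangles are mirror images, hence the alternation in `along`. -/
noncomputable def fanCoord (n l : ℕ) (t : Tri) : ℝ :=
  (((l : ℝ) - 1) * (t.1 1 + t.1 2) + along l t) / n

theorem fanCoord_mem {n l : ℕ} (h1 : 1 ≤ l) (h2 : l ≤ n) (t : Tri) :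
    0 ≤ fanCoord n l t ∧ fanCoord n l t ≤ t.1 1 + t.1 2 := by
  have hn : (0 : ℝ) < n := by exact_mod_cast (by omega : 0 < n)
  have h1' : (1 : ℝ) ≤ l := by exact_mod_cast h1
  have h2' : (l : ℝ) ≤ n := by exact_mod_cast h2
  have hr : 0 ≤ t.1 1 + t.1 2 := add_nonneg (nonneg t 1) (nonneg t 2)
  have ha := along_nonneg l t
  have hb := along_le l t
  unfold fanCoord
  refine ⟨div_nonneg (add_nonneg (mul_nonneg (by linarith) hr) ha) hn.le, ?_⟩
  rw [div_le_iff₀ hn]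
  nlinarith

/-- The `l`-th of `n` triangles with a common vertex `0` as a part of a single triangle. -/
noncomputable def fan (n l : ℕ) (h : 1 ≤ l ∧ l ≤ n) (t : Tri) : Tri :=
  mk (t.1 0) (t.1 1 + t.1 2 - fanCoord n l t) (fanCoord n l t) (nonneg t 0)
    (sub_nonneg.2 (fanCoord_mem h.1 h.2 t).2) (fanCoord_mem h.1 h.2 t).1
    (by have := sum_eq t; linarith)

theorem continuous_fan (n l : ℕ) (h : 1 ≤ l ∧ l ≤ n) : Continuous (fan n l h) := by
  have hc : Continuous (fanCoord n l) := by
    unfold fanCoord along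
    have h1 := continuous_coord 1
    have h2 := continuous_coord 2
    split_ifs
    · exact ((continuous_const.mul (h1.add h2)).add h2).div_const _
    · exact ((continuous_const.mul (h1.add h2)).add h1).div_const _
  exact continuous_mk _ _ _ _ (continuous_coord 0)
    (((continuous_coord 1).add (continuous_coord 2)).sub hc) hc

/-- The two triangles of a fan agree along their common side. -/
theorem fan_step {n l : ℕ} (h : 1 ≤ l ∧ l ≤ n) (h' : 1 ≤ l + 1 ∧ l + 1 ≤ n) {t : Tri}
    (ht : along l t = t.1 1 + t.1 2) : fan n (l + 1) h' t = fan n l h t := by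
  refine ext_of rfl ?_
  show fanCoord n (l + 1) t = fanCoord n l t
  unfold fanCoord
  rw [along_succ, ht]
  push_cast
  ring

/-- The two outer sides of the fan are laid undistorted on the sides `t 2 = 0` and `t 1 = 0`, so
what is glued along them can stay in place. For the last side this needs an odd number of triangles.
-/
theorem fan_first {n : ℕ} (h : 1 ≤ 1 ∧ 1 ≤ n) {t : Tri} (ht : t.1 2 = 0) : fan n 1 h t = t := by
  refine ext_of rfl ?_
  show fanCoord n 1 t = _
  simp [fanCoord, along, ht]

theorem fan_last {n : ℕ} (hn : Odd n) (h : 1 ≤ n ∧ n ≤ n) {t : Tri} (ht : t.1 1 = 0) :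
    fan n n h t = t := by
  have hn' : (n : ℝ) ≠ 0 := by exact_mod_cast (by omega : n ≠ 0)
  refine ext_of rfl ?_
  show fanCoord n n t = _
  simp only [fanCoord, along, ht, if_pos hn]
  field_simp
  ring

theorem fan_surjective {n : ℕ} (hn : 1 ≤ n) (y : Tri) : ∃ l h t, fan n l h t = y := by
  classical
  have hn' : (0 : ℝ) < n := by exact_mod_cast (by omega : 0 < n)
  set r := y.1 1 + y.1 2 with hr
  have hr0 : 0 ≤ r := add_nonneg (nonneg y 1) (nonneg y 2)
  have hy1 := nonneg y 1
  have hy2 := nonneg y 2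
  -- The triangle containing `y` is the first one whose part of the line reaches `y`; minimality
  -- also settles the degenerate case `r = 0`.
  have hex : ∃ l : ℕ, 1 ≤ l ∧ n * y.1 2 ≤ l * r :=
    ⟨n, hn, mul_le_mul_of_nonneg_left (by linarith) hn'.le⟩
  let l := Nat.find hex
  obtain ⟨hl1, hl2⟩ : 1 ≤ l ∧ n * y.1 2 ≤ l * r := Nat.find_spec hex
  have hln : l ≤ n :=
    Nat.find_min' hex ⟨hn, mul_le_mul_of_nonneg_left (by linarith) hn'.le⟩
  have hl3 : ((l : ℝ) - 1) * r ≤ n * y.1 2 := by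
    rcases Nat.eq_or_lt_of_le hl1 with h | h
    · rw [← h]; simp; positivity
    · have := Nat.find_min hex (m := l - 1) (by show l - 1 < l; omega)
      push Not at this
      have := this (by omega)
      rw [Nat.cast_sub hl1] at this
      push_cast at this
      exact this.le
  set a := n * y.1 2 - ((l : ℝ) - 1) * r with ha
  have ha0 : 0 ≤ a := by linarith
  have har : a ≤ r := by nlinarith
  have hs := sum_eq y
  by_cases ho : Odd l
  · refine ⟨l, ⟨hl1, hln⟩, mk (y.1 0) (r - a) a (nonneg y 0) (by linarith) ha0
      (by linarith), ext_of rfl ?_⟩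
    show fanCoord n l _ = _
    simp only [fanCoord, along, ho, if_true, mk_one, mk_two]
    field_simp
    rw [ha]; ring
  · refine ⟨l, ⟨hl1, hln⟩, mk (y.1 0) a (r - a) (nonneg y 0) ha0 (by linarith)
      (by linarith), ext_of rfl ?_⟩
    show fanCoord n l _ = _
    simp only [fanCoord, along, ho, if_false, mk_one, mk_two]
    field_simp
    rw [ha]; ring

/-- The height of the triangle above the point of the base determined by `t 1 - t 2`. -/
noncomputable def top (t : Tri) : ℝ := 1 - |t.1 1 - t.1 2|

theorem le_top (t : Tri) : t.1 0 ≤ top t := by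
  have hs := sum_eq t
  have h1 := nonneg t 1
  have h2 := nonneg t 2
  have : |t.1 1 - t.1 2| ≤ t.1 1 + t.1 2 := abs_le.2 ⟨by linarith, by linarith⟩
  unfold top; linarith

/-- The vertical segments over the base end exactly on the two sides through vertex `0`. -/
theorem eq_top_iff (t : Tri) : t.1 0 = top t ↔ t.1 1 = 0 ∨ t.1 2 = 0 := by
  have hs := sum_eq t
  have h1 := nonneg t 1
  have h2 := nonneg t 2
  unfold top
  constructor
  · intro h
    rcases abs_cases (t.1 1 - t.1 2) with ⟨h', _⟩ | ⟨h', _⟩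
    · right; linarith
    · left; linarith
  · rintro (h | h)
    · rw [h, zero_sub, abs_neg, abs_of_nonneg h2]; linarith
    · rw [h, sub_zero, abs_of_nonneg h1]; linarith

/-- Vertical displacement of the triangle. -/
noncomputable def shift (t : Tri) (h : ℝ) (h0 : 0 ≤ h) (h1 : h ≤ top t) : Tri :=
  mk h ((1 - h + (t.1 1 - t.1 2)) / 2) ((1 - h - (t.1 1 - t.1 2)) / 2) h0
    (by have := neg_abs_le (t.1 1 - t.1 2); unfold top at h1; linarith)
    (by have := le_abs_self (t.1 1 - t.1 2); unfold top at h1; linarith) (by ring)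

theorem shift_sub (t : Tri) (h : ℝ) (h0 h1) :
    (shift t h h0 h1).1 1 - (shift t h h0 h1).1 2 = t.1 1 - t.1 2 := by
  simp only [shift, mk_one, mk_two]; ring

theorem shift_top (t : Tri) (h : ℝ) (h0 h1) : top (shift t h h0 h1) = top t := by
  unfold top; rw [shift_sub]

theorem shift_zero (t : Tri) (h : ℝ) (h0 h1) : (shift t h h0 h1).1 0 = h := rfl

theorem ext_shift {s t : Tri} (h : s.1 1 - s.1 2 = t.1 1 - t.1 2) (h0 : s.1 0 = t.1 0) : s = t := by
  have hs := sum_eq s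
  have ht := sum_eq t
  exact ext_of h0 (by linarith)

/-- The three layers into which the triangle is cut: the upper, the middle (upside down) and the
lower part of every vertical segment. -/
noncomputable def upper (t : Tri) : Tri :=
  shift t ((2 * top t + t.1 0) / 3) (by have := le_top t; have := nonneg t 0; linarith)
    (by have := le_top t; linarith)

noncomputable def middle (t : Tri) : Tri :=
  shift t ((2 * top t - t.1 0) / 3) (by have := le_top t; have := nonneg t 0; linarith)
    (by have := le_top t; have := nonneg t 0; linarith)

noncomputable def lower (t : Tri) : Tri :=
  shift t (t.1 0 / 3) (by have := nonneg t 0; linarith)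
    (by have := le_top t; have := nonneg t 0; linarith)

theorem continuous_shift {h : Tri → ℝ} (h0 : ∀ t, 0 ≤ h t) (h1 : ∀ t, h t ≤ top t) (hc : Continuous h) :
    Continuous (fun t => shift t (h t) (h0 t) (h1 t)) := by
  have c := (continuous_coord 1).sub (continuous_coord 2)
  exact continuous_mk _ _ _ _ hc (((continuous_const.sub hc).add c).div_const _)
    (((continuous_const.sub hc).sub c).div_const _)

theorem continuous_top : Continuous top := by
  exact continuous_const.sub ((continuous_coord 1).sub (continuous_coord 2)).abs

theorem continuous_upper : Continuous upper :=
  continuous_shift _ _ (((continuous_const.mul continuous_top).add (continuous_coord 0)).div_const _)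

theorem continuous_middle : Continuous middle :=
  continuous_shift _ _ (((continuous_const.mul continuous_top).sub (continuous_coord 0)).div_const _)

theorem continuous_lower : Continuous lower :=
  continuous_shift _ _ ((continuous_coord 0).div_const _)

theorem layers_surjective (y : Tri) :
    (∃ t, upper t = y) ∨ (∃ t, middle t = y) ∨ ∃ t, lower t = y := by
  have h1 := le_top y
  have h0 := nonneg y 0
  rcases le_total (2 * top y) (3 * y.1 0) with h | h
  · refine Or.inl ⟨shift y (3 * y.1 0 - 2 * top y) (by linarith) (by linarith), ?_⟩
    refine ext_shift ?_ ?_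
    · unfold upper; rw [shift_sub, shift_sub]
    · unfold upper; rw [shift_zero, shift_zero, shift_top]; ring
  · rcases le_total (top y) (3 * y.1 0) with h' | h'
    · refine Or.inr (Or.inl ⟨shift y (2 * top y - 3 * y.1 0) (by linarith) (by linarith), ?_⟩)
      refine ext_shift ?_ ?_
      · unfold middle; rw [shift_sub, shift_sub]
      · unfold middle; rw [shift_zero, shift_zero, shift_top]; ring
    · refine Or.inr (Or.inr ⟨shift y (3 * y.1 0) (by linarith) (by linarith), ?_⟩)
      refine ext_shift ?_ ?_
      · unfold lower; rw [shift_sub, shift_sub]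
      · unfold lower; rw [shift_zero, shift_zero]; ring

theorem top_congr {s t : Tri} (h : s.1 1 - s.1 2 = t.1 1 - t.1 2) : top s = top t := by
  unfold top; rw [h]

theorem sub_congr {s t : Tri} {h h' : ℝ} {h0 h1 h0' h1'}
    (e : shift s h h0 h1 = shift t h' h0' h1') : s.1 1 - s.1 2 = t.1 1 - t.1 2 ∧ h = h' := by
  refine ⟨?_, congrArg (fun t : Tri => t.1 0) e⟩
  rw [← shift_sub s h h0 h1, e, shift_sub]

theorem upper_injective {s t : Tri} (h : upper s = upper t) : s = t := by
  obtain ⟨h1, h2⟩ := sub_congr h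
  rw [top_congr h1] at h2
  exact ext_shift h1 (by linarith)

theorem middle_injective {s t : Tri} (h : middle s = middle t) : s = t := by
  obtain ⟨h1, h2⟩ := sub_congr h
  rw [top_congr h1] at h2
  exact ext_shift h1 (by linarith)

theorem lower_injective {s t : Tri} (h : lower s = lower t) : s = t := by
  obtain ⟨h1, h2⟩ := sub_congr h
  exact ext_shift h1 (by linarith)

/-- Upper and middle layer touch along the image of the base `t 0 = 0`, middle and lower layer along
the image of the sides `t 1 = 0` and `t 2 = 0`. The middle layer is upside down so that these are
the gluings of `c` with `d` and of `d` with its fan. -/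
theorem upper_eq_middle {s t : Tri} (h : upper s = middle t) : s = t ∧ s.1 0 = 0 := by
  obtain ⟨h1, h2⟩ := sub_congr h
  rw [top_congr h1] at h2
  have h3 := nonneg s 0
  have h4 := nonneg t 0
  exact ⟨ext_shift h1 (by linarith), by linarith⟩

/-- Upper and lower layer meet only at the base vertices, where the height `top` vanishes. -/
theorem upper_eq_lower {s t : Tri} (h : upper s = lower t) : s.1 0 = 0 := by
  obtain ⟨h1, h2⟩ := sub_congr h
  rw [top_congr h1] at h2
  have h3 := nonneg s 0
  have h4 := nonneg t 0
  have h5 := le_top t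
  linarith

theorem middle_eq_lower {s t : Tri} (h : middle s = lower t) : s = t ∧ (s.1 1 = 0 ∨ s.1 2 = 0) := by
  obtain ⟨h1, h2⟩ := sub_congr h
  have h3 := le_top s
  have h5 := le_top t
  rw [← top_congr h1] at h5
  exact ⟨ext_shift h1 (by linarith), (eq_top_iff s).1 (by linarith)⟩

theorem upper_eq_middle_of {t : Tri} (h : t.1 0 = 0) : upper t = middle t :=
  ext_shift (by unfold upper middle; rw [shift_sub, shift_sub])
    (by unfold upper middle; rw [shift_zero, shift_zero, h]; ring)

theorem middle_eq_lower_of {t : Tri} (h : t.1 1 = 0 ∨ t.1 2 = 0) : middle t = lower t :=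
  ext_shift (by unfold lower middle; rw [shift_sub, shift_sub])
    (by unfold lower middle; rw [shift_zero, shift_zero, ← (eq_top_iff t).2 h]; ring)

theorem upper_eq_self {t : Tri} (h : t.1 1 = 0 ∨ t.1 2 = 0) : upper t = t :=
  ext_shift (by unfold upper; rw [shift_sub])
    (by unfold upper; rw [shift_zero, ← (eq_top_iff t).2 h]; ring)

theorem lower_eq_self {t : Tri} (h : t.1 0 = 0) : lower t = t :=
  ext_shift (by unfold lower; rw [shift_sub])
    (by unfold lower; rw [shift_zero, h]; ring)

end Tri

end Gem

namespace Gem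

variable {C : Type u} (G : Gem C)

/-! ### Cancellation of a pair of triangles -/

theorem mv_ne_of_comp {x y : C} (h : G.comp 0 x ≠ G.comp 0 y) {a : Fin 3} (ha : a ≠ 0) :
    G.mv a x ≠ y := by
  rintro rfl
  exact h (G.comp_mv ha x).symm

open Classical in
/-- The neighbour of `x` after the removal of `c` and `d`. -/
noncomputable def skip (c d : C) (a : Fin 3) (x : C) : C :=
  if G.mv a x = c then G.mv a d else if G.mv a x = d then G.mv a c else G.mv a x

/-- The data for the cancellation of two triangles that share the side opposite to a vertex numbered
`0` and lie at two different such vertices. -/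
structure Dipole (c d : C) : Prop where
  mv_eq : G.mv 0 c = d
  comp_ne : G.comp 0 c ≠ G.comp 0 d

namespace Dipole

variable {G} {c d : C}

theorem mv_eq' (D : G.Dipole c d) : G.mv 0 d = c := by rw [← D.mv_eq, G.mv_mv]

theorem ne (D : G.Dipole c d) : c ≠ d := fun h => D.comp_ne (by rw [h])

/-- Here the two different vertices matter: `d` is no neighbour of `c` across the other sides, so
bypassing the removed triangles never leads back to one of them. -/
theorem mv_c_ne (D : G.Dipole c d) {a : Fin 3} (ha : a ≠ 0) : G.mv a c ≠ c ∧ G.mv a c ≠ d :=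
  ⟨G.mv_ne a c, G.mv_ne_of_comp D.comp_ne ha⟩

theorem mv_d_ne (D : G.Dipole c d) {a : Fin 3} (ha : a ≠ 0) : G.mv a d ≠ c ∧ G.mv a d ≠ d :=
  ⟨G.mv_ne_of_comp D.comp_ne.symm ha, G.mv_ne a d⟩

theorem ne_zero_of_mv_eq_c (D : G.Dipole c d) {x : C} (h : x ≠ c ∧ x ≠ d) {a : Fin 3} (hx : G.mv a x = c) : a ≠ 0 := by
  rintro rfl
  exact h.2 (by rw [← D.mv_eq, ← hx, G.mv_mv])

theorem ne_zero_of_mv_eq_d (D : G.Dipole c d) {x : C} (h : x ≠ c ∧ x ≠ d) {a : Fin 3} (hx : G.mv a x = d) : a ≠ 0 := by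
  rintro rfl
  exact h.1 (by rw [← D.mv_eq', ← hx, G.mv_mv])

theorem skip_c (c d : C) {a : Fin 3} : G.skip c d a (G.mv a c) = G.mv a d := by
  simp [skip, G.mv_mv]

theorem skip_d (D : G.Dipole c d) {a : Fin 3} : G.skip c d a (G.mv a d) = G.mv a c := by
  have := D.ne
  simp [skip, G.mv_mv, this.symm]

theorem skip_other {a : Fin 3} {x : C} (h1 : G.mv a x ≠ c) (h2 : G.mv a x ≠ d) :
    G.skip c d a x = G.mv a x := by
  simp [skip, h1, h2]

theorem skip_ne (D : G.Dipole c d) (a : Fin 3) {x : C} (h : x ≠ c ∧ x ≠ d) :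
    G.skip c d a x ≠ c ∧ G.skip c d a x ≠ d := by
  by_cases h1 : G.mv a x = c
  · rw [(G.mv_eq_comm a).1 h1, skip_c c d]
    exact D.mv_d_ne (D.ne_zero_of_mv_eq_c h h1)
  by_cases h2 : G.mv a x = d
  · rw [(G.mv_eq_comm a).1 h2, D.skip_d]
    exact D.mv_c_ne (D.ne_zero_of_mv_eq_d h h2)
  rw [skip_other h1 h2]
  exact ⟨h1, h2⟩

theorem skip_skip (D : G.Dipole c d) (a : Fin 3) {x : C} (h : x ≠ c ∧ x ≠ d) :
    G.skip c d a (G.skip c d a x) = x := by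
  by_cases h1 : G.mv a x = c
  · rw [(G.mv_eq_comm a).1 h1, skip_c c d, D.skip_d]
  by_cases h2 : G.mv a x = d
  · rw [(G.mv_eq_comm a).1 h2, D.skip_d, skip_c c d]
  rw [skip_other h1 h2, skip_other (by rw [G.mv_mv]; exact h.1) (by rw [G.mv_mv]; exact h.2),
    G.mv_mv]

theorem skip_ne_self (D : G.Dipole c d) (a : Fin 3) (x : C) : G.skip c d a x ≠ x := by
  by_cases h1 : G.mv a x = c
  · rw [(G.mv_eq_comm a).1 h1, skip_c c d]
    exact fun h => D.ne (G.mv_inj a h).symm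
  by_cases h2 : G.mv a x = d
  · rw [(G.mv_eq_comm a).1 h2, D.skip_d]
    exact fun h => D.ne (G.mv_inj a h)
  rw [skip_other h1 h2]
  exact G.mv_ne a x

/-- The result of the cancellation. -/
noncomputable def cancel (D : G.Dipole c d) : Gem {x // x ≠ c ∧ x ≠ d} where
  mv a x := ⟨G.skip c d a x, D.skip_ne a x.2⟩
  mv_mv a x := Subtype.ext (D.skip_skip a x.2)
  mv_ne a x := fun h => D.skip_ne_self a x (congrArg Subtype.val h)

end Dipole

/-! ### Invariance of the surface -/

theorem mk_mv (i : Fin 3) (c : C) {t : Tri} (ht : t.1 i = 0) :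
    (Quot.mk G.rel ⟨c, t⟩ : Quot G.rel) = Quot.mk G.rel ⟨G.mv i c, t⟩ :=
  Quot.sound ⟨i, ht, rfl⟩

/-- Points of a fan with the same place in the triangle formed by the fan are equal. -/
theorem mk_eq_of_fan_eq {n : ℕ} {v : ℕ → C}
    (hv : ∀ l, 1 ≤ l → l + 1 ≤ n → v (l + 1) = if Even l then G.mv 2 (v l) else G.mv 1 (v l))
    {l l' : ℕ} (hl : 1 ≤ l ∧ l ≤ n) (hl' : 1 ≤ l' ∧ l' ≤ n) {t t' : Tri}
    (h : Tri.fan n l hl t = Tri.fan n l' hl' t') :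
    (Quot.mk G.rel ⟨v l, t⟩ : Quot G.rel) = Quot.mk G.rel ⟨v l', t'⟩ := by
  wlog hle : l ≤ l' generalizing l l' t t'
  · exact (this hl' hl h.symm (by omega)).symm
  obtain ⟨k, rfl⟩ := Nat.exists_eq_add_of_le hle
  have hn : (n : ℝ) ≠ 0 := by exact_mod_cast (by omega : n ≠ 0)
  induction k generalizing l t with
  | zero =>
    have h0 : t.1 0 = t'.1 0 := by
      have := congrArg (fun s : Tri => s.1 0) h
      exact this
    have h2 : Tri.fanCoord n l t = Tri.fanCoord n l t' := by
      have := congrArg (fun s : Tri => s.1 2) h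
      exact this
    have hs := Tri.sum_eq t
    have hs' := Tri.sum_eq t'
    have hr : t.1 1 + t.1 2 = t'.1 1 + t'.1 2 := by linarith
    unfold Tri.fanCoord at h2
    rw [div_left_inj' hn, hr, add_right_inj] at h2
    have : t = t' := by
      refine Tri.ext_of h0 ?_
      unfold Tri.along at h2
      split_ifs at h2 <;> linarith
    rw [this]
    rfl
  | succ k ih =>
    have hl1 : 1 ≤ l + 1 ∧ l + 1 ≤ n := ⟨by omega, by omega⟩
    have h0 : t.1 0 = t'.1 0 := by
      have := congrArg (fun s : Tri => s.1 0) h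
      exact this
    have h2 : Tri.fanCoord n l t = Tri.fanCoord n (l + (k + 1)) t' := by
      have := congrArg (fun s : Tri => s.1 2) h
      exact this
    have hs := Tri.sum_eq t
    have hs' := Tri.sum_eq t'
    have hr : t.1 1 + t.1 2 = t'.1 1 + t'.1 2 := by linarith
    -- The image of a later triangle starts where that of the `l`-th ends or beyond, so a common
    -- point forces `t` onto the far side of the `l`-th triangle. The next triangle then contains it
    -- too.
    have hfull : Tri.along l t = t.1 1 + t.1 2 := by
      unfold Tri.fanCoord at h2
      rw [div_left_inj' hn, ← hr] at h2
      push_cast at h2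
      have h3 := Tri.along_le l t
      have h4 := Tri.along_nonneg (l + (k + 1)) t'
      have h5 : 0 ≤ (k : ℝ) * (t.1 1 + t.1 2) :=
        mul_nonneg (Nat.cast_nonneg k) (add_nonneg (Tri.nonneg t 1) (Tri.nonneg t 2))
      nlinarith
    have hstep : (Quot.mk G.rel ⟨v l, t⟩ : Quot G.rel) = Quot.mk G.rel ⟨v (l + 1), t⟩ := by
      rw [hv l hl.1 hl1.2]
      unfold Tri.along at hfull
      by_cases he : Even l
      · rw [if_neg (by simpa using he)] at hfull
        rw [if_pos he]
        exact G.mk_mv 2 _ (by linarith)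
      · rw [if_pos (by simpa using he)] at hfull
        rw [if_neg he]
        exact G.mk_mv 1 _ (by linarith)
    have hl'' : 1 ≤ l + 1 + k ∧ l + 1 + k ≤ n := ⟨by omega, by omega⟩
    rw [hstep]
    have e : l + (k + 1) = l + 1 + k := by ring
    have h' : Tri.fan n (l + 1) hl1 t = Tri.fan n (l + 1 + k) hl'' t' := by
      rw [Tri.fan_step hl hl1 hfull, h]
      congr 1
    have := ih hl1 hl'' h' (by omega)
    rw [this, e]

namespace Dipole

variable {G} {c d : C}

/-- A numbering of the triangles, other than `d`, at the vertex numbered `0` of `d`; the number of all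
other triangles is `0`. -/
structure Numbering (n : ℕ) (u : ℕ → C) (idx : C → ℕ) : Prop where
  odd : Odd n
  zero : u 0 = d
  step : ∀ l, u (l + 1) = if Even l then G.mv 2 (u l) else G.mv 1 (u l)
  last : u (n + 1) = d
  idx_le : ∀ x, idx x ≤ n
  u_idx : ∀ x, idx x ≠ 0 → u (idx x) = x
  idx_u : ∀ l, 1 ≤ l → l ≤ n → idx (u l) = l
  idx_eq_zero : ∀ x, idx x = 0 ↔ x = d ∨ G.comp 0 x ≠ G.comp 0 d

theorem exists_numbering [Finite C] (d : C) :
    ∃ n u idx, Numbering (G := G) (d := d) n u idx := by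
  classical
  obtain ⟨n, u, hn, h0, hstep, hlast, hinj, hcov⟩ := G.exists_cycle d
  have hcomp : ∀ l, G.comp 0 (u l) = G.comp 0 d := by
    intro l
    induction l with
    | zero => rw [h0]
    | succ l ih =>
      rw [hstep]
      split_ifs
      · rw [G.comp_mv (by decide), ih]
      · rw [G.comp_mv (by decide), ih]
  let idx : C → ℕ := fun x => if h : ∃ l ≤ n, u l = x then h.choose else 0
  have hle : ∀ x, idx x ≤ n := by
    intro x
    by_cases h : ∃ l ≤ n, u l = x
    · simp only [idx, dif_pos h]; exact h.choose_spec.1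
    · simp [idx, dif_neg h]
  have hidx : ∀ l ≤ n, idx (u l) = l := by
    intro l hl
    have h : ∃ l' ≤ n, u l' = u l := ⟨l, hl, rfl⟩
    simp only [idx, dif_pos h]
    exact hinj h.choose_spec.1 hl h.choose_spec.2
  have hu : ∀ x, idx x ≠ 0 → u (idx x) = x := by
    intro x hx
    by_cases h : ∃ l ≤ n, u l = x
    · simp only [idx, dif_pos h]; exact h.choose_spec.2
    · simp [idx, dif_neg h] at hx
  refine ⟨n, u, idx, hn, h0, hstep, hlast, hle, hu, fun l _ h => hidx l h, fun x => ⟨?_, ?_⟩⟩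
  · intro h
    by_contra hcon
    push Not at hcon
    obtain ⟨l, hl, rfl⟩ := hcov x hcon.2
    rw [hidx l hl] at h
    exact hcon.1 (by rw [h, h0])
  · rintro (rfl | h)
    · have := hidx 0 (Nat.zero_le _)
      rwa [h0] at this
    · by_contra hcon
      exact h (by rw [← hu x hcon, hcomp])

namespace Numbering

variable {n : ℕ} {u : ℕ → C} {idx : C → ℕ}

theorem one_le (N : Numbering (G := G) (d := d) n u idx) : 1 ≤ n := by
  obtain ⟨k, hk⟩ := N.odd; omega

theorem idx_d (N : Numbering (G := G) (d := d) n u idx) : idx d = 0 :=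
  (N.idx_eq_zero d).2 (Or.inl rfl)

theorem idx_c (N : Numbering (G := G) (d := d) n u idx) (D : G.Dipole c d) : idx c = 0 :=
  (N.idx_eq_zero c).2 (Or.inr D.comp_ne)

theorem range (N : Numbering (G := G) (d := d) n u idx) {x : C} (h : idx x ≠ 0) :
    1 ≤ idx x ∧ idx x ≤ n := ⟨Nat.one_le_iff_ne_zero.2 h, N.idx_le x⟩

theorem mv_one (N : Numbering (G := G) (d := d) n u idx) : G.mv 2 d = u 1 := by
  have := N.step 0
  rw [N.zero] at this
  simpa using this.symm

theorem mv_last (N : Numbering (G := G) (d := d) n u idx) : G.mv 1 d = u n := by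
  have := N.step n
  rw [N.last, if_neg (by simpa using N.odd)] at this
  rw [this, G.mv_mv]

/-- The place of a point of the fan in the triangle formed by the fan. -/
noncomputable def place (N : Numbering (G := G) (d := d) n u idx) (x : C) (t : Tri) : Tri :=
  if h : idx x = 0 then t else Tri.fan n (idx x) (N.range h) t

theorem place_u (N : Numbering (G := G) (d := d) n u idx) {l : ℕ} (h : 1 ≤ l ∧ l ≤ n) (t : Tri) :
    N.place (u l) t = Tri.fan n l h t := by
  have e := N.idx_u l h.1 h.2
  have : idx (u l) ≠ 0 := by omega
  rw [place, dif_neg this]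
  congr 1

theorem place_zero (N : Numbering (G := G) (d := d) n u idx) (x : C) (t : Tri) :
    (N.place x t).1 0 = t.1 0 := by
  unfold place
  split_ifs
  · rfl
  · rfl

theorem continuous_place (N : Numbering (G := G) (d := d) n u idx) (x : C) :
    Continuous (N.place x) := by
  by_cases h : idx x = 0
  · have : N.place x = id := by funext t; simp [place, h]
    rw [this]; exact continuous_id
  · have : N.place x = Tri.fan n (idx x) (N.range h) := by funext t; simp [place, h]
    rw [this]; exact Tri.continuous_fan _ _ _

theorem place_mv_d (N : Numbering (G := G) (d := d) n u idx) {a : Fin 3} (ha : a ≠ 0) {t : Tri}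
    (ht : t.1 a = 0) : N.place (G.mv a d) t = t := by
  fin_cases a
  · exact absurd rfl ha
  · show N.place (G.mv 1 d) t = t
    rw [N.mv_last, N.place_u ⟨N.one_le, le_rfl⟩, Tri.fan_last N.odd _ ht]
  · show N.place (G.mv 2 d) t = t
    rw [N.mv_one, N.place_u ⟨le_rfl, N.one_le⟩, Tri.fan_first _ ht]

theorem idx_mv_d (N : Numbering (G := G) (d := d) n u idx) {a : Fin 3} (ha : a ≠ 0) :
    idx (G.mv a d) ≠ 0 := by
  have := N.one_le
  fin_cases a
  · exact absurd rfl ha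
  · show idx (G.mv 1 d) ≠ 0
    rw [N.mv_last, N.idx_u n N.one_le le_rfl]; omega
  · show idx (G.mv 2 d) ≠ 0
    rw [N.mv_one, N.idx_u 1 le_rfl N.one_le]; omega

/-- Going around the vertex one stays in the fan, where neighbours agree along common sides. -/
theorem mv_of_idx_ne (N : Numbering (G := G) (d := d) n u idx) {x : C} (hx : idx x ≠ 0) {a : Fin 3}
    (ha : a ≠ 0) : G.mv a x = d ∨ (idx (G.mv a x) ≠ 0 ∧
      ∀ t : Tri, t.1 a = 0 → N.place (G.mv a x) t = N.place x t) := by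
  have key : ∀ l, 1 ≤ l → l + 1 ≤ n → ∀ t : Tri, t.1 (if Even l then 2 else 1) = 0 →
      N.place (u (l + 1)) t = N.place (u l) t := by
    intro l h1 h2 t ht
    rw [N.place_u ⟨h1, by omega⟩, N.place_u ⟨by omega, h2⟩, Tri.fan_step ⟨h1, by omega⟩]
    unfold Tri.along
    by_cases he : Even l
    · rw [if_pos he] at ht
      rw [if_neg (by simpa using he), ht, add_zero]
    · rw [if_neg he] at ht
      rw [if_pos (by simpa using he), ht, zero_add]
  obtain ⟨h1, h2⟩ := N.range hx
  obtain ⟨l, hl⟩ : ∃ l, idx x = l := ⟨_, rfl⟩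
  have hxu := N.u_idx x hx
  rw [hl] at h1 h2 hxu
  subst hxu
  by_cases hdir : a = if Even l then 2 else 1
  · have e : G.mv a (u l) = u (l + 1) := by
      rw [N.step, hdir]; split_ifs <;> rfl
    rw [e]
    rcases Nat.eq_or_lt_of_le h2 with rfl | h3
    · exact Or.inl N.last
    · refine Or.inr ⟨by rw [N.idx_u _ (by omega) h3]; omega, fun t ht => key l h1 h3 t ?_⟩
      rw [← hdir]; exact ht
  · obtain ⟨k, rfl⟩ : ∃ k, l = k + 1 := ⟨l - 1, by omega⟩
    have hdir' : a = if Even k then 2 else 1 := by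
      have : Even (k + 1) ↔ ¬ Even k := by simp [parity_simps]
      simp only [this] at hdir
      by_cases he : Even k
      · simp only [he, not_true, if_false, if_true] at hdir ⊢
        omega
      · simp only [he, not_false_iff, if_true, if_false] at hdir ⊢
        omega
    have e : G.mv a (u (k + 1)) = u k := by
      rw [N.step, hdir']; split_ifs <;> rw [G.mv_mv]
    rw [e]
    rcases Nat.eq_zero_or_pos k with rfl | h3
    · exact Or.inl N.zero
    · refine Or.inr ⟨by rw [N.idx_u _ h3 (by omega)]; omega, fun t ht => (key k h3 h2 t ?_).symm⟩
      rw [← hdir']; exact ht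

theorem mv_of_idx_eq (N : Numbering (G := G) (d := d) n u idx) {x : C} (hx : idx x = 0) (hxd : x ≠ d)
    {a : Fin 3} (ha : a ≠ 0) : G.mv a x ≠ d ∧ idx (G.mv a x) = 0 := by
  have h : G.comp 0 x ≠ G.comp 0 d := ((N.idx_eq_zero x).1 hx).resolve_left hxd
  refine ⟨G.mv_ne_of_comp h ha, (N.idx_eq_zero _).2 (Or.inr ?_)⟩
  rwa [G.comp_mv ha]

end Numbering

end Dipole

end Gem

/-! ### The layouts before and after a cancellation, and their comparison -/

namespace Gem

variable {C : Type u} {G : Gem C} {c d : C}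

namespace Dipole

open Tri

open Classical in
/-- The surface before the cancellation, with `c`, `d` and the fan laid out in one triangle. -/
noncomputable def collapse {n : ℕ} {u : ℕ → C} {idx : C → ℕ}
    (N : Numbering (G := G) (d := d) n u idx) (c : C) (p : Σ _ : C, Tri) : Σ _ : C, Tri :=
  if p.1 = c then ⟨d, upper p.2⟩ else if p.1 = d then ⟨d, middle p.2⟩ else
    if idx p.1 = 0 then p else ⟨d, lower (N.place p.1 p.2)⟩

/-- The surface after the cancellation, with the fan laid out in one triangle. -/
noncomputable def collapse' {n : ℕ} {u : ℕ → C} {idx : C → ℕ}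
    (N : Numbering (G := G) (d := d) n u idx) (c : C) (p : Σ _ : {x // x ≠ c ∧ x ≠ d}, Tri) :
    Σ _ : C, Tri :=
  if idx p.1.1 = 0 then ⟨p.1.1, p.2⟩ else ⟨d, N.place p.1.1 p.2⟩

section

variable {n : ℕ} {u : ℕ → C} {idx : C → ℕ} (N : Numbering (G := G) (d := d) n u idx)

theorem collapse_c (t : Tri) : collapse N c ⟨c, t⟩ = ⟨d, upper t⟩ := by simp [collapse]

theorem collapse_d (h : c ≠ d) (t : Tri) : collapse N c ⟨d, t⟩ = ⟨d, middle t⟩ := by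
  simp [collapse, h.symm]

theorem collapse_other {x : C} (h : x ≠ c ∧ x ≠ d) (hx : idx x = 0) (t : Tri) :
    collapse N c ⟨x, t⟩ = ⟨x, t⟩ := by
  simp [collapse, h.1, h.2, hx]

theorem collapse_fan {x : C} (hc : idx c = 0) (hx : idx x ≠ 0) (t : Tri) :
    collapse N c ⟨x, t⟩ = ⟨d, lower (N.place x t)⟩ := by
  have h1 : x ≠ c := by rintro rfl; exact hx hc
  have h2 : x ≠ d := by rintro rfl; exact hx N.idx_d
  simp [collapse, h1, h2, hx]

theorem collapse'_other {x : C} (h : x ≠ c ∧ x ≠ d) (hx : idx x = 0) (t : Tri) :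
    collapse' N c ⟨⟨x, h⟩, t⟩ = ⟨x, t⟩ := by
  simp [collapse', hx]

theorem collapse'_fan {x : C} (h : x ≠ c ∧ x ≠ d) (hx : idx x ≠ 0) (t : Tri) :
    collapse' N c ⟨⟨x, h⟩, t⟩ = ⟨d, N.place x t⟩ := by
  simp [collapse', hx]

theorem continuous_mk_triangle (x : C) : Continuous (fun t : Tri => (⟨x, t⟩ : Σ _ : C, Tri)) :=
  continuous_sigmaMk (σ := fun _ : C => Tri) (i := x)

theorem continuous_collapse (D : G.Dipole c d) : Continuous (collapse N c) := by
  refine continuous_sigma fun x => ?_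
  by_cases h1 : x = c
  · rw [h1]
    simp only [collapse_c]
    exact (continuous_mk_triangle d).comp continuous_upper
  by_cases h2 : x = d
  · rw [h2]
    simp only [collapse_d N D.ne]
    exact (continuous_mk_triangle d).comp continuous_middle
  by_cases h3 : idx x = 0
  · simp only [collapse_other N ⟨h1, h2⟩ h3]
    exact continuous_mk_triangle x
  · simp only [collapse_fan N (N.idx_c D) h3]
    exact (continuous_mk_triangle d).comp (continuous_lower.comp (N.continuous_place x))

theorem continuous_collapse' : Continuous (collapse' N c) := by
  refine continuous_sigma fun x => ?_
  by_cases h3 : idx x.1 = 0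
  · simp only [collapse'_other N x.2 h3]
    exact continuous_mk_triangle x.1
  · simp only [collapse'_fan N x.2 h3]
    exact (continuous_mk_triangle d).comp (N.continuous_place x.1)

theorem snd_eq {x : C} {s t : Tri} (h : (⟨x, s⟩ : Σ _ : C, Tri) = ⟨x, t⟩) : s = t := by
  simpa using h

theorem fst_eq {x y : C} {s t : Tri} (h : (⟨x, s⟩ : Σ _ : C, Tri) = ⟨y, t⟩) : x = y :=
  congrArg Sigma.fst h

theorem idx_ne_imp (N : Numbering (G := G) (d := d) n u idx) (D : G.Dipole c d) {x : C} (hx : idx x ≠ 0) : x ≠ c ∧ x ≠ d := by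
  refine ⟨?_, ?_⟩
  · rintro rfl; exact hx (N.idx_c D)
  · rintro rfl; exact hx N.idx_d

/-- Points of the fan in the same place are equal. -/
theorem mk_eq_of_place_eq {x y : C} (hx : idx x ≠ 0) (hy : idx y ≠ 0) {s t : Tri}
    (h : N.place x s = N.place y t) : (Quot.mk G.rel ⟨x, s⟩ : Quot G.rel) = Quot.mk G.rel ⟨y, t⟩ := by
  rw [Numbering.place, dif_neg hx, Numbering.place, dif_neg hy] at h
  have := G.mk_eq_of_fan_eq (v := u) (fun l _ _ => N.step l) _ _ h
  rwa [N.u_idx x hx, N.u_idx y hy] at this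

/-- The fan contains neither `c` nor `d`, so all gluings inside it survive the cancellation. -/
theorem mk_eq_of_place_eq' (D : G.Dipole c d) {x y : C} (hx : idx x ≠ 0) (hy : idx y ≠ 0) {s t : Tri}
    (h : N.place x s = N.place y t) :
    (Quot.mk D.cancel.rel ⟨⟨x, idx_ne_imp N D hx⟩, s⟩ : Quot D.cancel.rel) =
      Quot.mk D.cancel.rel ⟨⟨y, idx_ne_imp N D hy⟩, t⟩ := by
  classical
  rw [Numbering.place, dif_neg hx, Numbering.place, dif_neg hy] at h
  let v : ℕ → {x // x ≠ c ∧ x ≠ d} := fun l =>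
    if h : u l ≠ c ∧ u l ≠ d then ⟨u l, h⟩ else ⟨x, idx_ne_imp N D hx⟩
  have hv : ∀ l, (1 ≤ l ∧ l ≤ n) → (v l).1 = u l := by
    intro l hl
    have : u l ≠ c ∧ u l ≠ d := idx_ne_imp N D (by rw [N.idx_u l hl.1 hl.2]; omega)
    simp only [v, dif_pos this]
  have := D.cancel.mk_eq_of_fan_eq (v := v) (n := n) (fun l h1 h2 => ?_) _ _ h
  · have e1 : v (idx x) = ⟨x, idx_ne_imp N D hx⟩ :=
      Subtype.ext (by rw [hv _ (N.range hx), N.u_idx x hx])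
    have e2 : v (idx y) = ⟨y, idx_ne_imp N D hy⟩ :=
      Subtype.ext (by rw [hv _ (N.range hy), N.u_idx y hy])
    rwa [e1, e2] at this
  · have h3 : u (l + 1) ≠ c ∧ u (l + 1) ≠ d :=
      idx_ne_imp N D (by rw [N.idx_u _ (by omega) h2]; omega)
    have hst := N.step l
    apply Subtype.ext
    rw [hv _ ⟨by omega, h2⟩]
    by_cases he : Even l
    · rw [if_pos he] at hst ⊢
      show _ = G.skip c d 2 (v l)
      rw [hv l ⟨h1, by omega⟩, skip_other (by rw [← hst]; exact h3.1) (by rw [← hst]; exact h3.2), hst]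
    · rw [if_neg he] at hst ⊢
      show _ = G.skip c d 1 (v l)
      rw [hv l ⟨h1, by omega⟩, skip_other (by rw [← hst]; exact h3.1) (by rw [← hst]; exact h3.2), hst]

/-- Such a point of `d` lies on an outer side; across this side it reaches the first or last
triangle of the fan, whose outer side is laid out undistorted. -/
theorem mk_d_eq_of_place {y : C} (hy : idx y ≠ 0) {s t : Tri}
    (h : middle s = lower (N.place y t)) :
    (Quot.mk G.rel ⟨d, s⟩ : Quot G.rel) = Quot.mk G.rel ⟨y, t⟩ := by
  obtain ⟨h1, h2⟩ := middle_eq_lower h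
  have : ∃ a : Fin 3, a ≠ 0 ∧ s.1 a = 0 := by
    rcases h2 with h2 | h2
    · exact ⟨1, by decide, h2⟩
    · exact ⟨2, by decide, h2⟩
  obtain ⟨a, ha, hs⟩ := this
  rw [G.mk_mv a d hs]
  refine mk_eq_of_place_eq N (N.idx_mv_d ha) hy ?_
  rw [N.place_mv_d ha hs, h1]

theorem mk_c_eq_d (D : G.Dipole c d) {s : Tri} (h : s.1 0 = 0) :
    (Quot.mk G.rel ⟨c, s⟩ : Quot G.rel) = Quot.mk G.rel ⟨d, s⟩ := by
  rw [G.mk_mv 0 c h, D.mv_eq]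

/-- The layers for `c`, `d` and the fan overlap only along their common borders, where the points
are glued in the surface; a coincidence of `c` with the fan is passed through `d`. -/
theorem collapse_fibre (D : G.Dipole c d) (p q : Σ _ : C, Tri) (h : collapse N c p = collapse N c q) :
    (Quot.mk G.rel p : Quot G.rel) = Quot.mk G.rel q := by
  have hc := N.idx_c D
  have hne := D.ne
  have key : ∀ x : C, x = c ∨ x = d ∨ (idx x = 0 ∧ x ≠ c ∧ x ≠ d) ∨ idx x ≠ 0 := by
    intro x; tauto
  have hmid : ∀ {y s t}, idx y ≠ 0 → upper s = lower (N.place y t) →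
      (Quot.mk G.rel ⟨c, s⟩ : Quot G.rel) = Quot.mk G.rel ⟨y, t⟩ := by
    intro y s t hy e
    have h0 := upper_eq_lower e
    rw [mk_c_eq_d D h0]
    exact mk_d_eq_of_place N hy (by rw [← upper_eq_middle_of h0, e])
  obtain ⟨x, s⟩ := p
  obtain ⟨y, t⟩ := q
  rcases key x with rfl | rfl | hx | hx <;> rcases key y with rfl | rfl | hy | hy
  · rw [collapse_c, collapse_c] at h
    rw [upper_injective (snd_eq h)]
  · rw [collapse_c, collapse_d N hne] at h
    obtain ⟨rfl, h0⟩ := upper_eq_middle (snd_eq h)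
    exact mk_c_eq_d D h0
  · rw [collapse_c, collapse_other N hy.2 hy.1] at h
    exact absurd (fst_eq h).symm hy.2.2
  · rw [collapse_c, collapse_fan N hc hy] at h
    exact hmid hy (snd_eq h)
  · rw [collapse_c, collapse_d N hne] at h
    obtain ⟨rfl, h0⟩ := upper_eq_middle (snd_eq h).symm
    exact (mk_c_eq_d D h0).symm
  · rw [collapse_d N hne, collapse_d N hne] at h
    rw [middle_injective (snd_eq h)]
  · rw [collapse_d N hne, collapse_other N hy.2 hy.1] at h
    exact absurd (fst_eq h).symm hy.2.2
  · rw [collapse_d N hne, collapse_fan N hc hy] at h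
    exact mk_d_eq_of_place N hy (snd_eq h)
  · rw [collapse_c, collapse_other N hx.2 hx.1] at h
    exact absurd (fst_eq h) hx.2.2
  · rw [collapse_d N hne, collapse_other N hx.2 hx.1] at h
    exact absurd (fst_eq h) hx.2.2
  · rw [collapse_other N hx.2 hx.1, collapse_other N hy.2 hy.1] at h
    rw [h]
  · rw [collapse_fan N hc hy, collapse_other N hx.2 hx.1] at h
    exact absurd (fst_eq h) hx.2.2
  · rw [collapse_c, collapse_fan N hc hx] at h
    exact (hmid hx (snd_eq h).symm).symm
  · rw [collapse_d N hne, collapse_fan N hc hx] at h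
    exact (mk_d_eq_of_place N hx (snd_eq h).symm).symm
  · rw [collapse_fan N hc hx, collapse_other N hy.2 hy.1] at h
    exact absurd (fst_eq h).symm hy.2.2
  · rw [collapse_fan N hc hx, collapse_fan N hc hy] at h
    exact mk_eq_of_place_eq N hx hy (lower_injective (snd_eq h))

theorem collapse'_fibre (D : G.Dipole c d) (p q : Σ _ : {x // x ≠ c ∧ x ≠ d}, Tri)
    (h : collapse' N c p = collapse' N c q) :
    (Quot.mk D.cancel.rel p : Quot D.cancel.rel) = Quot.mk D.cancel.rel q := by
  obtain ⟨⟨x, hx⟩, s⟩ := p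
  obtain ⟨⟨y, hy⟩, t⟩ := q
  by_cases h1 : idx x = 0 <;> by_cases h2 : idx y = 0
  · rw [collapse'_other N hx h1, collapse'_other N hy h2] at h
    obtain rfl := fst_eq h
    rw [snd_eq h]
  · rw [collapse'_other N hx h1, collapse'_fan N hy h2] at h
    exact absurd (fst_eq h) hx.2
  · rw [collapse'_fan N hx h1, collapse'_other N hy h2] at h
    exact absurd (fst_eq h).symm hy.2
  · rw [collapse'_fan N hx h1, collapse'_fan N hy h2] at h
    exact mk_eq_of_place_eq' N D h1 h2 (snd_eq h)

theorem exists_collapse_fan (y : Tri) : ∃ x, ∃ _ : idx x ≠ 0, ∃ t, N.place x t = y := by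
  obtain ⟨l, h, t, rfl⟩ := fan_surjective N.one_le y
  exact ⟨u l, by rw [N.idx_u l h.1 h.2]; omega, t, N.place_u h t⟩

theorem exists_collapse_d (D : G.Dipole c d) (y : Tri) : ∃ p, collapse N c p = ⟨d, y⟩ := by
  rcases layers_surjective y with ⟨t, rfl⟩ | ⟨t, rfl⟩ | ⟨t, rfl⟩
  · exact ⟨_, collapse_c N t⟩
  · exact ⟨_, collapse_d N D.ne t⟩
  · obtain ⟨x, hx, s, rfl⟩ := exists_collapse_fan N t
    exact ⟨_, collapse_fan N (N.idx_c D) hx s⟩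

theorem exists_collapse'_d (D : G.Dipole c d) (y : Tri) : ∃ p, collapse' N c p = ⟨d, y⟩ := by
  obtain ⟨x, hx, s, rfl⟩ := exists_collapse_fan N y
  exact ⟨_, collapse'_fan N (idx_ne_imp N D hx) hx s⟩

theorem exists_collapse_eq (D : G.Dipole c d) (p' : Σ _ : {x // x ≠ c ∧ x ≠ d}, Tri) :
    ∃ p, collapse N c p = collapse' N c p' := by
  obtain ⟨⟨x, hx⟩, s⟩ := p'
  by_cases h : idx x = 0
  · exact ⟨⟨x, s⟩, by rw [collapse'_other N hx h, collapse_other N hx h]⟩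
  · rw [collapse'_fan N hx h]
    exact exists_collapse_d N D _

theorem exists_collapse'_eq (D : G.Dipole c d) (p : Σ _ : C, Tri) :
    ∃ p', collapse' N c p' = collapse N c p := by
  obtain ⟨x, s⟩ := p
  by_cases h1 : x = c
  · subst h1; rw [collapse_c]; exact exists_collapse'_d N D _
  by_cases h2 : x = d
  · subst h2; rw [collapse_d N D.ne]; exact exists_collapse'_d N D _
  by_cases h : idx x = 0
  · exact ⟨⟨⟨x, h1, h2⟩, s⟩, by rw [collapse'_other N _ h, collapse_other N ⟨h1, h2⟩ h]⟩
  · rw [collapse_fan N (N.idx_c D) h]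
    exact exists_collapse'_d N D _

/-- Away from the lower part of the fan both layouts agree. -/
theorem collapse_eq_of (D : G.Dipole c d) {x : C} (hx : x ≠ c ∧ x ≠ d) {t : Tri}
    (h : idx x = 0 ∨ t.1 0 = 0) : collapse' N c ⟨⟨x, hx⟩, t⟩ = collapse N c ⟨x, t⟩ := by
  by_cases h0 : idx x = 0
  · rw [collapse'_other N hx h0, collapse_other N hx h0]
  · have ht := h.resolve_left h0
    rw [collapse'_fan N hx h0, collapse_fan N (N.idx_c D) h0,
      lower_eq_self (by rw [N.place_zero]; exact ht)]

/-- After the cancellation the outer sides of the fan take over the role of the sides of `c`;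
`upper` fixes these sides, so the two layouts agree there. -/
theorem collapse_c_eq (D : G.Dipole c d) {a : Fin 3} (ha : a ≠ 0) {t : Tri} (ht : t.1 a = 0) :
    collapse' N c ⟨⟨G.mv a d, D.mv_d_ne ha⟩, t⟩ = collapse N c ⟨c, t⟩ := by
  rw [collapse'_fan N _ (N.idx_mv_d ha), collapse_c, N.place_mv_d ha ht, upper_eq_self]
  fin_cases a
  · exact absurd rfl ha
  · exact Or.inl ht
  · exact Or.inr ht

theorem idx_mv_c (N : Numbering (G := G) (d := d) n u idx) (D : G.Dipole c d) {a : Fin 3} (ha : a ≠ 0) : idx (G.mv a c) = 0 :=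
  (N.mv_of_idx_eq (N.idx_c D) D.ne ha).2

theorem cancel_mv_eq (D : G.Dipole c d) {a : Fin 3} {x y : {x // x ≠ c ∧ x ≠ d}}
    (h : G.skip c d a x = y) {t : Tri} (ht : t.1 a = 0) :
    (Quot.mk D.cancel.rel ⟨x, t⟩ : Quot D.cancel.rel) = Quot.mk D.cancel.rel ⟨y, t⟩ := by
  rw [D.cancel.mk_mv a x ht]
  congr 2
  exact Subtype.ext h

theorem rel_collapse (D : G.Dipole c d) (p q : Σ _ : C, Tri) (h : G.rel p q) :
    ∃ p' q', collapse' N c p' = collapse N c p ∧ collapse' N c q' = collapse N c q ∧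
      (Quot.mk D.cancel.rel p' : Quot D.cancel.rel) = Quot.mk D.cancel.rel q' := by
  obtain ⟨i, ht, hq⟩ := h
  obtain ⟨x, t⟩ := p
  subst hq
  change t.1 i = 0 at ht
  show ∃ p' q', collapse' N c p' = collapse N c ⟨x, t⟩ ∧
    collapse' N c q' = collapse N c ⟨G.mv i x, t⟩ ∧ _
  -- If both points have the same place in the layout, one point over that place serves for both.
  have easy : collapse N c ⟨x, t⟩ = collapse N c ⟨G.mv i x, t⟩ →
      ∃ p' q', collapse' N c p' = collapse N c ⟨x, t⟩ ∧
      collapse' N c q' = collapse N c ⟨G.mv i x, t⟩ ∧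
      (Quot.mk D.cancel.rel p' : Quot D.cancel.rel) = Quot.mk D.cancel.rel q' := by
    intro e
    obtain ⟨p', hp'⟩ := exists_collapse'_eq N D ⟨x, t⟩
    exact ⟨p', p', hp', hp'.trans e, rfl⟩
  have hc := N.idx_c D
  have hcd : i = 0 → collapse N c ⟨c, t⟩ = collapse N c ⟨d, t⟩ := by
    rintro rfl
    rw [collapse_c, collapse_d N D.ne, upper_eq_middle_of ht]
  have hdfan : i ≠ 0 → collapse N c ⟨d, t⟩ = collapse N c ⟨G.mv i d, t⟩ := by
    intro hi
    rw [collapse_d N D.ne, collapse_fan N hc (N.idx_mv_d hi), N.place_mv_d hi ht, middle_eq_lower_of]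
    fin_cases i
    · exact absurd rfl hi
    · exact Or.inl ht
    · exact Or.inr ht
  have hcc : ∀ hi : i ≠ 0, collapse' N c ⟨⟨G.mv i c, D.mv_c_ne hi⟩, t⟩ = collapse N c ⟨G.mv i c, t⟩ ∧
      (Quot.mk D.cancel.rel ⟨⟨G.mv i d, D.mv_d_ne hi⟩, t⟩ : Quot D.cancel.rel) =
        Quot.mk D.cancel.rel ⟨⟨G.mv i c, D.mv_c_ne hi⟩, t⟩ := fun hi =>
    ⟨collapse_eq_of N D _ (Or.inl (idx_mv_c N D hi)), cancel_mv_eq D (skip_d D) ht⟩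
  by_cases h1 : x = c
  · rw [h1] at easy ⊢
    by_cases hi : i = 0
    · refine easy ?_
      rw [hcd hi, hi, D.mv_eq]
    · obtain ⟨e1, e2⟩ := hcc hi
      exact ⟨_, _, collapse_c_eq N D hi ht, e1, e2⟩
  by_cases h2 : x = d
  · rw [h2] at easy ⊢
    refine easy ?_
    by_cases hi : i = 0
    · rw [← hcd hi, hi, D.mv_eq']
    · exact hdfan hi
  by_cases h3 : G.mv i x = c
  · have hi := D.ne_zero_of_mv_eq_c ⟨h1, h2⟩ h3
    obtain rfl := (G.mv_eq_comm i).1 h3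
    obtain ⟨e1, e2⟩ := hcc hi
    rw [G.mv_mv]
    exact ⟨_, _, e1, collapse_c_eq N D hi ht, e2.symm⟩
  by_cases h4 : G.mv i x = d
  · have hi := D.ne_zero_of_mv_eq_d ⟨h1, h2⟩ h4
    obtain rfl := (G.mv_eq_comm i).1 h4
    rw [G.mv_mv] at easy ⊢
    exact easy (hdfan hi).symm
  by_cases hi : i = 0
  · subst hi
    exact ⟨_, _, collapse_eq_of N D ⟨h1, h2⟩ (Or.inr ht), collapse_eq_of N D ⟨h3, h4⟩ (Or.inr ht),
      cancel_mv_eq D (skip_other h3 h4) ht⟩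
  by_cases hx : idx x = 0
  · exact ⟨_, _, collapse_eq_of N D ⟨h1, h2⟩ (Or.inl hx),
      collapse_eq_of N D ⟨h3, h4⟩ (Or.inl (N.mv_of_idx_eq hx h2 hi).2),
      cancel_mv_eq D (skip_other h3 h4) ht⟩
  · obtain ⟨e1, e2⟩ := (N.mv_of_idx_ne hx hi).resolve_left h4
    refine easy ?_
    rw [collapse_fan N hc hx, collapse_fan N hc e1, e2 t ht]

theorem rel_collapse' (D : G.Dipole c d) (p' q' : Σ _ : {x // x ≠ c ∧ x ≠ d}, Tri)
    (h : D.cancel.rel p' q') :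
    ∃ p q, collapse N c p = collapse' N c p' ∧ collapse N c q = collapse' N c q' ∧
      (Quot.mk G.rel p : Quot G.rel) = Quot.mk G.rel q := by
  obtain ⟨i, ht, hq⟩ := h
  obtain ⟨⟨x, hx⟩, t⟩ := p'
  subst hq
  change t.1 i = 0 at ht
  have e : D.cancel.mv i ⟨x, hx⟩ = ⟨G.skip c d i x, D.skip_ne i hx⟩ := rfl
  show ∃ p q, collapse N c p = collapse' N c ⟨⟨x, hx⟩, t⟩ ∧
    collapse N c q = collapse' N c ⟨D.cancel.mv i ⟨x, hx⟩, t⟩ ∧ _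
  rw [e]
  by_cases h3 : G.mv i x = c
  · have hi := D.ne_zero_of_mv_eq_c hx h3
    obtain rfl := (G.mv_eq_comm i).1 h3
    refine ⟨⟨G.mv i c, t⟩, ⟨c, t⟩, (collapse_eq_of N D _ (Or.inl (idx_mv_c N D hi))).symm, ?_,
      (G.mk_mv i c ht).symm⟩
    rw [← collapse_c_eq N D hi ht]
    congr 3
    exact (skip_c c d).symm
  by_cases h4 : G.mv i x = d
  · have hi := D.ne_zero_of_mv_eq_d hx h4
    obtain rfl := (G.mv_eq_comm i).1 h4
    refine ⟨⟨c, t⟩, ⟨G.mv i c, t⟩, (collapse_c_eq N D hi ht).symm, ?_, G.mk_mv i c ht⟩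
    rw [← collapse_eq_of N D (D.mv_c_ne hi) (Or.inl (idx_mv_c N D hi))]
    congr 3
    exact (skip_d D).symm
  have e2 : (⟨G.skip c d i x, D.skip_ne i hx⟩ : {x // x ≠ c ∧ x ≠ d}) = ⟨G.mv i x, h3, h4⟩ :=
    Subtype.ext (skip_other h3 h4)
  rw [e2]
  by_cases hi : i = 0
  · subst hi
    exact ⟨_, _, (collapse_eq_of N D hx (Or.inr ht)).symm,
      (collapse_eq_of N D ⟨h3, h4⟩ (Or.inr ht)).symm, G.mk_mv 0 x ht⟩
  by_cases hx0 : idx x = 0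
  · exact ⟨_, _, (collapse_eq_of N D hx (Or.inl hx0)).symm,
      (collapse_eq_of N D ⟨h3, h4⟩ (Or.inl (N.mv_of_idx_eq hx0 hx.2 hi).2)).symm, G.mk_mv i x ht⟩
  · obtain ⟨e1, e2⟩ := (N.mv_of_idx_ne hx0 hi).resolve_left h4
    obtain ⟨p, hp⟩ := exists_collapse_eq N D ⟨⟨x, hx⟩, t⟩
    refine ⟨p, p, hp, hp.trans ?_, rfl⟩
    rw [collapse'_fan N hx hx0, collapse'_fan N _ e1, e2 t ht]

end

/-- Before the cancellation `c`, `d` and the fan fill one triangle in three layers; afterwards the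
stretched fan alone fills it. All other triangles stay fixed, and both layouts have the same image.
-/
theorem nonempty_homeomorph [Finite C] (D : G.Dipole c d) :
    Nonempty (G.Surface ≃ₜ D.cancel.Surface) := by
  obtain ⟨n, u, idx, N⟩ := exists_numbering (G := G) d
  have : CompactSpace Tri := isCompact_iff_compactSpace.1 (isCompact_stdSimplex ℝ (Fin 3))
  exact nonempty_homeomorph_quot (continuous_collapse N D) (continuous_collapse' N)
    (exists_collapse_eq N D) (exists_collapse'_eq N D) (collapse_fibre N D) (collapse'_fibre N D)
    (rel_collapse' N D) (rel_collapse N D)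

end Dipole

end Gem

universe v

namespace Gem

variable {C : Type u} {G : Gem C} {c d : C}

/-! ### Invariance of the other data under cancellation -/

variable (G) in
def Orb (S : Fin 3 → Prop) : Type u := Quot (fun c d : C => ∃ a, S a ∧ d = G.mv a c)

variable (G) in
def orb (S : Fin 3 → Prop) (c : C) : G.Orb S := Quot.mk _ c

theorem orb_mv (S : Fin 3 → Prop) {a : Fin 3} (ha : S a) (c : C) :
    G.orb S (G.mv a c) = G.orb S c :=
  (Quot.sound ⟨a, ha, rfl⟩ : G.orb S c = G.orb S (G.mv a c)).symm

namespace Dipole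

theorem Numbering.skip_u (D : G.Dipole c d) {n : ℕ} {u : ℕ → C} {idx : C → ℕ}
    (N : Numbering (G := G) (d := d) n u idx) {l : ℕ} (h1 : 1 ≤ l) (h2 : l + 1 ≤ n) :
    ∃ a, a ≠ 0 ∧ G.skip c d a (u l) = u (l + 1) := by
  have h3 : u (l + 1) ≠ c ∧ u (l + 1) ≠ d :=
    idx_ne_imp N D (by rw [N.idx_u _ (by omega) h2]; omega)
  have hst := N.step l
  by_cases he : Even l
  · rw [if_pos he] at hst
    exact ⟨2, by decide, by rw [skip_other (by rw [← hst]; exact h3.1) (by rw [← hst]; exact h3.2), hst]⟩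
  · rw [if_neg he] at hst
    exact ⟨1, by decide, by rw [skip_other (by rw [← hst]; exact h3.1) (by rw [← hst]; exact h3.2), hst]⟩

/-- Removing one triangle from the cycle around a vertex leaves a path, which is still connected. -/
theorem cancel_comp_fan [Finite C] (D : G.Dipole c d) {x y : {x // x ≠ c ∧ x ≠ d}}
    (hx : G.comp 0 x.1 = G.comp 0 d) (hy : G.comp 0 y.1 = G.comp 0 d) :
    D.cancel.comp 0 x = D.cancel.comp 0 y := by
  obtain ⟨n, u, idx, N⟩ := exists_numbering (G := G) d
  have key : ∀ l (z : {x // x ≠ c ∧ x ≠ d}), 1 ≤ l → l ≤ n → z.1 = u l →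
      D.cancel.comp 0 z = D.cancel.comp 0 ⟨G.mv 2 d, D.mv_d_ne (by decide)⟩ := by
    intro l z h1
    induction l, h1 using Nat.le_induction generalizing z with
    | base =>
      intro _ hz
      congr 1
      exact Subtype.ext (hz.trans N.mv_one.symm)
    | succ l hl ih =>
      intro hle hz
      have hw : u l ≠ c ∧ u l ≠ d := idx_ne_imp N D (by rw [N.idx_u _ hl (by omega)]; omega)
      rw [← ih ⟨u l, hw⟩ (by omega) rfl]
      obtain ⟨a, ha, hs⟩ := N.skip_u D hl hle
      have : z = D.cancel.mv a ⟨u l, hw⟩ := Subtype.ext (hz.trans hs.symm)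
      rw [this, D.cancel.comp_mv ha]
  have hidx : ∀ z : {x // x ≠ c ∧ x ≠ d}, G.comp 0 z.1 = G.comp 0 d → idx z.1 ≠ 0 := by
    intro z hz h
    rcases (N.idx_eq_zero _).1 h with h | h
    · exact z.2.2 h
    · exact h hz
  have hx' := N.range (hidx x hx)
  have hy' := N.range (hidx y hy)
  rw [key _ x hx'.1 hx'.2 (N.u_idx _ (hidx x hx)).symm, key _ y hy'.1 hy'.2 (N.u_idx _ (hidx y hy)).symm]

theorem cancel_mv_c (D : G.Dipole c d) {a : Fin 3} (ha : a ≠ 0) :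
    D.cancel.mv a ⟨G.mv a c, D.mv_c_ne ha⟩ = ⟨G.mv a d, D.mv_d_ne ha⟩ := Subtype.ext (skip_c c d)

theorem cancel_comp_c [Finite C] (D : G.Dipole c d) {a : Fin 3} (ha : a ≠ 0)
    {x : {x // x ≠ c ∧ x ≠ d}} (hx : G.comp 0 x.1 = G.comp 0 d) :
    D.cancel.comp 0 ⟨G.mv a c, D.mv_c_ne ha⟩ = D.cancel.comp 0 x := by
  rw [← D.cancel.comp_mv ha, D.cancel_mv_c ha]
  exact D.cancel_comp_fan (G.comp_mv ha d) hx

theorem cancel_orb_c [Finite C] (D : G.Dipole c d) {S : Fin 3 → Prop} {a b : Fin 3} (ha : a ≠ 0)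
    (hb : b ≠ 0) (hSa : S a) (hSb : S b) : D.cancel.orb S ⟨G.mv a c, D.mv_c_ne ha⟩ =
      D.cancel.orb S ⟨G.mv b c, D.mv_c_ne hb⟩ := by
  by_cases hab : a = b
  · subst hab; rfl
  have hS : ∀ i : Fin 3, i ≠ 0 → S i := by
    intro i hi
    have : i = a ∨ i = b := by omega
    rcases this with rfl | rfl <;> assumption
  have h : D.cancel.comp 0 ⟨G.mv a c, D.mv_c_ne ha⟩ = D.cancel.comp 0 ⟨G.mv b c, D.mv_c_ne hb⟩ := by
    have hx : G.comp 0 (G.mv 1 d) = G.comp 0 d := G.comp_mv (by decide) d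
    rw [D.cancel_comp_c ha (x := ⟨G.mv 1 d, D.mv_d_ne (by decide)⟩) hx,
      D.cancel_comp_c hb (x := ⟨G.mv 1 d, D.mv_d_ne (by decide)⟩) hx]
  exact congrArg (Quot.map id fun x y ⟨i, hi, e⟩ => ⟨i, hS i hi, e⟩) h

/-- When colour `0` is among the allowed moves, `c` and `d` belong to one orbit, which keeps other
members. The removed triangles are therefore represented by a remaining neighbour, and no orbit is
lost or split. -/
theorem exists_orb_equiv [Finite C] (D : G.Dipole c d) {S : Fin 3 → Prop} (h0 : S 0)
    {b : Fin 3} (hb : b ≠ 0) (hSb : S b) : Nonempty (D.cancel.Orb S ≃ G.Orb S) := by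
  classical
  have hcd : G.orb S d = G.orb S c := by rw [← D.mv_eq, orb_mv S h0]
  let prj : D.cancel.Orb S → G.Orb S := Quot.lift (fun x => G.orb S x.1) (by
    rintro x y ⟨a, ha, rfl⟩
    show G.orb S x.1 = G.orb S (G.skip c d a x.1)
    by_cases h1 : G.mv a x.1 = c
    · rw [(G.mv_eq_comm a).1 h1, skip_c, orb_mv S ha, orb_mv S ha, hcd]
    by_cases h2 : G.mv a x.1 = d
    · rw [(G.mv_eq_comm a).1 h2, skip_d D, orb_mv S ha, orb_mv S ha, hcd]
    rw [skip_other h1 h2, orb_mv S ha])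
  let g : C → D.cancel.Orb S := fun x =>
    if h : x ≠ c ∧ x ≠ d then D.cancel.orb S ⟨x, h⟩
    else D.cancel.orb S ⟨G.mv b c, D.mv_c_ne hb⟩
  have gc : g c = D.cancel.orb S ⟨G.mv b c, D.mv_c_ne hb⟩ := by simp [g]
  have gd : g d = D.cancel.orb S ⟨G.mv b c, D.mv_c_ne hb⟩ := by simp [g]
  have go : ∀ {x} (h : x ≠ c ∧ x ≠ d), g x = D.cancel.orb S ⟨x, h⟩ := fun h => by simp only [g, dif_pos h]
  have hc : ∀ a, S a → g (G.mv a c) = g c := by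
    intro a ha
    by_cases h : a = 0
    · rw [h, D.mv_eq, gc, gd]
    · rw [go (D.mv_c_ne h), gc, D.cancel_orb_c h hb ha hSb]
  have hd : ∀ a, S a → g (G.mv a d) = g d := by
    intro a ha
    by_cases h : a = 0
    · rw [h, D.mv_eq', gc, gd]
    · rw [go (D.mv_d_ne h), gd, ← D.cancel_orb_c h hb ha hSb, ← D.cancel_mv_c h, orb_mv S ha]
  have hg : ∀ x a, S a → g x = g (G.mv a x) := by
    intro x a ha
    by_cases hx1 : x = c
    · rw [hx1, hc a ha]
    by_cases hx2 : x = d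
    · rw [hx2, hd a ha]
    by_cases h1 : G.mv a x = c
    · rw [(G.mv_eq_comm a).1 h1, G.mv_mv, hc a ha]
    by_cases h2 : G.mv a x = d
    · rw [(G.mv_eq_comm a).1 h2, G.mv_mv, hd a ha]
    rw [go ⟨hx1, hx2⟩, go ⟨h1, h2⟩, ← orb_mv S ha]
    congr 1
    exact Subtype.ext (skip_other h1 h2)
  refine ⟨⟨prj, Quot.lift g ?_, ?_, ?_⟩⟩
  · rintro x y ⟨a, ha, rfl⟩
    exact hg x a ha
  · rintro ⟨x⟩
    exact go x.2
  · rintro ⟨x⟩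
    show prj (g x) = G.orb S x
    have tc : prj (D.cancel.orb S ⟨G.mv b c, D.mv_c_ne hb⟩) = G.orb S c := orb_mv S hSb c
    by_cases hx1 : x = c
    · rw [hx1, gc, tc]
    by_cases hx2 : x = d
    · rw [hx2, gd, tc, hcd]
    rw [go ⟨hx1, hx2⟩]
    rfl

/-- The vertices of `c` and `d` merge into one: the fan of `d` is inserted in the gap left by `c`.
The vertex of `d` is the one omitted from the count. -/
theorem exists_comp_zero_equiv [Finite C] (D : G.Dipole c d) :
    Nonempty (D.cancel.Comp 0 ≃ {q : G.Comp 0 // q ≠ G.comp 0 d}) := by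
  classical
  have h1 : (1 : Fin 3) ≠ 0 := by decide
  let sub : G.Comp 0 → {q : G.Comp 0 // q ≠ G.comp 0 d} := fun q =>
    if h : q = G.comp 0 d then ⟨G.comp 0 c, D.comp_ne⟩ else ⟨q, h⟩
  have hsub : sub (G.comp 0 d) = sub (G.comp 0 c) := by
    simp only [sub, dif_pos, dif_neg D.comp_ne]
  let prj : D.cancel.Comp 0 → {q : G.Comp 0 // q ≠ G.comp 0 d} := Quot.lift
    (fun x => sub (G.comp 0 x.1)) (by
    rintro x y ⟨a, ha, rfl⟩
    show sub (G.comp 0 x.1) = sub (G.comp 0 (G.skip c d a x.1))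
    by_cases h1 : G.mv a x.1 = c
    · rw [(G.mv_eq_comm a).1 h1, skip_c, G.comp_mv ha, G.comp_mv ha, hsub]
    by_cases h2 : G.mv a x.1 = d
    · rw [(G.mv_eq_comm a).1 h2, skip_d D, G.comp_mv ha, G.comp_mv ha, hsub]
    rw [skip_other h1 h2, G.comp_mv ha])
  let g : C → D.cancel.Comp 0 := fun x =>
    if h : x = c ∨ G.comp 0 x = G.comp 0 d then D.cancel.comp 0 ⟨G.mv 1 c, D.mv_c_ne h1⟩
    else D.cancel.comp 0 ⟨x, fun e => h (Or.inl e), fun e => h (Or.inr (by rw [e]))⟩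
  have gc : g c = D.cancel.comp 0 ⟨G.mv 1 c, D.mv_c_ne h1⟩ := by simp [g]
  have go : ∀ x (h : x ≠ c ∧ x ≠ d), g x = D.cancel.comp 0 ⟨x, h⟩ := by
    intro x h
    by_cases hx : G.comp 0 x = G.comp 0 d
    · have : x = c ∨ G.comp 0 x = G.comp 0 d := Or.inr hx
      simp only [g, dif_pos this]
      exact D.cancel_comp_c h1 (x := ⟨x, h⟩) hx
    · have : ¬ (x = c ∨ G.comp 0 x = G.comp 0 d) := by tauto
      simp only [g, dif_neg this]
  have hc : ∀ a, a ≠ 0 → g (G.mv a c) = g c := by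
    intro a ha
    rw [go _ (D.mv_c_ne ha), gc]
    exact D.cancel_orb_c (S := fun a => a ≠ 0) ha h1 ha h1
  have hg : ∀ x a, a ≠ 0 → g x = g (G.mv a x) := by
    intro x a ha
    by_cases hx1 : x = c
    · rw [hx1, hc a ha]
    by_cases h1 : G.mv a x = c
    · rw [(G.mv_eq_comm a).1 h1, G.mv_mv, hc a ha]
    by_cases hx : G.comp 0 x = G.comp 0 d
    · have e1 : x = c ∨ G.comp 0 x = G.comp 0 d := Or.inr hx
      have e2 : G.mv a x = c ∨ G.comp 0 (G.mv a x) = G.comp 0 d := Or.inr (by rwa [G.comp_mv ha])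
      simp only [g, dif_pos e1, dif_pos e2]
    · have hx2 : x ≠ d := by rintro rfl; exact hx rfl
      have h2 : G.mv a x ≠ d := by
        intro h; exact hx (by rw [← h, G.comp_mv ha])
      rw [go _ ⟨hx1, hx2⟩, go _ ⟨h1, h2⟩, ← D.cancel.comp_mv ha]
      congr 1
      exact Subtype.ext (skip_other h1 h2)
  let inv : G.Comp 0 → D.cancel.Comp 0 := Quot.lift g (by
    rintro x y ⟨a, ha, rfl⟩
    exact hg x a ha)
  refine ⟨⟨prj, fun q => inv q.1, ?_, ?_⟩⟩
  · rintro ⟨x⟩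
    show inv (prj (D.cancel.comp 0 x)).1 = D.cancel.comp 0 x
    by_cases h : G.comp 0 x.1 = G.comp 0 d
    · have : prj (D.cancel.comp 0 x) = ⟨G.comp 0 c, D.comp_ne⟩ := dif_pos h
      rw [this]
      show g c = _
      rw [gc]
      exact D.cancel_comp_c h1 h
    · have : prj (D.cancel.comp 0 x) = ⟨G.comp 0 x.1, h⟩ := dif_neg h
      rw [this]
      exact go x.1 x.2
  · rintro ⟨⟨x⟩, hx⟩
    change G.comp 0 x ≠ G.comp 0 d at hx
    have hxd : x ≠ d := by rintro rfl; exact hx rfl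
    have fo : ∀ y : {x // x ≠ c ∧ x ≠ d}, G.comp 0 y.1 ≠ G.comp 0 d →
        (prj (D.cancel.comp 0 y)).1 = G.comp 0 y.1 := by
      intro y hy
      have : prj (D.cancel.comp 0 y) = ⟨G.comp 0 y.1, hy⟩ := dif_neg hy
      rw [this]
    apply Subtype.ext
    show (prj (g x)).1 = G.comp 0 x
    by_cases hxc : x = c
    · rw [hxc, gc, fo _ (by rw [G.comp_mv h1]; exact D.comp_ne), G.comp_mv h1]
    · rw [go x ⟨hxc, hxd⟩, fo _ hx]

theorem card_cancel [Finite C] (D : G.Dipole c d) :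
    Nat.card {x // x ≠ c ∧ x ≠ d} + 2 = Nat.card C := by
  classical
  have := Fintype.ofFinite C
  rw [Nat.card_eq_fintype_card, Nat.card_eq_fintype_card, Fintype.card_subtype]
  have e : (Finset.univ.filter fun x => x ≠ c ∧ x ≠ d) = Finset.univ \ {c, d} := by
    ext x; simp
  have h2 : ({c, d} : Finset C).card = 2 := Finset.card_pair D.ne
  rw [e, Finset.card_sdiff_of_subset (Finset.subset_univ _), h2, Finset.card_univ]
  have : 2 ≤ Fintype.card C := by
    rw [← h2]; exact Finset.card_le_univ _
  omega

/-- One vertex of colour `0` and two triangles disappear, which contributes -2 and +2. -/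
theorem chi2_cancel [Finite C] (D : G.Dipole c d) : D.cancel.chi2 = G.chi2 := by
  classical
  have h0 : Nat.card (D.cancel.Comp 0) + 1 = Nat.card (G.Comp 0) := by
    obtain ⟨e⟩ := D.exists_comp_zero_equiv
    have : Finite (G.Comp 0) := inferInstanceAs (Finite (Quot _))
    have := Fintype.ofFinite (G.Comp 0)
    rw [Nat.card_congr e, Nat.card_eq_fintype_card, Nat.card_eq_fintype_card]
    have hpos : 0 < Fintype.card (G.Comp 0) := Fintype.card_pos_iff.2 ⟨G.comp 0 d⟩
    rw [Fintype.card_subtype, Finset.filter_ne', Finset.card_erase_of_mem (Finset.mem_univ _),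
      Finset.card_univ]
    omega
  have h1 : Nat.card (D.cancel.Comp 1) = Nat.card (G.Comp 1) := by
    obtain ⟨e⟩ := D.exists_orb_equiv (S := fun a => a ≠ 1) (by decide) (b := 2) (by decide) (by decide)
    exact Nat.card_congr e
  have h2 : Nat.card (D.cancel.Comp 2) = Nat.card (G.Comp 2) := by
    obtain ⟨e⟩ := D.exists_orb_equiv (S := fun a => a ≠ 2) (by decide) (b := 1) (by decide) (by decide)
    exact Nat.card_congr e
  have h3 := D.card_cancel
  unfold chi2
  rw [Fin.sum_univ_three, Fin.sum_univ_three, h1, h2, ← h0, ← h3]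
  push_cast
  ring

theorem connected_cancel [Finite C] (D : G.Dipole c d) (h : G.Connected) : D.cancel.Connected := by
  refine ⟨⟨⟨G.mv 1 c, D.mv_c_ne (by decide)⟩⟩, ⟨?_⟩⟩
  obtain ⟨e⟩ := D.exists_orb_equiv (S := fun _ => True) trivial (b := 1) (by decide) trivial
  have h1 : Subsingleton (G.Orb fun _ => True) := by
    refine ⟨?_⟩
    rintro ⟨x⟩ ⟨y⟩
    exact congrArg (Quot.map id fun x y ⟨i, e⟩ => ⟨i, trivial, e⟩) (h.2.elim (G.total x) (G.total y))
  have h2 : Subsingleton (D.cancel.Orb fun _ => True) := e.injective.subsingleton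
  rintro ⟨x⟩ ⟨y⟩
  exact congrArg (Quot.map id fun x y ⟨i, _, e⟩ => ⟨i, e⟩)
    (h2.elim (D.cancel.orb _ x) (D.cancel.orb _ y))

/-- The signs alternate along the fan, which has odd length, so the two neighbours of `d` in it have
equal signs and `d` can receive the opposite one. Bypassing `c` and `d` replaces three sign changes
by one, so `c` fits as well; the same count gives the converse. -/
theorem orientable_cancel [Finite C] (D : G.Dipole c d) : D.cancel.Orientable ↔ G.Orientable := by
  classical
  have bool3 : ∀ {a b c : Bool}, a ≠ b → b ≠ c → a = c := by decide
  constructor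
  · rintro ⟨σ, hσ⟩
    have hcd : ∀ {a : Fin 3} (ha : a ≠ 0), σ ⟨G.mv a d, D.mv_d_ne ha⟩ ≠ σ ⟨G.mv a c, D.mv_c_ne ha⟩ := by
      intro a ha
      rw [← D.cancel_mv_c ha]
      exact hσ _ _
    have hdd : ∀ {a b : Fin 3} (ha : a ≠ 0) (hb : b ≠ 0),
        σ ⟨G.mv a d, D.mv_d_ne ha⟩ = σ ⟨G.mv b d, D.mv_d_ne hb⟩ := by
      obtain ⟨n, u, idx, N⟩ := exists_numbering (G := G) d
      have key : ∀ l (z : {x // x ≠ c ∧ x ≠ d}), 1 ≤ l → l ≤ n → z.1 = u l →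
          (σ z = σ ⟨G.mv 2 d, D.mv_d_ne (by decide)⟩ ↔ Odd l) := by
        intro l z h1
        induction l, h1 using Nat.le_induction generalizing z with
        | base =>
          intro _ hz
          have : z = ⟨G.mv 2 d, D.mv_d_ne (by decide)⟩ := Subtype.ext (hz.trans N.mv_one.symm)
          simp [this]
        | succ l hl ih =>
          intro hle hz
          have hw : u l ≠ c ∧ u l ≠ d := idx_ne_imp N D (by rw [N.idx_u _ hl (by omega)]; omega)
          have ih' := ih ⟨u l, hw⟩ (by omega) rfl
          obtain ⟨a, ha, hs⟩ := N.skip_u D hl hle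
          have : z = D.cancel.mv a ⟨u l, hw⟩ := Subtype.ext (hz.trans hs.symm)
          have h4 := hσ a ⟨u l, hw⟩
          rw [← this] at h4
          rw [Nat.odd_add_one, ← ih']
          constructor
          · intro h5 h6; exact h4 (h5.trans h6.symm)
          · intro h5; exact bool3 h4 h5
      have h12 : σ ⟨G.mv 1 d, D.mv_d_ne (by decide)⟩ = σ ⟨G.mv 2 d, D.mv_d_ne (by decide)⟩ :=
        (key n ⟨G.mv 1 d, D.mv_d_ne (by decide)⟩ N.one_le le_rfl N.mv_last).2 N.odd
      intro a b ha hb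
      have ha' : a = 1 ∨ a = 2 := by omega
      have hb' : b = 1 ∨ b = 2 := by omega
      rcases ha' with rfl | rfl <;> rcases hb' with rfl | rfl
      exacts [rfl, h12, h12.symm, rfl]
    have hcc : ∀ {a b : Fin 3} (ha : a ≠ 0) (hb : b ≠ 0),
        σ ⟨G.mv a c, D.mv_c_ne ha⟩ = σ ⟨G.mv b c, D.mv_c_ne hb⟩ := by
      intro a b ha hb
      have h1 := hcd ha
      have h2 := hcd hb
      rw [hdd ha hb] at h1
      exact bool3 h1.symm h2
    let s : C → Bool := fun x => if h : x ≠ c ∧ x ≠ d then σ ⟨x, h⟩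
      else if x = c then !σ ⟨G.mv 1 c, D.mv_c_ne (by decide)⟩
      else !σ ⟨G.mv 1 d, D.mv_d_ne (by decide)⟩
    have sc : s c = !σ ⟨G.mv 1 c, D.mv_c_ne (by decide)⟩ := by simp [s]
    have sd : s d = !σ ⟨G.mv 1 d, D.mv_d_ne (by decide)⟩ := by
      have := D.ne
      simp [s, this.symm]
    have so : ∀ {x} (h : x ≠ c ∧ x ≠ d), s x = σ ⟨x, h⟩ := fun h => by simp only [s, dif_pos h]
    have hc : ∀ a, s (G.mv a c) ≠ s c := by
      intro a
      by_cases h : a = 0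
      · rw [h, D.mv_eq, sc, sd]
        have := hcd (a := 1) (by decide)
        simpa using this
      · rw [so (D.mv_c_ne h), sc, hcc h (by decide : (1 : Fin 3) ≠ 0)]
        simp
    have hd : ∀ a, s (G.mv a d) ≠ s d := by
      intro a
      by_cases h : a = 0
      · rw [h, D.mv_eq', sc, sd]
        have := hcd (a := 1) (by decide)
        simpa using this.symm
      · rw [so (D.mv_d_ne h), sd, hdd h (by decide : (1 : Fin 3) ≠ 0)]
        simp
    refine ⟨s, fun a x => ?_⟩
    by_cases hx1 : x = c
    · rw [hx1]; exact hc a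
    by_cases hx2 : x = d
    · rw [hx2]; exact hd a
    by_cases h1 : G.mv a x = c
    · rw [(G.mv_eq_comm a).1 h1, G.mv_mv]; exact (hc a).symm
    by_cases h2 : G.mv a x = d
    · rw [(G.mv_eq_comm a).1 h2, G.mv_mv]; exact (hd a).symm
    rw [so ⟨hx1, hx2⟩, so ⟨h1, h2⟩]
    have e : D.cancel.mv a ⟨x, hx1, hx2⟩ = ⟨G.mv a x, h1, h2⟩ := Subtype.ext (skip_other h1 h2)
    rw [← e]
    exact hσ a _
  · rintro ⟨σ, hσ⟩
    refine ⟨fun x => σ x.1, fun a x => ?_⟩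
    show σ (G.skip c d a x.1) ≠ σ x.1
    have hcd : σ d ≠ σ c := by rw [← D.mv_eq]; exact hσ 0 c
    by_cases h1 : G.mv a x.1 = c
    · rw [(G.mv_eq_comm a).1 h1, skip_c]
      have h2 := hσ a c
      have h3 := hσ a d
      intro h
      rw [h] at h3
      exact hcd (bool3 h3.symm h2)
    by_cases h2 : G.mv a x.1 = d
    · rw [(G.mv_eq_comm a).1 h2, skip_d D]
      have h2 := hσ a c
      have h3 := hσ a d
      intro h
      rw [h] at h2
      exact hcd (bool3 h3.symm h2)
    rw [skip_other h1 h2]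
    exact hσ a _

end Dipole

/-! ### Isomorphisms and permutations of the colours -/

/-- Isomorphic triangulations have homeomorphic surfaces. -/
theorem nonempty_homeomorph_of_equiv {C' : Type v} [Finite C] (G : Gem C) (G' : Gem C')
    (φ : C ≃ C') (h : ∀ a x, φ (G.mv a x) = G'.mv a (φ x)) : Nonempty (G.Surface ≃ₜ G'.Surface) := by
  have : CompactSpace Tri := isCompact_iff_compactSpace.1 (isCompact_stdSimplex ℝ (Fin 3))
  have : Finite C' := Finite.of_equiv C φ
  let f : (Σ _ : C, Tri) → Σ _ : C', Tri := fun p => ⟨φ p.1, p.2⟩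
  have hf : Continuous f := continuous_sigma fun x => Dipole.continuous_mk_triangle (φ x)
  refine nonempty_homeomorph_quot (f := f) (f' := id) hf continuous_id ?_ ?_ ?_ ?_ ?_ ?_
  · rintro ⟨x, t⟩
    exact ⟨⟨φ.symm x, t⟩, by simp [f]⟩
  · exact fun p => ⟨f p, rfl⟩
  · rintro ⟨x, t⟩ ⟨y, s⟩ e
    have hxy : x = y := φ.injective (Dipole.fst_eq e)
    subst hxy
    have hts : t = s := Dipole.snd_eq e
    rw [hts]
  · rintro p q rfl; rfl
  · rintro ⟨x, t⟩ q ⟨i, ht, rfl⟩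
    exact ⟨⟨φ.symm x, t⟩, ⟨G.mv i (φ.symm x), t⟩, by simp [f], by simp [f, h], G.mk_mv i _ ht⟩
  · rintro ⟨x, t⟩ q ⟨i, ht, rfl⟩
    refine ⟨_, _, rfl, rfl, ?_⟩
    rw [G'.mk_mv i (φ x) ht]
    simp [h]

theorem orientable_of_equiv {C' : Type v} (G : Gem C) (G' : Gem C')
    (φ : C ≃ C') (h : ∀ a x, φ (G.mv a x) = G'.mv a (φ x)) (hG : G.Orientable) : G'.Orientable := by
  obtain ⟨σ, hσ⟩ := hG
  refine ⟨fun x => σ (φ.symm x), fun a x => ?_⟩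
  have : φ.symm (G'.mv a x) = G.mv a (φ.symm x) := by
    rw [Equiv.symm_apply_eq, h, φ.apply_symm_apply]
  show σ (φ.symm (G'.mv a x)) ≠ σ (φ.symm x)
  rw [this]
  exact hσ a _

variable (G) in
def relabel (e : Equiv.Perm (Fin 3)) : Gem C where
  mv a := G.mv (e a)
  mv_mv a := G.mv_mv (e a)
  mv_ne a := G.mv_ne (e a)

theorem orientable_relabel (e : Equiv.Perm (Fin 3)) : (G.relabel e).Orientable ↔ G.Orientable := by
  constructor
  · rintro ⟨σ, h⟩
    refine ⟨σ, fun a x => ?_⟩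
    have := h (e.symm a) x
    simpa [relabel] using this
  · rintro ⟨σ, h⟩
    exact ⟨σ, fun a x => h (e a) x⟩

theorem connected_relabel (e : Equiv.Perm (Fin 3)) (h : G.Connected) : (G.relabel e).Connected := by
  refine ⟨h.1, ⟨?_⟩⟩
  rintro ⟨x⟩ ⟨y⟩
  refine congrArg (Quot.map id fun x y => ?_) (h.2.elim (G.total x) (G.total y))
  rintro ⟨a, ha⟩
  exact ⟨e.symm a, by simpa [relabel] using ha⟩

theorem comp_relabel_iff (e : Equiv.Perm (Fin 3)) (i : Fin 3) (x y : C) :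
    (∃ a, a ≠ i ∧ y = (G.relabel e).mv a x) ↔ ∃ a, a ≠ e i ∧ y = G.mv a x := by
  constructor
  · rintro ⟨a, ha, h⟩
    exact ⟨e a, fun h => ha (e.injective h), h⟩
  · rintro ⟨a, ha, h⟩
    refine ⟨e.symm a, fun h => ha ?_, by simpa [relabel] using h⟩
    rw [← h, e.apply_symm_apply]

theorem comp_relabel (e : Equiv.Perm (Fin 3)) (i : Fin 3) : (G.relabel e).Comp i = G.Comp (e i) := by
  unfold Comp
  congr 1
  funext x y
  exact propext (comp_relabel_iff e i x y)

theorem chi2_relabel (e : Equiv.Perm (Fin 3)) : (G.relabel e).chi2 = G.chi2 := by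
  unfold chi2
  simp only [comp_relabel]
  rw [Equiv.sum_comp e (fun i => (Nat.card (G.Comp i) : ℤ))]

/-- Permutation of the vertices of a triangle. -/
def Tri.permute (e : Equiv.Perm (Fin 3)) (t : Tri) : Tri :=
  ⟨fun i => t.1 (e i), fun i => t.2.1 (e i), by
    have := t.2.2
    rw [← Equiv.sum_comp e] at this
    exact this⟩

theorem nonempty_homeomorph_relabel [Finite C] (G : Gem C) (e : Equiv.Perm (Fin 3)) :
    Nonempty (G.Surface ≃ₜ (G.relabel e).Surface) := by
  have : CompactSpace Tri := isCompact_iff_compactSpace.1 (isCompact_stdSimplex ℝ (Fin 3))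
  let f : (Σ _ : C, Tri) → Σ _ : C, Tri := fun p => ⟨p.1, Tri.permute e p.2⟩
  have hp : Continuous (Tri.permute e) :=
    Continuous.subtype_mk (continuous_pi fun i => Tri.continuous_coord (e i)) _
  have hf : Continuous f :=
    continuous_sigma fun x => (Dipole.continuous_mk_triangle x).comp hp
  have hinv : ∀ t, Tri.permute e (Tri.permute e.symm t) = t := fun t =>
    Subtype.ext (funext fun i => by simp [Tri.permute])
  have hinv' : ∀ t, Tri.permute e.symm (Tri.permute e t) = t := fun t =>
    Subtype.ext (funext fun i => by simp [Tri.permute])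
  refine nonempty_homeomorph_quot (f := f) (f' := id) hf continuous_id ?_ ?_ ?_ ?_ ?_ ?_
  · rintro ⟨x, t⟩
    exact ⟨⟨x, Tri.permute e.symm t⟩, by simp [f, hinv]⟩
  · exact fun p => ⟨f p, rfl⟩
  · rintro ⟨x, t⟩ ⟨y, s⟩ h
    obtain rfl : x = y := Dipole.fst_eq h
    have := congrArg (Tri.permute e.symm) (Dipole.snd_eq h)
    simp only [hinv'] at this
    rw [this]
  · rintro p q rfl; rfl
  · rintro ⟨x, t⟩ q ⟨i, ht, rfl⟩
    refine ⟨⟨x, Tri.permute e.symm t⟩, ⟨G.mv (e i) x, Tri.permute e.symm t⟩, by simp [f, hinv],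
      by simp [f, hinv, relabel], G.mk_mv (e i) x ?_⟩
    show t.1 (e.symm (e i)) = 0
    rw [e.symm_apply_apply]; exact ht
  · rintro ⟨x, t⟩ q ⟨i, ht, rfl⟩
    refine ⟨_, _, rfl, rfl, ?_⟩
    have h0 : (Tri.permute e t).1 (e.symm i) = 0 := by
      show t.1 (e (e.symm i)) = 0
      rw [e.apply_symm_apply]; exact ht
    have := (G.relabel e).mk_mv (e.symm i) x h0
    simp only [relabel, e.apply_symm_apply] at this
    exact this

/-! ### Reduction to triangulations with three vertices -/

/-- While some colour has two vertices, a cancellation exists after that colour is renamed `0`; each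
cancellation removes two triangles, so the process ends. -/
theorem exists_crystallization (n : ℕ) : ∀ {C : Type u} [Finite C] (G : Gem C), Nat.card C = n →
    G.Connected → ∃ (C' : Type u) (_ : Finite C') (G' : Gem C'),
      Nonempty (G.Surface ≃ₜ G'.Surface) ∧ Nonempty C' ∧ (∀ i, Subsingleton (G'.Comp i)) ∧
      G'.chi2 = G.chi2 ∧ (G'.Orientable ↔ G.Orientable) := by
  induction n using Nat.strong_induction_on with
  | _ n ih =>
  intro C _ G hn hG
  by_cases hall : ∀ i, Subsingleton (G.Comp i)
  · exact ⟨C, inferInstance, G, ⟨Homeomorph.refl _⟩, hG.1, hall, rfl, Iff.rfl⟩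
  push Not at hall
  obtain ⟨i, hi⟩ := hall
  -- If no move of colour `i` changed the vertex, all moves would preserve it, and connectedness
  -- would leave a single vertex numbered `i`.
  obtain ⟨c, hc⟩ : ∃ c, G.comp i c ≠ G.comp i (G.mv i c) := by
    by_contra hcon
    push Not at hcon
    rw [← not_subsingleton_iff_nontrivial] at hi
    apply hi
    refine ⟨?_⟩
    rintro ⟨x⟩ ⟨y⟩
    refine congrArg (Quot.lift (G.comp i) ?_) (hG.2.elim (G.total x) (G.total y))
    rintro x y ⟨a, rfl⟩
    by_cases ha : a = i
    · rw [ha]; exact hcon x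
    · exact (G.comp_mv ha x).symm
  let e : Equiv.Perm (Fin 3) := Equiv.swap 0 i
  have he : e 0 = i := Equiv.swap_apply_left 0 i
  have D : (G.relabel e).Dipole c (G.mv i c) := by
    refine ⟨by show G.mv (e 0) c = _; rw [he], fun h => hc ?_⟩
    have := congrArg (Quot.map id fun x y h => by
      rw [← he]; exact (comp_relabel_iff e 0 x y).1 h : (G.relabel e).Comp 0 → G.Comp i) h
    exact this
  obtain ⟨C', hC', G', ⟨h1⟩, h2, h3, h4, h5⟩ := ih (Nat.card {x // x ≠ c ∧ x ≠ G.mv i c})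
    (by have := D.card_cancel; omega) D.cancel rfl (D.connected_cancel (connected_relabel e hG))
  obtain ⟨k1⟩ := nonempty_homeomorph_relabel G e
  obtain ⟨k2⟩ := D.nonempty_homeomorph
  exact ⟨C', hC', G', ⟨(k1.trans k2).trans h1⟩, h2, h3, by rw [h4, D.chi2_cancel, chi2_relabel],
    by rw [h5, D.orientable_cancel, orientable_relabel]⟩

end Gem

namespace Gem

/-! ### Classification of the triangulations with three vertices -/

/-- The sphere glued from two triangles. -/
def twoGem : Gem (Fin 2) where
  mv _ x := x + 1
  mv_mv := by decide
  mv_ne := by decide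

/-- The projective plane glued from four triangles. -/
def fourGem : Gem (Fin 4) where
  mv := ![![2, 3, 0, 1], ![3, 2, 1, 0], ![1, 0, 3, 2]]
  mv_mv := by decide
  mv_ne := by decide

/-- The torus glued from six triangles. -/
def torusGem : Gem (Fin 6) where
  mv := ![![3, 4, 5, 0, 1, 2], ![5, 2, 1, 4, 3, 0], ![1, 0, 3, 2, 5, 4]]
  mv_mv := by decide
  mv_ne := by decide

/-- The Klein bottle glued from six triangles. -/
def kleinGem : Gem (Fin 6) where
  mv := ![![3, 5, 4, 0, 2, 1], ![5, 2, 1, 4, 3, 0], ![1, 0, 3, 2, 5, 4]]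
  mv_mv := by decide
  mv_ne := by decide

theorem kleinGem_mv : ∀ a : Fin 3, a ≠ 0 → ∀ l, kleinGem.mv a l = torusGem.mv a l := by decide

theorem twoGem_orientable : twoGem.Orientable := ⟨fun x => x = 0, by decide⟩

theorem torusGem_orientable : torusGem.Orientable := ⟨![true, false, true, false, true, false], by decide⟩

variable {C : Type u} {G : Gem C}

/-- Where two moves agree, the pair of triangles is closed under both, hence is the whole link of
the vertex of the third colour, and there is only one such vertex. -/
theorem card_le_two_of_mv_eq [Finite C] (h : ∀ i, Subsingleton (G.Comp i)) {a b : Fin 3} (hab : a ≠ b)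
    {x : C} (hx : G.mv a x = G.mv b x) : Nat.card C ≤ 2 := by
  classical
  obtain ⟨i, hi⟩ : ∃ i : Fin 3, ∀ j, j ≠ i → j = a ∨ j = b := by
    clear hx; revert hab; revert a b; decide
  have key : ∀ y z, (∃ j, j ≠ i ∧ z = G.mv j y) → (y = x ∨ y = G.mv a x) → (z = x ∨ z = G.mv a x) := by
    rintro y z ⟨j, hj, rfl⟩ (rfl | rfl)
    · rcases hi j hj with rfl | rfl
      · exact Or.inr rfl
      · exact Or.inr hx.symm
    · rcases hi j hj with rfl | rfl
      · exact Or.inl (G.mv_mv _ _)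
      · exact Or.inl (by rw [hx, G.mv_mv])
  have hall : ∀ y, y = x ∨ y = G.mv a x := by
    intro y
    let P : G.Comp i → Prop := Quot.lift (fun y => y = x ∨ y = G.mv a x) (by
      intro y z hyz
      refine propext ⟨key y z hyz, key z y ?_⟩
      obtain ⟨j, hj, rfl⟩ := hyz
      exact ⟨j, hj, (G.mv_mv j y).symm⟩)
    have : P (G.comp i y) = P (G.comp i x) := congrArg P ((h i).elim (G.comp i y) (G.comp i x))
    have hP : P (G.comp i x) := Or.inl rfl
    rw [← this] at hP
    exact hP
  have := Fintype.ofFinite C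
  rw [Nat.card_eq_fintype_card, ← Finset.card_univ]
  refine (Finset.card_le_card (t := {x, G.mv a x}) fun y _ => ?_).trans Finset.card_le_two
  simpa using hall y

/-- The moves of colours `1` and `2` are the sides of a hexagon, so `τ` matches its corners by
diagonals. It takes the three long ones, or one long diagonal and the two short ones crossing it;
the latter matching has three rotations. -/
theorem hexagon_matching (τ : Fin 6 → Fin 6) (h : ∀ l, τ (τ l) = l)
    (h0 : ∀ l, τ l ≠ l) (h1 : ∀ l, τ l ≠ torusGem.mv 1 l) (h2 : ∀ l, τ l ≠ torusGem.mv 2 l) :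
    (τ = torusGem.mv 0 ∧ τ 0 = 3) ∨ (τ = kleinGem.mv 0 ∧ τ 0 = 3 ∧ τ 1 = 5) ∨
      (τ 0 = 2 ∧ τ 4 = 1) ∨ (τ 0 = 4 ∧ τ 2 = 5) := by
  have e : ∀ x : Fin 6, ∀ a b c d e f : Fin 6, x ≠ a → x ≠ b → x ≠ c →
      (∀ y, y = a ∨ y = b ∨ y = c ∨ y = d ∨ y = e ∨ y = f) → x = d ∨ x = e ∨ x = f := by
    intro x a b c d e f ha hb hc hall
    have := hall x
    tauto
  have f0 := e (τ 0) 0 5 1 2 3 4 (h0 0) (h1 0) (h2 0) (by decide)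
  have f1 := e (τ 1) 1 2 0 3 4 5 (h0 1) (h1 1) (h2 1) (by decide)
  have f2 := e (τ 2) 2 1 3 4 5 0 (h0 2) (h1 2) (h2 2) (by decide)
  have f3 := e (τ 3) 3 4 2 5 0 1 (h0 3) (h1 3) (h2 3) (by decide)
  have f4 := e (τ 4) 4 3 5 0 1 2 (h0 4) (h1 4) (h2 4) (by decide)
  have f5 := e (τ 5) 5 0 4 1 2 3 (h0 5) (h1 5) (h2 5) (by decide)
  have fin : ∀ σ : Fin 6 → Fin 6, τ 0 = σ 0 → τ 1 = σ 1 → τ 2 = σ 2 → τ 3 = σ 3 → τ 4 = σ 4 →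
      τ 5 = σ 5 → τ = σ := by
    intro σ a b c d e f
    funext l
    fin_cases l <;> assumption
  have inj : ∀ {a b c}, τ a = c → τ b = c → a = b := by
    intro a b c ha hb
    rw [← h a, ← h b, ha, hb]
  have back : ∀ {a b}, τ a = b → τ b = a := by
    intro a b e
    rw [← e, h]
  rcases f0 with g0 | g0 | g0
  · have b0 := back g0
    rcases f1 with g1 | g1 | g1
    · have b1 := back g1
      rcases f4 with g4 | g4 | g4
      · exact absurd (inj g4 b0) (by decide)
      · exact absurd (inj g4 b1) (by decide)
      · exact absurd (inj g4 g0) (by decide)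
    · have b1 := back g1
      exact Or.inr (Or.inr (Or.inl ⟨g0, b1⟩))
    · have b1 := back g1
      rcases f3 with g | g | g
      · exact absurd (inj g g1) (by decide)
      · exact absurd (inj g b0) (by decide)
      · exact absurd (inj g b1) (by decide)
  · have b0 := back g0
    rcases f1 with g1 | g1 | g1
    · exact absurd (inj g1 g0) (by decide)
    · have b1 := back g1
      have g2 : τ 2 = 5 := by
        rcases f2 with g | g | g
        · exact absurd (inj g g1) (by decide)
        · exact g
        · exact absurd (inj g b0) (by decide)
      exact Or.inl ⟨fin _ g0 g1 g2 b0 b1 (back g2), g0⟩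
    · have b1 := back g1
      have g2 : τ 2 = 4 := by
        rcases f2 with g | g | g
        · exact g
        · exact absurd (inj g g1) (by decide)
        · exact absurd (inj g b0) (by decide)
      exact Or.inr (Or.inl ⟨fin _ g0 g1 g2 b0 (back g2) b1, g0, g1⟩)
  · have b0 := back g0
    rcases f1 with g1 | g1 | g1
    · have b1 := back g1
      have g2 : τ 2 = 5 := by
        rcases f2 with g | g | g
        · exact absurd (inj g g0) (by decide)
        · exact g
        · exact absurd (inj g b0) (by decide)
      exact Or.inr (Or.inr (Or.inr ⟨g0, g2⟩))
    · exact absurd (inj g1 g0) (by decide)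
    · have b1 := back g1
      rcases f2 with g | g | g
      · exact absurd (inj g g0) (by decide)
      · exact absurd (inj g g1) (by decide)
      · exact absurd (inj g b0) (by decide)

/-- A gem with three vertices, with its triangles numbered around the vertex `0`. -/
theorem exists_equiv_of_crystal [Finite C] (h : ∀ i, Subsingleton (G.Comp i)) (d : C) :
    ∃ (n : ℕ) (u : ℕ → C), Odd n ∧ Nat.card C = n + 1 ∧ u 0 = d ∧ u (n + 1) = u 0 ∧
      (∀ l, Even l → G.mv 2 (u l) = u (l + 1) ∧ G.mv 2 (u (l + 1)) = u l) ∧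
      (∀ l, Odd l → G.mv 1 (u l) = u (l + 1) ∧ G.mv 1 (u (l + 1)) = u l) ∧
      Function.Bijective (fun l : Fin (n + 1) => u l) := by
  obtain ⟨n, u, hn, h0, hstep, hlast, hinj, hcov⟩ := G.exists_cycle d
  have hbij : Function.Bijective (fun l : Fin (n + 1) => u l) := by
    refine ⟨fun a b hab => ?_, fun c => ?_⟩
    · exact Fin.ext (hinj (Nat.lt_succ_iff.1 a.2) (Nat.lt_succ_iff.1 b.2) hab)
    · obtain ⟨l, hl, rfl⟩ := hcov c ((h 0).elim _ _)
      exact ⟨⟨l, Nat.lt_succ_iff.2 hl⟩, rfl⟩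
  refine ⟨n, u, hn, ?_, h0, hlast.trans h0.symm, fun l hl => ?_, fun l hl => ?_, hbij⟩
  · rw [← Nat.card_congr (Equiv.ofBijective _ hbij), Nat.card_eq_fintype_card, Fintype.card_fin]
  · have := hstep l
    rw [if_pos hl] at this
    rw [this, G.mv_mv]
    exact ⟨rfl, rfl⟩
  · have := hstep l
    rw [if_neg (by simpa using hl)] at this
    rw [this, G.mv_mv]
    exact ⟨rfl, rfl⟩

theorem chi2_of_crystal [Nonempty C] (h : ∀ i, Subsingleton (G.Comp i)) :
    G.chi2 = 6 - Nat.card C := by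
  obtain ⟨c⟩ : Nonempty C := inferInstance
  have : ∀ i, Nat.card (G.Comp i) = 1 := fun i => by
    have := h i
    have : Unique (G.Comp i) := uniqueOfSubsingleton (G.comp i c)
    exact Nat.card_unique
  unfold chi2
  simp [this]

/-- Two gems whose moves agree for a numbering are isomorphic. -/
theorem homeomorph_of_numbering {N : ℕ} (K : Gem (Fin N)) {w : Fin N → C} (hw : Function.Bijective w)
    (h : ∀ a l, w (K.mv a l) = G.mv a (w l)) :
    Nonempty (G.Surface ≃ₜ K.Surface) ∧ (K.Orientable → G.Orientable) := by
  obtain ⟨e⟩ := nonempty_homeomorph_of_equiv K G (Equiv.ofBijective w hw) h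
  exact ⟨⟨e.symm⟩, orientable_of_equiv K G (Equiv.ofBijective w hw) h⟩

theorem mv_of_numbering (u : ℕ → C) (hper : u 6 = u 0)
    (hev : ∀ l, Even l → G.mv 2 (u l) = u (l + 1) ∧ G.mv 2 (u (l + 1)) = u l)
    (hod : ∀ l, Odd l → G.mv 1 (u l) = u (l + 1) ∧ G.mv 1 (u (l + 1)) = u l)
    (a : Fin 3) (ha : a ≠ 0) (l : Fin 6) : u (torusGem.mv a l : Fin 6) = G.mv a (u l) := by
  have e0 := hev 0 (by decide)
  have e2 := hev 2 (by decide)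
  have e4 := hev 4 (by decide)
  have o1 := hod 1 (by decide)
  have o3 := hod 3 (by decide)
  have o5 := hod 5 (by decide)
  norm_num at e0 e2 e4 o1 o3 o5
  rw [hper] at o5
  have ha' : a = 1 ∨ a = 2 := by omega
  rcases ha' with rfl | rfl <;> fin_cases l
  exacts [o5.2.symm, o1.1.symm, o1.2.symm, o3.1.symm, o3.2.symm, o5.1.symm,
    e0.1.symm, e0.2.symm, e2.1.symm, e2.2.symm, e4.1.symm, e4.2.symm]
-- With one vertex of each colour `chi2` is 6 minus the number of triangles. For two or four
-- triangles the remaining matching is forced; for six it is one of the matchings of the hexagon.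
theorem classification_crystal [Finite C] [Nonempty C] (h : ∀ i, Subsingleton (G.Comp i)) :
    G.chi2 ≤ 4 ∧ (G.chi2 = 4 → G.Orientable ∧ Nonempty (G.Surface ≃ₜ twoGem.Surface)) ∧
      (G.chi2 = 2 → Nonempty (G.Surface ≃ₜ fourGem.Surface)) ∧
      (G.chi2 = 0 → (G.Orientable → Nonempty (G.Surface ≃ₜ torusGem.Surface)) ∧
        (¬ G.Orientable → Nonempty (G.Surface ≃ₜ kleinGem.Surface))) := by
  obtain ⟨d⟩ : Nonempty C := inferInstance
  obtain ⟨n, u, hn, hcard, -, hper, hev, hod, hbij⟩ := exists_equiv_of_crystal h d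
  rw [chi2_of_crystal h, hcard]
  push_cast
  have hn1 : 1 ≤ n := by obtain ⟨k, rfl⟩ := hn; omega
  have hmv : 2 ≤ n → ∀ (a : Fin 3) (_ : a ≠ 0) x, G.mv 0 x ≠ G.mv a x := by
    intro hn2 a ha x hx
    have := card_le_two_of_mv_eq h ha.symm hx
    omega
  refine ⟨by omega, fun hc => ?_, fun hc => ?_, fun hc => ?_⟩
  · obtain rfl : n = 1 := by omega
    have hw : ∀ a l, u (twoGem.mv a l : Fin 2) = G.mv a (u l) := by
      intro a l
      obtain ⟨m, hm⟩ := hbij.2 (G.mv a (u l))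
      have hne : m ≠ l := by
        rintro rfl; exact G.mv_ne a _ hm.symm
      rw [← hm]
      have : m = l + 1 := by clear hm; revert hne; revert m l; decide
      rw [this]; rfl
    obtain ⟨h1, h2⟩ := homeomorph_of_numbering twoGem hbij hw
    exact ⟨h2 twoGem_orientable, h1⟩
  · obtain rfl : n = 3 := by omega
    have h12 : ∀ a : Fin 3, a ≠ 0 → ∀ l : Fin 4, u (fourGem.mv a l : Fin 4) = G.mv a (u l) := by
      intro a ha l
      have e0 := hev 0 (by decide)
      have e2 := hev 2 (by decide)
      have o1 := hod 1 (by decide)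
      have o3 := hod 3 (by decide)
      norm_num at e0 e2 o1 o3 hper
      rw [hper] at o3
      have ha' : a = 1 ∨ a = 2 := by omega
      rcases ha' with rfl | rfl <;> fin_cases l
      exacts [o3.2.symm, o1.1.symm, o1.2.symm, o3.1.symm, e0.1.symm, e0.2.symm, e2.1.symm, e2.2.symm]
    have hw : ∀ a l, u (fourGem.mv a l : Fin 4) = G.mv a (u l) := by
      intro a l
      by_cases ha : a = 0
      · subst ha
        obtain ⟨m, hm⟩ := hbij.2 (G.mv 0 (u l))
        have h0 : m ≠ l := by rintro rfl; exact G.mv_ne 0 _ hm.symm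
        have h1 : m ≠ fourGem.mv 1 l := by
          rintro rfl; exact hmv (by omega) 1 (by decide) _ (hm.symm.trans (h12 1 (by decide) l))
        have h2 : m ≠ fourGem.mv 2 l := by
          rintro rfl; exact hmv (by omega) 2 (by decide) _ (hm.symm.trans (h12 2 (by decide) l))
        have : m = fourGem.mv 0 l := by clear hm; revert h0 h1 h2; revert m l; decide
        rw [← hm, this]
      · exact h12 a ha l
    exact (homeomorph_of_numbering fourGem hbij hw).1
  · obtain rfl : n = 5 := by omega
    have h12 := mv_of_numbering (G := G)
    have hmatch : ∀ (u : ℕ → C), u 6 = u 0 →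
        (∀ l, Even l → G.mv 2 (u l) = u (l + 1) ∧ G.mv 2 (u (l + 1)) = u l) →
        (∀ l, Odd l → G.mv 1 (u l) = u (l + 1) ∧ G.mv 1 (u (l + 1)) = u l) →
        Function.Bijective (fun l : Fin 6 => u l) → ∃ τ : Fin 6 → Fin 6,
        (∀ l : Fin 6, u (τ l) = G.mv 0 (u l)) ∧ ((τ = torusGem.mv 0 ∧ τ 0 = 3) ∨
          (τ = kleinGem.mv 0 ∧ τ 0 = 3 ∧ τ 1 = 5) ∨ (τ 0 = 2 ∧ τ 4 = 1) ∨ (τ 0 = 4 ∧ τ 2 = 5)) := by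
      intro u hper hev hod hbij
      have h12' := h12 u hper hev hod
      choose τ hτ using fun l : Fin 6 => hbij.2 (G.mv 0 (u l))
      refine ⟨τ, hτ, hexagon_matching τ (fun l => hbij.1 ?_) ?_ ?_ ?_⟩
      · show u (τ (τ l)) = u l
        have e1 : u (τ (τ l)) = G.mv 0 (u (τ l)) := hτ (τ l)
        have e2 : u (τ l) = G.mv 0 (u l) := hτ l
        rw [e1, e2, G.mv_mv]
      · intro l hl
        have e2 : u (τ l) = G.mv 0 (u l) := hτ l
        rw [hl] at e2
        exact G.mv_ne 0 _ e2.symm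
      · intro l hl
        have e2 : u (τ l) = G.mv 0 (u l) := hτ l
        rw [hl, h12' 1 (by decide)] at e2
        exact hmv (by omega) 1 (by decide) _ e2.symm
      · intro l hl
        have e2 : u (τ l) = G.mv 0 (u l) := hτ l
        rw [hl, h12' 2 (by decide)] at e2
        exact hmv (by omega) 2 (by decide) _ e2.symm
    have htorus : ∀ τ : Fin 6 → Fin 6, (∀ l : Fin 6, u (τ l) = G.mv 0 (u l)) →
        τ = torusGem.mv 0 → Nonempty (G.Surface ≃ₜ torusGem.Surface) ∧ G.Orientable := by
      intro τ hτ h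
      obtain ⟨h1, h2⟩ := homeomorph_of_numbering torusGem hbij fun a l => by
        by_cases ha : a = 0
        · subst ha; rw [← h]; exact hτ l
        · exact h12 u hper hev hod a ha l
      exact ⟨h1, h2 torusGem_orientable⟩
    obtain ⟨τ, hτ, hτ'⟩ := hmatch u hper hev hod hbij
    have hτ0 : u (τ 0) = G.mv 0 (u 0) := hτ 0
    have hτ1 : u (τ 1) = G.mv 0 (u 1) := hτ 1
    refine ⟨fun hO => ?_, fun hO => ?_⟩
    -- The signs alternate around the hexagon, so an orientation forbids short diagonals, which join
    -- positions of equal parity.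
    · obtain ⟨σ, hσ⟩ := hO
      have hσ2 : ∀ l, σ (u (l + 1)) = !σ (u l) := by
        intro l
        rcases Nat.even_or_odd l with hl | hl
        · rw [← (hev l hl).1]; exact Bool.eq_not.2 (hσ 2 _)
        · rw [← (hod l hl).1]; exact Bool.eq_not.2 (hσ 1 _)
      have e1 := hσ2 0
      have e2 := hσ2 1
      have e3 := hσ2 2
      have e4 := hσ2 3
      have e5 := hσ2 4
      norm_num at e1 e2 e3 e4 e5
      rcases hτ' with ⟨h, -⟩ | ⟨-, -, h⟩ | ⟨h, -⟩ | ⟨h, -⟩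
      · exact (htorus _ hτ h).1
      · exfalso
        rw [h] at hτ1
        have : u 5 = G.mv 0 (u 1) := hτ1
        apply hσ 0 (u 1)
        rw [← this, e5, e4, e3, e2]; simp
      · exfalso
        rw [h] at hτ0
        have : u 2 = G.mv 0 (u 0) := hτ0
        apply hσ 0 (u 0)
        rw [← this, e2, e1]; simp
      · exfalso
        rw [h] at hτ0
        have : u 4 = G.mv 0 (u 0) := hτ0
        apply hσ 0 (u 0)
        rw [← this, e4, e3, e2, e1]; simp
    -- Every possible matching contains a long diagonal. Numbering anew from one of its ends makes
    -- `τ 0 = 3`, which leaves only the matchings of the torus and of the Klein bottle as listed.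
    · obtain ⟨d', hd'⟩ : ∃ d', G.mv 0 d' = G.mv 2 (G.mv 1 (G.mv 2 d')) := by
        have e0 := hev 0 (by decide)
        have e2 := hev 2 (by decide)
        have e4 := hev 4 (by decide)
        have o1 := hod 1 (by decide)
        have o3 := hod 3 (by decide)
        have o5 := hod 5 (by decide)
        norm_num at e0 e2 e4 o1 o3 o5 hper
        rw [hper] at o5
        have hτ2 : u (τ 2) = G.mv 0 (u 2) := hτ 2
        have hτ4 : u (τ 4) = G.mv 0 (u 4) := hτ 4
        rcases hτ' with ⟨-, h⟩ | ⟨-, h, -⟩ | ⟨-, h⟩ | ⟨-, h⟩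
        · rw [h] at hτ0
          exact ⟨u 0, by rw [← hτ0, e0.1, o1.1, e2.1]; rfl⟩
        · rw [h] at hτ0
          exact ⟨u 0, by rw [← hτ0, e0.1, o1.1, e2.1]; rfl⟩
        · rw [h] at hτ4
          exact ⟨u 4, by rw [← hτ4, e4.1, o5.1, e0.1]; rfl⟩
        · rw [h] at hτ2
          exact ⟨u 2, by rw [← hτ2, e2.1, o3.1, e4.1]; rfl⟩
      obtain ⟨n, u, -, hcard', h0, hper, hev, hod, hbij⟩ := exists_equiv_of_crystal h d'
      obtain rfl : n = 5 := by omega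
      obtain ⟨τ, hτ, hτ'⟩ := hmatch u hper hev hod hbij
      have e3 : u 3 = G.mv 0 (u 0) := by
        rw [h0, hd', ← h0, (hev 0 (by decide)).1, (hod 1 (by decide)).1, (hev 2 (by decide)).1]
      have hτ3 : τ 0 = 3 := by
        have hτ0 : u (τ 0) = G.mv 0 (u 0) := hτ 0
        rw [← e3] at hτ0
        exact hbij.1 hτ0
      rcases hτ' with ⟨h, -⟩ | ⟨h, -⟩ | ⟨h, -⟩ | ⟨h, -⟩
      · exact absurd (homeomorph_of_numbering torusGem hbij fun a l => by
          by_cases ha : a = 0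
          · subst ha; rw [← h]; exact hτ l
          · exact h12 u hper hev hod a ha l).2 (fun h => hO (h torusGem_orientable))
      · exact (homeomorph_of_numbering kleinGem hbij fun a l => by
          by_cases ha : a = 0
          · subst ha; rw [← h]; exact hτ l
          · rw [kleinGem_mv a ha]
            exact h12 u hper hev hod a ha l).1
      · exact absurd (hτ3.symm.trans h) (by decide)
      · exact absurd (hτ3.symm.trans h) (by decide)

theorem classification_std [Finite C] (hG : G.Connected) :
    G.chi2 ≤ 4 ∧ (G.chi2 = 4 → G.Orientable ∧ Nonempty (G.Surface ≃ₜ twoGem.Surface)) ∧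
      (G.chi2 = 2 → Nonempty (G.Surface ≃ₜ fourGem.Surface)) ∧
      (G.chi2 = 0 → (G.Orientable → Nonempty (G.Surface ≃ₜ torusGem.Surface)) ∧
        (¬ G.Orientable → Nonempty (G.Surface ≃ₜ kleinGem.Surface))) := by
  obtain ⟨C', _, G', ⟨e⟩, _, h, hchi, hor⟩ := exists_crystallization _ G rfl hG
  obtain ⟨h1, h2, h3, h4⟩ := classification_crystal h
  rw [← hchi, ← hor]
  refine ⟨h1, fun hc => ⟨(h2 hc).1, ?_⟩, fun hc => ?_, fun hc => ⟨fun ho => ?_, fun ho => ?_⟩⟩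
  · obtain ⟨k⟩ := (h2 hc).2; exact ⟨e.trans k⟩
  · obtain ⟨k⟩ := h3 hc; exact ⟨e.trans k⟩
  · obtain ⟨k⟩ := (h4 hc).1 ho; exact ⟨e.trans k⟩
  · obtain ⟨k⟩ := (h4 hc).2 ho; exact ⟨e.trans k⟩

end Gem

namespace Gem

open Topology

/-! ### The sphere and the projective plane -/

/-- The octahedron. -/
def octahedron : Gem (Fin 3 → Bool) where
  mv i x := Function.update x i (!x i)
  mv_mv i x := by simp
  mv_ne i x := fun h => by
    have := congrFun h i
    simp at this

/-- Two faces whose signs differ only in coordinates from `P` are joined by flipping these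
coordinates one at a time. -/
theorem octahedron_walk {β : Type*} (F : (Fin 3 → Bool) → β) (P : Fin 3 → Prop)
    (hF : ∀ i, P i → ∀ x, F (octahedron.mv i x) = F x) {x y : Fin 3 → Bool}
    (h : ∀ i, x i = y i ∨ P i) : F x = F y := by
  have step : ∀ z i, z i = x i → F (Function.update z i (y i)) = F z := by
    intro z i hz
    by_cases hxy : x i = y i
    · rw [← hxy, ← hz, Function.update_eq_self]
    · have hp := (h i).resolve_left hxy
      have : y i = !z i := by rw [hz]; exact Bool.eq_not.2 (Ne.symm hxy)
      rw [this]
      exact hF i hp z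
  have e : Function.update (Function.update (Function.update x 0 (y 0)) 1 (y 1)) 2 (y 2) = y := by
    funext i; fin_cases i <;> simp [Function.update]
  rw [← e, step _ 2 (by simp [Function.update]), step _ 1 (by simp [Function.update]), step _ 0 rfl]

theorem octahedron_connected : octahedron.Connected := by
  refine ⟨⟨fun _ => true⟩, ⟨?_⟩⟩
  rintro ⟨x⟩ ⟨y⟩
  exact octahedron_walk octahedron.total (fun _ => True) (fun i _ x => octahedron.total_mv i x)
    fun i => Or.inr trivial

theorem card_quot {C β : Type*} {r : C → C → Prop} (g : C → β) (hr : ∀ x y, r x y → g x = g y)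
    (hg : ∀ x y, g x = g y → Quot.mk r x = Quot.mk r y) (hs : Function.Surjective g) :
    Nat.card (Quot r) = Nat.card β := by
  refine Nat.card_congr (Equiv.ofBijective (Quot.lift g hr) ⟨?_, ?_⟩)
  · rintro ⟨x⟩ ⟨y⟩ h
    exact hg x y h
  · intro b
    obtain ⟨x, rfl⟩ := hs b
    exact ⟨Quot.mk r x, rfl⟩

theorem octahedron_chi2 : octahedron.chi2 = 4 := by
  have h : ∀ i, Nat.card (octahedron.Comp i) = 2 := by
    intro i
    rw [show 2 = Nat.card Bool by simp]
    refine card_quot (fun x => x i) ?_ ?_ ?_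
    · rintro x y ⟨a, ha, rfl⟩
      simp [octahedron, Function.update, ha.symm]
    · intro x y hxy
      exact octahedron_walk (octahedron.comp i) (fun j => j ≠ i) (fun j hj x => octahedron.comp_mv hj x)
        fun j => by
          by_cases hj : j = i
          · subst hj; exact Or.inl hxy
          · exact Or.inr hj
    · intro b
      exact ⟨fun _ => b, rfl⟩
  simp [chi2, h]

def sign (b : Bool) : ℝ := if b then -1 else 1

theorem sign_sq (b : Bool) : sign b ^ 2 = 1 := by cases b <;> simp [sign]

theorem sign_not (b : Bool) : sign (!b) = -sign b := by cases b <;> simp [sign]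

theorem abs_sign (b : Bool) : |sign b| = 1 := by cases b <;> simp [sign]

noncomputable def Tri.length (t : Tri) : ℝ := Real.sqrt (∑ i, t.1 i ^ 2)

theorem Tri.length_pos (t : Tri) : 0 < t.length := by
  refine Real.sqrt_pos.2 ?_
  have hs := Tri.sum_eq t
  rw [Fin.sum_univ_three]
  by_contra h
  have h0 : t.1 0 = 0 := by nlinarith [sq_nonneg (t.1 0), sq_nonneg (t.1 1), sq_nonneg (t.1 2)]
  have h1 : t.1 1 = 0 := by nlinarith [sq_nonneg (t.1 0), sq_nonneg (t.1 1), sq_nonneg (t.1 2)]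
  have h2 : t.1 2 = 0 := by nlinarith [sq_nonneg (t.1 0), sq_nonneg (t.1 1), sq_nonneg (t.1 2)]
  linarith

theorem Tri.continuous_length : Continuous Tri.length :=
  (continuous_finsetSum _ fun i _ => (Tri.continuous_coord i).pow 2).sqrt

/-- Central projection of a face of the octahedron to the sphere. -/
noncomputable def proj (ε : Fin 3 → Bool) (t : Tri) : ModelSurface.Sphere :=
  ⟨WithLp.toLp 2 fun i => sign (ε i) * t.1 i / t.length, by
    have h := t.length_pos
    have h2 : t.length ^ 2 = ∑ i, t.1 i ^ 2 := Real.sq_sqrt (Finset.sum_nonneg fun i _ => sq_nonneg _)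
    rw [mem_sphere_zero_iff_norm, EuclideanSpace.norm_eq, Real.sqrt_eq_one]
    simp only [Real.norm_eq_abs, sq_abs, div_pow, mul_pow, sign_sq, one_mul]
    rw [← Finset.sum_div, ← h2, div_self (by positivity)]⟩

theorem proj_apply (ε : Fin 3 → Bool) (t : Tri) (i : Fin 3) :
    (proj ε t).1 i = sign (ε i) * t.1 i / t.length := rfl

theorem continuous_proj (ε : Fin 3 → Bool) : Continuous (proj ε) := by
  refine Continuous.subtype_mk ?_ _
  refine (PiLp.continuous_toLp 2 _).comp (continuous_pi fun i => ?_)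
  exact (continuous_const.mul (Tri.continuous_coord i)).div Tri.continuous_length
    fun t => t.length_pos.ne'

theorem sphere_ext {x y : ModelSurface.Sphere} (h : ∀ i, x.1 i = y.1 i) : x = y :=
  Subtype.ext (PiLp.ext h)

/-- The barycentric coordinates sum to 1, so the absolute values of the normalised coordinates sum
to the inverse length, which recovers the length. -/
theorem proj_eq_of_abs {ε ε' : Fin 3 → Bool} {t t' : Tri}
    (h : ∀ i, |(proj ε t).1 i| = |(proj ε' t').1 i|) : t = t' := by
  have h1 := t.length_pos
  have h2 := t'.length_pos
  have h3 : ∀ i, t.1 i / t.length = t'.1 i / t'.length := by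
    intro i
    have := h i
    rw [proj_apply, proj_apply, abs_div, abs_div, abs_mul, abs_mul, abs_sign, abs_sign,
      abs_of_pos h1, abs_of_pos h2, abs_of_nonneg (Tri.nonneg t i),
      abs_of_nonneg (Tri.nonneg t' i), one_mul, one_mul] at this
    exact this
  have h4 : 1 / t.length = 1 / t'.length := by
    have e : ∀ s : Tri, 1 / s.length = s.1 0 / s.length + s.1 1 / s.length + s.1 2 / s.length :=
      fun s => by rw [← add_div, ← add_div, Tri.sum_eq]
    rw [e, e, h3, h3, h3]
  have h5 : t.length = t'.length := by
    rw [div_eq_div_iff h1.ne' h2.ne'] at h4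
    linarith
  refine Subtype.ext (funext fun i => ?_)
  have := h3 i
  rwa [h5, div_left_inj' h2.ne'] at this

theorem sign_mul_inj {b b' : Bool} {x : ℝ} (h : sign b * x = sign b' * x) : b = b' ∨ x = 0 := by
  rcases mul_eq_mul_right_iff.1 h with h | h
  · left
    cases b <;> cases b' <;> norm_num [sign] at h <;> rfl
  · exact Or.inr h

theorem proj_eq {ε ε' : Fin 3 → Bool} {t t' : Tri} (h : proj ε t = proj ε' t') :
    t = t' ∧ ∀ i, ε i = ε' i ∨ t.1 i = 0 := by
  have ht : t = t' := proj_eq_of_abs (ε := ε) (ε' := ε') (fun i => by rw [h])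
  subst ht
  refine ⟨rfl, fun i => ?_⟩
  have : (proj ε t).1 i = (proj ε' t).1 i := by rw [h]
  rw [proj_apply, proj_apply, div_left_inj' t.length_pos.ne'] at this
  exact sign_mul_inj this

theorem proj_not (ε : Fin 3 → Bool) (t : Tri) : proj (fun i => !ε i) t = -proj ε t := by
  refine sphere_ext fun i => ?_
  show (proj (fun i => !ε i) t).1 i = -(proj ε t).1 i
  rw [proj_apply, proj_apply, sign_not]
  ring

theorem proj_congr {ε ε' : Fin 3 → Bool} {t : Tri} (h : ∀ i, ε i = ε' i ∨ t.1 i = 0) :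
    proj ε t = proj ε' t := by
  refine sphere_ext fun i => ?_
  rw [proj_apply, proj_apply]
  rcases h i with h | h
  · rw [h]
  · rw [h, mul_zero, mul_zero]

theorem exists_proj (y : ModelSurface.Sphere) : ∃ ε t, proj ε t = y := by
  classical
  have hy : ∑ i, y.1 i ^ 2 = 1 := by
    have := y.2
    rw [mem_sphere_zero_iff_norm, EuclideanSpace.norm_eq, Real.sqrt_eq_one] at this
    simpa using this
  -- The ray through `y` meets the octahedron where the absolute values of the coordinates sum to 1.
  set s := ∑ i, |y.1 i| with hs
  have hs0 : 0 < s := by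
    refine lt_of_le_of_ne (Finset.sum_nonneg fun i _ => abs_nonneg _) fun h => ?_
    have h0 := (Finset.sum_eq_zero_iff_of_nonneg fun i _ => abs_nonneg (y.1 i)).1 (hs ▸ h.symm)
    have : ∑ i, y.1 i ^ 2 = 0 := Finset.sum_eq_zero fun i hi => by
      rw [abs_eq_zero.1 (h0 i hi)]; norm_num
    linarith
  let t : Tri := ⟨fun i => |y.1 i| / s, fun i => by positivity, by
    rw [← Finset.sum_div, ← hs, div_self hs0.ne']⟩
  have ht : ∀ i, t.1 i = |y.1 i| / s := fun i => rfl
  have hl : t.length = 1 / s := by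
    unfold Tri.length
    simp only [ht, div_pow, sq_abs]
    rw [← Finset.sum_div, hy, Real.sqrt_div zero_le_one, Real.sqrt_one, Real.sqrt_sq hs0.le]
  refine ⟨fun i => decide (y.1 i < 0), t, sphere_ext fun i => ?_⟩
  rw [proj_apply, hl, ht]
  have e : sign (decide (y.1 i < 0)) * |y.1 i| = y.1 i := by
    by_cases h : y.1 i < 0
    · simp [sign, h, abs_of_neg h]
    · simp [sign, h, abs_of_nonneg (not_lt.1 h)]
  field_simp
  exact e

theorem octahedron_homeomorph : Nonempty (octahedron.Surface ≃ₜ ModelSurface.Sphere) := by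
  have : CompactSpace Tri := isCompact_iff_compactSpace.1 (isCompact_stdSimplex ℝ (Fin 3))
  have hflip : ∀ i (x : Fin 3 → Bool) (t : Tri), t.1 i = 0 →
      proj (octahedron.mv i x) t = proj x t := by
    intro i x t ht
    refine proj_congr fun j => ?_
    by_cases hj : j = i
    · subst hj; exact Or.inr ht
    · left; simp [octahedron, Function.update, hj]
  let f : (Σ _ : Fin 3 → Bool, Tri) → ModelSurface.Sphere := fun p => proj p.1 p.2
  have hf : Continuous f := continuous_sigma fun x => continuous_proj x
  have hquot : IsQuotientMap f := by
    refine hf.isClosedMap.isQuotientMap hf fun y => ?_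
    obtain ⟨ε, t, h⟩ := exists_proj y
    exact ⟨⟨ε, t⟩, h⟩
  obtain ⟨e⟩ : Nonempty (Quot octahedron.rel ≃ₜ Quot (fun x y : ModelSurface.Sphere => x = y)) := by
    refine nonempty_homeomorph_quot (f := f) (f' := id) hf continuous_id ?_ ?_ ?_ ?_ ?_ ?_
    · intro y
      obtain ⟨p, hp⟩ := hquot.surjective y
      exact ⟨p, hp⟩
    · exact fun p => ⟨f p, rfl⟩
    · rintro ⟨x, t⟩ ⟨y, s⟩ h
      obtain ⟨rfl, h2⟩ := proj_eq h
      exact octahedron_walk (fun x => (Quot.mk octahedron.rel ⟨x, t⟩ : Quot octahedron.rel))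
        (fun i => t.1 i = 0) (fun i hi x => (octahedron.mk_mv i x hi).symm) h2
    · rintro x y rfl; rfl
    · rintro x y rfl
      obtain ⟨p, hp⟩ := hquot.surjective x
      exact ⟨p, p, hp, hp, rfl⟩
    · rintro ⟨x, t⟩ q ⟨i, ht, rfl⟩
      exact ⟨f ⟨x, t⟩, f ⟨x, t⟩, rfl, (hflip i x t ht).symm, rfl⟩
  refine ⟨e.trans ⟨⟨Quot.lift id fun x y h => h, Quot.mk _, ?_, fun x => rfl⟩, ?_, ?_⟩⟩
  · rintro ⟨x⟩; rfl
  · exact continuous_quot_lift _ continuous_id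
  · exact continuous_quot_mk

/-- The products of coordinates of a point of the sphere. -/
def veronese (y : ModelSurface.Sphere) : Fin 3 → Fin 3 → ℝ := fun i j => y.1 i * y.1 j

theorem continuous_veronese : Continuous veronese := by
  have h : ∀ i, Continuous fun y : ModelSurface.Sphere => y.1 i := fun i =>
    ((continuous_apply i).comp (PiLp.continuous_ofLp 2 _)).comp continuous_subtype_val
  exact continuous_pi fun i => continuous_pi fun j => (h i).mul (h j)

theorem veronese_neg (y : ModelSurface.Sphere) : veronese (-y) = veronese y := by
  funext i j
  show -(y.1 i) * -(y.1 j) = _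
  rw [neg_mul_neg]; rfl

/-- The products of coordinates separate antipodal pairs, so the projective plane can be compared
with other quotients inside a space of matrices. -/
theorem veronese_eq {y z : ModelSurface.Sphere} (h : veronese y = veronese z) : z = y ∨ z = -y := by
  have h' : ∀ i j, y.1 i * y.1 j = z.1 i * z.1 j := fun i j => congrFun (congrFun h i) j
  obtain ⟨i, hi⟩ : ∃ i, y.1 i ≠ 0 := by
    by_contra hcon
    push Not at hcon
    have h2 := y.2
    rw [mem_sphere_zero_iff_norm, EuclideanSpace.norm_eq, Real.sqrt_eq_one] at h2
    simp [hcon] at h2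
  have hz : z.1 i ≠ 0 := by
    intro h0
    have := h' i i
    rw [h0, mul_zero] at this
    exact hi (mul_self_eq_zero.1 this)
  rcases mul_self_eq_mul_self_iff.1 (h' i i) with h2 | h2
  · left
    refine sphere_ext fun j => ?_
    have := h' i j
    rw [h2] at this
    exact (mul_left_cancel₀ hz this).symm
  · right
    refine sphere_ext fun j => ?_
    show z.1 j = -(y.1 j)
    have := h' i j
    rw [h2, neg_mul, ← mul_neg] at this
    exact (mul_left_cancel₀ hz this).symm

/-- The signs of the coordinates on the four faces of half of the octahedron. -/
def fourSign : Fin 4 → Fin 3 → Bool :=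
  ![![false, false, false], ![false, false, true], ![false, true, true], ![false, true, false]]

/-- `fourSign` picks one face from each antipodal pair. Crossing side `i` may lead to the antipode
of the picked face; the sign of coordinate `i` is irrelevant since that coordinate vanishes on the
side. -/
theorem fourSign_mv : ∀ i x, (∀ j, j ≠ i → fourSign (fourGem.mv i x) j = fourSign x j) ∨
    ∀ j, j ≠ i → fourSign (fourGem.mv i x) j = !fourSign x j := by decide

theorem fourSign_surj : ∀ a b c : Bool, (∃ x, fourSign x 0 = a ∧ fourSign x 1 = b ∧ fourSign x 2 = c) ∨
    ∃ x, fourSign x 0 = !a ∧ fourSign x 1 = !b ∧ fourSign x 2 = !c := by decide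

-- The Booleans record which coordinates of a point vanish. Faces agreeing there, up to a global
-- sign, are joined by moves across sides through the point.
set_option synthInstance.maxSize 2000 in
set_option synthInstance.maxHeartbeats 200000 in
theorem fourSign_fibre : ∀ (a b c : Bool) (x y : Fin 4),
    (((fourSign x 0 = fourSign y 0 ∨ a = true) ∧ (fourSign x 1 = fourSign y 1 ∨ b = true) ∧
      (fourSign x 2 = fourSign y 2 ∨ c = true)) ∨
     ((fourSign x 0 = !fourSign y 0 ∨ a = true) ∧ (fourSign x 1 = !fourSign y 1 ∨ b = true) ∧
      (fourSign x 2 = !fourSign y 2 ∨ c = true))) →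
    x = y ∨ (y = fourGem.mv 0 x ∧ (a = true ∨ b = true ∧ c = true)) ∨
      (y = fourGem.mv 1 x ∧ (b = true ∨ a = true ∧ c = true)) ∨
      (y = fourGem.mv 2 x ∧ (c = true ∨ a = true ∧ b = true)) := by decide

/-- Half of the octahedron covers the sphere up to antipodes, and the Veronese map identifies its
boundary points exactly as the moves of `fourGem` do. -/
theorem fourGem_homeomorph : Nonempty (fourGem.Surface ≃ₜ ModelSurface.ProjectivePlane) := by
  classical
  have : CompactSpace Tri := isCompact_iff_compactSpace.1 (isCompact_stdSimplex ℝ (Fin 3))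
  let f : (Σ _ : Fin 4, Tri) → Fin 3 → Fin 3 → ℝ := fun p => veronese (proj (fourSign p.1) p.2)
  have hf : Continuous f :=
    continuous_veronese.comp (continuous_sigma fun x => continuous_proj (fourSign x))
  have hsurj : ∀ y, ∃ p, f p = veronese y := by
    intro y
    obtain ⟨ε, t, rfl⟩ := exists_proj y
    rcases fourSign_surj (ε 0) (ε 1) (ε 2) with ⟨x, h0, h1, h2⟩ | ⟨x, h0, h1, h2⟩
    · refine ⟨⟨x, t⟩, ?_⟩
      have : fourSign x = ε := by funext i; fin_cases i <;> assumption
      simp only [f, this]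
    · refine ⟨⟨x, t⟩, ?_⟩
      have : fourSign x = fun i => !ε i := by funext i; fin_cases i <;> assumption
      simp only [f, this, proj_not, veronese_neg]
  refine nonempty_homeomorph_quot (f := f) (f' := veronese)
    (r' := fun x y : ModelSurface.Sphere => y = -x) hf continuous_veronese hsurj
    (fun p => ⟨_, rfl⟩) ?_ ?_ ?_ ?_
  · rintro ⟨x, t⟩ ⟨y, s⟩ h
    have key : t = s ∧ ((∀ i, fourSign x i = fourSign y i ∨ t.1 i = 0) ∨
        ∀ i, fourSign x i = !fourSign y i ∨ t.1 i = 0) := by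
      rcases veronese_eq h with h | h
      · obtain ⟨h1, h2⟩ := proj_eq h.symm
        exact ⟨h1, Or.inl h2⟩
      · have h' : proj (fourSign x) t = proj (fun i => !fourSign y i) s := by
          show proj (fourSign x) t = _
          rw [proj_not]
          have : proj (fourSign y) s = -proj (fourSign x) t := h
          rw [this, neg_neg]
        obtain ⟨h1, h2⟩ := proj_eq h'
        exact ⟨h1, Or.inr h2⟩
    obtain ⟨rfl, hk⟩ := key
    have hm := fun i (z : Fin 4) (hi : t.1 i = 0) => fourGem.mk_mv i z hi
    have hcomp : ∀ z : Fin 4, fourGem.mv 1 (fourGem.mv 2 z) = fourGem.mv 0 z ∧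
        fourGem.mv 0 (fourGem.mv 2 z) = fourGem.mv 1 z ∧
        fourGem.mv 0 (fourGem.mv 1 z) = fourGem.mv 2 z := by decide
    have := fourSign_fibre (decide (t.1 0 = 0)) (decide (t.1 1 = 0)) (decide (t.1 2 = 0)) x y (by
      simp only [decide_eq_true_eq]
      rcases hk with hk | hk
      · exact Or.inl ⟨hk 0, hk 1, hk 2⟩
      · exact Or.inr ⟨hk 0, hk 1, hk 2⟩)
    simp only [decide_eq_true_eq] at this
    rcases this with rfl | ⟨rfl, h0 | ⟨h1, h2⟩⟩ | ⟨rfl, h1 | ⟨h0, h2⟩⟩ | ⟨rfl, h2 | ⟨h0, h1⟩⟩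
    · rfl
    · exact hm 0 x h0
    · rw [hm 2 x h2, hm 1 _ h1, (hcomp x).1]
    · exact hm 1 x h1
    · rw [hm 2 x h2, hm 0 _ h0, (hcomp x).2.1]
    · exact hm 2 x h2
    · rw [hm 1 x h1, hm 0 _ h0, (hcomp x).2.2]
  · intro y z h
    rcases veronese_eq h with rfl | rfl
    · rfl
    · exact Quot.sound rfl
  · rintro y z rfl
    obtain ⟨p, hp⟩ := hsurj y
    exact ⟨p, p, hp, by rw [hp, veronese_neg], rfl⟩
  · rintro ⟨x, t⟩ q ⟨i, ht, rfl⟩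
    refine ⟨_, _, rfl, ?_, rfl⟩
    show veronese (proj (fourSign x) t) = veronese (proj (fourSign (fourGem.mv i x)) t)
    rcases fourSign_mv i x with h | h
    · congr 1
      refine proj_congr fun j => ?_
      by_cases hj : j = i
      · subst hj; exact Or.inr ht
      · exact Or.inl (h j hj).symm
    · rw [← veronese_neg, ← proj_not]
      congr 1
      refine proj_congr fun j => ?_
      by_cases hj : j = i
      · subst hj; exact Or.inr ht
      · exact Or.inl (h j hj).symm

end Gem

namespace Gem

open Topology

/-! ### The torus and the Klein bottle -/

/-- The barycentric subdivision of a square with opposite sides identified; `k` tells whether the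
vertical sides are identified with a reflection.  The triangles are numbered by the signs of the two
coordinates and by whether the first coordinate is the larger one. -/
def squareGem (k : Bool) : Gem (Bool × Bool × Bool) where
  mv i x := ![if x.2.2 then (x.1, !x.2.1, x.2.2) else (!x.1, x.2.1, x.2.2), (x.1, x.2.1, !x.2.2),
    if x.2.2 then (!x.1, xor x.2.1 k, x.2.2) else (x.1, !x.2.1, x.2.2)] i
  mv_mv := by revert k; decide
  mv_ne := by revert k; decide

variable {C : Type u}

theorem comp_word (G : Gem C) {i a b : Fin 3} (ha : a ≠ i) (hb : b ≠ i) (n : ℕ) (x : C) :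
    G.comp i ((fun x => G.mv a (G.mv b x))^[n] x) = G.comp i x := by
  induction n with
  | zero => rfl
  | succ n ih => rw [Function.iterate_succ_apply', G.comp_mv ha, G.comp_mv hb, ih]

/-- Walks around the vertices are made explicit as short words in two moves, so that a finite check
shows which triangles share a vertex. There are two vertices of colour `1`, told apart by the last
entry. -/
theorem square_words (k : Bool) (x : Bool × Bool × Bool) :
    (∃ n : Fin 4, x = (fun x => (squareGem k).mv 0 ((squareGem k).mv 1 x))^[n] (true, true, true) ∨
      (squareGem k).mv 1 x = (fun x => (squareGem k).mv 0 ((squareGem k).mv 1 x))^[n] (true, true, true)) ∧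
    (∃ n : Fin 4, x = (fun x => (squareGem k).mv 2 ((squareGem k).mv 1 x))^[n] (true, true, true) ∨
      (squareGem k).mv 1 x = (fun x => (squareGem k).mv 2 ((squareGem k).mv 1 x))^[n] (true, true, true)) ∧
    (∃ n : Fin 2, x = (fun x => (squareGem k).mv 2 ((squareGem k).mv 0 x))^[n] (true, true, x.2.2) ∨
      (squareGem k).mv 0 x = (fun x => (squareGem k).mv 2 ((squareGem k).mv 0 x))^[n] (true, true, x.2.2)) := by
  revert x k; decide

theorem square_comp_two (k : Bool) (x : Bool × Bool × Bool) :
    (squareGem k).comp 2 x = (squareGem k).comp 2 (true, true, true) := by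
  obtain ⟨⟨n, h | h⟩, -, -⟩ := square_words k x
  · rw [h, comp_word _ (by decide) (by decide)]
  · rw [← (squareGem k).comp_mv (a := 1) (by decide) x, h, comp_word _ (by decide) (by decide)]

theorem square_comp_zero (k : Bool) (x : Bool × Bool × Bool) :
    (squareGem k).comp 0 x = (squareGem k).comp 0 (true, true, true) := by
  obtain ⟨-, ⟨n, h | h⟩, -⟩ := square_words k x
  · rw [h, comp_word _ (by decide) (by decide)]
  · rw [← (squareGem k).comp_mv (a := 1) (by decide) x, h, comp_word _ (by decide) (by decide)]

theorem square_comp_one (k : Bool) (x : Bool × Bool × Bool) :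
    (squareGem k).comp 1 x = (squareGem k).comp 1 (true, true, x.2.2) := by
  obtain ⟨-, -, ⟨n, h | h⟩⟩ := square_words k x
  · conv_lhs => rw [h]
    rw [comp_word _ (by decide) (by decide)]
  · rw [← (squareGem k).comp_mv (a := 0) (by decide) x, h, comp_word _ (by decide) (by decide)]

theorem squareGem_connected (k : Bool) : (squareGem k).Connected := by
  refine ⟨⟨(true, true, true)⟩, ⟨?_⟩⟩
  rintro ⟨x⟩ ⟨y⟩
  exact congrArg (Quot.map id fun x y ⟨a, _, h⟩ => ⟨a, h⟩)
    ((square_comp_two k x).trans (square_comp_two k y).symm)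

theorem squareGem_chi2 (k : Bool) : (squareGem k).chi2 = 0 := by
  have h2 : Nat.card ((squareGem k).Comp 2) = 1 := by
    refine (card_quot (fun _ => ()) (fun _ _ _ => rfl) (fun x y _ => ?_) fun _ =>
      ⟨(true, true, true), rfl⟩).trans (by simp)
    exact (square_comp_two k x).trans (square_comp_two k y).symm
  have h0 : Nat.card ((squareGem k).Comp 0) = 1 := by
    refine (card_quot (fun _ => ()) (fun _ _ _ => rfl) (fun x y _ => ?_) fun _ =>
      ⟨(true, true, true), rfl⟩).trans (by simp)
    exact (square_comp_zero k x).trans (square_comp_zero k y).symm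
  have h1 : Nat.card ((squareGem k).Comp 1) = 2 := by
    refine (card_quot (fun x => x.2.2) ?_ (fun x y h => ?_) fun b =>
      ⟨(true, true, b), rfl⟩).trans (by simp)
    · rintro x y ⟨a, ha, rfl⟩
      clear h0 h2
      revert k x; revert a; decide
    · refine (square_comp_one k x).trans ((square_comp_one k y).trans ?_).symm
      rw [h]
  unfold chi2
  rw [Fin.sum_univ_three, h0, h1, h2]
  simp

theorem squareGem_orientable : (squareGem false).Orientable :=
  ⟨fun x => xor (xor x.1 x.2.1) x.2.2, by decide⟩

theorem squareGem_not_orientable : ¬ (squareGem true).Orientable := by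
  rintro ⟨σ, h⟩
  -- These five moves form a closed walk of odd length.
  have h1 := h 2 (true, true, true)
  have h2 := h 0 (false, false, true)
  have h3 := h 1 (false, true, true)
  have h4 := h 0 (false, true, false)
  have h5 := h 1 (true, true, false)
  have key : ∀ a b c d e : Bool, b ≠ a → c ≠ b → d ≠ c → e ≠ d → a ≠ e → False := by
    intro a b c d e
    cases a <;> cases b <;> cases c <;> cases d <;> cases e <;> simp
  exact key (σ (true, true, true)) (σ (false, false, true)) (σ (false, true, true))
    (σ (false, true, false)) (σ (true, true, false)) h1 h2 h3 h4 h5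

abbrev Square : Type := unitInterval × unitInterval

/-- A point of `[0, 1]` from its signed distance from the centre. -/
noncomputable def centred (b : Bool) (m : ℝ) (h : 0 ≤ m ∧ m ≤ 1) : unitInterval :=
  ⟨(1 + sign b * m) / 2, by
    cases b <;> simp only [sign] <;> constructor <;> norm_num <;> linarith⟩

theorem centred_eq {b b' : Bool} {m m' : ℝ} {h : 0 ≤ m ∧ m ≤ 1} {h' : 0 ≤ m' ∧ m' ≤ 1}
    (e : centred b m h = centred b' m' h') : m = m' ∧ (b = b' ∨ m = 0) := by
  have e1 : sign b * m = sign b' * m' := by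
    have := congrArg Subtype.val e
    simp only [centred] at this
    linarith
  have e2 : m = m' := by
    have := congrArg (fun x => |x|) e1
    simpa [abs_mul, abs_sign, abs_of_nonneg h.1, abs_of_nonneg h'.1] using this
  subst e2
  exact ⟨rfl, sign_mul_inj e1⟩

theorem exists_centred (s : unitInterval) : ∃ b m h, centred b m h = s := by
  have h0 := s.2.1
  have h1 := s.2.2
  rcases le_total (1 / 2) (s : ℝ) with h | h
  · exact ⟨false, 2 * s - 1, ⟨by linarith, by linarith⟩, Subtype.ext (by simp [centred, sign])⟩
  · exact ⟨true, 1 - 2 * s, ⟨by linarith, by linarith⟩, Subtype.ext (by simp [centred, sign])⟩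

theorem Tri.mem_max (t : Tri) : 0 ≤ t.1 0 + t.1 1 ∧ t.1 0 + t.1 1 ≤ 1 := by
  have := Tri.sum_eq t
  have h0 := Tri.nonneg t 0
  have h1 := Tri.nonneg t 1
  have h2 := Tri.nonneg t 2
  exact ⟨by linarith, by linarith⟩

theorem Tri.mem_min (t : Tri) : 0 ≤ t.1 0 ∧ t.1 0 ≤ 1 := by
  have := Tri.mem_max t
  have h0 := Tri.nonneg t 0
  have h1 := Tri.nonneg t 1
  exact ⟨h0, by linarith⟩

/-- The vertices `0, 1, 2` go to a corner of the square, the midpoint of a side and the centre. Thus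
`t 0 + t 1` is the larger and `t 0` the smaller distance from the two axes, and `t 2 = 0` is the
boundary of the square. -/
noncomputable def squareMap (p : Σ _ : Bool × Bool × Bool, Tri) : Square :=
  if p.1.2.2 then (centred p.1.1 _ p.2.mem_max, centred p.1.2.1 _ p.2.mem_min)
  else (centred p.1.1 _ p.2.mem_min, centred p.1.2.1 _ p.2.mem_max)

theorem continuous_centred (b : Bool) {f : Tri → ℝ} (hf : Continuous f) (h : ∀ t, 0 ≤ f t ∧ f t ≤ 1) :
    Continuous fun t => centred b (f t) (h t) :=
  Continuous.subtype_mk ((continuous_const.add (continuous_const.mul hf)).div_const 2) _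

theorem continuous_squareMap : Continuous squareMap := by
  have h0 := Tri.continuous_coord 0
  have h1 := Tri.continuous_coord 1
  refine continuous_sigma ?_
  rintro ⟨b1, b2, b3⟩
  cases b3
  · exact (continuous_centred b1 h0 Tri.mem_min).prodMk (continuous_centred b2 (h0.add h1) Tri.mem_max)
  · exact (continuous_centred b1 (h0.add h1) Tri.mem_max).prodMk (continuous_centred b2 h0 Tri.mem_min)

theorem squareMap_surjective : Function.Surjective squareMap := by
  rintro ⟨s1, s2⟩
  obtain ⟨b1, m1, h1, rfl⟩ := exists_centred s1
  obtain ⟨b2, m2, h2, rfl⟩ := exists_centred s2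
  rcases le_total m1 m2 with h | h
  · refine ⟨⟨(b1, b2, false), Tri.mk m1 (m2 - m1) (1 - m2) h1.1 (by linarith) (by linarith [h2.2])
      (by ring)⟩, ?_⟩
    simp [squareMap]
  · refine ⟨⟨(b1, b2, true), Tri.mk m2 (m1 - m2) (1 - m1) h2.1 (by linarith) (by linarith [h1.2])
      (by ring)⟩, ?_⟩
    simp [squareMap]

/-- The triangles meet in the square as they do in the surface. -/
theorem squareMap_fibre (k : Bool) (p q : Σ _ : Bool × Bool × Bool, Tri) (h : squareMap p = squareMap q) :
    (Quot.mk (squareGem k).rel p : Quot (squareGem k).rel) = Quot.mk (squareGem k).rel q := by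
  have flip0 : ∀ b1 b2 b3 (t : Tri), t.1 0 = 0 →
      (Quot.mk (squareGem k).rel ⟨(b1, b2, b3), t⟩ : Quot (squareGem k).rel) =
      Quot.mk (squareGem k).rel ⟨if b3 then (b1, !b2, b3) else (!b1, b2, b3), t⟩ :=
    fun b1 b2 b3 t ht => (squareGem k).mk_mv 0 (b1, b2, b3) ht
  have flip1 : ∀ b1 b2 b3 (t : Tri), t.1 1 = 0 →
      (Quot.mk (squareGem k).rel ⟨(b1, b2, b3), t⟩ : Quot (squareGem k).rel) =
      Quot.mk (squareGem k).rel ⟨(b1, b2, !b3), t⟩ :=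
    fun b1 b2 b3 t ht => (squareGem k).mk_mv 1 (b1, b2, b3) ht
  have hsmall : ∀ b1 b2 b3 b (t : Tri), t.1 0 = 0 →
      (Quot.mk (squareGem k).rel ⟨(b1, b2, b3), t⟩ : Quot (squareGem k).rel) =
      Quot.mk (squareGem k).rel ⟨if b3 then (b1, b, b3) else (b, b2, b3), t⟩ := by
    intro b1 b2 b3 b t ht
    have := flip0 b1 b2 b3 t ht
    cases b3 <;> cases b <;> cases b1 <;> cases b2 <;> first | rfl | exact this
  -- Both coordinates vanish here. The sign of the larger one is changed by passing over a diagonal,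
  -- where it becomes the smaller one, and back.
  have hbig : ∀ b1 b2 b3 b (t : Tri), t.1 0 + t.1 1 = 0 →
      (Quot.mk (squareGem k).rel ⟨(b1, b2, b3), t⟩ : Quot (squareGem k).rel) =
      Quot.mk (squareGem k).rel ⟨if b3 then (b, b2, b3) else (b1, b, b3), t⟩ := by
    intro b1 b2 b3 b t ht
    have h0 : t.1 0 = 0 := by linarith [Tri.nonneg t 0, Tri.nonneg t 1]
    have h1 : t.1 1 = 0 := by linarith
    rw [flip1 b1 b2 b3 t h1, hsmall b1 b2 (!b3) b t h0]
    cases b3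
    · exact flip1 b1 b true t h1
    · exact flip1 b b2 false t h1
  obtain ⟨⟨b1, b2, b3⟩, t⟩ := p
  obtain ⟨⟨c1, c2, c3⟩, s⟩ := q
  have same : ∀ b3, squareMap ⟨(b1, b2, b3), t⟩ = squareMap ⟨(c1, c2, b3), s⟩ →
      (Quot.mk (squareGem k).rel ⟨(b1, b2, b3), t⟩ : Quot (squareGem k).rel) =
      Quot.mk (squareGem k).rel ⟨(c1, c2, b3), s⟩ := by
    clear h b3 c3
    intro b3 h
    cases b3
    · have hh := Prod.ext_iff.1 h
      obtain ⟨e1, e2⟩ := centred_eq (h := t.mem_min) (h' := s.mem_min) (e := hh.1)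
      obtain ⟨e3, e4⟩ := centred_eq (h := t.mem_max) (h' := s.mem_max) (e := hh.2)
      have hts : t = s := Tri.ext_of e1 (by
        have := Tri.sum_eq t
        have := Tri.sum_eq s
        change t.1 0 + t.1 1 = s.1 0 + s.1 1 at e3
        linarith)
      subst hts
      have a1 : (Quot.mk (squareGem k).rel ⟨(b1, b2, false), t⟩ : Quot (squareGem k).rel) =
          Quot.mk (squareGem k).rel ⟨(c1, b2, false), t⟩ := by
        rcases e2 with rfl | e2
        · rfl
        · exact hsmall b1 b2 false c1 t e2
      rw [a1]
      rcases e4 with e4 | e4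
      · change b2 = c2 at e4; rw [e4]
      · exact hbig c1 b2 false c2 t e4
    · have hh := Prod.ext_iff.1 h
      obtain ⟨e1, e2⟩ := centred_eq (h := t.mem_max) (h' := s.mem_max) (e := hh.1)
      obtain ⟨e3, e4⟩ := centred_eq (h := t.mem_min) (h' := s.mem_min) (e := hh.2)
      have hts : t = s := Tri.ext_of e3 (by
        have := Tri.sum_eq t
        have := Tri.sum_eq s
        change t.1 0 + t.1 1 = s.1 0 + s.1 1 at e1
        change t.1 0 = s.1 0 at e3
        linarith)
      subst hts
      have a1 : (Quot.mk (squareGem k).rel ⟨(b1, b2, true), t⟩ : Quot (squareGem k).rel) =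
          Quot.mk (squareGem k).rel ⟨(b1, c2, true), t⟩ := by
        rcases e4 with e4 | e4
        · change b2 = c2 at e4; rw [e4]
        · exact hsmall b1 b2 true c2 t e4
      rw [a1]
      rcases e2 with e2 | e2
      · change b1 = c1 at e2; rw [e2]
      · exact hbig b1 c2 true c1 t e2
  by_cases hb : b3 = c3
  · subst hb
    exact same _ h
  · have h1 : t.1 1 = 0 := by
      have n1 := Tri.nonneg t 1
      have n2 := Tri.nonneg s 1
      cases b3 <;> cases c3
      · exact absurd rfl hb
      · have hh := Prod.ext_iff.1 h
        have e1 : t.1 0 = s.1 0 + s.1 1 := (centred_eq (h := t.mem_min) (h' := s.mem_max) hh.1).1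
        have e2 : t.1 0 + t.1 1 = s.1 0 := (centred_eq (h := t.mem_max) (h' := s.mem_min) hh.2).1
        linarith
      · have hh := Prod.ext_iff.1 h
        have e1 : t.1 0 + t.1 1 = s.1 0 := (centred_eq (h := t.mem_max) (h' := s.mem_min) hh.1).1
        have e2 : t.1 0 = s.1 0 + s.1 1 := (centred_eq (h := t.mem_min) (h' := s.mem_max) hh.2).1
        linarith
      · exact absurd rfl hb
    obtain rfl : c3 = !b3 := by clear same h; revert hb; revert b3 c3; decide
    rw [flip1 b1 b2 b3 t h1]
    refine same _ (Eq.trans ?_ h)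
    cases b3 <;> simp [squareMap, h1]

theorem centred_true {m : ℝ} {h : 0 ≤ m ∧ m ≤ 1} (hm : m = 1) : centred true m h = 0 :=
  Subtype.ext (by simp [centred, sign, hm])

theorem centred_false {m : ℝ} {h : 0 ≤ m ∧ m ≤ 1} (hm : m = 1) : centred false m h = 1 :=
  Subtype.ext (by simp [centred, sign, hm])

theorem centred_not (b : Bool) (m : ℝ) (h : 0 ≤ m ∧ m ≤ 1) :
    centred (!b) m h = unitInterval.symm (centred b m h) :=
  Subtype.ext (by cases b <;> simp [centred, sign] <;> ring)

/-- How the reflection of a vertical side acts. -/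
def turn (k : Bool) (t : unitInterval) : unitInterval := if k then unitInterval.symm t else t

theorem centred_xor (b k : Bool) (m : ℝ) (h : 0 ≤ m ∧ m ≤ 1) :
    centred (xor b k) m h = turn k (centred b m h) := by
  cases k
  · simp [turn]
  · simpa [turn] using centred_not b m h

theorem turn_turn (k : Bool) (t : unitInterval) : turn k (turn k t) = t := by
  cases k <;> simp [turn]

/-- The choice of preimages does not matter by `squareMap_fibre`, so both may be taken in the two
triangles joined by the move of colour `2`. -/
theorem square_horizontal (k : Bool) {t : unitInterval} {p q : Σ _ : Bool × Bool × Bool, Tri}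
    (hp : squareMap p = (t, 0)) (hq : squareMap q = (t, 1)) :
    (Quot.mk (squareGem k).rel p : Quot (squareGem k).rel) = Quot.mk (squareGem k).rel q := by
  obtain ⟨b, m, h, rfl⟩ := exists_centred t
  let u : Tri := Tri.mk m (1 - m) 0 h.1 (by linarith [h.2]) le_rfl (by ring)
  have hu : u.1 0 + u.1 1 = 1 := by simp [u]
  rw [squareMap_fibre k p ⟨(b, true, false), u⟩ (hp.trans (Prod.ext rfl (centred_true (h := u.mem_max) hu).symm)),
    (squareGem k).mk_mv 2 _ (show u.1 2 = 0 by simp [u])]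
  exact (squareMap_fibre k q ⟨(b, false, false), u⟩
    (hq.trans (Prod.ext rfl (centred_false (h := u.mem_max) hu).symm))).symm

theorem square_vertical (k : Bool) {t : unitInterval} {p q : Σ _ : Bool × Bool × Bool, Tri}
    (hp : squareMap p = (0, t)) (hq : squareMap q = (1, turn k t)) :
    (Quot.mk (squareGem k).rel p : Quot (squareGem k).rel) = Quot.mk (squareGem k).rel q := by
  obtain ⟨b, m, h, rfl⟩ := exists_centred t
  let u : Tri := Tri.mk m (1 - m) 0 h.1 (by linarith [h.2]) le_rfl (by ring)
  have hu : u.1 0 + u.1 1 = 1 := by simp [u]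
  rw [squareMap_fibre k p ⟨(true, b, true), u⟩ (hp.trans (Prod.ext (centred_true (h := u.mem_max) hu).symm rfl)),
    (squareGem k).mk_mv 2 _ (show u.1 2 = 0 by simp [u])]
  exact (squareMap_fibre k q ⟨(false, xor b k, true), u⟩
    (hq.trans (Prod.ext (centred_false (h := u.mem_max) hu).symm (centred_xor b k m h).symm))).symm

/-- What is glued in the surface is glued in the square. -/
theorem square_rel (k : Bool) {p q : Σ _ : Bool × Bool × Bool, Tri} (h : (squareGem k).rel p q) :
    squareMap p = squareMap q ∨
    (∃ t, squareMap p = (t, 0) ∧ squareMap q = (t, 1) ∨ squareMap q = (t, 0) ∧ squareMap p = (t, 1)) ∨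
    ∃ t, squareMap p = (0, t) ∧ squareMap q = (1, turn k t) ∨
      squareMap q = (0, t) ∧ squareMap p = (1, turn k t) := by
  obtain ⟨⟨b1, b2, b3⟩, t⟩ := p
  obtain ⟨i, hi, rfl⟩ := h
  simp only at hi
  have hs := Tri.sum_eq t
  fin_cases i
  · left
    have hi : t.1 0 = 0 := hi
    cases b3 <;> simp [squareMap, squareGem, centred, hi]
  · left
    have hi : t.1 1 = 0 := hi
    cases b3 <;> simp [squareMap, squareGem, hi]
  · right
    have hi : t.1 2 = 0 := hi
    have hu : t.1 0 + t.1 1 = 1 := by linarith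
    cases b3
    · left
      refine ⟨centred b1 _ t.mem_min, ?_⟩
      cases b2
      · exact Or.inr ⟨Prod.ext rfl (centred_true (h := t.mem_max) hu), Prod.ext rfl (centred_false (h := t.mem_max) hu)⟩
      · exact Or.inl ⟨Prod.ext rfl (centred_true (h := t.mem_max) hu), Prod.ext rfl (centred_false (h := t.mem_max) hu)⟩
    · right
      cases b1
      · refine ⟨centred (xor b2 k) _ t.mem_min, Or.inr ⟨Prod.ext (centred_true (h := t.mem_max) hu) rfl,
          Prod.ext (centred_false (h := t.mem_max) hu) ?_⟩⟩
        show centred b2 _ t.mem_min = _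
        rw [centred_xor, turn_turn]
      · exact ⟨centred b2 _ t.mem_min, Or.inl ⟨Prod.ext (centred_true (h := t.mem_max) hu) rfl,
          Prod.ext (centred_false (h := t.mem_max) hu) (centred_xor _ _ _ _)⟩⟩

theorem squareGem_homeomorph_kleinBottle :
    Nonempty ((squareGem true).Surface ≃ₜ ModelSurface.KleinBottle) := by
  have : CompactSpace Tri := isCompact_iff_compactSpace.1 (isCompact_stdSimplex ℝ (Fin 3))
  refine nonempty_homeomorph_quot (f := squareMap) (f' := id) (r' := ModelSurface.kleinRel)
    continuous_squareMap continuous_id squareMap_surjective (fun p => ⟨_, rfl⟩)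
    (squareMap_fibre true) (fun p q h => congrArg _ h) ?_ ?_
  · intro p' q' h
    obtain ⟨p, rfl⟩ := squareMap_surjective p'
    obtain ⟨q, rfl⟩ := squareMap_surjective q'
    refine ⟨p, q, rfl, rfl, ?_⟩
    rcases h with ⟨h1, h2, h3⟩ | ⟨h1, h2, h3⟩
    · exact square_horizontal true (Prod.ext rfl h1) (Prod.ext h3.symm h2)
    · exact square_vertical true (Prod.ext h1 rfl) (Prod.ext h2 h3)
  · intro p q h
    refine ⟨squareMap p, squareMap q, rfl, rfl, ?_⟩
    rcases square_rel true h with h | ⟨t, ⟨h1, h2⟩ | ⟨h1, h2⟩⟩ | ⟨t, ⟨h1, h2⟩ | ⟨h1, h2⟩⟩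
    · rw [h]
    · exact Quot.sound (Or.inl ⟨by rw [h1], by rw [h2], by rw [h1, h2]⟩)
    · exact (Quot.sound (r := ModelSurface.kleinRel)
        (Or.inl ⟨by rw [h1], by rw [h2], by rw [h1, h2]⟩)).symm
    · exact Quot.sound (Or.inr ⟨by rw [h1], by rw [h2], by rw [h1, h2]; rfl⟩)
    · exact (Quot.sound (r := ModelSurface.kleinRel)
        (Or.inr ⟨by rw [h1], by rw [h2], by rw [h1, h2]; rfl⟩)).symm

noncomputable def wind (t : unitInterval) : Circle := Circle.exp (2 * Real.pi * t)

theorem continuous_wind : Continuous wind :=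
  Circle.exp.continuous.comp (continuous_const.mul continuous_subtype_val)

theorem wind_zero : wind 0 = 1 := by simp [wind]

theorem wind_one : wind 1 = 1 := by simp [wind]

theorem wind_eq {s t : unitInterval} (h : wind s = wind t) :
    s = t ∨ (s = 0 ∧ t = 1) ∨ (s = 1 ∧ t = 0) := by
  obtain ⟨m, hm⟩ := Circle.exp_eq_exp.1 h
  have hpi := Real.pi_pos
  have hm' : (s : ℝ) = t + m := by
    have : 2 * Real.pi * (s : ℝ) = 2 * Real.pi * (t + m) := by rw [hm]; ring
    exact mul_left_cancel₀ (by positivity) this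
  have h0 := s.2.1
  have h1 := s.2.2
  have h2 := t.2.1
  have h3 := t.2.2
  have l1 : (-1 : ℝ) ≤ m := by linarith
  have l2 : (m : ℝ) ≤ 1 := by linarith
  have l1' : -1 ≤ m := by exact_mod_cast l1
  have l2' : m ≤ 1 := by exact_mod_cast l2
  obtain rfl | rfl | rfl : m = -1 ∨ m = 0 ∨ m = 1 := by omega
  · push_cast at hm'
    exact Or.inr (Or.inl ⟨Subtype.ext (show (s : ℝ) = 0 by linarith),
      Subtype.ext (show (t : ℝ) = 1 by linarith)⟩)
  · exact Or.inl (Subtype.ext (by simpa using hm'))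
  · push_cast at hm'
    exact Or.inr (Or.inr ⟨Subtype.ext (show (s : ℝ) = 1 by linarith),
      Subtype.ext (show (t : ℝ) = 0 by linarith)⟩)

theorem wind_surjective : Function.Surjective wind := by
  intro z
  obtain ⟨x, rfl⟩ := Circle.exp_surjective z
  have hpi := Real.pi_pos
  refine ⟨⟨Int.fract (x / (2 * Real.pi)), Int.fract_nonneg _, (Int.fract_lt_one _).le⟩, ?_⟩
  refine Circle.exp_eq_exp.2 ⟨-⌊x / (2 * Real.pi)⌋, ?_⟩
  simp only [Int.fract]
  push_cast
  field_simp
  ring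

theorem squareGem_homeomorph_torus :
    Nonempty ((squareGem false).Surface ≃ₜ ModelSurface.Torus) := by
  have : CompactSpace Tri := isCompact_iff_compactSpace.1 (isCompact_stdSimplex ℝ (Fin 3))
  let F : Square → Circle × Circle := Prod.map wind wind
  have hF : Continuous F := continuous_wind.prodMap continuous_wind
  have hsurj : ∀ z, ∃ p, F (squareMap p) = z := fun z => by
    obtain ⟨y, hy⟩ := (wind_surjective.prodMap wind_surjective) z
    obtain ⟨p, rfl⟩ := squareMap_surjective y
    exact ⟨p, hy⟩
  have key : Nonempty ((squareGem false).Surface ≃ₜ Quot (fun _ _ : Circle × Circle => False)) := by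
    refine nonempty_homeomorph_quot (f := F ∘ squareMap) (f' := id)
      (hF.comp continuous_squareMap) continuous_id hsurj (fun p => ⟨_, rfl⟩)
      ?_ (fun p q h => congrArg _ h) (fun _ _ h => h.elim) ?_
    · intro p q h
      have h1 := wind_eq (s := (squareMap p).1) (t := (squareMap q).1) (congrArg Prod.fst h)
      have h2 := wind_eq (s := (squareMap p).2) (t := (squareMap q).2) (congrArg Prod.snd h)
      -- The two coordinates are corrected one after the other, through a point that has one
      -- coordinate of each.
      obtain ⟨r, hr⟩ := squareMap_surjective ((squareMap p).1, (squareMap q).2)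
      have e1 : (Quot.mk (squareGem false).rel p : Quot (squareGem false).rel) =
          Quot.mk (squareGem false).rel r := by
        rcases h2 with h2 | ⟨h2, h3⟩ | ⟨h2, h3⟩
        · exact squareMap_fibre false p r (by rw [hr, ← h2])
        · exact square_horizontal false (Prod.ext rfl h2) (hr.trans (Prod.ext rfl h3))
        · exact (square_horizontal false (hr.trans (Prod.ext rfl h3)) (Prod.ext rfl h2)).symm
      refine e1.trans ?_
      rcases h1 with h1 | ⟨h1, h3⟩ | ⟨h1, h3⟩
      · exact squareMap_fibre false r q (by rw [hr, h1])
      · exact square_vertical false (hr.trans (Prod.ext h1 rfl)) (Prod.ext h3 rfl)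
      · exact (square_vertical false (Prod.ext h3 rfl) (hr.trans (Prod.ext h1 rfl))).symm
    · intro p q h
      refine ⟨_, _, rfl, rfl, congrArg _ ?_⟩
      have z := wind_zero.trans wind_one.symm
      rcases square_rel false h with h | ⟨t, ⟨h1, h2⟩ | ⟨h1, h2⟩⟩ | ⟨t, ⟨h1, h2⟩ | ⟨h1, h2⟩⟩ <;>
        simp [F, *, turn]
  obtain ⟨e⟩ := key
  refine ⟨e.trans ⟨⟨Quot.lift id fun _ _ h => h.elim, Quot.mk _, ?_, fun _ => rfl⟩, ?_, ?_⟩⟩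
  · rintro ⟨x⟩; rfl
  · exact continuous_quot_lift _ continuous_id
  · exact continuous_quot_mk

/-- The classification of the closed surfaces of nonnegative Euler characteristic. -/
theorem classification [Finite C] {G : Gem C} (hG : G.Connected) :
    G.chi2 ≤ 4 ∧
    (G.chi2 = 4 → G.Orientable ∧ Nonempty (G.Surface ≃ₜ ModelSurface.Sphere)) ∧
    (G.chi2 = 2 → Nonempty (G.Surface ≃ₜ ModelSurface.ProjectivePlane)) ∧
    (G.chi2 = 0 → (G.Orientable → Nonempty (G.Surface ≃ₜ ModelSurface.Torus)) ∧
      (¬ G.Orientable → Nonempty (G.Surface ≃ₜ ModelSurface.KleinBottle))) := by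
  obtain ⟨h, h4, h2, h0⟩ := classification_std hG
  refine ⟨h, fun e => ?_, fun e => ?_, fun e => ⟨fun o => ?_, fun o => ?_⟩⟩
  · obtain ⟨o, ⟨a⟩⟩ := h4 e
    -- The octahedron has the same invariants and hence reduces to the same two triangles; thus the
    -- latter are identified as a sphere. The squares serve likewise for the torus and the Klein
    -- bottle.
    obtain ⟨-, ⟨b⟩⟩ := (classification_std octahedron_connected).2.1 octahedron_chi2
    obtain ⟨c⟩ := octahedron_homeomorph
    exact ⟨o, ⟨a.trans (b.symm.trans c)⟩⟩
  · obtain ⟨a⟩ := h2 e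
    obtain ⟨c⟩ := fourGem_homeomorph
    exact ⟨a.trans c⟩
  · obtain ⟨a⟩ := (h0 e).1 o
    obtain ⟨b⟩ := ((classification_std (squareGem_connected false)).2.2.2 (squareGem_chi2 false)).1
      squareGem_orientable
    obtain ⟨c⟩ := squareGem_homeomorph_torus
    exact ⟨a.trans (b.symm.trans c)⟩
  · obtain ⟨a⟩ := (h0 e).2 o
    obtain ⟨b⟩ := ((classification_std (squareGem_connected true)).2.2.2 (squareGem_chi2 true)).2
      squareGem_not_orientable
    obtain ⟨c⟩ := squareGem_homeomorph_kleinBottle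
    exact ⟨a.trans (b.symm.trans c)⟩

end Gem

/-! ### Counting -/

section Counting

variable {C : Type u}

theorem ncard_eq_sum_fibre {B : Type*} [Finite C] [Fintype B] (f : C → B) (P : C → Prop) :
    Set.ncard {c | P c} = ∑ b, Set.ncard {c | f c = b ∧ P c} := by
  classical
  have := Fintype.ofFinite C
  simp only [Set.ncard_eq_toFinset_card', Set.toFinset_ofPred]
  rw [Finset.card_eq_sum_card_fiberwise (f := f) (t := Finset.univ) fun _ _ => by simp]
  simp only [Finset.filter_filter, and_comm]

/-- To derive something from an equality in a quotient it suffices to find an equivalence relation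
containing the generators; usually it is equality of an invariant. -/
theorem rel_of_quot_eq {r R : C → C → Prop} (hR : Equivalence R) (h : ∀ c d, r c d → R c d) {c d : C}
    (e : Quot.mk r c = Quot.mk r d) : R c d :=
  Quotient.exact (s := ⟨R, hR⟩) (congrArg (Quot.lift (fun c => (Quot.mk R c : Quotient ⟨R, hR⟩))
    fun c d hcd => Quot.sound (h c d hcd)) e)

theorem quot_involution_iff {i : C → C} (hi : ∀ c, i (i c) = c) {c d : C} :
    (Quot.mk (fun c d => d = i c) c = Quot.mk _ d) ↔ d = c ∨ d = i c := by
  constructor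
  · refine rel_of_quot_eq (R := fun c d => d = c ∨ d = i c) ⟨fun c => Or.inl rfl, ?_, ?_⟩
      fun c d h => Or.inr h
    · rintro x y (rfl | rfl) <;> simp [hi]
    · rintro x y z (rfl | rfl) (rfl | rfl) <;> simp [hi]
  · rintro (rfl | rfl)
    · rfl
    · exact Quot.sound rfl

/-- The orbits of a fixed-point-free involution are pairs, and the invariant set is a union of
orbits. This turns conditions on edge ends and strands into counts of corners. -/
theorem ncard_eq_two_mul_image [Finite C] {i : C → C} (hi : ∀ c, i (i c) = c) (hn : ∀ c, i c ≠ c)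
    {P : C → Prop} (hP : ∀ c, P (i c) ↔ P c) :
    Set.ncard {c | P c} =
      2 * Set.ncard {q : Quot (fun c d : C => d = i c) | ∃ c, Quot.mk _ c = q ∧ P c} := by
  classical
  have := Fintype.ofFinite (Quot (fun c d : C => d = i c))
  rw [ncard_eq_sum_fibre (fun c => Quot.mk (fun c d : C => d = i c) c) P,
    Set.ncard_eq_toFinset_card', Set.toFinset_ofPred, Finset.card_filter, Finset.mul_sum]
  refine Finset.sum_congr rfl fun q _ => ?_
  obtain ⟨c, rfl⟩ := Quot.exists_rep q
  have key : ∀ d, Quot.mk (fun c d : C => d = i c) d = Quot.mk _ c ↔ d = c ∨ d = i c := fun d => by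
    rw [eq_comm, quot_involution_iff hi]
  have hPd : ∀ d, d = c ∨ d = i c → (P d ↔ P c) := by
    rintro d (rfl | rfl)
    exacts [Iff.rfl, hP _]
  by_cases h : P c
  · rw [if_pos ⟨c, rfl, h⟩]
    have : {d | Quot.mk (fun c d : C => d = i c) d = Quot.mk _ c ∧ P d} = {c, i c} := by
      ext d
      simp only [Set.mem_ofPred_eq, key, Set.mem_insert_iff, Set.mem_singleton_iff]
      exact ⟨fun hd => hd.1, fun hd => ⟨hd, (hPd d hd).2 h⟩⟩
    rw [this, Set.ncard_pair (hn c).symm, mul_one]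
  · rw [if_neg, mul_zero, Set.ncard_eq_zero]
    · ext d
      simp only [Set.mem_ofPred_eq, key, Set.mem_empty_iff_false, iff_false, not_and]
      exact fun hd hp => h ((hPd d hd).1 hp)
    · rintro ⟨d, hd, hp⟩
      exact h ((hPd d ((key d).1 hd)).1 hp)

end Counting

/-! ### The surface of a ribbon graph -/

namespace RibbonGraph

variable {C : Type u} (G : RibbonGraph C)

@[simp] theorem vertex_arc (c : C) : G.vertex (G.arc c) = G.vertex c :=
  (Quot.sound (Or.inl rfl) : G.vertex c = G.vertex (G.arc c)).symm

@[simp] theorem vertex_cross (c : C) : G.vertex (G.cross c) = G.vertex c :=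
  (Quot.sound (Or.inr rfl) : G.vertex c = G.vertex (G.cross c)).symm

@[simp] theorem edge_strand (c : C) : G.edge (G.strand c) = G.edge c :=
  (Quot.sound (Or.inl rfl) : G.edge c = G.edge (G.strand c)).symm

@[simp] theorem edge_cross (c : C) : G.edge (G.cross c) = G.edge c :=
  (Quot.sound (Or.inr rfl) : G.edge c = G.edge (G.cross c)).symm

@[simp] theorem face_strand (c : C) : G.face (G.strand c) = G.face c :=
  (Quot.sound (Or.inl rfl) : G.face c = G.face (G.strand c)).symm

@[simp] theorem face_arc (c : C) : G.face (G.arc c) = G.face c :=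
  (Quot.sound (Or.inr rfl) : G.face c = G.face (G.arc c)).symm

/-- The gluing of the triangles of the barycentric subdivision. -/
def toGem : Gem C where
  mv := G.move
  mv_mv i c := by
    fin_cases i
    exacts [G.strand_strand c, G.arc_arc c, G.cross_cross c]
  mv_ne i c := by
    fin_cases i
    exacts [G.strand_ne c, G.arc_ne c, G.cross_ne c]

theorem toGem_connected (h : G.Connected) : G.toGem.Connected := by
  obtain ⟨h1, ⟨h2⟩⟩ := h
  refine ⟨h1, ⟨?_⟩⟩
  rintro ⟨c⟩ ⟨d⟩
  refine congrArg (Quot.map id ?_) (h2 (Quot.mk _ c) (Quot.mk _ d))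
  rintro c d (h | h | h)
  exacts [⟨0, h⟩, ⟨1, h⟩, ⟨2, h⟩]

theorem toGem_orientable : G.toGem.Orientable ↔ G.Orientable := by
  refine exists_congr fun σ => ⟨fun h c => ⟨h 0 c, h 1 c, h 2 c⟩, fun h i c => ?_⟩
  fin_cases i
  exacts [(h c).1, (h c).2.1, (h c).2.2]

theorem card_vertex : Nat.card (G.toGem.Comp 0) = Nat.card G.Vertex := by
  refine Nat.card_congr (Quot.congrRight fun c d => ⟨?_, ?_⟩)
  · rintro ⟨a, ha, h⟩
    fin_cases a
    exacts [(ha rfl).elim, Or.inl h, Or.inr h]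
  · rintro (h | h)
    exacts [⟨1, by decide, h⟩, ⟨2, by decide, h⟩]

theorem card_edge : Nat.card (G.toGem.Comp 1) = Nat.card G.Edge := by
  refine Nat.card_congr (Quot.congrRight fun c d => ⟨?_, ?_⟩)
  · rintro ⟨a, ha, h⟩
    fin_cases a
    exacts [Or.inl h, (ha rfl).elim, Or.inr h]
  · rintro (h | h)
    exacts [⟨0, by decide, h⟩, ⟨2, by decide, h⟩]

theorem card_face : Nat.card (G.toGem.Comp 2) = Nat.card G.Face := by
  refine Nat.card_congr (Quot.congrRight fun c d => ⟨?_, ?_⟩)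
  · rintro ⟨a, ha, h⟩
    fin_cases a
    exacts [Or.inl h, Or.inr h, (ha rfl).elim]
  · rintro (h | h)
    exacts [⟨0, by decide, h⟩, ⟨1, by decide, h⟩]

theorem edge_eq_iff {c d : C} :
    G.edge c = G.edge d ↔ d = c ∨ d = G.strand c ∨ d = G.cross c ∨ d = G.strand (G.cross c) := by
  have hs := G.strand_strand
  have hx := G.cross_cross
  have hsx := G.strand_cross
  constructor
  · refine rel_of_quot_eq (R := fun c d => d = c ∨ d = G.strand c ∨ d = G.cross c ∨
      d = G.strand (G.cross c)) ⟨fun c => Or.inl rfl, ?_, ?_⟩ ?_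
    · rintro x y (rfl | rfl | rfl | rfl) <;> simp [hs, hx, hsx]
    · rintro x y z (rfl | rfl | rfl | rfl) (rfl | rfl | rfl | rfl) <;> simp [hs, hx, hsx]
    · rintro x y (h | h) <;> simp [h]
  · rintro (rfl | rfl | rfl | rfl) <;> simp

theorem card_eq_four_mul_edge [Finite C] : Nat.card C = 4 * Nat.card G.Edge := by
  classical
  have : Finite G.Edge := inferInstanceAs (Finite (Quot _))
  have := Fintype.ofFinite G.Edge
  have h := ncard_eq_sum_fibre G.edge (fun _ => True)
  have h4 : ∀ e : G.Edge, Set.ncard {c | G.edge c = e ∧ True} = 4 := by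
    rintro ⟨c⟩
    have : {d | G.edge d = Quot.mk _ c ∧ True} =
        ({c, G.strand c, G.cross c, G.strand (G.cross c)} : Set C) := by
      ext d
      simp only [and_true, Set.mem_ofPred_eq, Set.mem_insert_iff, Set.mem_singleton_iff]
      exact eq_comm.trans G.edge_eq_iff
    have h1 := G.strand_ne c
    have h2 := G.cross_ne c
    have h3 := G.strand_cross_ne c
    have h4 : G.strand c ≠ G.cross c := fun h => h3 (by rw [← h, G.strand_strand])
    have h5 := G.strand_ne (G.cross c)
    have h6 : G.strand c ≠ G.strand (G.cross c) := fun h =>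
      h2 (by rw [← G.strand_strand (G.cross c), ← h, G.strand_strand])
    rw [this, Set.ncard_insert_of_notMem, Set.ncard_insert_of_notMem, Set.ncard_pair h5.symm]
    · simp [h4, h6]
    · simp [h1.symm, h2.symm, h3.symm]
  simp only [h4, Finset.sum_const, Finset.card_univ, Set.ofPred_true, Set.ncard_univ] at h
  rw [h, Nat.card_eq_fintype_card, smul_eq_mul, mul_comm]

/-- The vertices of the three colours are the discs, rectangles and faces, and there are `4E`
triangles. -/
theorem toGem_chi2 [Finite C] : G.toGem.chi2 = 2 * G.eulerChar := by
  unfold Gem.chi2 eulerChar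
  rw [Fin.sum_univ_three, card_vertex, card_edge, card_face, card_eq_four_mul_edge G]
  push_cast
  ring

/-- The classification of the surfaces of ribbon graphs of nonnegative Euler characteristic. -/
theorem classification [Finite C] (hG : G.Connected) :
    G.eulerChar ≤ 2 ∧
    (G.eulerChar = 2 → G.Orientable ∧ Nonempty (G.Surface ≃ₜ ModelSurface.Sphere)) ∧
    (G.eulerChar = 1 → Nonempty (G.Surface ≃ₜ ModelSurface.ProjectivePlane)) ∧
    (G.eulerChar = 0 → (G.Orientable → Nonempty (G.Surface ≃ₜ ModelSurface.Torus)) ∧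
      (¬ G.Orientable → Nonempty (G.Surface ≃ₜ ModelSurface.KleinBottle))) := by
  obtain ⟨h, h4, h2, h0⟩ := Gem.classification (G.toGem_connected hG)
  rw [toGem_chi2] at h h4 h2 h0
  rw [toGem_orientable] at h4 h0
  exact ⟨by omega, fun e => h4 (by omega), fun e => h2 (by omega), fun e => h0 (by omega)⟩

end RibbonGraph

/-! ### The Euler characteristic counts the singular faces -/

namespace ColoredRibbonGraph

variable {C : Type u} {G : ColoredRibbonGraph C}

theorem IsCDT.ncard_timelike [Finite C] (hG : G.IsCDT) (v : G.Vertex) :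
    Set.ncard {c | G.vertex c = v ∧ G.timelike c} = 2 := by
  have h := hG.vertex_timelike v
  rw [ncard_eq_two_mul_image G.cross_cross G.cross_ne
    (P := fun c => G.vertex c = v ∧ G.timelike c)]
  · exact congrArg (2 * ·) h
  · intro c
    rw [G.timelike_cross, G.vertex_cross]

theorem IsCDT.ncard_spacelike [Finite C] (hG : G.IsCDT) (v : G.Vertex) :
    Set.ncard {c | G.vertex c = v ∧ ¬ G.timelike c} = 4 := by
  have h := hG.vertex_spacelike v
  rw [ncard_eq_two_mul_image G.cross_cross G.cross_ne
    (P := fun c => G.vertex c = v ∧ ¬ G.timelike c)]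
  · exact congrArg (2 * ·) h
  · intro c
    rw [G.timelike_cross, G.vertex_cross]

theorem ncard_face_timelike [Finite C] (f : G.Face) :
    Set.ncard {c | G.face c = f ∧ G.timelike c} = 2 * G.numTimelike f := by
  rw [ncard_eq_two_mul_image G.strand_strand G.strand_ne
    (P := fun c => G.face c = f ∧ G.timelike c)]
  · rfl
  · intro c
    rw [G.timelike_strand, G.face_strand]

theorem numTimelike_eq_zero_iff [Finite C] (f : G.Face) :
    G.numTimelike f = 0 ↔ ∀ c, G.face c = f → ¬ G.timelike c := by
  have h := ncard_face_timelike f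
  have : G.numTimelike f = 0 ↔ Set.ncard {c | G.face c = f ∧ G.timelike c} = 0 := by omega
  rw [this, Set.ncard_eq_zero, Set.eq_empty_iff_forall_notMem]
  simp

theorem IsCDT.eulerChar_eq [Finite C] (hG : G.IsCDT) : G.eulerChar = G.numSingularFaces := by
  classical
  have : Finite G.Vertex := inferInstanceAs (Finite (Quot _))
  have : Finite G.Face := inferInstanceAs (Finite (Quot _))
  have := Fintype.ofFinite G.Vertex
  have := Fintype.ofFinite G.Face
  have e1 := ncard_eq_sum_fibre G.vertex G.timelike
  have e2 := ncard_eq_sum_fibre G.vertex (fun c => ¬ G.timelike c)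
  have e3 := ncard_eq_sum_fibre G.face G.timelike
  simp only [hG.ncard_timelike, hG.ncard_spacelike, Finset.sum_const, Finset.card_univ,
    smul_eq_mul] at e1 e2
  have e4 : Set.ncard {c | G.timelike c} + Set.ncard {c | ¬ G.timelike c} = Nat.card C :=
    Set.ncard_add_ncard_compl {c | G.timelike c}
  have e5 := G.card_eq_four_mul_edge
  -- A face with two timelike strands has four timelike corners.
  have e6 : ∀ f : G.Face, Set.ncard {c | G.face c = f ∧ G.timelike c} =
      if ∀ c, G.face c = f → ¬ G.timelike c then 0 else 4 := by
    intro f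
    rw [ncard_face_timelike, ← numTimelike_eq_zero_iff]
    rcases hG.face_timelike f with h | h <;> simp [h]
  have e7 : G.numSingularFaces + (Finset.univ.filter fun f : G.Face =>
      ¬ ∀ c, G.face c = f → ¬ G.timelike c).card = Fintype.card G.Face := by
    rw [numSingularFaces, Nat.card_eq_fintype_card, Fintype.card_subtype,
      Finset.card_filter_add_card_filter_not, Finset.card_univ]
  simp only [e6] at e3
  rw [Finset.sum_ite, Finset.sum_const_zero, Finset.sum_const, zero_add, smul_eq_mul] at e3
  unfold RibbonGraph.eulerChar
  rw [Nat.card_eq_fintype_card (α := G.Vertex), Nat.card_eq_fintype_card (α := G.Face)]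
  omega

end ColoredRibbonGraph

/-! ### Symmetries and ends of chains of two alternating involutions -/

section Involutions

variable {C : Type u}

/-- An orientation-reversing symmetry of alternating cycles that never agrees with an edge does not
preserve any of the cycles. -/
theorem quot_ne_of_alternating {α β θ : C → C} (hα : ∀ c, α (α c) = c) (hβ : ∀ c, β (β c) = c)
    (hθ : ∀ c, θ (θ c) = c) (hθα : ∀ c, θ (α c) = α (θ c)) (hθβ : ∀ c, θ (β c) = β (θ c))
    (h1 : ∀ c, θ c ≠ α c) (h2 : ∀ c, θ c ≠ β c) {σ : C → Bool} (hσα : ∀ c, σ (α c) ≠ σ c)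
    (hσβ : ∀ c, σ (β c) ≠ σ c) (hσθ : ∀ c, σ (θ c) ≠ σ c) (c : C) :
    Quot.mk (fun c d => d = α c ∨ d = β c) c ≠ Quot.mk _ (θ c) := by
  intro h
  let A := Function.Involutive.toPerm α hα
  let B := Function.Involutive.toPerm β hβ
  let T := Function.Involutive.toPerm θ hθ
  have hA : A * A = 1 := Equiv.ext hα
  have hB : B * B = 1 := Equiv.ext hβ
  have even : ∀ (m : ℤ) (c : C), σ (((A * B) ^ m) c) = σ c := by
    have step : ∀ c, σ ((A * B) c) = σ c := fun c => by
      have e1 := hσα (β c)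
      have e2 := hσβ c
      show σ (α (β c)) = σ c
      revert e1 e2
      cases σ (α (β c)) <;> cases σ (β c) <;> cases σ c <;> simp
    intro m
    induction m using Int.induction_on with
    | zero => exact fun c => rfl
    | succ i ih =>
      intro c
      rw [zpow_add_one, Equiv.Perm.mul_apply, ih, step]
    | pred i ih =>
      intro c
      rw [zpow_sub_one, Equiv.Perm.mul_apply, ih, ← step ((A * B)⁻¹ c), ← Equiv.Perm.mul_apply, mul_inv_cancel,
        Equiv.Perm.one_apply]
  -- As a rotation `θ` would preserve the sign of `c`; as a reflection it would agree with `α` or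
  -- `β` somewhere.
  obtain ⟨m, hm | hm⟩ := dihedral_orbit A B hA hB h
  · exact hσθ c (by rw [hm, even])
  · exact ne_reflection A B T hA hB (Equiv.ext hθα) (Equiv.ext hθβ) h1 h2 m c hm

theorem exists_period (γ : Equiv.Perm C) (c : C) :
    ∃ p : ℕ, ∀ k : ℤ, (γ ^ k) c = c ↔ (p : ℤ) ∣ k :=
  ⟨_, fun k => MulAction.zpow_smul_eq_iff_minimalPeriod_dvd (a := γ) (b := c) (n := k)⟩

/-- A path has at most two ends. -/
theorem eq_of_fixed_of_fixed {α β : C → C} (hα : ∀ c, α (α c) = c) (hβ : ∀ c, β (β c) = c)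
    {u v w : C} (hu : β u = u) (hv : β v = v) (hw : β w = w)
    (huv : Quot.mk (fun c d => d = α c ∨ d = β c) u = Quot.mk _ v)
    (huw : Quot.mk (fun c d => d = α c ∨ d = β c) u = Quot.mk _ w) (hne : v ≠ u) (hne' : w ≠ u) :
    v = w := by
  let A := Function.Involutive.toPerm α hα
  let B := Function.Involutive.toPerm β hβ
  have hA : A * A = 1 := Equiv.ext hα
  have hB : B * B = 1 := Equiv.ext hβ
  -- Reflection at the end `u` inverts the rotations. An end `γ ^ m u` is fixed by `β`, so it equals
  -- `γ ^ (-m) u`, and `2 * m` is a multiple of the period.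
  have key : ∀ v, β v = v → Quot.mk (fun c d => d = α c ∨ d = β c) u = Quot.mk _ v →
      ∃ m : ℤ, v = ((A * B) ^ m) u ∧ ((A * B) ^ (2 * m)) u = u := by
    intro v hv h
    have hB' : ∀ m : ℤ, B (((A * B) ^ m) u) = ((A * B) ^ (-m)) u := by
      intro m
      have e := involution_conj_zpow A B hA hB (m + 1)
      have e2 : B * (A * B) ^ m = A * (A * B) ^ (m + 1) := by
        rw [add_comm, zpow_add, zpow_one, ← mul_assoc, ← mul_assoc, hA, one_mul]
      have e3 : (A * B) ^ (-(m + 1)) * A = (A * B) ^ (-m) * B := by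
        rw [neg_add, zpow_add, zpow_neg_one, mul_inv_rev, mul_assoc, mul_assoc,
          inv_mul_cancel, mul_one, inv_eq_of_mul_eq_one_left hB]
      rw [← Equiv.Perm.mul_apply, e2, e, e3, Equiv.Perm.mul_apply]
      exact congrArg _ hu
    have fin : ∀ m : ℤ, v = ((A * B) ^ m) u → ((A * B) ^ (2 * m)) u = u := by
      rintro m rfl
      have := hB' m
      rw [two_mul, zpow_add, Equiv.Perm.mul_apply, ← show B (((A * B) ^ m) u) = _ from hv, this,
        ← Equiv.Perm.mul_apply, ← zpow_add, add_neg_cancel, zpow_zero, Equiv.Perm.one_apply]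
    obtain ⟨m, hm | hm⟩ := dihedral_orbit A B hA hB h
    · exact ⟨m, hm, fin m hm⟩
    · have hm' : v = ((A * B) ^ (1 - m)) u := by
        rw [hm, involution_conj_zpow A B hA hB, sub_eq_add_neg, add_comm, zpow_add, zpow_one,
          Equiv.Perm.mul_apply, Equiv.Perm.mul_apply, Equiv.Perm.mul_apply]
        rw [show B u = u from hu]
      exact ⟨1 - m, hm', fin _ hm'⟩
  obtain ⟨m, rfl, hm⟩ := key v hv huv
  obtain ⟨l, rfl, hl⟩ := key w hw huw
  obtain ⟨p, hH⟩ := exists_period (A * B) u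
  rw [hH] at hm hl
  have hm' : ¬ (p : ℤ) ∣ m := fun h => hne ((hH m).2 h)
  have hl' : ¬ (p : ℤ) ∣ l := fun h => hne' ((hH l).2 h)
  -- Both `m` and `l` are half periods but not full periods, so each is an odd multiple of half the
  -- period and they differ by a multiple of it.
  have hml : (p : ℤ) ∣ l - m := by
    obtain ⟨k, hk⟩ := hm
    obtain ⟨j, hj⟩ := hl
    obtain ⟨k', rfl | rfl⟩ := Int.even_or_odd' k
    · exact absurd ⟨k', by linarith⟩ hm'
    obtain ⟨j', rfl | rfl⟩ := Int.even_or_odd' j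
    · exact absurd ⟨j', by linarith⟩ hl'
    exact ⟨j' - k', by linarith⟩
  have e := (hH _).2 hml
  rw [sub_eq_neg_add, zpow_add, zpow_neg, Equiv.Perm.mul_apply, Equiv.Perm.inv_eq_iff_eq] at e
  exact e.symm

end Involutions

namespace ColoredRibbonGraph

variable {C : Type u} {G : ColoredRibbonGraph C}

/-! ### Vertices -/

theorem vertex_subset {A : Set C} (h1 : ∀ c ∈ A, G.arc c ∈ A) (h2 : ∀ c ∈ A, G.cross c ∈ A)
    {c d : C} (hc : c ∈ A) (h : G.vertex d = G.vertex c) : d ∈ A := by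
  refine (rel_of_quot_eq (R := fun c d => c ∈ A ↔ d ∈ A)
    ⟨fun _ => Iff.rfl, fun h => h.symm, fun h h' => h.trans h'⟩ ?_ h).2 hc
  rintro c d (rfl | rfl)
  · exact ⟨h1 c, fun h => G.arc_arc c ▸ h1 _ h⟩
  · exact ⟨h2 c, fun h => G.cross_cross c ▸ h2 _ h⟩

namespace IsCDT

variable [Finite C] {c d : C}

theorem eq_or_eq_cross (hG : G.IsCDT) (hc : G.timelike c) (hd : G.timelike d) (h : G.vertex d = G.vertex c) :
    d = c ∨ d = G.cross c := by
  have e : ({c, G.cross c} : Set C) = {d | G.vertex d = G.vertex c ∧ G.timelike d} := by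
    refine Set.eq_of_subset_of_ncard_le ?_ ?_ (Set.toFinite _)
    · rintro _ (rfl | rfl)
      · exact ⟨rfl, hc⟩
      · exact ⟨G.vertex_cross c, (G.timelike_cross c).2 hc⟩
    · rw [hG.ncard_timelike, Set.ncard_pair (G.cross_ne c).symm]
  have : d ∈ ({c, G.cross c} : Set C) := e ▸ ⟨h, hd⟩
  exact this

/-- Otherwise `c` and `cross c` would be closed under arcs and crossings and make up the whole disc,
without spacelike ends. -/
theorem not_timelike_arc (hG : G.IsCDT) (hc : G.timelike c) : ¬ G.timelike (G.arc c) := by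
  intro h
  have hac : G.arc c = G.cross c :=
    (hG.eq_or_eq_cross hc h (G.vertex_arc c)).resolve_left (G.arc_ne c)
  have e : {d | G.vertex d = G.vertex c ∧ ¬ G.timelike d} = ∅ := by
    refine Set.eq_empty_of_forall_notMem fun d hd => ?_
    have : d ∈ ({c, G.cross c} : Set C) := by
      refine vertex_subset ?_ ?_ (Or.inl rfl) hd.1
      · rintro _ (rfl | rfl)
        · exact Or.inr hac
        · exact Or.inl (by rw [← hac, G.arc_arc])
      · rintro _ (rfl | rfl)
        · exact Or.inr rfl
        · exact Or.inl (G.cross_cross c)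
    rcases this with rfl | rfl
    · exact hd.2 hc
    · exact hd.2 ((G.timelike_cross c).2 hc)
  have := hG.ncard_spacelike (G.vertex c)
  rw [e, Set.ncard_empty] at this
  omega

/-- Otherwise the disc would close up after four corners, only two of them spacelike. -/
theorem cross_arc_ne (hG : G.IsCDT) (hc : G.timelike c) : G.cross (G.arc c) ≠ G.arc (G.cross c) := by
  intro h
  have hs : {d | G.vertex d = G.vertex c ∧ ¬ G.timelike d} ⊆ {G.arc c, G.cross (G.arc c)} := by
    intro d hd
    have : d ∈ ({c, G.cross c, G.arc c, G.cross (G.arc c)} : Set C) := by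
      refine vertex_subset ?_ ?_ (Or.inl rfl) hd.1
      · rintro _ (rfl | rfl | rfl | rfl)
        · simp
        · simp [h]
        · simp [G.arc_arc]
        · simp [h, G.arc_arc]
      · rintro _ (rfl | rfl | rfl | rfl) <;> simp [G.cross_cross]
    rcases this with rfl | rfl | h | h
    · exact absurd hc hd.2
    · exact absurd ((G.timelike_cross c).2 hc) hd.2
    · exact Or.inl h
    · exact Or.inr h
  have h1 := Set.ncard_le_ncard hs (Set.toFinite _)
  rw [hG.ncard_spacelike, Set.ncard_pair (G.cross_ne _).symm] at h1
  omega

/-- The spacelike corners of a vertex. -/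
theorem eq_of_vertex_eq (hG : G.IsCDT) (hc : G.timelike c) (hd : ¬ G.timelike d) (h : G.vertex d = G.vertex c) :
    d = G.arc c ∨ d = G.cross (G.arc c) ∨ d = G.arc (G.cross c) ∨ d = G.cross (G.arc (G.cross c)) := by
  have hxc := (G.timelike_cross c).2 hc
  have n1 := hG.not_timelike_arc hc
  have n2 := hG.not_timelike_arc hxc
  have hinj : Function.Injective G.arc := Function.Involutive.injective G.arc_arc
  have hinj' : Function.Injective G.cross := Function.Involutive.injective G.cross_cross
  have h1 := hG.cross_arc_ne hc
  have h2 : G.arc c ≠ G.arc (G.cross c) := fun h => G.cross_ne c (hinj h).symm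
  have e : ({G.arc c, G.cross (G.arc c), G.arc (G.cross c), G.cross (G.arc (G.cross c))} : Set C) =
      {d | G.vertex d = G.vertex c ∧ ¬ G.timelike d} := by
    refine Set.eq_of_subset_of_ncard_le ?_ ?_ (Set.toFinite _)
    · rintro _ (rfl | rfl | rfl | rfl)
      · exact ⟨by simp, n1⟩
      · exact ⟨by simp, by rwa [G.timelike_cross]⟩
      · exact ⟨by simp, n2⟩
      · exact ⟨by simp, by rwa [G.timelike_cross]⟩
    · rw [hG.ncard_spacelike, Set.ncard_insert_of_notMem, Set.ncard_insert_of_notMem,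
        Set.ncard_pair (G.cross_ne _).symm]
      · simp only [Set.mem_insert_iff, Set.mem_singleton_iff, not_or]
        exact ⟨h1, fun h => h2 (hinj' h)⟩
      · simp only [Set.mem_insert_iff, Set.mem_singleton_iff, not_or]
        exact ⟨(G.cross_ne _).symm, h2, fun h => h1 (by rw [h, G.cross_cross])⟩
  have : d ∈ ({G.arc c, G.cross (G.arc c), G.arc (G.cross c), G.cross (G.arc (G.cross c))} : Set C) :=
    e ▸ ⟨h, hd⟩
  exact this

/-- The last arc that closes the hexagon of six corners: all other possible values are already
taken. -/
theorem arc_cross_arc (hG : G.IsCDT) (hc : G.timelike c) :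
    G.arc (G.cross (G.arc c)) = G.cross (G.arc (G.cross c)) := by
  have hinj : Function.Injective G.arc := Function.Involutive.injective G.arc_arc
  have hxc := (G.timelike_cross c).2 hc
  have n1 := hG.not_timelike_arc hc
  have hs : ¬ G.timelike (G.arc (G.cross (G.arc c))) := by
    intro h
    rcases hG.eq_or_eq_cross hc h (by simp) with e | e
    · exact G.cross_ne _ (hinj (e.trans (G.arc_arc c).symm))
    · exact hG.cross_arc_ne hc (hinj (e.trans (G.arc_arc _).symm))
  rcases hG.eq_of_vertex_eq hc hs (by simp) with e | e | e | e
  · refine absurd hc (fun h => n1 ?_)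
    rw [← G.timelike_cross, hinj e]
    exact hc
  · exact absurd e (G.arc_ne _)
  · have := hinj e
    exact absurd hxc (this ▸ fun h => n1 ((G.timelike_cross _).1 h))
  · exact e

theorem exists_timelike (hG : G.IsCDT) (c : C) : ∃ d, G.timelike d ∧ G.vertex c = G.vertex d := by
  have h := hG.ncard_timelike (G.vertex c)
  obtain ⟨d, hd⟩ : {d | G.vertex d = G.vertex c ∧ G.timelike d}.Nonempty := by
    rw [← Set.ncard_pos (Set.toFinite _)]; omega
  exact ⟨d, hd.2, hd.1.symm⟩

/-- A vertex seen from a corner. -/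
theorem corner_cases (hG : G.IsCDT) (c : C) : G.timelike c ∨ (∃ t, G.timelike t ∧ c = G.arc t) ∨
    ∃ t, G.timelike t ∧ c = G.cross (G.arc t) := by
  by_cases hc : G.timelike c
  · exact Or.inl hc
  · obtain ⟨t, ht, h⟩ := hG.exists_timelike c
    have ht' := (G.timelike_cross t).2 ht
    rcases hG.eq_of_vertex_eq ht hc h with h | h | h | h
    exacts [Or.inr (Or.inl ⟨t, ht, h⟩), Or.inr (Or.inr ⟨t, ht, h⟩), Or.inr (Or.inl ⟨_, ht', h⟩),
      Or.inr (Or.inr ⟨_, ht', h⟩)]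

end IsCDT

end ColoredRibbonGraph

namespace ColoredRibbonGraph

variable {C : Type u} {G : ColoredRibbonGraph C} {c d : C}

theorem boundary_arc (c : C) : G.boundary (G.arc c) = G.boundary c :=
  (Quot.sound (Or.inr (Or.inl rfl)) : G.boundary c = G.boundary (G.arc c)).symm

theorem boundary_strand (h : ¬ G.timelike c) : G.boundary (G.strand c) = G.boundary c :=
  (Quot.sound (Or.inl ⟨h, rfl⟩) : G.boundary c = G.boundary (G.strand c)).symm

theorem boundary_cross (h : G.timelike c) : G.boundary (G.cross c) = G.boundary c :=
  (Quot.sound (Or.inr (Or.inr ⟨h, rfl⟩)) : G.boundary c = G.boundary (G.cross c)).symm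

theorem slice_cross (c : C) : G.slice (G.cross c) = G.slice c :=
  (Quot.sound (Or.inr (Or.inr rfl)) : G.slice c = G.slice (G.cross c)).symm

theorem strip_strand (c : C) : G.strip (G.strand c) = G.strip c :=
  (Quot.sound (Or.inl rfl) : G.strip c = G.strip (G.strand c)).symm

theorem strip_arc (c : C) : G.strip (G.arc c) = G.strip c :=
  (Quot.sound (Or.inr (Or.inl rfl)) : G.strip c = G.strip (G.arc c)).symm

theorem sliceOf_boundary (c : C) : G.sliceOf (G.boundary c) = G.slice c := rfl

theorem stripOf_boundary (c : C) : G.stripOf (G.boundary c) = G.strip c := rfl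

theorem exists_boundary_eq (β : G.Boundary) : ∃ c, G.boundary c = β := Quot.exists_rep β

/-! ### The other side of a slice -/

namespace IsCDT

open Classical in
/-- The next corner along a boundary of a strip. -/
noncomputable def turn (_ : G.IsCDT) (c : C) : C :=
  -- The value at timelike corners is immaterial for boundaries; it makes `turn` an involution on
  -- all corners that commutes with `cross` and never agrees with it.
  if G.timelike c then G.strand c
  else if G.timelike (G.arc c) then G.arc (G.cross (G.arc c)) else G.arc c

theorem turn_timelike (hG : G.IsCDT) (h : G.timelike c) : hG.turn c = G.strand c := if_pos h

theorem turn_spacelike (hG : G.IsCDT) (h : ¬ G.timelike c) (h' : ¬ G.timelike (G.arc c)) :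
    hG.turn c = G.arc c := by rw [turn, if_neg h, if_neg h']

theorem flips_turn (hG : G.IsCDT) {σ : C → Bool}
    (hσ : ∀ c, σ (G.strand c) ≠ σ c ∧ σ (G.arc c) ≠ σ c ∧ σ (G.cross c) ≠ σ c) (c : C) :
    σ (hG.turn c) ≠ σ c := by
  unfold turn
  split_ifs with h h'
  · exact (hσ c).1
  · have h1 := (hσ c).2.1
    have h2 := (hσ (G.arc c)).2.2
    have h3 := (hσ (G.cross (G.arc c))).2.1
    revert h1 h2 h3
    cases σ (G.arc (G.cross (G.arc c))) <;> cases σ (G.cross (G.arc c)) <;> cases σ (G.arc c) <;>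
      cases σ c <;> simp
  · exact (hσ c).2.1

variable [Finite C]

open Classical in
/-- The boundary on the other side of a slice. -/
noncomputable def acrossSlice (hG : G.IsCDT) : G.Boundary → G.Boundary :=
  -- From a timelike corner the other side is reached by stepping first to the spacelike corner next
  -- to it, which lies on the same boundary.
  Quot.lift (fun c => if G.timelike c then G.boundary (G.cross (G.arc c)) else G.boundary (G.cross c)) (by
    have step : ∀ c, G.timelike c → ¬ G.timelike (G.arc c) := fun c => hG.not_timelike_arc
    rintro c d (⟨hc, rfl⟩ | rfl | ⟨hc, rfl⟩)
    · rw [if_neg hc, if_neg (by rwa [G.timelike_strand]), ← G.strand_cross,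
        boundary_strand (by rwa [G.timelike_cross])]
    · rcases hG.corner_cases c with hc | ⟨t, ht, rfl⟩ | ⟨t, ht, rfl⟩
      · rw [if_pos hc, if_neg (step c hc)]
      · rw [G.arc_arc, if_pos ht, if_neg (step t ht)]
      · have hx := (G.timelike_cross t).2 ht
        rw [hG.arc_cross_arc ht, G.timelike_cross, G.timelike_cross, if_neg (step t ht),
          if_neg (step _ hx), G.cross_cross, G.cross_cross, boundary_arc, boundary_arc,
          boundary_cross ht]
    · have hx := (G.timelike_cross c).2 hc
      rw [if_pos hc, if_pos hx, ← hG.arc_cross_arc hc, boundary_arc])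

theorem acrossSlice_boundary (hG : G.IsCDT) (h : ¬ G.timelike c) :
    hG.acrossSlice (G.boundary c) = G.boundary (G.cross c) := if_neg h

theorem exists_spacelike (hG : G.IsCDT) (β : G.Boundary) : ∃ c, ¬ G.timelike c ∧ G.boundary c = β := by
  obtain ⟨c, rfl⟩ := exists_boundary_eq β
  by_cases h : G.timelike c
  · exact ⟨G.arc c, hG.not_timelike_arc h, boundary_arc c⟩
  · exact ⟨c, h, rfl⟩

theorem acrossSlice_acrossSlice (hG : G.IsCDT) (β : G.Boundary) :
    hG.acrossSlice (hG.acrossSlice β) = β := by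
  obtain ⟨c, h, rfl⟩ := hG.exists_spacelike β
  rw [hG.acrossSlice_boundary h, hG.acrossSlice_boundary (by rwa [G.timelike_cross]), G.cross_cross]

theorem sliceOf_acrossSlice (hG : G.IsCDT) (β : G.Boundary) :
    G.sliceOf (hG.acrossSlice β) = G.sliceOf β := by
  obtain ⟨c, h, rfl⟩ := hG.exists_spacelike β
  rw [hG.acrossSlice_boundary h, sliceOf_boundary, sliceOf_boundary, slice_cross]

/-- A slice needs only one generator beyond those of boundaries, the crossing at spacelike corners.
On boundaries it acts as an involution, so at most two boundaries run along a slice. -/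
theorem sliceOf_eq_iff (hG : G.IsCDT) {β γ : G.Boundary} :
    G.sliceOf γ = G.sliceOf β ↔ γ = β ∨ γ = hG.acrossSlice β := by
  constructor
  · obtain ⟨c, rfl⟩ := exists_boundary_eq β
    obtain ⟨d, rfl⟩ := exists_boundary_eq γ
    have hρ := hG.acrossSlice_acrossSlice
    refine rel_of_quot_eq (R := fun d c => G.boundary d = G.boundary c ∨
      G.boundary d = hG.acrossSlice (G.boundary c)) ⟨fun c => Or.inl rfl, ?_, ?_⟩ ?_
    · rintro x y (h | h) <;> simp [h, hρ]
    · rintro x y z (h | h) (h' | h') <;> simp [h, h', hρ]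
    · rintro x y (⟨h, rfl⟩ | rfl | rfl)
      · exact Or.inl (boundary_strand h).symm
      · exact Or.inl (boundary_arc x).symm
      · by_cases h : G.timelike x
        · exact Or.inl (boundary_cross h).symm
        · right
          rw [← hG.acrossSlice_boundary h, hρ]
  · rintro (rfl | rfl)
    · rfl
    · exact hG.sliceOf_acrossSlice β

theorem turn_arc (hG : G.IsCDT) (h : G.timelike c) : hG.turn (G.arc c) = G.arc (G.cross c) := by
  rw [turn, if_neg (hG.not_timelike_arc h), G.arc_arc, if_pos h]

theorem turn_cross_arc (hG : G.IsCDT) (h : G.timelike c) :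
    hG.turn (G.cross (G.arc c)) = G.cross (G.arc (G.cross c)) := by
  have h2 := hG.not_timelike_arc ((G.timelike_cross c).2 h)
  rw [turn, if_neg (by rw [G.timelike_cross]; exact hG.not_timelike_arc h), hG.arc_cross_arc h,
    if_neg (by rwa [G.timelike_cross])]

theorem turn_turn (hG : G.IsCDT) (c : C) : hG.turn (hG.turn c) = c := by
  rcases hG.corner_cases c with h | ⟨t, h, rfl⟩ | ⟨t, h, rfl⟩
  · rw [hG.turn_timelike h, hG.turn_timelike ((G.timelike_strand c).2 h), G.strand_strand]
  · rw [hG.turn_arc h, hG.turn_arc ((G.timelike_cross t).2 h), G.cross_cross]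
  · rw [hG.turn_cross_arc h, hG.turn_cross_arc ((G.timelike_cross t).2 h), G.cross_cross]

theorem cross_turn (hG : G.IsCDT) (c : C) : G.cross (hG.turn c) = hG.turn (G.cross c) := by
  rcases hG.corner_cases c with h | ⟨t, h, rfl⟩ | ⟨t, h, rfl⟩
  · rw [hG.turn_timelike h, hG.turn_timelike ((G.timelike_cross c).2 h), G.strand_cross]
  · rw [hG.turn_arc h, hG.turn_cross_arc h]
  · rw [hG.turn_cross_arc h, G.cross_cross, G.cross_cross, hG.turn_arc h]

theorem cross_ne_turn (hG : G.IsCDT) (c : C) : G.cross c ≠ hG.turn c := by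
  rcases hG.corner_cases c with h | ⟨t, h, rfl⟩ | ⟨t, h, rfl⟩
  · rw [hG.turn_timelike h]
    intro e
    exact G.strand_cross_ne c (by rw [e, G.strand_strand])
  · rw [hG.turn_arc h]
    exact hG.cross_arc_ne h
  · rw [hG.turn_cross_arc h, G.cross_cross]
    have := hG.cross_arc_ne ((G.timelike_cross t).2 h)
    rw [G.cross_cross] at this
    exact this.symm

/-- Replacing each timelike corner by the spacelike one next to it turns the walk along a boundary
into steps of `turn` and `strand`. -/
theorem quot_turn_of_boundary_eq (hG : G.IsCDT) (hc : ¬ G.timelike c) (hd : ¬ G.timelike d)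
    (h : G.boundary c = G.boundary d) :
    Quot.mk (fun c d => d = hG.turn c ∨ d = G.strand c) c = Quot.mk _ d := by
  classical
  have key := rel_of_quot_eq (R := fun c d =>
    Quot.mk (fun c d => d = hG.turn c ∨ d = G.strand c) (if G.timelike c then G.arc c else c) =
      Quot.mk (fun c d => d = hG.turn c ∨ d = G.strand c) (if G.timelike d then G.arc d else d))
    ⟨fun _ => rfl, fun h => h.symm, fun h h' => h.trans h'⟩ ?_ h
  · simpa only [if_neg hc, if_neg hd] using key
  · rintro x y (⟨h, rfl⟩ | rfl | ⟨h, rfl⟩)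
    · rw [if_neg h, if_neg (by rwa [G.timelike_strand])]
      exact Quot.sound (Or.inr rfl)
    · by_cases h : G.timelike x
      · rw [if_pos h, if_neg (hG.not_timelike_arc h)]
      · rw [if_neg h]
        by_cases h' : G.timelike (G.arc x)
        · rw [if_pos h', G.arc_arc]
        · rw [if_neg h']
          exact Quot.sound (Or.inl (hG.turn_spacelike h h').symm)
    · rw [if_pos h, if_pos ((G.timelike_cross x).2 h)]
      exact Quot.sound (Or.inl (hG.turn_arc h).symm)

/-- There are no crosscaps in an orientable graph. -/
theorem acrossSlice_ne (hG : G.IsCDT) (ho : G.Orientable) (β : G.Boundary) :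
    hG.acrossSlice β ≠ β := by
  obtain ⟨σ, hσ⟩ := ho
  obtain ⟨c, hc, rfl⟩ := hG.exists_spacelike β
  rw [hG.acrossSlice_boundary hc]
  intro h
  -- A crosscap would make `cross` preserve a cycle of alternating turns and strands.
  refine quot_ne_of_alternating hG.turn_turn G.strand_strand G.cross_cross hG.cross_turn
    (fun c => (G.strand_cross c).symm) hG.cross_ne_turn
    (fun c e => G.strand_cross_ne c (by rw [e, G.strand_strand])) (hG.flips_turn hσ)
    (fun c => (hσ c).1) (fun c => (hσ c).2.2) c ?_
  exact hG.quot_turn_of_boundary_eq hc (by rwa [G.timelike_cross]) h.symm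

end IsCDT

end ColoredRibbonGraph

namespace ColoredRibbonGraph

variable {C : Type u} (G : ColoredRibbonGraph C) {c d : C}

/-! ### Pieces of faces between timelike strands -/

/-- The pieces into which the faces are cut by the timelike strands. -/
def Segment : Type u := Quot (fun c d : C => d = G.arc c ∨ (¬ G.timelike c ∧ d = G.strand c))

def segment (c : C) : G.Segment := Quot.mk _ c

variable {G}

theorem segment_arc (c : C) : G.segment (G.arc c) = G.segment c :=
  (Quot.sound (Or.inl rfl) : G.segment c = G.segment (G.arc c)).symm

theorem segment_strand (h : ¬ G.timelike c) : G.segment (G.strand c) = G.segment c :=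
  (Quot.sound (Or.inr ⟨h, rfl⟩) : G.segment c = G.segment (G.strand c)).symm

theorem boundary_of_segment (h : G.segment c = G.segment d) : G.boundary c = G.boundary d := by
  refine rel_of_quot_eq (R := fun c d => G.boundary c = G.boundary d)
    ⟨fun _ => rfl, fun h => h.symm, fun h h' => h.trans h'⟩ ?_ h
  rintro c d (rfl | ⟨h, rfl⟩)
  · exact (boundary_arc c).symm
  · exact (boundary_strand h).symm

theorem face_of_segment (h : G.segment c = G.segment d) : G.face c = G.face d := by
  refine rel_of_quot_eq (R := fun c d => G.face c = G.face d)
    ⟨fun _ => rfl, fun h => h.symm, fun h h' => h.trans h'⟩ ?_ h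
  rintro c d (rfl | ⟨h, rfl⟩)
  · exact (G.face_arc c).symm
  · exact (G.face_strand c).symm

/-- Arcs pair all corners of a segment and strands pair its spacelike corners, so the number of the
others is even too. -/
theorem even_ncard_segment [Finite C] (q : G.Segment) :
    Even (Set.ncard {c | G.segment c = q ∧ G.timelike c}) := by
  have h1 := ncard_eq_two_mul_image G.arc_arc G.arc_ne (P := fun c => G.segment c = q)
    fun c => by rw [segment_arc]
  have h2 := ncard_eq_two_mul_image G.strand_strand G.strand_ne
    (P := fun c => G.segment c = q ∧ ¬ G.timelike c) fun c => by
      rw [G.timelike_strand]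
      exact ⟨fun h => ⟨segment_strand h.2 ▸ h.1, h.2⟩, fun h => ⟨(segment_strand h.2).trans h.1, h.2⟩⟩
  have h3 : Set.ncard {c | G.segment c = q ∧ G.timelike c} +
      Set.ncard {c | G.segment c = q ∧ ¬ G.timelike c} = Set.ncard {c | G.segment c = q} := by
    rw [← Set.ncard_union_eq]
    · congr 1
      ext c
      by_cases h : G.timelike c <;> simp [h]
    · exact Set.disjoint_left.2 fun c h h' => h'.2 h.2
  rw [h1, h2] at h3
  rw [Nat.even_iff]
  omega

/-- Parity provides a second timelike corner. With strands stopped at timelike corners a segment is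
a path whose ends are these corners, so there is no third. -/
theorem exists_partner [Finite C] (hc : G.timelike c) :
    ∃ d, G.timelike d ∧ d ≠ c ∧ G.segment d = G.segment c ∧
      ∀ e, G.timelike e → G.segment e = G.segment c → e = c ∨ e = d := by
  classical
  obtain ⟨m, hm⟩ := even_ncard_segment (G.segment c)
  have hpos : 0 < Set.ncard {d | G.segment d = G.segment c ∧ G.timelike d} :=
    (Set.ncard_pos (Set.toFinite _)).2 ⟨c, rfl, hc⟩
  obtain ⟨d, ⟨hd1, hd2⟩, hd3⟩ := Set.exists_ne_of_one_lt_ncard (show 1 <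
    Set.ncard {d | G.segment d = G.segment c ∧ G.timelike d} by omega) c
  refine ⟨d, hd2, hd3, hd1, fun e he h => or_iff_not_imp_left.2 fun hne => ?_⟩
  have key : ∀ d, G.segment d = G.segment c →
      Quot.mk (fun c d => d = G.arc c ∨ d = if G.timelike c then c else G.strand c) c = Quot.mk _ d := by
    intro d hd
    refine (rel_of_quot_eq (R := fun x y =>
      Quot.mk (fun c d => d = G.arc c ∨ d = if G.timelike c then c else G.strand c) x = Quot.mk _ y)
      ⟨fun _ => rfl, fun h => h.symm, fun h h' => h.trans h'⟩ ?_ hd).symm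
    rintro x y (rfl | ⟨h, rfl⟩)
    · exact Quot.sound (Or.inl rfl)
    · exact Quot.sound (Or.inr (by rw [if_neg h]))
  refine eq_of_fixed_of_fixed (β := fun x => if G.timelike x then x else G.strand x) G.arc_arc (fun x => ?_) (if_pos hc) (if_pos he) (if_pos hd2)
    (key e h) (key d hd1) hne hd3
  by_cases hx : G.timelike x
  · simp only [if_pos hx]
  · simp only [if_neg hx, G.timelike_strand, G.strand_strand]

open Classical in
/-- The timelike corner at the other end of a segment. -/
noncomputable def partner [Finite C] (G : ColoredRibbonGraph C) (c : C) : C :=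
  -- The value `cross` at spacelike corners makes `partner` an involution of all corners that
  -- commutes with `strand`.
  if h : G.timelike c then (exists_partner h).choose else G.cross c

variable [Finite C]

theorem partner_timelike (h : G.timelike c) : G.timelike (G.partner c) ∧ G.partner c ≠ c ∧
    G.segment (G.partner c) = G.segment c ∧
    ∀ e, G.timelike e → G.segment e = G.segment c → e = c ∨ e = G.partner c := by
  rw [partner, dif_pos h]
  exact (exists_partner h).choose_spec

theorem partner_spacelike (h : ¬ G.timelike c) : G.partner c = G.cross c := dif_neg h

theorem timelike_partner (c : C) : G.timelike (G.partner c) ↔ G.timelike c := by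
  by_cases h : G.timelike c
  · exact iff_of_true (partner_timelike h).1 h
  · rw [partner_spacelike h, G.timelike_cross]

theorem partner_partner (c : C) : G.partner (G.partner c) = c := by
  by_cases h : G.timelike c
  · obtain ⟨h1, h2, h3, h4⟩ := partner_timelike h
    exact (((partner_timelike h1).2.2.2 c h h3.symm).resolve_left h2.symm).symm
  · rw [partner_spacelike h, partner_spacelike (by rwa [G.timelike_cross]), G.cross_cross]

namespace IsCDT

theorem ncard_face (hG : G.IsCDT) (h : G.timelike c) :
    Set.ncard {d | G.face d = G.face c ∧ G.timelike d} = 4 := by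
  rw [ncard_face_timelike]
  rcases hG.face_timelike (G.face c) with e | e
  · rw [e]
  · exact absurd h ((numTimelike_eq_zero_iff _).1 e c rfl)

/-- Otherwise the segment would close up to an entire face with a single timelike strand, while such
a face has four timelike corners. -/
theorem partner_ne_strand (hG : G.IsCDT) (h : G.timelike c) : G.partner c ≠ G.strand c := by
  intro e
  obtain ⟨-, -, h3, h4⟩ := partner_timelike h
  have hface : ∀ d, G.face d = G.face c → G.segment d = G.segment c := by
    intro d hd
    refine (rel_of_quot_eq (R := fun x y => G.segment x = G.segment c ↔ G.segment y = G.segment c)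
      ⟨fun _ => Iff.rfl, fun h => h.symm, fun h h' => h.trans h'⟩ ?_ hd).2 rfl
    have key : ∀ x, G.segment x = G.segment c → G.segment (G.strand x) = G.segment c := by
      intro x hx
      by_cases ht : G.timelike x
      · rcases h4 x ht hx with rfl | rfl
        · rw [← e, h3]
        · rw [e, G.strand_strand]
      · rw [segment_strand ht, hx]
    rintro x y (rfl | rfl)
    · exact ⟨key x, fun h => by simpa only [G.strand_strand] using key _ h⟩
    · rw [segment_arc]
  have hs : {d | G.face d = G.face c ∧ G.timelike d} ⊆ {c, G.partner c} := fun d hd =>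
    h4 d hd.2 (hface d hd.1)
  have := (Set.ncard_le_ncard hs (Set.toFinite _)).trans (Set.ncard_insert_le _ _)
  rw [hG.ncard_face h, Set.ncard_singleton] at this
  omega

/-- The face has just four timelike corners, `c`, `strand c` and the corresponding two at `partner
c`; only the last is left as partner of `strand c`. -/
theorem strand_partner (hG : G.IsCDT) (c : C) : G.strand (G.partner c) = G.partner (G.strand c) := by
  by_cases h : G.timelike c
  · have hs := (G.timelike_strand c).2 h
    obtain ⟨h1, h2, h3, h4⟩ := partner_timelike h
    have h5 := hG.partner_ne_strand h
    have hinj : Function.Injective G.strand := Function.Involutive.injective G.strand_strand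
    have h6 : G.strand (G.partner c) ≠ c := fun e => h5 (by rw [← e, G.strand_strand, e])
    have e : ({c, G.strand c, G.partner c, G.strand (G.partner c)} : Set C) =
        {d | G.face d = G.face c ∧ G.timelike d} := by
      have h7 := face_of_segment h3
      refine Set.eq_of_subset_of_ncard_le ?_ ?_ (Set.toFinite _)
      · rintro _ (rfl | rfl | rfl | rfl)
        · exact ⟨rfl, h⟩
        · exact ⟨G.face_strand c, hs⟩
        · exact ⟨h7, h1⟩
        · exact ⟨(G.face_strand _).trans h7, (G.timelike_strand _).2 h1⟩
      · rw [hG.ncard_face h, Set.ncard_insert_of_notMem, Set.ncard_insert_of_notMem,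
          Set.ncard_pair (G.strand_ne _).symm]
        · simp only [Set.mem_insert_iff, Set.mem_singleton_iff, not_or]
          exact ⟨h5.symm, fun h => h2 (hinj h).symm⟩
        · simp only [Set.mem_insert_iff, Set.mem_singleton_iff, not_or]
          exact ⟨(G.strand_ne c).symm, h2.symm, h6.symm⟩
    obtain ⟨k1, k2, k3, -⟩ := partner_timelike hs
    have : G.partner (G.strand c) ∈ ({c, G.strand c, G.partner c, G.strand (G.partner c)} : Set C) :=
      e ▸ ⟨(face_of_segment k3).trans (G.face_strand c), k1⟩
    rcases this with k | k | k | k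
    · exact absurd (by rw [← congrArg G.partner k, partner_partner]) h5
    · exact absurd k k2
    · have := congrArg G.partner k
      rw [partner_partner, partner_partner] at this
      exact absurd this (G.strand_ne c)
    · exact k.symm
  · rw [partner_spacelike h, partner_spacelike (by rwa [G.timelike_strand]), G.strand_cross]

theorem quot_partner_of_boundary_eq (hc : G.timelike c) (hd : G.timelike d)
    (h : G.boundary c = G.boundary d) :
    Quot.mk (fun c d => d = G.partner c ∨ d = G.cross c) c = Quot.mk _ d := by
  -- `T c` collects the classes of the timelike corners on the segment of `c`. It is a singleton at
  -- a timelike corner and stays constant along the boundary.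
  let T : C → Set (Quot fun c d => d = G.partner c ∨ d = G.cross c) := fun c =>
    {q | ∃ d, G.timelike d ∧ G.segment d = G.segment c ∧ Quot.mk _ d = q}
  have hT : ∀ c, G.timelike c → T c = {Quot.mk _ c} := by
    intro c hc
    refine Set.eq_singleton_iff_unique_mem.2 ⟨⟨c, hc, rfl, rfl⟩, ?_⟩
    rintro _ ⟨d, hd, hs, rfl⟩
    rcases (partner_timelike hc).2.2.2 d hd hs with rfl | rfl
    · rfl
    · exact (Quot.sound (r := fun c d => d = G.partner c ∨ d = G.cross c) (Or.inl rfl)).symm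
  have key := rel_of_quot_eq (R := fun x y => T x = T y)
    ⟨fun _ => rfl, fun h => h.symm, fun h h' => h.trans h'⟩ ?_ h
  · rw [hT c hc, hT d hd] at key
    exact Set.singleton_injective key
  · rintro x y (⟨h, rfl⟩ | rfl | ⟨h, rfl⟩)
    · simp only [T, segment_strand h]
    · simp only [T, segment_arc]
    · rw [hT x h, hT _ ((G.timelike_cross x).2 h)]
      exact congrArg _ (Quot.sound (Or.inr rfl))

/-- Timelike corners of one boundary are connected by partners and crossings. Passing to the other
end of the strand commutes with both, so those ends share a boundary as well. -/
theorem boundary_strand_eq (hG : G.IsCDT) (hc : G.timelike c) (hd : G.timelike d)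
    (h : G.boundary c = G.boundary d) : G.boundary (G.strand c) = G.boundary (G.strand d) := by
  refine (rel_of_quot_eq (R := fun x y => (G.timelike x ↔ G.timelike y) ∧
    (G.timelike x → G.boundary (G.strand x) = G.boundary (G.strand y)))
    ⟨fun _ => ⟨Iff.rfl, fun _ => rfl⟩, fun h => ⟨h.1.symm, fun t => (h.2 (h.1.2 t)).symm⟩,
      fun h h' => ⟨h.1.trans h'.1, fun t => (h.2 t).trans (h'.2 (h.1.1 t))⟩⟩ ?_
    (quot_partner_of_boundary_eq hc hd h)).2 hc
  rintro x y (rfl | rfl)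
  · refine ⟨(timelike_partner x).symm, fun h => ?_⟩
    rw [hG.strand_partner]
    exact (boundary_of_segment (partner_timelike ((G.timelike_strand x).2 h)).2.2.1).symm
  · refine ⟨(G.timelike_cross x).symm, fun h => ?_⟩
    rw [G.strand_cross, boundary_cross ((G.timelike_strand x).2 h)]

/-! ### The other side of a strip -/

open Classical in
/-- The boundary on the other side of a strip. -/
noncomputable def acrossStrip (_ : G.IsCDT) (β : G.Boundary) : G.Boundary :=
  -- A boundary that no timelike strand reaches bounds a singular strip and counts as its own
  -- opposite.
  if h : ∃ c, G.timelike c ∧ G.boundary c = β then G.boundary (G.strand h.choose) else β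

theorem acrossStrip_boundary (hG : G.IsCDT) (h : G.timelike c) :
    hG.acrossStrip (G.boundary c) = G.boundary (G.strand c) := by
  have hex : ∃ d, G.timelike d ∧ G.boundary d = G.boundary c := ⟨c, h, rfl⟩
  rw [acrossStrip, dif_pos hex]
  exact hG.boundary_strand_eq hex.choose_spec.1 h hex.choose_spec.2

theorem acrossStrip_acrossStrip (hG : G.IsCDT) (β : G.Boundary) :
    hG.acrossStrip (hG.acrossStrip β) = β := by
  by_cases hex : ∃ c, G.timelike c ∧ G.boundary c = β
  · obtain ⟨c, h, rfl⟩ := hex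
    rw [hG.acrossStrip_boundary h, hG.acrossStrip_boundary ((G.timelike_strand c).2 h),
      G.strand_strand]
  · have e : hG.acrossStrip β = β := dif_neg hex
    rw [e, e]

theorem stripOf_acrossStrip (hG : G.IsCDT) (β : G.Boundary) :
    G.stripOf (hG.acrossStrip β) = G.stripOf β := by
  by_cases hex : ∃ c, G.timelike c ∧ G.boundary c = β
  · obtain ⟨c, h, rfl⟩ := hex
    rw [hG.acrossStrip_boundary h, stripOf_boundary, stripOf_boundary, strip_strand]
  · have e : hG.acrossStrip β = β := dif_neg hex
    rw [e]

/-- The generator of strips missing from boundaries is the timelike strand, which acts on boundaries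
as the involution `acrossStrip`; so a strip has at most two boundaries. -/
theorem stripOf_eq_iff (hG : G.IsCDT) {β γ : G.Boundary} :
    G.stripOf γ = G.stripOf β ↔ γ = β ∨ γ = hG.acrossStrip β := by
  constructor
  · obtain ⟨c, rfl⟩ := exists_boundary_eq β
    obtain ⟨d, rfl⟩ := exists_boundary_eq γ
    have hμ := hG.acrossStrip_acrossStrip
    refine rel_of_quot_eq (R := fun d c => G.boundary d = G.boundary c ∨
      G.boundary d = hG.acrossStrip (G.boundary c)) ⟨fun c => Or.inl rfl, ?_, ?_⟩ ?_
    · rintro x y (h | h) <;> simp [h, hμ]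
    · rintro x y z (h | h) (h' | h') <;> simp [h, h', hμ]
    · rintro x y (rfl | rfl | ⟨h, rfl⟩)
      · by_cases h : G.timelike x
        · right
          rw [← hG.acrossStrip_boundary h, hμ]
        · exact Or.inl (boundary_strand h).symm
      · exact Or.inl (boundary_arc x).symm
      · exact Or.inl (boundary_cross h).symm
  · rintro (rfl | rfl)
    · rfl
    · exact hG.stripOf_acrossStrip β

theorem numBoundaries_eq (hG : G.IsCDT) (β : G.Boundary) :
    G.numBoundaries (G.stripOf β) = Set.ncard {β, hG.acrossStrip β} := by
  unfold numBoundaries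
  congr 1
  ext γ
  exact hG.stripOf_eq_iff

theorem isRegularStrip_iff (hG : G.IsCDT) (β : G.Boundary) :
    G.IsRegularStrip (G.stripOf β) ↔ hG.acrossStrip β ≠ β := by
  unfold IsRegularStrip
  rw [hG.numBoundaries_eq]
  constructor
  · intro h e
    rw [e, Set.pair_eq_singleton, Set.ncard_singleton] at h
    omega
  · intro h
    exact Set.ncard_pair h.symm

/-- A strip is singular when no timelike strand ends at a boundary of it. -/
theorem isSingularStrip_iff (β : G.Boundary) :
    G.IsSingularStrip (G.stripOf β) ↔ ∀ c, G.boundary c = β → ¬ G.timelike c := by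
  constructor
  · rintro ⟨f, hf, h0⟩ c rfl
    exact (numTimelike_eq_zero_iff f).1 h0 c ((hf c).1 rfl)
  · intro h
    obtain ⟨c, rfl⟩ := exists_boundary_eq β
    refine ⟨G.face c, fun d => ⟨fun hd => ?_, fun hd => ?_⟩, (numTimelike_eq_zero_iff _).2 fun d hd => ?_⟩
    · refine ((rel_of_quot_eq (R := fun x y => (G.face x = G.face c ∧ G.boundary x = G.boundary c) ↔
        (G.face y = G.face c ∧ G.boundary y = G.boundary c))
        ⟨fun _ => Iff.rfl, fun h => h.symm, fun h h' => h.trans h'⟩ ?_ hd).2 ⟨rfl, rfl⟩).1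
      rintro x y (rfl | rfl | ⟨ht, rfl⟩)
      · rw [G.face_strand]
        by_cases ht : G.timelike x
        · exact iff_of_false (fun e => h x e.2 ht) (fun e => h _ e.2 ((G.timelike_strand x).2 ht))
        · rw [boundary_strand ht]
      · rw [G.face_arc, boundary_arc]
      · exact iff_of_false (fun e => h x e.2 ht) (fun e => h _ e.2 ((G.timelike_cross x).2 ht))
    · refine rel_of_quot_eq (R := fun x y => G.strip x = G.strip y)
        ⟨fun _ => rfl, fun h => h.symm, fun h h' => h.trans h'⟩ ?_ hd
      rintro x y (rfl | rfl)
      · exact (strip_strand x).symm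
      · exact (strip_arc x).symm
    · refine h d ((rel_of_quot_eq (R := fun x y => G.boundary x = G.boundary c ↔
        G.boundary y = G.boundary c)
        ⟨fun _ => Iff.rfl, fun h => h.symm, fun h h' => h.trans h'⟩ ?_ hd).2 rfl)
      rintro x y (rfl | rfl)
      · by_cases ht : G.timelike x
        · exact iff_of_false (fun e => h x e ht) (fun e => h _ e ((G.timelike_strand x).2 ht))
        · rw [boundary_strand ht]
      · rw [boundary_arc]

theorem acrossStrip_of_isSingularStrip (hG : G.IsCDT) {β : G.Boundary}
    (h : G.IsSingularStrip (G.stripOf β)) : hG.acrossStrip β = β :=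
  dif_neg fun ⟨c, hc, e⟩ => (isSingularStrip_iff β).1 h c e hc

theorem isMobiusStrip_iff (hG : G.IsCDT) (β : G.Boundary) :
    G.IsMobiusStrip (G.stripOf β) ↔
      ¬ G.IsSingularStrip (G.stripOf β) ∧ hG.acrossStrip β = β := by
  refine and_congr_right fun _ => ?_
  rw [hG.numBoundaries_eq]
  by_cases h : hG.acrossStrip β = β
  · simp [h]
  · rw [Set.ncard_pair (Ne.symm h)]
    simp [h]

/-- Arcs balance the signs on a segment and strands balance them on its spacelike corners, so the
two timelike ends have opposite signs. -/
theorem flips_partner {σ : C → Bool}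
    (hσ : ∀ c, σ (G.strand c) ≠ σ c ∧ σ (G.arc c) ≠ σ c ∧ σ (G.cross c) ≠ σ c) (c : C) :
    σ (G.partner c) ≠ σ c := by
  by_cases h : G.timelike c
  · intro e
    obtain ⟨h1, h2, h3, h4⟩ := partner_timelike h
    have flip : ∀ (i : C → C) (P : C → Prop), (∀ c, i (i c) = c) → (∀ c, σ (i c) ≠ σ c) →
        (∀ c, P c → P (i c)) → ∀ b, Set.ncard {d | P d ∧ σ d = b} ≤ Set.ncard {d | P d ∧ σ d = !b} := by
      intro i P hi hσi hP b
      refine Set.ncard_le_ncard_of_injOn i ?_ (Function.Involutive.injective hi).injOn (Set.toFinite _)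
      rintro d ⟨hd, rfl⟩
      exact ⟨hP d hd, Bool.eq_not.2 (hσi d)⟩
    have split : ∀ b, Set.ncard {d | G.segment d = G.segment c ∧ σ d = b} =
        Set.ncard {d | (G.segment d = G.segment c ∧ G.timelike d) ∧ σ d = b} +
        Set.ncard {d | (G.segment d = G.segment c ∧ ¬ G.timelike d) ∧ σ d = b} := by
      intro b
      rw [← Set.ncard_union_eq]
      · congr 1
        ext d
        by_cases h : G.timelike d <;> simp [h]
      · exact Set.disjoint_left.2 fun c h h' => h'.1.2 h.1.2
    have e1 := flip G.arc (fun d => G.segment d = G.segment c) G.arc_arc (fun c => (hσ c).2.1)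
      (fun d hd => (segment_arc d).trans hd) (σ c)
    have e2 := flip G.strand (fun d => G.segment d = G.segment c ∧ ¬ G.timelike d) G.strand_strand
      (fun c => (hσ c).1) (fun d hd => ⟨(segment_strand hd.2).trans hd.1, by
        rw [G.timelike_strand]; exact hd.2⟩) (!(σ c))
    rw [split, split] at e1
    rw [Bool.not_not] at e2
    have e3 : Set.ncard {d | (G.segment d = G.segment c ∧ G.timelike d) ∧ σ d = !(σ c)} = 0 := by
      rw [Set.ncard_eq_zero]
      refine Set.eq_empty_of_forall_notMem ?_
      rintro d ⟨⟨hd1, hd2⟩, hd3⟩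
      rcases h4 d hd2 hd1 with rfl | rfl
      · simp at hd3
      · rw [e] at hd3; simp at hd3
    have e4 : 0 < Set.ncard {d | (G.segment d = G.segment c ∧ G.timelike d) ∧ σ d = σ c} :=
      (Set.ncard_pos (Set.toFinite _)).2 ⟨c, ⟨rfl, h⟩, rfl⟩
    omega
  · rw [partner_spacelike h]
    exact (hσ c).2.2

/-- There are no Möbius strips in an orientable graph. -/
theorem not_isMobiusStrip (hG : G.IsCDT) (ho : G.Orientable) (β : G.Boundary) :
    ¬ G.IsMobiusStrip (G.stripOf β) := by
  rw [isMobiusStrip_iff hG, isSingularStrip_iff]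
  rintro ⟨h1, h2⟩
  push Not at h1
  obtain ⟨c, rfl, hc⟩ := h1
  rw [hG.acrossStrip_boundary hc] at h2
  obtain ⟨σ, hσ⟩ := ho
  have hxs : ∀ c, G.strand c ≠ G.cross c := fun c e =>
    G.strand_cross_ne c (by rw [← e, G.strand_strand])
  -- A Möbius strip would make `strand` preserve a cycle of alternating partners and crossings.
  refine quot_ne_of_alternating partner_partner G.cross_cross G.strand_strand hG.strand_partner
    G.strand_cross (fun c => ?_) hxs (flips_partner hσ) (fun c => (hσ c).2.2) (fun c => (hσ c).1) c ?_
  · by_cases h : G.timelike c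
    · exact (hG.partner_ne_strand h).symm
    · rw [partner_spacelike h]
      exact hxs c
  · exact quot_partner_of_boundary_eq hc ((G.timelike_strand c).2 hc) h2.symm

/-- Every slice borders on a strip that is not singular. -/
theorem exists_not_isSingularStrip (hG : G.IsCDT) (β : G.Boundary) :
    ¬ G.IsSingularStrip (G.stripOf β) ∨ ¬ G.IsSingularStrip (G.stripOf (hG.acrossSlice β)) := by
  obtain ⟨c, hc, rfl⟩ := hG.exists_spacelike β
  rw [hG.acrossSlice_boundary hc]
  simp only [isSingularStrip_iff]
  rcases hG.corner_cases c with h | ⟨t, h, rfl⟩ | ⟨t, h, rfl⟩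
  · exact absurd h hc
  · exact Or.inl fun k => k t (boundary_arc t).symm h
  · rw [G.cross_cross]
    exact Or.inr fun k => k t (boundary_arc t).symm h

/-- In a connected graph all boundaries are reached through strips and slices. -/
theorem boundary_induction (hG : G.IsCDT) (hc : G.Connected) {A : Set G.Boundary} (hA : A.Nonempty)
    (h1 : ∀ β ∈ A, hG.acrossSlice β ∈ A) (h2 : ∀ β ∈ A, hG.acrossStrip β ∈ A) (β : G.Boundary) :
    β ∈ A := by
  obtain ⟨γ, hγ⟩ := hA
  obtain ⟨c, rfl⟩ := exists_boundary_eq γ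
  obtain ⟨d, rfl⟩ := exists_boundary_eq β
  have h1' : ∀ β, hG.acrossSlice β ∈ A ↔ β ∈ A := fun β =>
    ⟨fun h => hG.acrossSlice_acrossSlice β ▸ h1 _ h, h1 β⟩
  have h2' : ∀ β, hG.acrossStrip β ∈ A ↔ β ∈ A := fun β =>
    ⟨fun h => hG.acrossStrip_acrossStrip β ▸ h2 _ h, h2 β⟩
  refine (rel_of_quot_eq (R := fun x y => G.boundary x ∈ A ↔ G.boundary y ∈ A)
    ⟨fun _ => Iff.rfl, fun h => h.symm, fun h h' => h.trans h'⟩ ?_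
    (hc.2.elim (Quot.mk _ c) (Quot.mk _ d))).1 hγ
  rintro x y (rfl | rfl | rfl)
  · by_cases h : G.timelike x
    · rw [← hG.acrossStrip_boundary h, h2']
    · rw [boundary_strand h]
  · rw [boundary_arc]
  · by_cases h : G.timelike x
    · rw [boundary_cross h]
    · rw [← hG.acrossSlice_boundary h, h1']

/-- Singular faces and singular strips are the same. -/
theorem numSingularFaces_eq :
    G.numSingularFaces = Nat.card {s : G.Strip // G.IsSingularStrip s} := by
  have hstrip : ∀ c d, G.face c = G.face d → G.strip c = G.strip d := by
    intro c d h
    refine rel_of_quot_eq (R := fun x y => G.strip x = G.strip y)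
      ⟨fun _ => rfl, fun h => h.symm, fun h h' => h.trans h'⟩ ?_ h
    rintro x y (rfl | rfl)
    · exact (strip_strand x).symm
    · exact (strip_arc x).symm
  let F : G.Face → G.Strip := Quot.lift G.strip fun c d h => hstrip c d (Quot.sound h)
  have hF : ∀ f : G.Face, (∀ c, G.face c = f → ¬ G.timelike c) → G.IsSingularStrip (F f) := by
    rintro ⟨c⟩ h
    refine (isSingularStrip_iff (G.boundary c)).2 fun d hd ht => ?_
    refine absurd ht (h d ?_)
    have := (rel_of_quot_eq (R := fun x y => G.face x = G.face c ↔ G.face y = G.face c)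
      ⟨fun _ => Iff.rfl, fun h => h.symm, fun h h' => h.trans h'⟩ ?_ hd).2 rfl
    · exact this
    · rintro x y (⟨-, rfl⟩ | rfl | ⟨ht, rfl⟩)
      · rw [G.face_strand]
      · rw [G.face_arc]
      · exact iff_of_false (fun e => h x e ht) (fun e => h _ e ((G.timelike_cross x).2 ht))
  refine Nat.card_congr (Equiv.ofBijective (fun f => ⟨F f.1, hF f.1 f.2⟩) ⟨?_, ?_⟩)
  · rintro ⟨⟨c⟩, hc⟩ ⟨⟨d⟩, hd⟩ h
    have h' : G.strip c = G.strip d := congrArg Subtype.val h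
    obtain ⟨f, hf, -⟩ := hF _ hc
    exact Subtype.ext (((hf c).1 rfl).trans ((hf d).1 h'.symm).symm)
  · rintro ⟨s, f, hf, h0⟩
    refine ⟨⟨f, (numTimelike_eq_zero_iff f).1 h0⟩, Subtype.ext ?_⟩
    obtain ⟨c, rfl⟩ := Quot.exists_rep f
    exact (hf c).2 rfl

end IsCDT

end ColoredRibbonGraph

/-! ### Two involutions on a connected set -/

section PathOrCycle

variable {B : Type u}

/-- `L 0, ρ (L 0), L 1, ρ (L 1), …, L n, ρ (L n)` is a path whose steps are made by `ρ` and `μ` in turn;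
`p` and `q` tell whether it is `ρ` that stops at the two ends. -/
structure IsPath (ρ μ : B → B) (p q : Prop) (n : ℕ) (L : ℤ → B) : Prop where
  one_le : p → q → 1 ≤ n
  exhaust : ∀ β, ∃ i : ℤ, 0 ≤ i ∧ i ≤ n ∧ (β = L i ∨ β = ρ (L i))
  eq_of : ∀ i j : ℤ, 0 ≤ i → i ≤ n → 0 ≤ j → j ≤ n → L i = L j ∨ L i = ρ (L j) → i = j
  fixed_iff : ∀ i : ℤ, 0 ≤ i → i ≤ n → (L i = ρ (L i) ↔ (i = 0 ∧ p) ∨ (i = n ∧ q))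
  step : ∀ i : ℤ, 0 ≤ i → i < n → μ (ρ (L i)) = L (i + 1) ∧ ρ (L i) ≠ L (i + 1)
  left : ¬ p → μ (L 0) = L 0
  right : ¬ q → μ (ρ (L n)) = ρ (L n)

/-- `…, L 0, ρ (L 0), L 1, ρ (L 1), …` is a cycle whose steps are made by `ρ` and `μ` in turn. -/
structure IsLoop (ρ μ : B → B) (n : ℕ) (L : ℤ → B) : Prop where
  one_le : 1 ≤ n
  exhaust : ∀ β, ∃ i : ℤ, β = L i ∨ β = ρ (L i)
  periodic : ∀ i j : ℤ, (n : ℤ) ∣ i - j → L i = L j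
  eq_of : ∀ i j : ℤ, L i = L j ∨ L i = ρ (L j) → (n : ℤ) ∣ i - j
  not_fixed : ∀ i, L i ≠ ρ (L i)
  step : ∀ i, μ (ρ (L i)) = L (i + 1) ∧ ρ (L i) ≠ L (i + 1)

theorem Int.eq_zero_or_eq_of_dvd {P z : ℤ} (h : P ∣ z) (h1 : -P < z) (h2 : z < 2 * P) :
    z = 0 ∨ z = P := by
  obtain ⟨k, rfl⟩ := h
  have hP : 0 < P := by linarith
  have k1 : -1 < k := by nlinarith
  have k2 : k < 2 := by nlinarith
  obtain rfl | rfl : k = 0 ∨ k = 1 := by omega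
  · simp
  · simp

/-- Put `γ = μ ρ`. If one involution fixes `x`, then `B` is the single `γ`-orbit of `x`, both
involutions act as reflections of the exponents, and parity decides which of them stops at the far
end. Without fixed points, the `γ`-orbit of `x` and its image under `ρ` are disjoint and form a
cycle. -/
theorem exists_isPath_or_isLoop [Finite B] [Nonempty B] {ρ μ : B → B} (hρ : ∀ β, ρ (ρ β) = β)
    (hμ : ∀ β, μ (μ β) = β)
    (hconn : ∀ A : Set B, A.Nonempty → (∀ β ∈ A, ρ β ∈ A) → (∀ β ∈ A, μ β ∈ A) → ∀ β, β ∈ A) :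
    (∃ p q n L, IsPath ρ μ p q n L) ∨ ∃ n L, IsLoop ρ μ n L := by
  let M := Function.Involutive.toPerm μ hμ
  let R := Function.Involutive.toPerm ρ hρ
  have hM : M * M = 1 := Equiv.ext hμ
  have hR : R * R = 1 := Equiv.ext hρ
  have hγ : ∀ (x : B) (k l : ℤ), ((M * R) ^ k) (((M * R) ^ l) x) = ((M * R) ^ (k + l)) x :=
    fun x k l => by rw [zpow_add, Equiv.Perm.mul_apply]
  have hstep : ∀ (x : B) (k : ℤ), μ (ρ (((M * R) ^ k) x)) = ((M * R) ^ (k + 1)) x := fun x k => by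
    rw [add_comm, zpow_add, zpow_one]; rfl
  have hμγ : ∀ (x : B) (m : ℤ), μ (((M * R) ^ m) x) = ((M * R) ^ (-m)) (μ x) := fun x m =>
    congrArg (fun f : Equiv.Perm B => f x) (involution_conj_zpow M R hM hR m)
  have hργ : ∀ (x : B) (m : ℤ), ρ (((M * R) ^ m) x) = ((M * R) ^ (-m - 1)) (μ x) := fun x m => by
    rw [← hμ (ρ _), hstep, hμγ]; congr 3; ring
  have hμe : ∀ (x : B) (e m : ℤ), μ x = ((M * R) ^ e) x →
      μ (((M * R) ^ m) x) = ((M * R) ^ (e - m)) x := fun x e m h => by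
    rw [hμγ, h, hγ]; congr 2; ring
  have hρe : ∀ (x : B) (e m : ℤ), μ x = ((M * R) ^ e) x →
      ρ (((M * R) ^ m) x) = ((M * R) ^ (e - m - 1)) x := fun x e m h => by
    rw [hργ, h, hγ]; congr 2; ring
  have hper : ∀ x : B, ∃ P : ℕ, 1 ≤ P ∧
      ∀ k l : ℤ, ((M * R) ^ k) x = ((M * R) ^ l) x ↔ (P : ℤ) ∣ k - l := by
    intro x
    obtain ⟨P, hP⟩ := exists_period (M * R) x
    have h : ∀ k l : ℤ, ((M * R) ^ k) x = ((M * R) ^ l) x ↔ (P : ℤ) ∣ k - l := fun k l => by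
      rw [← hP, sub_eq_neg_add, zpow_add, zpow_neg, Equiv.Perm.mul_apply, Equiv.Perm.inv_eq_iff_eq]
    refine ⟨P, Nat.one_le_iff_ne_zero.2 ?_, h⟩
    rintro rfl
    refine not_injective_infinite_finite (fun k : ℤ => ((M * R) ^ k) x) fun k l hkl => ?_
    have := (h k l).1 hkl
    rw [Nat.cast_zero, zero_dvd_iff] at this
    omega
  have horbit : ∀ x e, μ x = ((M * R) ^ (e : ℤ)) x → ∀ β, ∃ k : ℤ, β = ((M * R) ^ k) x := by
    intro x e h
    refine hconn {β | ∃ k : ℤ, β = ((M * R) ^ k) x} ⟨x, 0, rfl⟩ ?_ ?_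
    · rintro _ ⟨k, rfl⟩
      exact ⟨_, hρe x e k h⟩
    · rintro _ ⟨k, rfl⟩
      exact ⟨_, hμe x e k h⟩
  by_cases h1 : ∃ x, μ x = x
  · left
    obtain ⟨x, hx⟩ := h1
    have h0 : μ x = ((M * R) ^ (0 : ℤ)) x := hx
    obtain ⟨P, hP1, hP⟩ := hper x
    have horb := horbit x 0 h0
    have hρ0 := fun m => hρe x 0 m h0
    have hμ0 := fun m => hμe x 0 m h0
    -- From an end fixed by `μ` the elements come in pairs `L i, ρ (L i)`; the last pair degenerates
    -- to one element exactly when the period is odd.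
    obtain ⟨n, hn⟩ : ∃ n : ℕ, P = 2 * n + 1 ∨ P = 2 * n + 2 := ⟨(P - 1) / 2, by omega⟩
    refine ⟨False, P = 2 * n + 1, n, fun i => ((M * R) ^ i) x, fun h => h.elim, ?_, ?_, ?_, ?_,
      fun _ => hx, ?_⟩
    · intro β
      obtain ⟨k, rfl⟩ := horb β
      simp only [hρ0, hP]
      have e1 := Int.emod_nonneg k (show (P : ℤ) ≠ 0 by omega)
      have e2 := Int.emod_lt_of_pos k (show (0 : ℤ) < P by omega)
      have e3 : (P : ℤ) ∣ k - k % P := Int.dvd_self_sub_emod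
      by_cases h : k % P ≤ n
      · exact ⟨_, e1, h, Or.inl e3⟩
      · refine ⟨P - 1 - k % P, by omega, by omega, Or.inr ?_⟩
        have : k - (0 - (P - 1 - k % P) - 1) = (k - k % P) + P := by ring
        rw [this]
        exact dvd_add e3 (dvd_refl _)
    · intro i j i1 i2 j1 j2 h
      simp only [hρ0, hP] at h
      rcases h with h | h <;>
        rcases Int.eq_zero_or_eq_of_dvd h (by omega) (by omega) with h | h <;> omega
    · intro i i1 i2
      simp only [hρ0, hP, and_false, false_or]
      constructor
      · intro h
        rcases Int.eq_zero_or_eq_of_dvd h (by omega) (by omega) with h | h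
        · omega
        · omega
      · rintro ⟨rfl, h⟩
        refine ⟨1, ?_⟩
        rw [h]; push_cast; ring
    · intro i i1 i2
      refine ⟨hstep x i, ?_⟩
      simp only [hρ0, ne_eq, hP]
      rw [dvd_sub_comm]
      intro h
      rcases Int.eq_zero_or_eq_of_dvd h (by omega) (by omega) with h | h <;> omega
    · intro h
      simp only [hρ0, hμ0, hP]
      have h' : P = 2 * n + 2 := hn.resolve_left h
      refine ⟨1, ?_⟩
      rw [h']; push_cast; ring
  by_cases h2 : ∃ x, ρ x = x
  · left
    obtain ⟨x, hx⟩ := h2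
    have h0 : μ x = ((M * R) ^ (1 : ℤ)) x := by
      conv_lhs => rw [← hx]
      rfl
    obtain ⟨P, hP1, hP⟩ := hper x
    have horb := horbit x 1 h0
    have hρ0 := fun m => hρe x 1 m h0
    have hμ0 := fun m => hμe x 1 m h0
    -- An odd period would produce a fixed point of `μ`, which has been excluded, so `ρ` stops at
    -- both ends.
    obtain ⟨n, hn⟩ : ∃ n : ℕ, P = 2 * n := by
      obtain ⟨q, hq | hq⟩ := Nat.even_or_odd' P
      · exact ⟨q, hq⟩
      · refine absurd ⟨((M * R) ^ ((q : ℤ) + 1)) x, ?_⟩ h1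
        rw [hμ0, hP, dvd_sub_comm]
        exact ⟨1, by rw [hq]; push_cast; ring⟩
    refine ⟨True, True, n, fun i => ((M * R) ^ i) x, fun _ _ => by omega, ?_, ?_, ?_, ?_,
      fun h => absurd trivial h, fun h => absurd trivial h⟩
    · intro β
      obtain ⟨k, rfl⟩ := horb β
      simp only [hρ0, hP]
      have e1 := Int.emod_nonneg k (show (P : ℤ) ≠ 0 by omega)
      have e2 := Int.emod_lt_of_pos k (show (0 : ℤ) < P by omega)
      have e3 : (P : ℤ) ∣ k - k % P := Int.dvd_self_sub_emod
      by_cases h : k % P ≤ n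
      · exact ⟨_, e1, h, Or.inl e3⟩
      · refine ⟨P - k % P, by omega, by omega, Or.inr ?_⟩
        have : k - (1 - (P - k % P) - 1) = (k - k % P) + P := by ring
        rw [this]
        exact dvd_add e3 (dvd_refl _)
    · intro i j i1 i2 j1 j2 h
      simp only [hρ0, hP] at h
      rcases h with h | h <;>
        rcases Int.eq_zero_or_eq_of_dvd h (by omega) (by omega) with h | h <;> omega
    · intro i i1 i2
      simp only [hρ0, hP, and_true]
      constructor
      · intro h
        rcases Int.eq_zero_or_eq_of_dvd h (by omega) (by omega) with h | h <;> omega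
      · rintro (rfl | rfl)
        · simp
        · exact ⟨1, by rw [hn]; push_cast; ring⟩
    · intro i i1 i2
      refine ⟨hstep x i, ?_⟩
      simp only [hρ0, ne_eq, hP]
      rw [dvd_sub_comm]
      intro h
      rcases Int.eq_zero_or_eq_of_dvd h (by omega) (by omega) with h | h <;> omega
  · right
    push Not at h1 h2
    obtain ⟨x⟩ := ‹Nonempty B›
    obtain ⟨P, hP1, hP⟩ := hper x
    -- If `ρ` led back into the orbit, `μ x` would be `γ ^ e x`, and the middle of the way there
    -- would be fixed by `μ` or `ρ` according to the parity of `e`.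
    have hdisj : ∀ i j : ℤ, ((M * R) ^ i) x ≠ ρ (((M * R) ^ j) x) := by
      intro i j h
      have he : μ x = ((M * R) ^ (i + j + 1)) x := by
        rw [hργ] at h
        have := congrArg ((M * R) ^ (j + 1)) h
        rw [hγ, hγ, show j + 1 + (-j - 1) = 0 by ring, zpow_zero, Equiv.Perm.one_apply] at this
        rw [← this]; congr 2; ring
      obtain ⟨q, hq | hq⟩ := Int.even_or_odd' (i + j + 1)
      · rw [hq] at he
        refine h1 (((M * R) ^ q) x) ?_
        rw [hμe x _ q he]; congr 2; ring
      · rw [hq] at he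
        refine h2 (((M * R) ^ q) x) ?_
        rw [hρe x _ q he]; congr 2; ring
    refine ⟨P, fun i => ((M * R) ^ i) x, hP1, ?_, fun i j h => (hP i j).2 h, ?_, fun i => hdisj i i,
      fun i => ⟨hstep x i, (hdisj _ _).symm⟩⟩
    · refine hconn {β | ∃ i : ℤ, β = ((M * R) ^ i) x ∨ β = ρ (((M * R) ^ i) x)} ⟨x, 0, Or.inl rfl⟩ ?_ ?_
      · rintro _ ⟨i, rfl | rfl⟩
        · exact ⟨i, Or.inr rfl⟩
        · exact ⟨i, Or.inl (hρ _)⟩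
      · rintro _ ⟨i, rfl | rfl⟩
        · refine ⟨i - 1, Or.inr ?_⟩
          have := hstep x (i - 1)
          rw [sub_add_cancel] at this
          rw [← this, hμ]
        · exact ⟨i + 1, Or.inl (hstep x i)⟩
    · rintro i j (h | h)
      · exact (hP i j).1 h
      · exact absurd h (hdisj i j)

end PathOrCycle

namespace ColoredRibbonGraph

variable {C : Type u} {G : ColoredRibbonGraph C}

theorem exists_sliceOf_eq (s : G.Slice) : ∃ β, G.sliceOf β = s := by
  obtain ⟨c, rfl⟩ := Quot.exists_rep s
  exact ⟨G.boundary c, rfl⟩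

theorem exists_stripOf_eq (s : G.Strip) : ∃ β, G.stripOf β = s := by
  obtain ⟨c, rfl⟩ := Quot.exists_rep s
  exact ⟨G.boundary c, rfl⟩

/-! ### Sequences of strips from paths and cycles of boundaries -/

/-- Where `acrossSlice` stops there is a crosscap. At any other end `acrossStrip` stops, so the
strip has one boundary and is singular or Möbius. -/
theorem isLinear_of_isPath [Finite C] (hG : G.IsCDT) {p q : Prop} {n : ℕ} {L : ℤ → G.Boundary}
    (h : IsPath hG.acrossSlice hG.acrossStrip p q n L) {a b : Cap} (ha : a = Cap.crosscap ↔ p)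
    (hb : b = Cap.crosscap ↔ q) (ha1 : a = Cap.singular → G.IsSingularStrip (G.stripOf (L 0)))
    (ha2 : a = Cap.mobius → ¬ G.IsSingularStrip (G.stripOf (L 0)))
    (hb1 : b = Cap.singular → G.IsSingularStrip (G.stripOf (hG.acrossSlice (L n))))
    (hb2 : b = Cap.mobius → ¬ G.IsSingularStrip (G.stripOf (hG.acrossSlice (L n)))) :
    G.IsLinear a b n := by
  refine ⟨fun h1 h2 => h.one_le (ha.1 h1) (hb.1 h2), fun i => L i.1, fun i => hG.acrossSlice (L i.1),
    ⟨?_, ?_⟩, fun i β => hG.sliceOf_eq_iff, ?_, ?_, ?_, ?_, ?_, ?_⟩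
  · intro i j hij
    have := h.eq_of i.1 j.1 (by omega) (by omega) (by omega) (by omega) (hG.sliceOf_eq_iff.1 hij)
    exact Fin.ext (by omega)
  · intro s
    obtain ⟨β, rfl⟩ := exists_sliceOf_eq s
    obtain ⟨i, h0, hi, hβ⟩ := h.exhaust β
    refine ⟨⟨i.toNat, by omega⟩, ?_⟩
    simp only [Int.toNat_of_nonneg h0]
    exact (hG.sliceOf_eq_iff.2 hβ).symm
  · intro i
    rw [h.fixed_iff i.1 (by omega) (by omega), ha, hb, Fin.ext_iff, Fin.ext_iff, Fin.val_last, Fin.val_zero,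
      Nat.cast_eq_zero, Nat.cast_inj]
  · intro i
    obtain ⟨h1, h2⟩ := h.step i.1 (by omega) (by omega)
    have e : (i.succ.1 : ℤ) = i.1 + 1 := by simp
    simp only [e, Fin.val_castSucc]
    refine ⟨h2, ?_, ?_⟩
    · rw [← h1, hG.stripOf_acrossStrip]
    · rw [hG.isRegularStrip_iff, h1]
      exact h2.symm
  · exact ha1
  · intro e
    have hp : ¬ p := fun hp => by simp [ha.2 hp] at e
    exact (hG.isMobiusStrip_iff _).2 ⟨ha2 e, h.left hp⟩
  · exact hb1
  · intro e
    have hq : ¬ q := fun hq => by simp [hb.2 hq] at e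
    exact (hG.isMobiusStrip_iff _).2 ⟨hb2 e, h.right hq⟩

theorem isPeriodic_of_isLoop [Finite C] (hG : G.IsCDT) {n : ℕ} {L : ℤ → G.Boundary}
    (h : IsLoop hG.acrossSlice hG.acrossStrip n L) : G.IsPeriodic n := by
  have hn := h.one_le
  have hL : ∀ i : ℤ, L ((i : ZMod n).cast) = L i := fun i => h.periodic _ _ (by
    rw [dvd_sub_comm, ← ZMod.intCast_eq_intCast_iff_dvd_sub, ZMod.intCast_zmod_cast])
  refine ⟨hn, fun z => L z.cast, fun z => hG.acrossSlice (L z.cast), ⟨?_, ?_⟩,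
    fun i β => hG.sliceOf_eq_iff, fun z => h.not_fixed _, fun z => ?_⟩
  · intro z w hzw
    have := h.eq_of _ _ (hG.sliceOf_eq_iff.1 hzw)
    rw [dvd_sub_comm, ← ZMod.intCast_eq_intCast_iff_dvd_sub, ZMod.intCast_zmod_cast,
      ZMod.intCast_zmod_cast] at this
    exact this
  · intro s
    obtain ⟨β, rfl⟩ := exists_sliceOf_eq s
    obtain ⟨i, hβ⟩ := h.exhaust β
    refine ⟨(i : ZMod n), ?_⟩
    simp only [hL]
    exact (hG.sliceOf_eq_iff.2 hβ).symm
  · obtain ⟨i, rfl⟩ := ZMod.intCast_surjective z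
    obtain ⟨h1, h2⟩ := h.step i
    have e : L ((i : ZMod n) + 1).cast = L (i + 1) := by
      rw [← hL (i + 1)]
      push_cast
      rfl
    simp only [hL, e]
    refine ⟨h2, ?_, ?_⟩
    · rw [← h1, hG.stripOf_acrossStrip]
    · rw [hG.isRegularStrip_iff, h1]
      exact h2.symm

theorem IsLinear.symm {a b : Cap} {n : ℕ} (h : G.IsLinear a b n) : G.IsLinear b a n := by
  obtain ⟨h1, L, R, hb, hs, hr, hstep, a1, a2, b1, b2⟩ := h
  have hR : ∀ i, G.sliceOf (R i) = G.sliceOf (L i) := fun i => (hs i _).2 (Or.inr rfl)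
  refine ⟨fun k l => h1 l k, fun i => R i.rev, fun i => L i.rev, ?_, fun i β => ?_, fun i => ?_,
    fun i => ?_, ?_, ?_, ?_, ?_⟩
  · have e : (fun i => G.sliceOf (R (Fin.rev i))) = (fun i => G.sliceOf (L i)) ∘ Fin.rev :=
      funext fun i => hR _
    rw [e]
    exact hb.comp Fin.rev_bijective
  · rw [hR, hs, or_comm]
  · rw [eq_comm, hr, Fin.rev_eq_iff, Fin.rev_eq_iff, Fin.rev_zero, Fin.rev_last, or_comm]
  · obtain ⟨k1, k2, k3⟩ := hstep i.rev
    simp only [Fin.rev_castSucc, Fin.rev_succ]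
    refine ⟨k1.symm, k2.symm, ?_⟩
    rwa [← k2]
  · simpa only [Fin.rev_zero] using b1
  · simpa only [Fin.rev_zero] using b2
  · simpa only [Fin.rev_last] using a1
  · simpa only [Fin.rev_last] using a2

/-! ### Ends of sequences, the Euler characteristic and the surface -/

namespace IsCDT

variable [Finite C]

theorem isLinear_or_isPeriodic (hG : G.IsCDT) (hc : G.Connected) :
    (∃ a b n, G.IsLinear a b n) ∨ ∃ n, G.IsPeriodic n := by
  classical
  obtain ⟨c⟩ := hc.1
  have : Finite G.Boundary := inferInstanceAs (Finite (Quot _))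
  have : Nonempty G.Boundary := ⟨G.boundary c⟩
  rcases exists_isPath_or_isLoop hG.acrossSlice_acrossSlice hG.acrossStrip_acrossStrip
    (fun A hA h1 h2 => hG.boundary_induction hc hA h1 h2) with ⟨p, q, n, L, h⟩ | ⟨n, L, h⟩
  · left
    have cap : ∀ (r : Prop) (β : G.Boundary), ∃ a : Cap, (a = Cap.crosscap ↔ r) ∧
        (a = Cap.singular → G.IsSingularStrip (G.stripOf β)) ∧
        (a = Cap.mobius → ¬ G.IsSingularStrip (G.stripOf β)) := by
      intro r β
      by_cases hr : r
      · exact ⟨Cap.crosscap, by simp [hr]⟩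
      · by_cases hs : G.IsSingularStrip (G.stripOf β)
        · exact ⟨Cap.singular, by simp [hr, hs]⟩
        · exact ⟨Cap.mobius, by simp [hr, hs]⟩
    obtain ⟨a, ha, ha1, ha2⟩ := cap p (L 0)
    obtain ⟨b, hb, hb1, hb2⟩ := cap q (hG.acrossSlice (L n))
    exact ⟨a, b, n, isLinear_of_isPath hG h ha hb ha1 ha2 hb1 hb2⟩
  · exact Or.inr ⟨n, isPeriodic_of_isLoop hG h⟩

theorem acrossSlice_eq (hG : G.IsCDT) {β γ : G.Boundary}
    (h : ∀ δ, G.sliceOf δ = G.sliceOf β ↔ δ = β ∨ δ = γ) : hG.acrossSlice β = γ := by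
  rcases (h _).1 (hG.sliceOf_acrossSlice β) with e | e
  · rcases hG.sliceOf_eq_iff.1 ((h γ).2 (Or.inr rfl)) with e' | e'
    · rw [e, e']
    · exact e'.symm
  · exact e

theorem numSingularFaces_eq_zero (hs : ∀ β : G.Boundary, ¬ G.IsSingularStrip (G.stripOf β)) :
    G.numSingularFaces = 0 := by
  rw [numSingularFaces_eq, Nat.card_eq_zero]
  refine Or.inl ⟨?_⟩
  rintro ⟨s, h⟩
  obtain ⟨β, rfl⟩ := exists_stripOf_eq s
  exact hs β h

theorem one_le_numSingularFaces {s : G.Strip} (hs : G.IsSingularStrip s) :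
    1 ≤ G.numSingularFaces := by
  have : Finite G.Strip := inferInstanceAs (Finite (Quot _))
  rw [numSingularFaces_eq, Nat.one_le_iff_ne_zero, ← Nat.pos_iff_ne_zero]
  exact Finite.card_pos_iff.2 ⟨⟨s, hs⟩⟩

theorem two_le_numSingularFaces {s t : G.Strip} (hs : G.IsSingularStrip s) (ht : G.IsSingularStrip t)
    (h : s ≠ t) : 2 ≤ G.numSingularFaces := by
  have : Finite G.Strip := inferInstanceAs (Finite (Quot _))
  rw [numSingularFaces_eq]
  have : Nontrivial {s : G.Strip // G.IsSingularStrip s} :=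
    ⟨⟨s, hs⟩, ⟨t, ht⟩, fun e => h (congrArg Subtype.val e)⟩
  exact Finite.one_lt_card

/-- `β` is where a sequence of strips ends with a cap of kind `e`. -/
def HasCap (hG : G.IsCDT) : Cap → G.Boundary → Prop
  | .singular, β => G.IsSingularStrip (G.stripOf β)
  | .mobius, β => G.IsMobiusStrip (G.stripOf β)
  | .crosscap, β => hG.acrossSlice β = β

/-- The only caps of a linear sequence are its ends. -/
theorem _root_.ColoredRibbonGraph.IsLinear.exists_ends (hG : G.IsCDT) {a b : Cap} {n : ℕ}
    (h : G.IsLinear a b n) :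
    ∃ β γ, ∀ e δ, hG.HasCap e δ → (e = a ∧ δ = β) ∨ (e = b ∧ δ = γ) := by
  obtain ⟨h1, L, R, hbij, hs, hr, hstep, a1, a2, b1, b2⟩ := h
  have hL : ∀ i : Fin n, hG.acrossStrip (L i.succ) ≠ L i.succ := fun i => by
    rw [← hG.isRegularStrip_iff, ← (hstep i).2.1]
    exact (hstep i).2.2
  have hR : ∀ i : Fin n, hG.acrossStrip (R i.castSucc) ≠ R i.castSucc := fun i =>
    (hG.isRegularStrip_iff _).1 (hstep i).2.2
  have fixed : ∀ δ, hG.acrossStrip δ = δ →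
      (a ≠ .crosscap ∧ δ = L 0) ∨ (b ≠ .crosscap ∧ δ = R (Fin.last n)) := by
    -- At a crosscap `L 0 = R 0`. For `n ≥ 1` this boundary belongs to a regular strip; for `n = 0`
    -- it may carry the cap at the other end, which is then not a crosscap.
    have h0 : hG.acrossStrip (L 0) = L 0 → a ≠ .crosscap ∨ b ≠ .crosscap ∧ L 0 = R (Fin.last n) := by
      intro e
      by_contra! hc
      have e' := (hr 0).2 (Or.inl ⟨rfl, hc.1⟩)
      cases n with
      | zero => exact absurd (h1 hc.1 (not_not.1 fun hb => hc.2 hb e')) (by omega)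
      | succ n => exact hR 0 (by rw [Fin.castSucc_zero, ← e']; exact e)
    have hl : hG.acrossStrip (R (Fin.last n)) = R (Fin.last n) →
        b ≠ .crosscap ∨ a ≠ .crosscap ∧ R (Fin.last n) = L 0 := by
      intro e
      by_contra! hc
      have e' := (hr (Fin.last n)).2 (Or.inr ⟨rfl, hc.1⟩)
      cases n with
      | zero => exact absurd (h1 (not_not.1 fun ha => hc.2 ha e'.symm) hc.1) (by omega)
      | succ n => exact hL (Fin.last n) (by rw [Fin.succ_last, e']; exact e)
    intro δ hδ
    obtain ⟨i, hi⟩ := hbij.2 (G.sliceOf δ)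
    rcases (hs i δ).1 hi.symm with rfl | rfl
    · cases i using Fin.cases with
      | zero =>
        rcases h0 hδ with k | k
        · exact Or.inl ⟨k, rfl⟩
        · exact Or.inr k
      | succ i => exact absurd hδ (hL i)
    · cases i using Fin.lastCases with
      | last =>
        rcases hl hδ with k | k
        · exact Or.inr ⟨k, rfl⟩
        · exact Or.inl k
      | cast i => exact absurd hδ (hR i)
  refine ⟨L 0, R (Fin.last n), fun e δ he => ?_⟩
  cases e with
  | singular =>
    rcases fixed δ (hG.acrossStrip_of_isSingularStrip he) with ⟨k, rfl⟩ | ⟨k, rfl⟩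
    · left
      cases a with
      | singular => exact ⟨rfl, rfl⟩
      | mobius => exact absurd he (a2 rfl).1
      | crosscap => exact absurd rfl k
    · right
      cases b with
      | singular => exact ⟨rfl, rfl⟩
      | mobius => exact absurd he (b2 rfl).1
      | crosscap => exact absurd rfl k
  | mobius =>
    rcases fixed δ ((hG.isMobiusStrip_iff δ).1 he).2 with ⟨k, rfl⟩ | ⟨k, rfl⟩
    · left
      cases a with
      | singular => exact absurd (a1 rfl) he.1
      | mobius => exact ⟨rfl, rfl⟩
      | crosscap => exact absurd rfl k
    · right
      cases b with
      | singular => exact absurd (b1 rfl) he.1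
      | mobius => exact ⟨rfl, rfl⟩
      | crosscap => exact absurd rfl k
  | crosscap =>
    have he : hG.acrossSlice δ = δ := he
    obtain ⟨i, hi⟩ := hbij.2 (G.sliceOf δ)
    have hLR : hG.acrossSlice (L i) = R i := hG.acrossSlice_eq (hs i)
    have key : δ = L i ∧ δ = R i := by
      rcases (hs i δ).1 hi.symm with rfl | rfl
      · exact ⟨rfl, he.symm.trans hLR⟩
      · have := congrArg hG.acrossSlice hLR
        rw [hG.acrossSlice_acrossSlice, he] at this
        exact ⟨this.symm, rfl⟩
    rcases (hr i).1 (key.1.symm.trans key.2) with ⟨rfl, k⟩ | ⟨rfl, k⟩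
    · exact Or.inl ⟨k.symm, key.1⟩
    · exact Or.inr ⟨k.symm, key.2⟩

theorem _root_.ColoredRibbonGraph.IsLinear.not_isSingularStrip (hG : G.IsCDT) {a b : Cap} {n : ℕ}
    (h : G.IsLinear a b n) (ha : a ≠ Cap.singular) (hb : b ≠ Cap.singular) (β : G.Boundary) :
    ¬ G.IsSingularStrip (G.stripOf β) := by
  obtain ⟨_, _, key⟩ := h.exists_ends hG
  intro hs
  rcases key .singular β hs with ⟨e, -⟩ | ⟨e, -⟩
  exacts [ha e.symm, hb e.symm]

theorem _root_.ColoredRibbonGraph.IsPeriodic.not_hasCap (hG : G.IsCDT) {n : ℕ}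
    (h : G.IsPeriodic n) (e : Cap) (β : G.Boundary) : ¬ hG.HasCap e β := by
  obtain ⟨h1, L, R, hbij, hs, hr, hstep⟩ := h
  obtain ⟨i, hi⟩ := hbij.2 (G.sliceOf β)
  have hLR : hG.acrossSlice (L i) = R i := hG.acrossSlice_eq (hs i)
  have h2 : hG.acrossStrip β ≠ β := by
    rw [← hG.isRegularStrip_iff]
    rcases (hs i β).1 hi.symm with rfl | rfl
    · obtain ⟨k1, k2, k3⟩ := hstep (i - 1)
      rw [sub_add_cancel] at k2
      rwa [← k2]
    · exact (hstep i).2.2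
  cases e with
  | singular => exact fun k => h2 (hG.acrossStrip_of_isSingularStrip k)
  | mobius => exact fun k => h2 ((hG.isMobiusStrip_iff β).1 k).2
  | crosscap =>
    intro k
    have k : hG.acrossSlice β = β := k
    rcases (hs i β).1 hi.symm with rfl | rfl
    · exact hr i (k.symm.trans hLR)
    · rw [← hLR, hG.acrossSlice_acrossSlice] at k
      exact hr i (k.trans hLR)

/-- Two different caps exclude a cycle and must be the two ends of a path, in one order or the
other; the number of slices gives the length. -/
theorem isLinear_of_hasCap (hG : G.IsCDT) (hc : G.Connected) {e e' : Cap} {β β' : G.Boundary}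
    (h : hG.HasCap e β) (h' : hG.HasCap e' β') (hne : e ≠ e' ∨ β ≠ β') :
    ∃ n, G.IsLinear e e' n ∧ Nat.card G.Slice = n + 1 := by
  rcases hG.isLinear_or_isPeriodic hc with ⟨a, b, n, hl⟩ | ⟨n, hl⟩
  · have hcard : Nat.card G.Slice = n + 1 := by
      obtain ⟨-, L, R, hbij, -⟩ := hl
      rw [← Nat.card_congr (Equiv.ofBijective _ hbij), Nat.card_fin]
    refine ⟨n, ?_, hcard⟩
    obtain ⟨γ, γ', key⟩ := hl.exists_ends hG
    rcases key e β h with ⟨rfl, rfl⟩ | ⟨rfl, rfl⟩ <;>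
      rcases key e' β' h' with ⟨rfl, rfl⟩ | ⟨rfl, rfl⟩
    · simp at hne
    · exact hl
    · exact hl.symm
    · simp at hne
  · exact absurd h (hl.not_hasCap hG e β)

/-- Every linear sequence has a cap at its first boundary. -/
theorem isPeriodic_of_not_hasCap (hG : G.IsCDT) (hc : G.Connected)
    (h : ∀ e β, ¬ hG.HasCap e β) : G.IsPeriodic (Nat.card G.Slice) := by
  rcases hG.isLinear_or_isPeriodic hc with ⟨a, b, n, hl⟩ | ⟨n, hl⟩
  · obtain ⟨-, L, R, -, hs, hr, -, a1, a2, -, -⟩ := hl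
    refine absurd ?_ (h a (L 0))
    cases a with
    | singular => exact a1 rfl
    | mobius => exact a2 rfl
    | crosscap => exact (hG.acrossSlice_eq (hs 0)).trans ((hr 0).2 (Or.inl ⟨rfl, rfl⟩)).symm
  · have hcard : Nat.card G.Slice = n := by
      obtain ⟨-, L, R, hbij, -⟩ := hl
      rw [← Nat.card_congr (Equiv.ofBijective _ hbij), Nat.card_zmod]
    rwa [hcard]

/-- The two singular ends are different faces, and χ counts singular faces but is at most 2. -/
theorem eulerChar_of_singular_singular (hG : G.IsCDT) (hc : G.Connected) {n : ℕ}
    (h : G.IsLinear .singular .singular n) : G.eulerChar = 2 ∧ 1 ≤ n := by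
  obtain ⟨-, L, R, hbij, hs, hr, hstep, a1, -, b1, -⟩ := h
  -- Equality would put both ends on one slice with coinciding sides, that is, on a crosscap.
  have hne : L 0 ≠ R (Fin.last n) := by
    intro e
    have : (0 : Fin (n + 1)) = Fin.last n := by
      refine hbij.1 ?_
      show G.sliceOf (L 0) = G.sliceOf (L (Fin.last n))
      rw [e]
      exact (hs _ _).2 (Or.inr rfl)
    rw [← this, hr] at e
    simp at e
  have h2 : 2 ≤ G.numSingularFaces := by
    refine two_le_numSingularFaces (a1 rfl) (b1 rfl) fun e => ?_
    rcases hG.stripOf_eq_iff.1 e with e | e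
    · exact hne e
    · rw [hG.acrossStrip_of_isSingularStrip (b1 rfl)] at e
      exact hne e
  have h3 := (G.classification hc).1
  rw [hG.eulerChar_eq] at h3 ⊢
  refine ⟨by omega, Nat.one_le_iff_ne_zero.2 ?_⟩
  -- With `n = 0` both sides of the only slice would be singular, leaving no room for the timelike
  -- ends at its discs.
  rintro rfl
  rcases hG.exists_not_isSingularStrip (L 0) with k | k
  · exact k (a1 rfl)
  · rw [hG.acrossSlice_eq (hs 0)] at k
    exact k (b1 rfl)

theorem _root_.ColoredRibbonGraph.IsLinear.eq_singular (hG : G.IsCDT) (ho : G.Orientable) {a b : Cap}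
    {n : ℕ} (h : G.IsLinear a b n) : a = .singular ∧ b = .singular := by
  have key : ∀ {a b}, G.IsLinear a b n → a = .singular := by
    rintro a b ⟨-, L, R, -, hs, hr, -, -, a2, -, -⟩
    cases a with
    | singular => rfl
    | mobius => exact absurd (a2 rfl) (hG.not_isMobiusStrip ho _)
    | crosscap =>
      have e := (hr 0).2 (Or.inl ⟨rfl, rfl⟩)
      rw [← hG.acrossSlice_eq (hs 0)] at e
      exact absurd e.symm (hG.acrossSlice_ne ho _)
  exact ⟨key h, key h.symm⟩

theorem eulerChar_of_isPeriodic (hG : G.IsCDT) {n : ℕ} (h : G.IsPeriodic n) : G.eulerChar = 0 := by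
  rw [hG.eulerChar_eq, numSingularFaces_eq_zero (h.not_hasCap hG .singular)]
  rfl

theorem eulerChar_of_orientable (hG : G.IsCDT) (hc : G.Connected) (ho : G.Orientable) :
    (G.eulerChar = 2 ∧ ∃ n, 1 ≤ n ∧ G.IsLinear .singular .singular n) ∨
      (G.eulerChar = 0 ∧ ∃ n, G.IsPeriodic n) := by
  rcases hG.isLinear_or_isPeriodic hc with ⟨a, b, n, h⟩ | ⟨n, h⟩
  · obtain ⟨rfl, rfl⟩ := h.eq_singular hG ho
    obtain ⟨h1, h2⟩ := hG.eulerChar_of_singular_singular hc h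
    exact Or.inl ⟨h1, n, h2, h⟩
  · exact Or.inr ⟨hG.eulerChar_of_isPeriodic h, n, h⟩

/-- χ is nonnegative as a number of faces and at most 2 by the classification. -/
theorem eulerChar_cases (hG : G.IsCDT) (hc : G.Connected) :
    G.eulerChar = 0 ∨ G.eulerChar = 1 ∨ G.eulerChar = 2 := by
  have := (G.classification hc).1
  rw [hG.eulerChar_eq] at this ⊢
  omega

theorem surface_of_not_orientable (hG : G.IsCDT) (hc : G.Connected) (ho : ¬ G.Orientable) :
    (G.eulerChar = 1 ∧ Nonempty (G.Surface ≃ₜ ModelSurface.ProjectivePlane)) ∨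
      (G.eulerChar = 0 ∧ Nonempty (G.Surface ≃ₜ ModelSurface.KleinBottle)) := by
  obtain ⟨-, h2, h1, h0⟩ := G.classification hc
  rcases hG.eulerChar_cases hc with e | e | e
  · exact Or.inr ⟨e, (h0 e).2 ho⟩
  · exact Or.inl ⟨e, h1 e⟩
  · exact absurd (h2 e).1 ho

theorem sphere_of_isLinear (hG : G.IsCDT) (hc : G.Connected) {n : ℕ}
    (h : G.IsLinear .singular .singular n) : Nonempty (G.Surface ≃ₜ ModelSurface.Sphere) :=
  ((G.classification hc).2.1 (hG.eulerChar_of_singular_singular hc h).1).2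

/-- An end that is not singular prevents orientability, which leaves χ = 0 or 1; the singular end
makes χ positive. -/
theorem projectivePlane_of_isLinear (hG : G.IsCDT) (hc : G.Connected) {n : ℕ} {b : Cap}
    (hb : b ≠ .singular) (h : G.IsLinear .singular b n) :
    Nonempty (G.Surface ≃ₜ ModelSurface.ProjectivePlane) := by
  have ho : ¬ G.Orientable := fun ho => hb (h.eq_singular hG ho).2
  obtain ⟨-, L, R, -, -, -, -, a1, -⟩ := h
  rcases hG.surface_of_not_orientable hc ho with e | ⟨e, -⟩
  · exact e.2
  · have := one_le_numSingularFaces (a1 rfl)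
    rw [hG.eulerChar_eq] at e
    omega

theorem kleinBottle_of_isLinear (hG : G.IsCDT) (hc : G.Connected) {n : ℕ} {a b : Cap}
    (ha : a ≠ .singular) (hb : b ≠ .singular) (h : G.IsLinear a b n) :
    Nonempty (G.Surface ≃ₜ ModelSurface.KleinBottle) := by
  have ho : ¬ G.Orientable := fun ho => hb (h.eq_singular hG ho).2
  refine ((G.classification hc).2.2.2 ?_).2 ho
  rw [hG.eulerChar_eq, numSingularFaces_eq_zero (h.not_isSingularStrip hG ha hb)]
  rfl

theorem torus_of_isPeriodic (hG : G.IsCDT) (hc : G.Connected) {n : ℕ} (h : G.IsPeriodic n)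
    (ho : G.Orientable) : Nonempty (G.Surface ≃ₜ ModelSurface.Torus) :=
  ((G.classification hc).2.2.2 (hG.eulerChar_of_isPeriodic h)).1 ho

theorem kleinBottle_of_isPeriodic (hG : G.IsCDT) (hc : G.Connected) {n : ℕ} (h : G.IsPeriodic n)
    (ho : ¬ G.Orientable) : Nonempty (G.Surface ≃ₜ ModelSurface.KleinBottle) :=
  ((G.classification hc).2.2.2 (hG.eulerChar_of_isPeriodic h)).2 ho

end IsCDT

end ColoredRibbonGraph

theorem classification_of_isCDT {C : Type u} [Finite C] (G : ColoredRibbonGraph C) (hG : G.IsCDT) :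
    G.eulerChar = G.numSingularFaces ∧
      (G.Connected →
        (G.eulerChar = 0 ∨ G.eulerChar = 1 ∨ G.eulerChar = 2) ∧
        ((∃ a b n, G.IsLinear a b n) ∨ ∃ n, G.IsPeriodic n) ∧
        (G.Orientable →
          (G.eulerChar = 2 ∧ Nonempty (G.Surface ≃ₜ ModelSurface.Sphere) ∧
            ∃ n, 1 ≤ n ∧ G.IsLinear .singular .singular n) ∨
          (G.eulerChar = 0 ∧ Nonempty (G.Surface ≃ₜ ModelSurface.Torus) ∧ ∃ n, G.IsPeriodic n)) ∧
        (¬ G.Orientable →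
          (G.eulerChar = 1 ∧ Nonempty (G.Surface ≃ₜ ModelSurface.ProjectivePlane)) ∨
          (G.eulerChar = 0 ∧ Nonempty (G.Surface ≃ₜ ModelSurface.KleinBottle))) ∧
        (∀ n, G.IsLinear .singular .singular n → Nonempty (G.Surface ≃ₜ ModelSurface.Sphere)) ∧
        (∀ n, G.IsPeriodic n → G.Orientable → Nonempty (G.Surface ≃ₜ ModelSurface.Torus)) ∧
        (∀ n, G.IsLinear .singular .mobius n ∨ G.IsLinear .singular .crosscap n →
          Nonempty (G.Surface ≃ₜ ModelSurface.ProjectivePlane)) ∧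
        (∀ n, G.IsLinear .mobius .mobius n ∨ G.IsLinear .mobius .crosscap n ∨
            G.IsLinear .crosscap .crosscap n ∨ (G.IsPeriodic n ∧ ¬ G.Orientable) →
          Nonempty (G.Surface ≃ₜ ModelSurface.KleinBottle))) := by
  refine ⟨hG.eulerChar_eq, fun hc => ⟨hG.eulerChar_cases hc, hG.isLinear_or_isPeriodic hc,
    fun ho => ?_, hG.surface_of_not_orientable hc, fun n h => hG.sphere_of_isLinear hc h,
    fun n h => hG.torus_of_isPeriodic hc h, ?_, ?_⟩⟩
  · rcases hG.eulerChar_of_orientable hc ho with ⟨h1, n, h2, h3⟩ | ⟨h1, n, h2⟩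
    · exact Or.inl ⟨h1, hG.sphere_of_isLinear hc h3, n, h2, h3⟩
    · exact Or.inr ⟨h1, hG.torus_of_isPeriodic hc h2 ho, n, h2⟩
  · rintro n (h | h)
    · exact hG.projectivePlane_of_isLinear hc (by simp) h
    · exact hG.projectivePlane_of_isLinear hc (by simp) h
  · rintro n (h | h | h | ⟨h, ho⟩)
    · exact hG.kleinBottle_of_isLinear hc (by simp) (by simp) h
    · exact hG.kleinBottle_of_isLinear hc (by simp) (by simp) h
    · exact hG.kleinBottle_of_isLinear hc (by simp) (by simp) h
    · exact hG.kleinBottle_of_isPeriodic hc h ho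

/-! ### Models for statement (B): discs along slices -/

/-- A rule for joining trivalent discs along slices: `next` is the successor along a slice, whose
edge is twisted as told by `twist`; `mate` is the other end of the timelike edge, which leaves the
slice on the side told by `side` and is twisted as told by `flip`. -/
structure SlicePattern (W : Type) where
  next : Equiv.Perm W
  mate : W → W
  side : W → Bool
  twist : W → Bool
  flip : W → Bool
  mate_mate : ∀ m, mate (mate m) = m
  mate_ne : ∀ m, mate m ≠ m
  flip_mate : ∀ m, flip (mate m) = flip m

namespace SlicePattern

variable {W : Type} (P : SlicePattern W)

/-- The corners of the timelike edge ends, which lie in forward (`true`) or backward direction, and the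
corners of the spacelike edge ends in forward or backward direction on the two sides of the slice. -/
abbrev Corner (W : Type) : Type := W × Bool ⊕ W × Bool × Bool

abbrev time (m : W) (d : Bool) : Corner W := Sum.inl (m, d)

abbrev space (m : W) (d s : Bool) : Corner W := Sum.inr (m, d, s)

/-- The disc of a corner. -/
def disc : Corner W → W := Sum.elim Prod.fst Prod.fst

def strand : Corner W → Corner W
  | Sum.inl (m, d) => time (P.mate m) (xor d (P.flip m))
  | Sum.inr (m, true, s) => space (P.next m) false (xor s (P.twist m))
  | Sum.inr (m, false, s) => space (P.next.symm m) true (xor s (P.twist (P.next.symm m)))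

def arc : Corner W → Corner W
  | Sum.inl (m, d) => space m d (P.side m)
  | Sum.inr (m, d, s) => if s = P.side m then time m d else space m (!d) s

def cross : Corner W → Corner W
  | Sum.inl (m, d) => time m (!d)
  | Sum.inr (m, d, s) => space m d (!s)

def graph : ColoredRibbonGraph (Corner W) where
  strand := P.strand
  arc := P.arc
  cross := cross
  strand_strand := by
    rintro (⟨m, d⟩ | ⟨m, _ | _, s⟩) <;> simp [strand, P.mate_mate, P.flip_mate]
  arc_arc := by
    rintro (⟨m, d⟩ | ⟨m, d, s⟩)
    · simp [arc]
    · by_cases h : s = P.side m <;> simp [arc, h]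
  cross_cross := by rintro (⟨m, d⟩ | ⟨m, d, s⟩) <;> simp [cross]
  strand_ne := by rintro (⟨m, d⟩ | ⟨m, _ | _, s⟩) <;> simp [strand, P.mate_ne]
  arc_ne := by
    rintro (⟨m, d⟩ | ⟨m, d, s⟩)
    · simp [arc]
    · by_cases h : s = P.side m <;> simp [arc, h]
  cross_ne := by rintro (⟨m, d⟩ | ⟨m, d, s⟩) <;> simp [cross]
  strand_cross := by rintro (⟨m, d⟩ | ⟨m, _ | _, s⟩) <;> simp [strand, cross]
  strand_cross_ne := by rintro (⟨m, d⟩ | ⟨m, _ | _, s⟩) <;> simp [strand, cross, P.mate_ne]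
  timelike c := c.isLeft
  timelike_strand := by rintro (⟨m, d⟩ | ⟨m, _ | _, s⟩) <;> simp [strand]
  timelike_cross := by rintro (⟨m, d⟩ | ⟨m, d, s⟩) <;> simp [cross]

theorem timelike_time (m : W) (d : Bool) : P.graph.timelike (time m d) := rfl

theorem not_timelike_space (m : W) (d s : Bool) : ¬ P.graph.timelike (space m d s) :=
  Bool.false_ne_true

theorem exists_time {c : Corner W} (h : P.graph.timelike c) : ∃ m d, c = time m d := by
  rcases c with ⟨m, d⟩ | ⟨m, d, s⟩
  · exact ⟨m, d, rfl⟩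
  · exact absurd h (P.not_timelike_space m d s)

theorem exists_space {c : Corner W} (h : ¬ P.graph.timelike c) : ∃ m d s, c = space m d s := by
  rcases c with ⟨m, d⟩ | ⟨m, d, s⟩
  · exact absurd (P.timelike_time m d) h
  · exact ⟨m, d, s, rfl⟩

theorem arc_other (m : W) (d : Bool) : P.graph.arc (space m d (!P.side m)) = space m (!d) (!P.side m) :=
  if_neg (by simp)

/-! ### Paths inside boundaries -/

theorem boundary_time (m : W) (d : Bool) :
    P.graph.boundary (time m d) = P.graph.boundary (space m d (P.side m)) :=
  (P.graph.boundary_arc (time m d)).symm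

theorem boundary_time_not (m : W) (d : Bool) :
    P.graph.boundary (time m (!d)) = P.graph.boundary (time m d) :=
  ColoredRibbonGraph.boundary_cross (P.timelike_time m d)

theorem boundary_other (m : W) (d : Bool) :
    P.graph.boundary (space m (!d) (!P.side m)) = P.graph.boundary (space m d (!P.side m)) := by
  rw [← P.arc_other m d, ColoredRibbonGraph.boundary_arc]

/-- The two directions of a slice at a disc belong to the same boundary. -/
theorem boundary_space (m : W) (s : Bool) :
    P.graph.boundary (space m true s) = P.graph.boundary (space m false s) := by
  by_cases h : s = P.side m
  · rw [h, ← boundary_time, ← boundary_time, ← P.boundary_time_not m false, Bool.not_false]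
  · obtain rfl : s = !P.side m := Bool.eq_not.2 h
    exact P.boundary_other m false

theorem boundary_next (m : W) (d d' s : Bool) :
    P.graph.boundary (space (P.next m) d (xor s (P.twist m))) = P.graph.boundary (space m d' s) := by
  have key : P.graph.boundary (space (P.next m) false (xor s (P.twist m))) =
      P.graph.boundary (space m true s) :=
    ColoredRibbonGraph.boundary_strand (P.not_timelike_space m true s)
  have h1 := P.boundary_space (P.next m) (xor s (P.twist m))
  have h2 := P.boundary_space m s
  cases d <;> cases d'
  exacts [key.trans h2, key, h1.trans (key.trans h2), h1.trans key]

/-- The boundary on one side of a disc. -/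
def bd (m : W) (s : Bool) : P.graph.Boundary := P.graph.boundary (space m false s)

theorem bd_next (m : W) (s : Bool) : P.bd (P.next m) (xor s (P.twist m)) = P.bd m s :=
  P.boundary_next m false false s

theorem boundary_time_eq (m : W) (d : Bool) : P.graph.boundary (time m d) = P.bd m (P.side m) := by
  rw [boundary_time]
  cases d
  · rfl
  · exact P.boundary_space m _

theorem boundary_space_eq (m : W) (d s : Bool) : P.graph.boundary (space m d s) = P.bd m s := by
  cases d
  · rfl
  · exact P.boundary_space m _

theorem exists_bd (β : P.graph.Boundary) : ∃ m s, β = P.bd m s := by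
  obtain ⟨⟨m, d⟩ | ⟨m, d, s⟩, rfl⟩ := ColoredRibbonGraph.exists_boundary_eq β
  · exact ⟨m, _, P.boundary_time_eq m d⟩
  · exact ⟨m, s, P.boundary_space_eq m d s⟩

/-- Quantities that are constant along the sides of the slices distinguish boundaries. -/
theorem eq_of_bd_eq {Λ : Type*} (F : W → Bool → Λ)
    (hF : ∀ m s, F (P.next m) (xor s (P.twist m)) = F m s) {m m' : W} {s s' : Bool}
    (h : P.bd m s = P.bd m' s') : F m s = F m' s' := by
  let R : Corner W → Λ := Sum.elim (fun x => F x.1 (P.side x.1)) (fun x => F x.1 x.2.2)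
  refine rel_of_quot_eq (R := fun x y => R x = R y)
    ⟨fun _ => rfl, fun h => h.symm, fun h h' => h.trans h'⟩ ?_ h
  rintro x y (⟨ht, rfl⟩ | rfl | ⟨ht, rfl⟩)
  · obtain ⟨m, _ | _, s, rfl⟩ := P.exists_space ht
    · have := hF (P.next.symm m) (xor s (P.twist (P.next.symm m)))
      rw [Equiv.apply_symm_apply, Bool.xor_assoc, Bool.xor_self, Bool.xor_false] at this
      exact this
    · exact (hF m s).symm
  · rcases x with ⟨m, d⟩ | ⟨m, d, s⟩
    · rfl
    · by_cases h : s = P.side m <;> simp [graph, arc, h, R]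
  · obtain ⟨m, d, rfl⟩ := P.exists_time ht
    rfl

theorem isSingularStrip_bd [Finite W] {m : W} {s : Bool}
    (h : ∀ m' s', P.bd m' s' = P.bd m s → s' ≠ P.side m') :
    P.graph.IsSingularStrip (P.graph.stripOf (P.bd m s)) := by
  refine (ColoredRibbonGraph.IsCDT.isSingularStrip_iff _).2 fun c hc ht => ?_
  obtain ⟨m', d, rfl⟩ := P.exists_time ht
  rw [boundary_time_eq] at hc
  exact h _ _ hc rfl

theorem not_isSingularStrip_bd [Finite W] (m : W) :
    ¬ P.graph.IsSingularStrip (P.graph.stripOf (P.bd m (P.side m))) := fun h =>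
  (ColoredRibbonGraph.IsCDT.isSingularStrip_iff _).1 h _ (P.boundary_time_eq m false)
    (P.timelike_time m false)

theorem acrossSlice_bd [Finite W] (hG : P.graph.IsCDT) (m : W) (s : Bool) :
    hG.acrossSlice (P.bd m s) = P.bd m (!s) :=
  hG.acrossSlice_boundary (P.not_timelike_space m false s)

theorem acrossStrip_bd [Finite W] (hG : P.graph.IsCDT) (m : W) :
    hG.acrossStrip (P.bd m (P.side m)) = P.bd (P.mate m) (P.side (P.mate m)) := by
  rw [← P.boundary_time_eq m false, hG.acrossStrip_boundary (P.timelike_time m false)]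
  exact P.boundary_time_eq _ _

theorem face_mate (m : W) (d : Bool) (hf : P.flip m = false) :
    P.graph.face (time (P.mate m) d) = P.graph.face (time m d) := by
  have := P.graph.face_strand (time m d)
  rw [← this]
  show _ = P.graph.face (time (P.mate m) (xor d (P.flip m)))
  rw [hf, Bool.xor_false]

/-- The face at a timelike edge that joins consecutive discs of a slice on the same side. -/
theorem face_of_next_eq_mate {m : W} (hn : P.next m = P.mate m) (ht : P.twist m = false)
    (hs : P.side (P.mate m) = P.side m) (hf : P.flip m = false) :
    P.graph.face (time m true) = P.graph.face (time m false) := by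
  have h1 : P.graph.face (space m true (P.side m)) = P.graph.face (time m true) :=
    P.graph.face_arc (time m true)
  have h2 : P.graph.face (space (P.next m) false (xor (P.side m) (P.twist m))) =
      P.graph.face (space m true (P.side m)) := P.graph.face_strand (space m true (P.side m))
  have h3 : P.graph.face (space (P.mate m) false (P.side (P.mate m))) =
      P.graph.face (time (P.mate m) false) := P.graph.face_arc (time (P.mate m) false)
  rw [ht, Bool.xor_false, hn, ← hs, h3, hs, h1] at h2
  rw [← h2, P.face_mate m false hf]

/-! ### Vertices, slices and connectedness -/

theorem vertex_eq (c : Corner W) : P.graph.vertex c = P.graph.vertex (time (disc c) false) := by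
  have h1 : ∀ m d, P.graph.vertex (time m d) = P.graph.vertex (time m false) := by
    intro m d
    cases d
    · rfl
    · exact P.graph.vertex_cross (time m false)
  have h2 : ∀ m d, P.graph.vertex (space m d (P.side m)) = P.graph.vertex (time m false) := fun m d =>
    (P.graph.vertex_arc (time m d)).trans (h1 m d)
  rcases c with ⟨m, d⟩ | ⟨m, d, s⟩
  · exact h1 m d
  · by_cases h : s = P.side m
    · rw [h]; exact h2 m d
    · obtain rfl : s = !P.side m := Bool.eq_not.2 h
      exact (P.graph.vertex_cross (space m d (P.side m))).trans (h2 m d)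

theorem disc_eq_of_vertex_eq {c d : Corner W} (h : P.graph.vertex c = P.graph.vertex d) :
    disc c = disc d := by
  refine rel_of_quot_eq (R := fun c d => disc c = disc d)
    ⟨fun _ => rfl, fun h => h.symm, fun h h' => h.trans h'⟩ ?_ h
  rintro (⟨m, d⟩ | ⟨m, d, s⟩) _ (rfl | rfl)
  · rfl
  · rfl
  · by_cases h : s = P.side m <;> simp [graph, arc, h, disc]
  · rfl

theorem slice_eq (c : Corner W) : P.graph.slice c = P.graph.slice (time (disc c) false) := by
  refine rel_of_quot_eq (R := fun x y => P.graph.slice x = P.graph.slice y)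
    ⟨fun _ => rfl, fun h => h.symm, fun h h' => h.trans h'⟩ ?_ (P.vertex_eq c)
  rintro x y (h | h)
  · exact Quot.sound (Or.inr (Or.inl h))
  · exact Quot.sound (Or.inr (Or.inr h))

theorem slice_next (m : W) :
    P.graph.slice (time (P.next m) false) = P.graph.slice (time m false) := by
  have h : P.graph.slice (space m true false) =
      P.graph.slice (space (P.next m) false (xor false (P.twist m))) :=
    Quot.sound (Or.inl ⟨P.not_timelike_space m true false, rfl⟩)
  rw [slice_eq, slice_eq _ (space _ _ _)] at h
  exact h.symm

theorem card_slice {B : Type} (S : W → B) (hS : ∀ m, S (P.next m) = S m)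
    (hinj : ∀ m m', S m = S m' → P.graph.slice (time m false) = P.graph.slice (time m' false))
    (hsurj : Function.Surjective S) : Nat.card P.graph.Slice = Nat.card B := by
  refine Gem.card_quot (fun c => S (disc c)) ?_ ?_ ?_
  · rintro x y (⟨ht, rfl⟩ | h | h)
    · obtain ⟨m, _ | _, s, rfl⟩ := P.exists_space ht
      · have := hS (P.next.symm m)
        rw [Equiv.apply_symm_apply] at this
        exact this
      · exact (hS m).symm
    · exact congrArg S (P.disc_eq_of_vertex_eq (Quot.sound (Or.inl h)))
    · exact congrArg S (P.disc_eq_of_vertex_eq (Quot.sound (Or.inr h)))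
  · intro c d h
    exact (P.slice_eq c).trans ((hinj _ _ h).trans (P.slice_eq d).symm)
  · intro b
    obtain ⟨m, rfl⟩ := hsurj b
    exact ⟨time m false, rfl⟩

theorem connected [Nonempty W] (h : ∀ A : Set W, A.Nonempty → (∀ m, P.next m ∈ A ↔ m ∈ A) →
    (∀ m, P.mate m ∈ A ↔ m ∈ A) → ∀ m, m ∈ A) : P.graph.Connected := by
  let comp : Corner W → P.graph.Component := fun c => Quot.mk _ c
  have hdisc : ∀ c, comp c = comp (time (disc c) false) := by
    intro c
    refine rel_of_quot_eq (R := fun x y => comp x = comp y)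
      ⟨fun _ => rfl, fun h => h.symm, fun h h' => h.trans h'⟩ ?_ (P.vertex_eq c)
    rintro x y (h | h)
    · exact Quot.sound (Or.inr (Or.inl h))
    · exact Quot.sound (Or.inr (Or.inr h))
  have hstrand : ∀ c, comp (time (disc (P.strand c)) false) = comp (time (disc c) false) := by
    intro c
    rw [← hdisc, ← hdisc]
    exact (Quot.sound (Or.inl rfl) : comp c = comp (P.strand c)).symm
  obtain ⟨m₀⟩ := ‹Nonempty W›
  refine ⟨⟨time m₀ false⟩, ⟨?_⟩⟩
  have key := h {m | comp (time m false) = comp (time m₀ false)} ⟨m₀, rfl⟩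
    (fun m => by
      have := hstrand (space m true false)
      exact ⟨fun e => this.symm.trans e, fun e => this.trans e⟩)
    (fun m => by
      have := hstrand (time m false)
      exact ⟨fun e => this.symm.trans e, fun e => this.trans e⟩)
  rintro ⟨c⟩ ⟨d⟩
  exact (hdisc c).trans ((key _).trans ((hdisc d).trans (key _)).symm)

/-! ### The CDT conditions -/

/-- `S` names the slice of a disc and `reg` the strip on a side. By `hsep` each strip contains one
timelike edge only, so a face meeting it has two timelike strands as soon as it passes both corners
of a timelike end. `hface` is needed only where the two ends lie on the same slice. -/
theorem isCDT [Finite W] {Λ Λ' : Type*} (S : W → Λ) (reg : W → Bool → Λ')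
    (hS : ∀ m, S (P.next m) = S m)
    (hreg : ∀ m s, reg (P.next m) (xor s (P.twist m)) = reg m s)
    (hmate : ∀ m, reg (P.mate m) (P.side (P.mate m)) = reg m (P.side m))
    (hsep : ∀ m m', reg m' (P.side m') = reg m (P.side m) → m' = m ∨ m' = P.mate m)
    (hface : ∀ m, S (P.mate m) ≠ S m ∨ P.graph.face (time m true) = P.graph.face (time m false)) :
    P.graph.IsCDT := by
  have hhalf : ∀ c, P.graph.halfEdgeAt (P.graph.cross c) = P.graph.halfEdgeAt c := fun c =>
    (Quot.sound rfl : P.graph.halfEdgeAt c = P.graph.halfEdgeAt (P.graph.cross c)).symm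
  have hhalf' : ∀ c d, P.graph.halfEdgeAt c = P.graph.halfEdgeAt d → d = c ∨ d = P.graph.cross c :=
    fun c d => (quot_involution_iff P.graph.cross_cross).1
  let R : Corner W → Λ' := Sum.elim (fun x => reg x.1 (P.side x.1)) (fun x => reg x.1 x.2.2)
  have hRs : ∀ c, R (P.graph.strand c) = R c := by
    rintro (⟨m, d⟩ | ⟨m, _ | _, s⟩)
    · exact hmate m
    · have := hreg (P.next.symm m) (xor s (P.twist (P.next.symm m)))
      rw [Equiv.apply_symm_apply, Bool.xor_assoc, Bool.xor_self, Bool.xor_false] at this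
      exact this.symm
    · exact hreg m s
  have hRa : ∀ c, R (P.graph.arc c) = R c := by
    rintro (⟨m, d⟩ | ⟨m, d, s⟩)
    · rfl
    · by_cases h : s = P.side m <;> simp [graph, arc, h, R]
  have hR : ∀ c d, P.graph.face c = P.graph.face d → R c = R d := by
    intro c d h
    refine rel_of_quot_eq (R := fun x y => R x = R y)
      ⟨fun _ => rfl, fun h => h.symm, fun h h' => h.trans h'⟩ ?_ h
    rintro x y (rfl | rfl)
    exacts [(hRs x).symm, (hRa x).symm]
  have hT : ∀ c d, P.graph.segment c = P.graph.segment d → S (disc c) = S (disc d) := by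
    intro c d h
    refine rel_of_quot_eq (R := fun x y => S (disc x) = S (disc y))
      ⟨fun _ => rfl, fun h => h.symm, fun h h' => h.trans h'⟩ ?_ h
    rintro x y (rfl | ⟨ht, rfl⟩)
    · exact congrArg S (P.disc_eq_of_vertex_eq (P.graph.vertex_arc x).symm)
    · obtain ⟨m, _ | _, s, rfl⟩ := P.exists_space ht
      · have := hS (P.next.symm m)
        rw [Equiv.apply_symm_apply] at this
        exact this
      · exact (hS m).symm
  have hface' : ∀ m, P.graph.face (time m true) = P.graph.face (time m false) := by
    intro m
    -- The segment from `time m false` stays on its slice and in its strip, so it cannot end at the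
    -- mate; it ends at the other corner of the same timelike end.
    refine (hface m).elim (fun h => ?_) id
    obtain ⟨c, h1, h2, h3, -⟩ := ColoredRibbonGraph.exists_partner (P.timelike_time m false)
    obtain ⟨m', d, rfl⟩ := P.exists_time h1
    have h4 := ColoredRibbonGraph.face_of_segment h3
    have h5 : S m' = S m := hT _ _ h3
    rcases hsep m m' (hR _ _ h4) with rfl | rfl
    · cases d
      · exact absurd rfl h2
      · exact h4
    · exact absurd h5 h
  refine ⟨?_, ?_, ?_⟩
  · rintro ⟨c⟩
    refine Set.ncard_eq_one.2 ⟨P.graph.halfEdgeAt (time (disc c) false), ?_⟩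
    refine Set.eq_singleton_iff_unique_mem.2 ⟨⟨_, rfl, (P.vertex_eq c).symm, P.timelike_time _ _⟩, ?_⟩
    rintro _ ⟨d, rfl, hd, ht⟩
    obtain ⟨m, d, rfl⟩ := P.exists_time ht
    obtain rfl : m = disc c := P.disc_eq_of_vertex_eq hd
    cases d
    · rfl
    · exact hhalf (time (disc c) false)
  · rintro ⟨c⟩
    have e : {h | ∃ d, P.graph.halfEdgeAt d = h ∧ P.graph.vertex d = Quot.mk _ c ∧
        ¬ P.graph.timelike d} = {P.graph.halfEdgeAt (space (disc c) false false),
          P.graph.halfEdgeAt (space (disc c) true false)} := by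
      ext h
      constructor
      · rintro ⟨d, rfl, hd, ht⟩
        obtain ⟨m, d, s, rfl⟩ := P.exists_space ht
        obtain rfl : m = disc c := P.disc_eq_of_vertex_eq hd
        have : P.graph.halfEdgeAt (space (disc c) d s) = P.graph.halfEdgeAt (space (disc c) d false) := by
          cases s
          · rfl
          · exact hhalf (space (disc c) d false)
        rw [this]
        cases d
        · exact Or.inl rfl
        · exact Or.inr rfl
      · rintro (rfl | rfl)
        · exact ⟨_, rfl, (P.vertex_eq _).trans (P.vertex_eq c).symm, P.not_timelike_space _ _ _⟩
        · exact ⟨_, rfl, (P.vertex_eq _).trans (P.vertex_eq c).symm, P.not_timelike_space _ _ _⟩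
    refine (congrArg Set.ncard e).trans (Set.ncard_pair fun h => ?_)
    rcases hhalf' _ _ h with h | h <;> simp [graph, cross] at h
  · intro f
    by_cases hf : ∀ c, P.graph.face c = f → ¬ P.graph.timelike c
    · exact Or.inr ((ColoredRibbonGraph.numTimelike_eq_zero_iff f).2 hf)
    · left
      push Not at hf
      obtain ⟨c, rfl, ht⟩ := hf
      obtain ⟨m, d, rfl⟩ := P.exists_time ht
      have hstr : ∀ d, P.graph.strandAt (time (P.mate m) d) = P.graph.strandAt (time m (xor d (P.flip m))) := by
        intro d
        refine (Quot.sound ?_ : P.graph.strandAt (time m (xor d (P.flip m))) = _).symm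
        show time (P.mate m) d = time (P.mate m) _
        rw [Bool.xor_assoc, Bool.xor_self, Bool.xor_false]
      have e : {s | ∃ c, P.graph.strandAt c = s ∧ P.graph.face c = P.graph.face (time m d) ∧
          P.graph.timelike c} = {P.graph.strandAt (time m false), P.graph.strandAt (time m true)} := by
        ext s
        constructor
        · rintro ⟨c, rfl, hc, ht⟩
          obtain ⟨m', d', rfl⟩ := P.exists_time ht
          have hm : ∀ d, P.graph.strandAt (time m d) ∈
              ({P.graph.strandAt (time m false), P.graph.strandAt (time m true)} : Set _) := by
            rintro (_ | _) <;> simp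
          rcases hsep m m' (hR _ _ hc) with rfl | rfl
          · exact hm d'
          · rw [hstr]
            exact hm _
        · rintro (rfl | rfl)
          · refine ⟨_, rfl, ?_, P.timelike_time _ _⟩
            cases d
            exacts [rfl, (hface' m).symm]
          · refine ⟨_, rfl, ?_, P.timelike_time _ _⟩
            cases d
            exacts [hface' m, rfl]
      refine (congrArg Set.ncard e).trans (Set.ncard_pair fun h => ?_)
      rcases (quot_involution_iff P.graph.strand_strand).1 h with h | h
      · simp at h
      · simp [graph, strand, (P.mate_ne m).symm] at h

end SlicePattern

namespace SlicePattern

/-! ### Linear sequences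

The discs are numbered `0, …, 2N - 1`, and timelike edges join `2j` with `2j + 1`.  The slices are blocks
of consecutive discs: `{0}, {1, 2}, {3, 4}, …, {2N - 1}`, except that the first two blocks are
merged if `a` holds and the last two if `b` holds.  Then the first or the last timelike edge lies in a
Möbius strip. -/

section Blocks

variable (N : ℕ) (a b : Bool)

/-- The slice of a disc. -/
def block (m : ℕ) : ℕ :=
  if a = true ∧ m = 0 then 1 else if b = true ∧ m + 1 = 2 * N then N - 1 else (m + 1) / 2

/-- A block normally ends at an even number; the exceptions are `0` and `2N - 2` when they lie
inside a merged block. After the last disc the block starts again. -/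
def succInBlock (m : ℕ) : ℕ :=
  if m + 1 = 2 * N ∨ (m % 2 = 0 ∧ ¬ (a = true ∧ m = 0) ∧ ¬ (b = true ∧ m + 2 = 2 * N)) then
    -- Truncated subtraction gives the right start `0` for block `0` too.
    if a = true ∧ block N a b m = 1 then 0 else 2 * block N a b m - 1
  else m + 1

/-- The inverse cyclic order: from the first disc of a block to its last, which is cut off at `2N -
1`. -/
def predInBlock (m : ℕ) : ℕ :=
  if m = 0 ∨ (m % 2 = 1 ∧ ¬ (a = true ∧ m = 1) ∧ ¬ (b = true ∧ m + 1 = 2 * N)) then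
    if b = true ∧ block N a b m + 1 = N then 2 * N - 1 else min (2 * block N a b m) (2 * N - 1)
  else m - 1

/-- Even discs have their timelike edge above the slice and odd ones below. At a Möbius end the
outermost disc is switched, so that both ends of its edge lie on the same side of the same slice. -/
def sideInBlock (m : ℕ) : Bool :=
  if a = true ∧ m = 0 then false else if b = true ∧ m + 1 = 2 * N then true else m % 2 = 0

def mateInBlock (m : ℕ) : ℕ := if m % 2 = 0 then m + 1 else m - 1

variable {N a b}

theorem succInBlock_lt (hN : 1 ≤ N) {m : ℕ} (hm : m < 2 * N) : succInBlock N a b m < 2 * N := by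
  cases a <;> cases b <;>
    simp only [succInBlock, block, Bool.false_eq_true, false_and, true_and, if_false, not_false_eq_true,
      and_true] <;> split_ifs <;> omega

theorem predInBlock_lt (hN : 1 ≤ N) {m : ℕ} (hm : m < 2 * N) : predInBlock N a b m < 2 * N := by
  cases a <;> cases b <;>
    simp only [predInBlock, block, Bool.false_eq_true, false_and, true_and, if_false, not_false_eq_true,
      and_true] <;> split_ifs <;> omega

theorem block_succInBlock (hN : 1 ≤ N) (hab : a = true → b = true → 2 ≤ N) {m : ℕ}
    (hm : m < 2 * N) : block N a b (succInBlock N a b m) = block N a b m := by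
  cases a <;> cases b <;>
    simp only [succInBlock, block, Bool.false_eq_true, false_and, true_and, if_false, not_false_eq_true,
      and_true, forall_const] at hab ⊢ <;> grind

theorem predInBlock_succInBlock (hN : 1 ≤ N) (hab : a = true → b = true → 2 ≤ N) {m : ℕ}
    (hm : m < 2 * N) : predInBlock N a b (succInBlock N a b m) = m := by
  unfold predInBlock
  rw [block_succInBlock hN hab hm]
  cases a <;> cases b <;>
    simp only [succInBlock, block, Bool.false_eq_true, false_and, true_and, if_false, not_false_eq_true,
      and_true, forall_const] at hab ⊢ <;> grind

theorem block_predInBlock (hN : 1 ≤ N) (hab : a = true → b = true → 2 ≤ N) {m : ℕ}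
    (hm : m < 2 * N) : block N a b (predInBlock N a b m) = block N a b m := by
  cases a <;> cases b <;>
    simp only [predInBlock, block, Bool.false_eq_true, false_and, true_and, if_false, not_false_eq_true,
      and_true, forall_const] at hab ⊢ <;> grind

theorem succInBlock_predInBlock (hN : 1 ≤ N) (hab : a = true → b = true → 2 ≤ N) {m : ℕ}
    (hm : m < 2 * N) : succInBlock N a b (predInBlock N a b m) = m := by
  unfold succInBlock
  rw [block_predInBlock hN hab hm]
  cases a <;> cases b <;>
    simp only [predInBlock, block, Bool.false_eq_true, false_and, true_and, if_false, not_false_eq_true,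
      and_true, forall_const] at hab ⊢ <;> grind

theorem mateInBlock_lt {m : ℕ} (hm : m < 2 * N) : mateInBlock m < 2 * N := by
  unfold mateInBlock
  split_ifs <;> omega

theorem block_mono (hab : a = true → b = true → 2 ≤ N) {m : ℕ} (hm : m + 1 < 2 * N) :
    block N a b m ≤ block N a b (m + 1) := by
  cases a <;> cases b <;>
    simp only [block, Bool.false_eq_true, false_and, true_and, if_false, forall_const] at hab ⊢ <;> grind

theorem succInBlock_eq (hab : a = true → b = true → 2 ≤ N) {m : ℕ} (hm : m + 1 < 2 * N)
    (h : block N a b (m + 1) = block N a b m) : succInBlock N a b m = m + 1 := by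
  cases a <;> cases b <;>
    simp only [succInBlock, block, Bool.false_eq_true, false_and, true_and, if_false, not_false_eq_true,
      and_true, forall_const] at hab h ⊢ <;> grind

theorem block_mateInBlock {m : ℕ} (hm : m < 2 * N)
    (h : block N a b (mateInBlock m) = block N a b m) :
    (a = true ∧ m / 2 = 0) ∨ (b = true ∧ m / 2 + 1 = N) := by
  cases a <;> cases b <;>
    simp only [mateInBlock, block, Bool.false_eq_true, false_and, true_and, if_false, or_false,
      false_or] at h ⊢ <;> grind

theorem le_block (a b : Bool) (hab : a = true → b = true → 2 ≤ N) (m : ℕ) :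
    a.toNat ≤ block N a b m := by
  cases a <;> cases b <;>
    simp only [block, Bool.false_eq_true, false_and, true_and, if_false, Bool.toNat_true,
      Bool.toNat_false, forall_const] at hab ⊢ <;> grind

theorem block_le (hN : 1 ≤ N) (hab : a = true → b = true → 2 ≤ N) {m : ℕ} (hm : m < 2 * N) :
    block N a b m ≤ N - b.toNat := by
  cases a <;> cases b <;>
    simp only [block, Bool.false_eq_true, false_and, true_and, if_false, Bool.toNat_true,
      Bool.toNat_false, forall_const] at hab ⊢ <;> grind

theorem exists_block_eq (hN : 1 ≤ N) (hab : a = true → b = true → 2 ≤ N) {k : ℕ} (hk : a.toNat ≤ k)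
    (hk' : k ≤ N - b.toNat) : ∃ m < 2 * N, block N a b m = k := by
  refine ⟨2 * k - 1, ?_⟩
  cases a <;> cases b <;>
    simp only [block, Bool.false_eq_true, false_and, true_and, if_false, Bool.toNat_true,
      Bool.toNat_false, forall_const] at hab hk hk' ⊢ <;> grind

/-- The strip on a side of a disc. -/
def region (N : ℕ) (a b c d : Bool) (m : ℕ) (s : Bool) : ℕ :=
  if c = true ∧ block N a b m + s.toNat = 0 then 1
  else if d = true ∧ block N a b m + s.toNat = N + 1 then N else block N a b m + s.toNat

/-- The strip number seen from a timelike end determines its edge, the one joining `2j` with `2j +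
1`. -/
theorem region_side {c d : Bool} (hN : 1 ≤ N) (hab : a = true → b = true → 2 ≤ N) {m : ℕ}
    (hm : m < 2 * N) : region N a b c d m (sideInBlock N a b m) = m / 2 + 1 := by
  rcases Nat.mod_two_eq_zero_or_one m with h | h <;> cases a <;> cases b <;>
    simp only [region, block, sideInBlock, Bool.false_eq_true, false_and, true_and, if_false,
      forall_const, h, decide_true, decide_false, one_ne_zero] at hab ⊢ <;> grind

/-- At a crosscap both sides of the slice belong to the same strip, so a twist there does not change
the strip. -/
theorem region_not {c d : Bool} (hN : 1 ≤ N) (hc : c = true → a = false ∧ b = false)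
    (hd : d = true → b = false) {m : ℕ} (hm : (c = true ∧ m = 0) ∨ (d = true ∧ m + 1 = 2 * N))
    (s : Bool) : region N a b c d m (!s) = region N a b c d m s := by
  cases s <;> cases a <;> cases b <;>
    simp only [region, block, Bool.false_eq_true, false_and, true_and, if_false, Bool.toNat_true,
      Bool.toNat_false, Bool.not_true, Bool.not_false] at hc hd ⊢ <;> grind

end Blocks

/-- The data of a linear sequence: `2 * N` discs, Möbius strips at the ends if `a`, `b` hold, crosscaps
at the ends if `c`, `d` hold, and singular strips otherwise. -/
structure LinearShape where
  N : ℕ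
  a : Bool
  b : Bool
  c : Bool
  d : Bool
  one_le : 1 ≤ N
  two_le : a = true → b = true → 2 ≤ N
  -- A crosscap at the bottom is used only together with one at the top; mixed sequences have their
  -- crosscap at the top.
  bottom : c = true → a = false ∧ b = false
  top : d = true → b = false

namespace LinearShape

variable (Q : LinearShape)

def pattern : SlicePattern (Fin (2 * Q.N)) where
  next :=
    { toFun := fun m => ⟨succInBlock Q.N Q.a Q.b m, succInBlock_lt Q.one_le m.2⟩
      invFun := fun m => ⟨predInBlock Q.N Q.a Q.b m, predInBlock_lt Q.one_le m.2⟩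
      left_inv := fun m => Fin.ext (predInBlock_succInBlock Q.one_le Q.two_le m.2)
      right_inv := fun m => Fin.ext (succInBlock_predInBlock Q.one_le Q.two_le m.2) }
  mate m := ⟨mateInBlock m, mateInBlock_lt m.2⟩
  side m := sideInBlock Q.N Q.a Q.b m
  -- A crosscap arises from one twisted spacelike edge, placed after the first or last disc: going
  -- once around the slice exchanges its sides.
  twist m := (Q.c = true ∧ m.1 = 0) ∨ (Q.d = true ∧ m.1 + 1 = 2 * Q.N)
  flip _ := false
  mate_mate m := Fin.ext (by simp only [mateInBlock]; grind)
  mate_ne m h := by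
    have := congrArg Fin.val h
    simp only [mateInBlock] at this
    grind
  flip_mate _ := rfl

theorem next_val (m : Fin (2 * Q.N)) : (Q.pattern.next m).1 = succInBlock Q.N Q.a Q.b m := rfl

theorem mate_val (m : Fin (2 * Q.N)) : (Q.pattern.mate m).1 = mateInBlock m := rfl

theorem side_eq (m : Fin (2 * Q.N)) : Q.pattern.side m = sideInBlock Q.N Q.a Q.b m := rfl

theorem twist_eq (m : Fin (2 * Q.N)) : Q.pattern.twist m =
    decide ((Q.c = true ∧ m.1 = 0) ∨ (Q.d = true ∧ m.1 + 1 = 2 * Q.N)) := rfl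

/-- At a Möbius end the discs of the edge are consecutive on a slice with their timelike ends on the
same side, so the face runs from one to the other along one spacelike edge. -/
theorem face_eq (m : Fin (2 * Q.N))
    (h : (Q.a = true ∧ m.1 / 2 = 0) ∨ (Q.b = true ∧ m.1 / 2 + 1 = Q.N)) :
    Q.pattern.graph.face (time m true) = Q.pattern.graph.face (time m false) := by
  have h1 := Q.one_le
  have h2 := Q.two_le
  have h3 := Q.bottom
  have h4 := Q.top
  have key : ∀ m : Fin (2 * Q.N),
      ((Q.a = true ∧ m.1 / 2 = 0) ∨ (Q.b = true ∧ m.1 / 2 + 1 = Q.N)) → m.1 % 2 = 0 →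
      Q.pattern.graph.face (time m true) = Q.pattern.graph.face (time m false) := by
    intro m h hm
    have hlt := m.2
    apply face_of_next_eq_mate
    · apply Fin.ext
      rw [next_val, mate_val]
      simp only [succInBlock, mateInBlock]
      grind
    · rw [twist_eq, decide_eq_false_iff_not]
      grind
    · rw [side_eq, side_eq, mate_val]
      simp only [sideInBlock, mateInBlock]
      grind
    · rfl
  by_cases hm : m.1 % 2 = 0
  · exact key m h hm
  · have := key (Q.pattern.mate m) (by
      rw [mate_val]; simp only [mateInBlock]; grind) (by
      rw [mate_val]; simp only [mateInBlock]; grind)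
    rwa [face_mate _ _ _ rfl, face_mate _ _ _ rfl] at this

theorem isCDT : Q.pattern.graph.IsCDT := by
  have h1 := Q.one_le
  refine Q.pattern.isCDT (fun m => block Q.N Q.a Q.b m)
    (fun m s => region Q.N Q.a Q.b Q.c Q.d m s) ?_ ?_ ?_ ?_ ?_
  · exact fun m => block_succInBlock Q.one_le Q.two_le m.2
  · intro m s
    have e : ∀ s, region Q.N Q.a Q.b Q.c Q.d (Q.pattern.next m) s =
        region Q.N Q.a Q.b Q.c Q.d m s := by
      intro s
      simp only [region, next_val, block_succInBlock Q.one_le Q.two_le m.2]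
    rw [e, twist_eq]
    by_cases h : (Q.c = true ∧ m.1 = 0) ∨ (Q.d = true ∧ m.1 + 1 = 2 * Q.N)
    · rw [decide_eq_true h, Bool.xor_true]
      exact region_not Q.one_le Q.bottom Q.top h s
    · rw [decide_eq_false h, Bool.xor_false]
  · intro m
    rw [side_eq, side_eq, region_side Q.one_le Q.two_le m.2,
      region_side Q.one_le Q.two_le (Q.pattern.mate m).2, mate_val, mateInBlock]
    split_ifs <;> omega
  · intro m m' h
    rw [side_eq, side_eq, region_side Q.one_le Q.two_le m.2,
      region_side Q.one_le Q.two_le m'.2] at h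
    rw [Fin.ext_iff, Fin.ext_iff, mate_val, mateInBlock]
    split_ifs <;> omega
  · intro m
    by_cases h : block Q.N Q.a Q.b (Q.pattern.mate m) = block Q.N Q.a Q.b m
    · exact Or.inr (Q.face_eq m (block_mateInBlock m.2 h))
    · exact Or.inl h

def first : Fin (2 * Q.N) := ⟨0, by have := Q.one_le; omega⟩

def last : Fin (2 * Q.N) := ⟨2 * Q.N - 1, by have := Q.one_le; omega⟩

instance : Nonempty (Fin (2 * Q.N)) := ⟨Q.first⟩

theorem connected : Q.pattern.graph.Connected := by
  have hstep : ∀ (A : Set (Fin (2 * Q.N))), (∀ m, Q.pattern.next m ∈ A ↔ m ∈ A) →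
      (∀ m, Q.pattern.mate m ∈ A ↔ m ∈ A) → ∀ m (h : m + 1 < 2 * Q.N),
      (⟨m + 1, h⟩ : Fin (2 * Q.N)) ∈ A ↔ (⟨m, by omega⟩ : Fin (2 * Q.N)) ∈ A := by
    intro A h1 h2 m h
    by_cases hm : m % 2 = 0
    · rw [← h2 ⟨m, by omega⟩]
      have : Q.pattern.mate ⟨m, by omega⟩ = ⟨m + 1, h⟩ := Fin.ext (if_pos hm)
      rw [this]
    · rw [← h1 ⟨m, by omega⟩]
      have : Q.pattern.next ⟨m, by omega⟩ = ⟨m + 1, h⟩ := Fin.ext (by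
        rw [next_val]
        refine succInBlock_eq Q.two_le h ?_
        have h1 := Q.one_le
        have h2 := Q.two_le
        simp only [block]
        grind)
      rw [this]
  refine Q.pattern.connected fun A ⟨m₀, h0⟩ h1 h2 => ?_
  have hall : ∀ m (h : m < 2 * Q.N), (⟨m, h⟩ : Fin (2 * Q.N)) ∈ A ↔ Q.first ∈ A := by
    intro m
    induction m with
    | zero => exact fun _ => Iff.rfl
    | succ m ih => exact fun h => (hstep A h1 h2 m h).trans (ih (by omega))
  exact fun m => (hall m.1 m.2).2 ((hall m₀.1 m₀.2).1 h0)

theorem slice_eq_of_block_eq {m m' : Fin (2 * Q.N)}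
    (h : block Q.N Q.a Q.b m = block Q.N Q.a Q.b m') :
    Q.pattern.graph.slice (time m false) = Q.pattern.graph.slice (time m' false) := by
  have key : ∀ k m (hm : m + k < 2 * Q.N), block Q.N Q.a Q.b (m + k) ≤ block Q.N Q.a Q.b m →
      block Q.N Q.a Q.b m ≤ block Q.N Q.a Q.b (m + k) ∧
      Q.pattern.graph.slice (time ⟨m, by omega⟩ false) =
        Q.pattern.graph.slice (time ⟨m + k, hm⟩ false) := by
    intro k m hm h
    induction k with
    | zero => exact ⟨le_rfl, rfl⟩
    | succ k ih =>
      have hmono := block_mono Q.two_le hm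
      obtain ⟨ih1, ih2⟩ := ih (by omega) (hmono.trans h)
      refine ⟨ih1.trans hmono, ih2.trans ?_⟩
      have hs := succInBlock_eq Q.two_le hm (le_antisymm (h.trans ih1) hmono)
      have := Q.pattern.slice_next ⟨m + k, by omega⟩
      have e : Q.pattern.next ⟨m + k, by omega⟩ = ⟨m + (k + 1), hm⟩ := Fin.ext hs
      rw [e] at this
      exact this.symm
  rcases le_total m.1 m'.1 with hle | hle
  · obtain ⟨k, hk⟩ := Nat.exists_eq_add_of_le hle
    have := (key k m (hk ▸ m'.2) (by rw [← hk, h])).2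
    simp only [← hk] at this
    exact this
  · obtain ⟨k, hk⟩ := Nat.exists_eq_add_of_le hle
    have := (key k m' (hk ▸ m.2) (by rw [← hk, h])).2
    simp only [← hk] at this
    exact this.symm

/-- There are `N + 1` blocks, less one for each Möbius end, where two blocks are merged. -/
theorem card_slice : Nat.card Q.pattern.graph.Slice = Q.N - Q.b.toNat - Q.a.toNat + 1 := by
  have hle : ∀ m : Fin (2 * Q.N), Q.a.toNat ≤ block Q.N Q.a Q.b m ∧
      block Q.N Q.a Q.b m ≤ Q.N - Q.b.toNat := fun m =>
    ⟨le_block Q.a Q.b Q.two_le m, block_le Q.one_le Q.two_le m.2⟩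
  rw [Q.pattern.card_slice (B := Fin (Q.N - Q.b.toNat - Q.a.toNat + 1))
    (fun m => ⟨block Q.N Q.a Q.b m - Q.a.toNat, by have := hle m; omega⟩), Nat.card_fin]
  · intro m
    simp only [next_val, block_succInBlock Q.one_le Q.two_le m.2]
  · intro m m' h
    apply Q.slice_eq_of_block_eq
    have h1 := hle m
    have h2 := hle m'
    have h3 := congrArg Fin.val h
    simp only at h3
    omega
  · intro k
    have h1 := hle Q.first
    obtain ⟨m, hm, e⟩ := exists_block_eq (a := Q.a) (b := Q.b) (k := k + Q.a.toNat) Q.one_le Q.two_le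
      (by omega) (by have := k.2; omega)
    exact ⟨⟨m, hm⟩, Fin.ext (by simp [e])⟩

end LinearShape

end SlicePattern

/-! ### Ends and lengths of the linear models -/

namespace SlicePattern.LinearShape

open ColoredRibbonGraph

variable (Q : LinearShape)

def bottomCap : Cap := if Q.a = true then .mobius else if Q.c = true then .crosscap else .singular

def topCap : Cap := if Q.b = true then .mobius else if Q.d = true then .crosscap else .singular

theorem bd_congr {m m' : Fin (2 * Q.N)} {s s' : Bool} (hn : Q.pattern.next m = m')
    (ht : xor s (Q.pattern.twist m) = s') : Q.pattern.bd m' s' = Q.pattern.bd m s := by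
  subst hn ht
  exact Q.pattern.bd_next m s

theorem isMobiusStrip_of_next_eq_mate {m : Fin (2 * Q.N)} (hn : Q.pattern.next m = Q.pattern.mate m)
    (ht : Q.pattern.twist m = false) (hs : Q.pattern.side (Q.pattern.mate m) = Q.pattern.side m) :
    Q.pattern.graph.IsMobiusStrip (Q.pattern.graph.stripOf (Q.pattern.bd m (Q.pattern.side m))) := by
  rw [Q.isCDT.isMobiusStrip_iff]
  refine ⟨Q.pattern.not_isSingularStrip_bd m, ?_⟩
  rw [Q.pattern.acrossStrip_bd Q.isCDT]
  exact Q.bd_congr hn (by rw [ht, hs, Bool.xor_false])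

theorem hasCap_bottom : Q.isCDT.HasCap Q.bottomCap (Q.pattern.bd Q.first false) := by
  have h1 := Q.one_le
  have h2 := Q.two_le
  have h3 := Q.bottom
  have h4 := Q.top
  unfold bottomCap
  split_ifs with ha hc
  · have hs : Q.pattern.side Q.first = false := by
      rw [side_eq, first]; simp [sideInBlock, ha]
    have hs' : Q.pattern.side (Q.pattern.mate Q.first) = false := by
      rw [side_eq, mate_val, first]
      simp only [sideInBlock, mateInBlock]
      grind
    have := Q.isMobiusStrip_of_next_eq_mate (m := Q.first)
      (by apply Fin.ext; rw [next_val, mate_val, first]; simp only [succInBlock, mateInBlock]; grind)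
      (by rw [twist_eq, first, decide_eq_false_iff_not]; grind) (hs'.trans hs.symm)
    rwa [hs] at this
  -- The slice is a single disc with a twisted loop, which leads from one side to the other.
  · refine (Q.pattern.acrossSlice_bd Q.isCDT _ _).trans (Q.bd_congr ?_ ?_)
    · apply Fin.ext
      rw [next_val, first]
      simp only [succInBlock, block]
      grind
    · rw [twist_eq, first]
      simp [hc]
  · refine Q.pattern.isSingularStrip_bd fun m s h => ?_
    have hm := m.2
    -- Lying below the lowest slice is an invariant of the boundary, and no timelike edge leaves
    -- that slice downwards.
    have := Q.pattern.eq_of_bd_eq (fun m s => block Q.N Q.a Q.b m = 0 ∧ s = false) ?_ h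
    · have h0 : block Q.N Q.a Q.b m = 0 ∧ s = false := by
        rw [this, first]
        simp only [block]
        grind
      rw [side_eq]
      simp only [block, sideInBlock] at h0 ⊢
      grind
    · intro m s
      have hm := m.2
      simp only [next_val, twist_eq, block_succInBlock Q.one_le Q.two_le m.2]
      by_cases ht : (Q.c = true ∧ m.1 = 0) ∨ (Q.d = true ∧ m.1 + 1 = 2 * Q.N)
      · have hb : block Q.N Q.a Q.b m ≠ 0 := by
          simp only [block]
          grind
        simp [hb]
      · simp [ht]

theorem hasCap_top : Q.isCDT.HasCap Q.topCap (Q.pattern.bd Q.last true) := by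
  have h1 := Q.one_le
  have h2 := Q.two_le
  have h3 := Q.bottom
  have h4 := Q.top
  unfold topCap
  split_ifs with hb hd
  · let m : Fin (2 * Q.N) := ⟨2 * Q.N - 2, by omega⟩
    have hs : Q.pattern.side m = true := by
      rw [side_eq]
      simp only [sideInBlock, m]
      grind
    have hmate : Q.pattern.mate m = Q.last := by
      apply Fin.ext
      rw [mate_val, last]
      simp only [mateInBlock, m]
      grind
    have hnext : Q.pattern.next m = Q.last := by
      apply Fin.ext
      rw [next_val, last]
      simp only [succInBlock, m]
      grind
    have hs' : Q.pattern.side Q.last = true := by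
      rw [side_eq, last]
      simp only [sideInBlock]
      grind
    have ht : Q.pattern.twist m = false := by
      rw [twist_eq, decide_eq_false_iff_not]
      simp only [m]
      grind
    have := Q.isMobiusStrip_of_next_eq_mate (hnext.trans hmate.symm) ht (by rw [hmate, hs, hs'])
    rw [hs] at this
    rwa [Q.bd_congr hnext (by rw [ht, Bool.xor_false])]
  · refine (Q.pattern.acrossSlice_bd Q.isCDT _ _).trans ?_
    have ht : Q.pattern.twist Q.last = true := by
      rw [twist_eq, last, decide_eq_true_iff]
      grind
    -- In this smallest case the top slice also carries the Möbius edge and has two discs, so the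
    -- way around passes both and meets one twist; otherwise it is a twisted loop at one disc.
    by_cases ha : Q.a = true ∧ Q.N = 1
    · have e1 : Q.pattern.next Q.last = Q.first := by
        apply Fin.ext
        rw [next_val, first, last]
        simp only [succInBlock, block]
        grind
      have e2 : Q.pattern.next Q.first = Q.last := by
        apply Fin.ext
        rw [next_val, first, last]
        simp only [succInBlock, block]
        grind
      have ht' : Q.pattern.twist Q.first = false := by
        rw [twist_eq, first, decide_eq_false_iff_not]
        grind
      exact (Q.bd_congr (s := false) e2 (by rw [ht']; rfl)).trans (Q.bd_congr e1 (by rw [ht]; rfl))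
    · refine Q.bd_congr ?_ (by rw [ht]; rfl)
      apply Fin.ext
      rw [next_val, last]
      simp only [succInBlock, block]
      grind
  · refine Q.pattern.isSingularStrip_bd fun m s h => ?_
    have hm := m.2
    have := Q.pattern.eq_of_bd_eq (fun m s => block Q.N Q.a Q.b m = Q.N ∧ s = true) ?_ h
    · have h0 : block Q.N Q.a Q.b m = Q.N ∧ s = true := by
        rw [this, last]
        simp only [block]
        grind
      rw [side_eq]
      simp only [block, sideInBlock] at h0 ⊢
      grind
    · intro m s
      have hm := m.2
      simp only [next_val, twist_eq, block_succInBlock Q.one_le Q.two_le m.2]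
      by_cases ht : (Q.c = true ∧ m.1 = 0) ∨ (Q.d = true ∧ m.1 + 1 = 2 * Q.N)
      · have hb : block Q.N Q.a Q.b m ≠ Q.N := by
          simp only [block]
          grind
        simp [hb]
      · simp [ht]

/-- Two crosscaps lie on different slices. Without twists the sides of slices are invariants, so the
lower and the upper end have different boundaries; in all remaining shapes the kinds of caps differ.
-/
theorem caps_ne : Q.bottomCap ≠ Q.topCap ∨ Q.pattern.bd Q.first false ≠ Q.pattern.bd Q.last true := by
  have h1 := Q.one_le
  by_cases hc : Q.c = true
  · obtain ⟨ha, hb⟩ := Q.bottom hc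
    by_cases hd : Q.d = true
    · refine Or.inr fun h => ?_
      have := Q.pattern.eq_of_bd_eq (fun m _ => block Q.N Q.a Q.b m)
        (fun m _ => block_succInBlock Q.one_le Q.two_le m.2) h
      rw [first, last, ha, hb] at this
      simp only [block] at this
      grind
    · exact Or.inl (by simp [bottomCap, topCap, ha, hb, hc, hd])
  · by_cases hd : Q.d = true
    · refine Or.inl ?_
      have hb := Q.top hd
      by_cases ha : Q.a = true <;> simp [bottomCap, topCap, ha, hb, hc, hd]
    · refine Or.inr fun h => ?_
      have := Q.pattern.eq_of_bd_eq (fun _ s => s) (fun m s => by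
        rw [twist_eq]; simp [hc, hd]) h
      exact Bool.false_ne_true this

theorem isLinear : Q.pattern.graph.IsLinear Q.bottomCap Q.topCap (Q.N - Q.b.toNat - Q.a.toNat) := by
  obtain ⟨n, h, hn⟩ := Q.isCDT.isLinear_of_hasCap Q.connected Q.hasCap_bottom Q.hasCap_top Q.caps_ne
  rw [card_slice] at hn
  rwa [Nat.add_right_cancel hn]

end SlicePattern.LinearShape

namespace ColoredRibbonGraph

open SlicePattern

/-- A linear sequence of strips is realized by the pattern with the right ends. -/
theorem Realizes.of_shape {P : ∀ {C : Type}, ColoredRibbonGraph C → Prop} {X : Type}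
    [TopologicalSpace X] (Q : LinearShape) (h : P Q.pattern.graph)
    (hX : Nonempty (Q.pattern.graph.Surface ≃ₜ X)) : Realizes P X :=
  ⟨_, inferInstance, Q.pattern.graph, Q.isCDT, Q.connected, h, hX⟩

theorem realizes_singular_singular {n : ℕ} (hn : 1 ≤ n) :
    Realizes (fun G => G.IsLinear .singular .singular n) ModelSurface.Sphere := by
  let Q : LinearShape := ⟨n, false, false, false, false, hn, by simp, by simp, by simp⟩
  have h : Q.pattern.graph.IsLinear .singular .singular n := Q.isLinear
  exact .of_shape Q h (Q.isCDT.sphere_of_isLinear Q.connected h)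

theorem realizes_singular_mobius (n : ℕ) :
    Realizes (fun G => G.IsLinear .singular .mobius n) ModelSurface.ProjectivePlane := by
  let Q : LinearShape := ⟨n + 1, false, true, false, false, by simp, by simp, by simp, by simp⟩
  have h : Q.pattern.graph.IsLinear .singular .mobius n := Q.isLinear
  exact .of_shape Q h (Q.isCDT.projectivePlane_of_isLinear Q.connected (by simp) h)

theorem realizes_singular_crosscap {n : ℕ} (hn : 1 ≤ n) :
    Realizes (fun G => G.IsLinear .singular .crosscap n) ModelSurface.ProjectivePlane := by
  let Q : LinearShape := ⟨n, false, false, false, true, hn, by simp, by simp, by simp⟩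
  have h : Q.pattern.graph.IsLinear .singular .crosscap n := Q.isLinear
  exact .of_shape Q h (Q.isCDT.projectivePlane_of_isLinear Q.connected (by simp) h)

theorem realizes_mobius_mobius (n : ℕ) :
    Realizes (fun G => G.IsLinear .mobius .mobius n) ModelSurface.KleinBottle := by
  let Q : LinearShape := ⟨n + 2, true, true, false, false, by simp, by simp, by simp, by simp⟩
  have h : Q.pattern.graph.IsLinear .mobius .mobius n := Q.isLinear
  exact .of_shape Q h (Q.isCDT.kleinBottle_of_isLinear Q.connected (by simp) (by simp) h)

theorem realizes_mobius_crosscap (n : ℕ) :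
    Realizes (fun G => G.IsLinear .mobius .crosscap n) ModelSurface.KleinBottle := by
  let Q : LinearShape := ⟨n + 1, true, false, false, true, by simp, by simp, by simp, by simp⟩
  have h : Q.pattern.graph.IsLinear .mobius .crosscap n := Q.isLinear
  exact .of_shape Q h (Q.isCDT.kleinBottle_of_isLinear Q.connected (by simp) (by simp) h)

theorem realizes_crosscap_crosscap {n : ℕ} (hn : 1 ≤ n) :
    Realizes (fun G => G.IsLinear .crosscap .crosscap n) ModelSurface.KleinBottle := by
  let Q : LinearShape := ⟨n, false, false, true, true, hn, by simp, by simp, by simp⟩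
  have h : Q.pattern.graph.IsLinear .crosscap .crosscap n := Q.isLinear
  exact .of_shape Q h (Q.isCDT.kleinBottle_of_isLinear Q.connected (by simp) (by simp) h)

end ColoredRibbonGraph

/-! ### The periodic models -/

namespace SlicePattern

open ColoredRibbonGraph

/-- A cyclic sequence of `n` strips with two discs on every slice, each having one timelike edge on
either side; one timelike edge is twisted if `z` holds. -/
def cyclic (n : ℕ) (z : Bool) : SlicePattern (ZMod n × Bool) where
  next := (Equiv.refl _).prodCongr Equiv.boolNot
  mate m := if m.2 = true then (m.1 + 1, false) else (m.1 - 1, true)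
  side m := m.2
  twist _ := false
  flip m := z && decide ((if m.2 = true then m.1 + 1 else m.1) = 0)
  mate_mate := by rintro ⟨i, _ | _⟩ <;> simp
  mate_ne := by rintro ⟨i, _ | _⟩ <;> simp
  flip_mate := by rintro ⟨i, _ | _⟩ <;> simp

namespace cyclic

variable (n : ℕ) (z : Bool)

theorem bd_not (i : ZMod n) (t s : Bool) : (cyclic n z).bd (i, !t) s = (cyclic n z).bd (i, t) s := by
  have := (cyclic n z).bd_next (i, t) s
  rwa [show (cyclic n z).twist (i, t) = false from rfl, Bool.xor_false] at this

theorem bd_eq_side (i : ZMod n) (t s : Bool) :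
    (cyclic n z).bd (i, t) s = (cyclic n z).bd (i, s) ((cyclic n z).side (i, s)) := by
  by_cases h : t = s
  · rw [h]; rfl
  · obtain rfl : t = !s := Bool.eq_not.2 h
    exact bd_not n z i s s

theorem bd_ne (i j : ZMod n) (t t' s : Bool) :
    (cyclic n z).bd (i, t) (!s) ≠ (cyclic n z).bd (j, t') s := fun h => by
  have := (cyclic n z).eq_of_bd_eq (fun _ s => s) (fun m s => Bool.xor_false s) h
  simp at this

/-- From one corner of a timelike end the face runs along the slice past the other disc, whose
timelike end is on the opposite side, and returns to the other corner. This holds even for `n = 1`,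
where the edge joins discs of one slice. -/
theorem face_eq (i : ZMod n) (t : Bool) :
    (cyclic n z).graph.face (time (i, t) true) = (cyclic n z).graph.face (time (i, t) false) := by
  have hs : ∀ t s, (cyclic n z).graph.face (space (i, !t) false s) =
      (cyclic n z).graph.face (space (i, t) true s) := by
    intro t s
    have h := (cyclic n z).graph.face_strand (space (i, t) true s)
    have e : (cyclic n z).graph.strand (space (i, t) true s) = space (i, !t) false s :=
      congrArg (space (i, !t) false) (Bool.xor_false s)
    rwa [e] at h
  have ha : ∀ d, (cyclic n z).graph.face (space (i, t) d t) =
      (cyclic n z).graph.face (time (i, t) d) := fun d =>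
    (cyclic n z).graph.face_arc (time (i, t) d)
  have ho : (cyclic n z).graph.face (space (i, !t) true t) =
      (cyclic n z).graph.face (space (i, !t) false t) := by
    have e := (cyclic n z).arc_other (i, !t) false
    have h := (cyclic n z).graph.face_arc (space (i, !t) false (!!t))
    rw [show (cyclic n z).side (i, !t) = !t from rfl] at e
    rw [e, Bool.not_not] at h
    exact h
  rw [← ha, ← hs, ← ho, ← hs, Bool.not_not, ha]

theorem orientable : (cyclic n false).graph.Orientable := by
  refine ⟨Sum.elim (fun x => xor x.1.2 x.2) (fun x => !xor x.2.1 x.2.2), ?_⟩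
  rintro (⟨⟨i, _ | _⟩, _ | _⟩ | ⟨⟨i, _ | _⟩, _ | _, _ | _⟩) <;>
    simp [graph, strand, arc, cross, cyclic]

theorem card_slice : Nat.card (cyclic n z).graph.Slice = n := by
  rw [(cyclic n z).card_slice (fun m => m.1) (fun _ => rfl), Nat.card_zmod]
  · rintro ⟨i, t⟩ ⟨j, t'⟩ (rfl : i = j)
    by_cases h : t = t'
    · rw [h]
    · obtain rfl : t = !t' := Bool.eq_not.2 h
      exact (cyclic n z).slice_next (i, t')
  · exact fun i => ⟨(i, false), rfl⟩

variable [NeZero n]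

theorem isCDT : (cyclic n z).graph.IsCDT := by
  refine (cyclic n z).isCDT (fun m => m.1) (fun m s => if s = true then m.1 + 1 else m.1)
    (fun _ => rfl) ?_ ?_ ?_ (fun m => Or.inr (face_eq n z m.1 m.2))
  · rintro m (_ | _) <;> rfl
  · rintro ⟨i, _ | _⟩ <;> simp [cyclic]
  · rintro ⟨i, _ | _⟩ ⟨j, _ | _⟩ <;> simp [cyclic]
    grind

theorem connected : (cyclic n z).graph.Connected := by
  refine (cyclic n z).connected fun A ⟨⟨j, t⟩, hj⟩ h1 h2 => ?_
  have ht : ∀ i t, (i, t) ∈ A ↔ (i, false) ∈ A := by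
    rintro i (_ | _)
    · rfl
    · exact h1 (i, false)
  have hk : ∀ k : ℕ, ((k : ZMod n), false) ∈ A ↔ (0, false) ∈ A := by
    intro k
    induction k with
    | zero => rw [Nat.cast_zero]
    | succ k ih =>
      rw [Nat.cast_succ, ← ih, ← ht (k : ZMod n) true]
      exact h2 (k, true)
  have hi : ∀ i : ZMod n, (i, false) ∈ A ↔ (0, false) ∈ A := fun i => by
    rw [← hk i.val, ZMod.natCast_zmod_val]
  exact fun m => (ht m.1 m.2).2 ((hi _).2 ((hi _).1 ((ht j t).1 hj)))

/-- The side of a slice is an invariant of boundaries, as no spacelike edge is twisted. Both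
involutions change it, so nothing is a cap. -/
theorem isPeriodic : (cyclic n z).graph.IsPeriodic n := by
  have hG := isCDT n z
  have := hG.isPeriodic_of_not_hasCap (connected n z) (fun e β h => ?_)
  · rwa [card_slice] at this
  · obtain ⟨⟨i, t⟩, s, rfl⟩ := (cyclic n z).exists_bd β
    cases e with
    | crosscap => exact bd_ne n z i i t t s (((cyclic n z).acrossSlice_bd hG _ _).symm.trans h)
    | singular =>
      rw [bd_eq_side] at h
      exact (cyclic n z).not_isSingularStrip_bd _ h
    | mobius =>
      rw [bd_eq_side] at h
      have := ((hG.isMobiusStrip_iff _).1 h).2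
      rw [(cyclic n z).acrossStrip_bd hG] at this
      cases s
      exacts [bd_ne n z (i - 1) i true false false this, bd_ne n z (i + 1) i false true true this]

theorem not_orientable : ¬ (cyclic n true).graph.Orientable := by
  rintro ⟨σ, hσ⟩
  have hs : ∀ c, σ ((cyclic n true).strand c) = !σ c := fun c => Bool.eq_not.2 (hσ c).1
  have ha : ∀ c, σ ((cyclic n true).arc c) = !σ c := fun c => Bool.eq_not.2 (hσ c).2.1
  have hx : ∀ c, σ (cross c) = !σ c := fun c => Bool.eq_not.2 (hσ c).2.2
  -- Five moves lead along the slice from one disc to the other.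
  have htime : ∀ i : ZMod n, σ (time (i, true) false) = !σ (time (i, false) false) := by
    intro i
    have h1 := hx (time (i, false) false)
    have h2 := ha (time (i, false) true)
    have h3 := hs (space (i, false) true false)
    have h4 := hx (space (i, true) false false)
    have h5 := ha (time (i, true) false)
    simp only [cross, arc, strand, cyclic, Bool.xor_false, Bool.not_false, Equiv.prodCongr_apply,
      Equiv.boolNot_apply, Prod.map, Equiv.refl_apply] at h1 h2 h3 h4 h5
    rw [← Bool.not_not (σ (time (i, true) false)), ← h5, h4, Bool.not_not, h3, h2, Bool.not_not, h1]
  -- A timelike edge restores the sign, except for the twisted one; after a full turn exactly one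
  -- sign change remains.
  have hstep : ∀ i : ZMod n, σ (time (i + 1, false) false) =
      xor (σ (time (i, false) false)) (decide (i + 1 = 0)) := by
    intro i
    have h1 := hs (time (i, true) false)
    have h2 := hx (time (i + 1, false) false)
    have h3 := htime i
    by_cases h : i + 1 = 0
    · simp [strand, cyclic, cross, h] at h1 h2 h3 ⊢
      rw [h2, h3] at h1
      simpa using h1
    · simp [strand, cyclic, h] at h1 h3 ⊢
      rw [h1, h3, Bool.not_not]
  have hk : ∀ k : ℕ, k < n → σ (time ((k : ZMod n), false) false) = σ (time (0, false) false) := by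
    intro k
    induction k with
    | zero => intro _; rw [Nat.cast_zero]
    | succ k ih =>
      intro hk
      have h0 : (k : ZMod n) + 1 ≠ 0 := fun h => by
        rw [← Nat.cast_succ, ZMod.natCast_eq_zero_iff] at h
        exact absurd (Nat.le_of_dvd k.succ_pos h) (by omega)
      rw [Nat.cast_succ, hstep, decide_eq_false h0, Bool.xor_false]
      exact ih (by omega)
  have hn : 1 ≤ n := NeZero.one_le
  have h := hk (n - 1) (by omega)
  have e : ((n - 1 : ℕ) : ZMod n) + 1 = 0 := by
    rw [← Nat.cast_succ, Nat.succ_eq_add_one, Nat.sub_add_cancel hn, ZMod.natCast_self]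
  have := hstep ((n - 1 : ℕ) : ZMod n)
  rw [h, decide_eq_true e, e, Bool.xor_true] at this
  exact Bool.eq_not.1 this rfl

end cyclic

end SlicePattern

namespace ColoredRibbonGraph

open SlicePattern

theorem realizes_periodic_orientable {n : ℕ} (hn : 1 ≤ n) :
    Realizes (fun G => G.IsPeriodic n ∧ G.Orientable) ModelSurface.Torus := by
  have : NeZero n := ⟨by omega⟩
  exact ⟨_, inferInstance, (cyclic n false).graph, cyclic.isCDT n _, cyclic.connected n _,
    ⟨cyclic.isPeriodic n _, cyclic.orientable n⟩,
    (cyclic.isCDT n _).torus_of_isPeriodic (cyclic.connected n _) (cyclic.isPeriodic n _)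
      (cyclic.orientable n)⟩

theorem realizes_periodic_not_orientable {n : ℕ} (hn : 1 ≤ n) :
    Realizes (fun G => G.IsPeriodic n ∧ ¬ G.Orientable) ModelSurface.KleinBottle := by
  have : NeZero n := ⟨by omega⟩
  exact ⟨_, inferInstance, (cyclic n true).graph, cyclic.isCDT n _, cyclic.connected n _,
    ⟨cyclic.isPeriodic n _, cyclic.not_orientable n⟩,
    (cyclic.isCDT n _).kleinBottle_of_isPeriodic (cyclic.connected n _) (cyclic.isPeriodic n _)
      (cyclic.not_orientable n)⟩

end ColoredRibbonGraph

theorem mainTheorem7 :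
    (∀ (C : Type u) [Finite C] (G : ColoredRibbonGraph C), G.IsCDT →
      G.eulerChar = G.numSingularFaces ∧
      (G.Connected →
        (G.eulerChar = 0 ∨ G.eulerChar = 1 ∨ G.eulerChar = 2) ∧
        ((∃ a b n, G.IsLinear a b n) ∨ ∃ n, G.IsPeriodic n) ∧
        (G.Orientable →
          (G.eulerChar = 2 ∧ Nonempty (G.Surface ≃ₜ ModelSurface.Sphere) ∧
            ∃ n, 1 ≤ n ∧ G.IsLinear .singular .singular n) ∨
          (G.eulerChar = 0 ∧ Nonempty (G.Surface ≃ₜ ModelSurface.Torus) ∧ ∃ n, G.IsPeriodic n)) ∧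
        (¬ G.Orientable →
          (G.eulerChar = 1 ∧ Nonempty (G.Surface ≃ₜ ModelSurface.ProjectivePlane)) ∨
          (G.eulerChar = 0 ∧ Nonempty (G.Surface ≃ₜ ModelSurface.KleinBottle))) ∧
        (∀ n, G.IsLinear .singular .singular n → Nonempty (G.Surface ≃ₜ ModelSurface.Sphere)) ∧
        (∀ n, G.IsPeriodic n → G.Orientable → Nonempty (G.Surface ≃ₜ ModelSurface.Torus)) ∧
        (∀ n, G.IsLinear .singular .mobius n ∨ G.IsLinear .singular .crosscap n →
          Nonempty (G.Surface ≃ₜ ModelSurface.ProjectivePlane)) ∧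
        (∀ n, G.IsLinear .mobius .mobius n ∨ G.IsLinear .mobius .crosscap n ∨
            G.IsLinear .crosscap .crosscap n ∨ (G.IsPeriodic n ∧ ¬ G.Orientable) →
          Nonempty (G.Surface ≃ₜ ModelSurface.KleinBottle)))) ∧
    (∀ n, 1 ≤ n → ColoredRibbonGraph.Realizes (fun G => G.IsLinear .singular .singular n) ModelSurface.Sphere) ∧
    (∀ n, 1 ≤ n → ColoredRibbonGraph.Realizes (fun G => G.IsPeriodic n ∧ G.Orientable) ModelSurface.Torus) ∧
    (∀ n, ColoredRibbonGraph.Realizes (fun G => G.IsLinear .singular .mobius n) ModelSurface.ProjectivePlane) ∧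
    (∀ n, 1 ≤ n → ColoredRibbonGraph.Realizes (fun G => G.IsLinear .singular .crosscap n) ModelSurface.ProjectivePlane) ∧
    (∀ n, ColoredRibbonGraph.Realizes (fun G => G.IsLinear .mobius .mobius n) ModelSurface.KleinBottle) ∧
    (∀ n, ColoredRibbonGraph.Realizes (fun G => G.IsLinear .mobius .crosscap n) ModelSurface.KleinBottle) ∧
    (∀ n, 1 ≤ n → ColoredRibbonGraph.Realizes (fun G => G.IsLinear .crosscap .crosscap n) ModelSurface.KleinBottle) ∧
    (∀ n, 1 ≤ n → ColoredRibbonGraph.Realizes (fun G => G.IsPeriodic n ∧ ¬ G.Orientable) ModelSurface.KleinBottle) :=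
  ⟨fun _ _ G hG => classification_of_isCDT G hG,
    fun _ hn => ColoredRibbonGraph.realizes_singular_singular hn,
    fun _ hn => ColoredRibbonGraph.realizes_periodic_orientable hn,
    fun n => ColoredRibbonGraph.realizes_singular_mobius n,
    fun _ hn => ColoredRibbonGraph.realizes_singular_crosscap hn,
    fun n => ColoredRibbonGraph.realizes_mobius_mobius n,
    fun n => ColoredRibbonGraph.realizes_mobius_crosscap n,
    fun _ hn => ColoredRibbonGraph.realizes_crosscap_crosscap hn,
    fun _ hn => ColoredRibbonGraph.realizes_periodic_not_orientable hn⟩
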